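/- **Model.** For each $t\ge1$ consider the longitudinal mixed model $y_i=X_i\beta+Z_iv_i+e_i$, $i=1,\dots,t$, where $X_i$ is $n_i\times p$, $Z_i$ is $n_i\times r_i$, and the $v_i\sim N(0,G_i)$, $e_i\sim N(0,R_i)$ are all independent. The matrices $G_i=G_i(\sigma)$ and $R_i=R_i(\sigma)$ are symmetric and (affine) linear in $\sigma=(\sigma_0,\dots,\sigma_q)'$, with $q$ fixed. Put $\Sigma_i=R_i+Z_iG_iZ_i'$, $\Sigma_{i,j}=\partial\Sigma_i/\partial\sigma_j$, $\Sigma=\mathrm{diag}(\Sigma_1,\dots,\Sigma_t)$, $X=(X_1',\dots,X_t')'$, $n=\sum_i n_i$, and $\Theta=\{\sigma:\Sigma_i\text{ is nonnegative definite},\ i=1,\dots,t\}$, so that $y=(y_1',\dots,y_t')'\sim N(X\beta,\Sigma)$. Let $\mu=l'\beta+\sum_i m_i'v_i$. All of these objects except $q$ and the true $\sigma$ may depend on $t$, and $t\to\infty$. Vector norms $|\cdot|$ are Euclidean and $\|\cdot\|$ is the spectral norm; for arrays with three or more indices $\|\cdot\|$ is the maximal absolute value of the elements. **REML.** Let $T$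 be any $n\times(n-p)$ matrix of rank $n-p$ with $T'X=0$, and let $l(\sigma)=l(\sigma,y)=-\frac12\left[\log|T'\Sigma T|+y'Py\right]$, $P=T(T'\Sigma T)^{-1}T'$, be the restricted log-likelihood up to a constant. Put $a=\partial l/\partial\sigma$, $F=\partial^2l/\partial\sigma^2$, $A=E(F)$, $H_i=\partial^3l/\partial\sigma_i\partial\sigma^2$, and let $C$ be the matrix with rows $a'A^{-1}H_i$. Let $d_i=\sqrt t$, $D=\mathrm{diag}(d_0,\dots,d_q)$, $d_*=\min_i d_i=\sqrt t$, $Q=D^{-1}AD^{-1}$. With $(\lambda_i)=D^{-1}a$, $(\lambda_{ij})=D^{-1/2}(F-A)D^{-1/2}$, $(\lambda_{ijk})_{j,k}=D^{-1}H_iD^{-1}$, let $U_1=(E\lambda_i\lambda_l)$, $U_2=(E\lambda_{jk}\lambda_l)$, $U_3=(E\lambda_{jkm}\lambda_l\lambda_n)$. When these expectations are regarded as functions of the parameter, the law of $y$ and the integrand are taken at the same parameter value. For $\delta>0$ put $S_\delta(\sigma)=\{\tilde\sigma:|\tilde\sigma_i-\sigma_i|\le\delta d_*/d_i\ \forall i\}$.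 **MSE approximation and its estimator.** Let $s_i=\Sigma_i^{-1}Z_iG_im_i$ and $\eta=g_1+g_2+g_3$, where $$g_1=\sum_i m_i'(G_i-G_iZ_i'\Sigma_i^{-1}Z_iG_i)m_i,$$ $$g_2=\Bigl(l-\sum_iX_i's_i\Bigr)'\Bigl(\sum_iX_i'\Sigma_i^{-1}X_i\Bigr)^{-1}\Bigl(l-\sum_iX_i's_i\Bigr),$$ $$g_3=\mathrm{tr}\Bigl\{\sum_i\Bigl(\frac{\partial s_i}{\partial\sigma'}\Bigr)'\Sigma_i\Bigl(\frac{\partial s_i}{\partial\sigma'}\Bigr)(-A)^{-1}\Bigr\},$$ the second-order approximation to the mean squared error of the empirical BLUP of $\mu$. With $b=\partial\eta/\partial\sigma$, $B=\partial^2\eta/\partial\sigma^2$ let $\Delta_0=-2b'A^{-1}E(a)$, $\Delta_1=b'A^{-1}E(FA^{-1}a)$, $\Delta_2=\frac12E(a'A^{-1}BA^{-1}a)$, $\Delta_3=-\frac12b'A^{-1}E(CA^{-1}a)$. Given $c_0,\lambda>0$, a point $\sigma^*\in\Theta$ and an estimator $\hat\sigma$, let $\hat\eta=\eta(\hat\sigma)-\sum_{j=0}^3\Delta_j(\hat\sigma)$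 if $\hat\sigma$ is in the interior of $\Theta$ and the absolute value of this expression is at most $c_0d_*^\lambda$; otherwise let $\hat\eta=\eta(\sigma^*)$. **Hypotheses.** At the true $\sigma$ all $G_i,R_i$ are nonnegative definite and all $\Sigma_i$ are nonsingular, and: 1. $\|G_i\|$, $\|R_i\|$, $\|\partial G_i/\partial\sigma_j\|$, $\|\partial R_i/\partial\sigma_j\|$ ($0\le j\le q$) and $\|\Sigma_i^{-1}\|$ are bounded uniformly in $i$ and $t$, and $\max_{i\le t}\|G_i(\tilde\sigma)-G_i(\sigma)\|\to0$, $\max_{i\le t}\|R_i(\tilde\sigma)-R_i(\sigma)\|\to0$ uniformly in $t$ as $\tilde\sigma\to\sigma$; 2. $\sigma\in\Theta^\circ$, the interior of $\Theta$, for every $t$; 3. $p$, $n_i$, $\|X_i\|$, $\|Z_i\|$, $|l|$ and $\sum_{i=1}^t|m_i|$ are bounded; 4. $\liminf_{t}\lambda_{\min}(t^{-1}\sum_{i=1}^tB_i)>0$ and $\liminf_t\lambda_{\min}(t^{-1}\sum_{i=1}^tX_i'\Sigma_i^{-1}X_i)>0$, where $B_i$ is the $(q+1)\times(q+1)$ matrix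 with elements $\mathrm{tr}(\Sigma_i^{-1}\Sigma_{i,j}\Sigma_i^{-1}\Sigma_{i,k})$. **Conclusions.** (a) For all $\lambda>0$ and $g>8+4\lambda$ there is $\delta>0$ with $S_\delta(\sigma)\subset\Theta^\circ$ for large $t$ such that, for large $t$, all expectations above exist on $S_\delta(\sigma)$, and the following hold (boundedness and limits being as $t\to\infty$): (i) $\eta$ is $C^3$ on $\Theta^\circ$, and $\eta(\sigma)$, $|b|$, $\|B\|$ and $\sup_{\tilde\sigma\in S_\delta(\sigma)}|\partial^3\eta(\tilde\sigma)/\partial\sigma_i\partial\sigma_j\partial\sigma_k|$ are bounded; (ii) $l(\cdot,y)$ is $C^4$ on $\Theta^\circ$ for every $y$; $\sigma\in\Theta^\circ$; $d_i>0$, $d_*\to\infty$; $-\infty<\limsup\lambda_{\max}(D^{-1}AD^{-1})<0$; and the $g$-th moments of $d_i^{-1}|\partial l/\partial\sigma_i|$, $(d_id_j)^{-1/2}|F_{ij}-A_{ij}|$ and $\frac{d_*}{d_id_jd_k}\sup_{\tilde\sigma\in S_\delta(\sigma)}|\partial^3l(\tilde\sigma)/\partial\sigma_i\partial\sigma_j\partial\sigma_k|$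 are bounded; (iii) the $g$-th moments of $(d_jd_k)^{-1/2}\left|\frac{\partial^3l}{\partial\sigma_i\partial\sigma_j\partial\sigma_k}-E\frac{\partial^3l}{\partial\sigma_i\partial\sigma_j\partial\sigma_k}\right|$, $(d_jd_k)^{-1}\left|\frac{\partial^3l}{\partial\sigma_i\partial\sigma_j\partial\sigma_k}\right|$ and $\frac{d_*^2}{d_id_jd_kd_l}\sup_{\tilde\sigma\in S_\delta(\sigma)}\left|\frac{\partial^4l(\tilde\sigma)}{\partial\sigma_i\partial\sigma_j\partial\sigma_k\partial\sigma_l}\right|$ are bounded; (iv) $\sup_{\tilde\sigma\in S_{\delta'}(\sigma)}\|Q(\tilde\sigma)-Q(\sigma)\|\to0$ and $\sup_{\tilde\sigma\in S_{\delta'}(\sigma)}\|U_j(\tilde\sigma)-U_j(\sigma)\|\to0$, $j=1,2,3$, as $\delta'\to0$, uniformly in all large $t$; (v) $|E(a)|$ is bounded, and $\sup_{\tilde\sigma\in S_{\delta'}(\sigma)}|E(a)|_{\sigma=\tilde\sigma}-E(a)|\to0$ as $\delta'\to0$, uniformly in all large $t$. (b) There is a measurable REML estimator $\hat\sigma$ such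 that for every $g>0$ the following property $(\ast_g)$ holds: for every $0<\rho<1$ there are a constant $c$, events $\mathcal B$ with $P(\mathcal B^c)\le c\,d_*^{-\tau g}$, $\tau=\frac14\wedge(1-\rho)$, and random variables $u_*\ge0$ with $E(u_*^g)$ bounded, such that for large $t$, on $\mathcal B$, $\hat\sigma\in\Theta$, $\partial l(\hat\sigma)/\partial\sigma=0$, $|D(\hat\sigma-\sigma)|<d_*^{1-\rho}$ and $|\hat\sigma-\sigma+A^{-1}a|\le d_*^{-2\rho}u_*$. (c) Let $\lambda,c_0>0$, $g>8+4\lambda$, let $\sigma^*\in\Theta$ for all $t$ with $\eta(\sigma^*)=O(d_*^\lambda)$, and let $\hat\sigma$ be measurable with property $(\ast_g)$. Then $\hat\eta$ is integrable for large $t$ and $E(\hat\eta)=\eta(\sigma)+o(d_*^{-2})=\eta(\sigma)+o(t^{-1})$. -/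

import Mathlib

open Filter Topology MeasureTheory ProbabilityTheory Asymptotics Matrix
open scoped ENNReal NNReal Matrix.Norms.L2Operator

namespace EmpiricalPredictor

noncomputable section

/-- Dispersion parameters with `s` components, with the Euclidean norm. -/
abbrev Param (s : ℕ) : Type := EuclideanSpace ℝ (Fin s)

/-- The partial derivative `∂f/∂σ_i` at `x`. -/
def pderiv {s : ℕ} (i : Fin s) (f : Param s → ℝ) (x : Param s) : ℝ :=
  fderiv ℝ f x (EuclideanSpace.single i 1)

/-- The gradient `∂f/∂σ`. -/
def grad {s : ℕ} (f : Param s → ℝ) (x : Param s) : Fin s → ℝ := fun i => pderiv i f x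

/-- The matrix of second derivatives `∂²f/∂σ²`. -/
def hessian {s : ℕ} (f : Param s → ℝ) (x : Param s) : Matrix (Fin s) (Fin s) ℝ :=
  Matrix.of fun i j => pderiv i (pderiv j f) x

/-- The third derivatives `∂³f/∂σ_i∂σ_j∂σ_k`. -/
def deriv3 {s : ℕ} (f : Param s → ℝ) (x : Param s) (i j k : Fin s) : ℝ :=
  pderiv i (pderiv j (pderiv k f)) x

/-- The fourth derivatives `∂⁴f/∂σ_i∂σ_j∂σ_k∂σ_l`. -/
def deriv4 {s : ℕ} (f : Param s → ℝ) (x : Param s) (i j k l : Fin s) : ℝ :=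
  pderiv i (pderiv j (pderiv k (pderiv l f))) x

/-- The smallest eigenvalue of a (symmetric, nonempty) real matrix. -/
def lambdaMin {s : ℕ} (M : Matrix (Fin s) (Fin s) ℝ) : ℝ := sInf (spectrum ℝ M)

/-- The largest eigenvalue of a (symmetric, nonempty) real matrix. -/
def lambdaMax {s : ℕ} (M : Matrix (Fin s) (Fin s) ℝ) : ℝ := sSup (spectrum ℝ M)

/-! ### Score equations -/

/-- A statistical model together with a criterion function `l(σ, y)` whose score equation
`∂l/∂σ = 0` is used for estimating `σ`, and with normalizing constants `d_1, …, d_s`. -/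
structure ScoreModel (s : ℕ) where
  /-- the sample space of the data `y` -/
  Y : Type
  [measurableSpace : MeasurableSpace Y]
  /-- the law of `y` at the parameter value `σ` -/
  law : Param s → Measure Y
  /-- the parameter space -/
  Θ : Set (Param s)
  /-- the criterion function -/
  l : Param s → Y → ℝ
  /-- the normalizing constants -/
  d : Fin s → ℝ

attribute [instance] ScoreModel.measurableSpace

namespace ScoreModel

variable {s : ℕ}

/-- `d_* = min_i d_i`. -/
def dStar (S : ScoreModel s) : ℝ := ⨅ i, S.d i

/-- `a = ∂l/∂σ`. -/
def score (S : ScoreModel s) (x : Param s) (y : S.Y) : Fin s → ℝ :=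
  grad (fun x' => S.l x' y) x

/-- `F = ∂²l/∂σ²`. -/
def F (S : ScoreModel s) (x : Param s) (y : S.Y) : Matrix (Fin s) (Fin s) ℝ :=
  hessian (fun x' => S.l x' y) x

/-- `H_i = ∂³l/∂σ_i∂σ²`. -/
def H (S : ScoreModel s) (x : Param s) (y : S.Y) (i : Fin s) : Matrix (Fin s) (Fin s) ℝ :=
  Matrix.of fun j k => deriv3 (fun x' => S.l x' y) x i j k

/-- `E(a)`, as a function of the parameter: the expectation is taken at the same parameter value
at which the integrand is evaluated. The same convention is used for `A`, `U₁`, `U₂`, `U₃` and the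
`Δ_j` below. -/
def meanScore (S : ScoreModel s) (x : Param s) : Fin s → ℝ :=
  fun i => ∫ y, S.score x y i ∂S.law x

/-- `A = E(∂²l/∂σ²)`. -/
def A (S : ScoreModel s) (x : Param s) : Matrix (Fin s) (Fin s) ℝ :=
  Matrix.of fun i j => ∫ y, S.F x y i j ∂S.law x

/-- `D⁻¹`, where `D = diag(d_1, …, d_s)`. -/
def Dinv (S : ScoreModel s) : Matrix (Fin s) (Fin s) ℝ := Matrix.diagonal fun i => (S.d i)⁻¹

/-- `Q = D⁻¹ A D⁻¹`. -/
def Q (S : ScoreModel s) (x : Param s) : Matrix (Fin s) (Fin s) ℝ := S.Dinv * S.A x * S.Dinv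

/-- `U₁ = (E(λ_i λ_l))`, where `(λ_i) = D⁻¹ a`. -/
def U1 (S : ScoreModel s) (x : Param s) : Matrix (Fin s) (Fin s) ℝ :=
  Matrix.of fun i l => ∫ y, (S.score x y i / S.d i) * (S.score x y l / S.d l) ∂S.law x

/-- `U₂ = (E(λ_{jk} λ_l))`, where `(λ_{jk}) = D^{-1/2} (F - A) D^{-1/2}`. -/
def U2 (S : ScoreModel s) (x : Param s) (j k l : Fin s) : ℝ :=
  ∫ y, ((S.F x y j k - S.A x j k) / √(S.d j * S.d k)) * (S.score x y l / S.d l) ∂S.law x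

/-- `U₃ = (E(λ_{jkm} λ_l λ_n))`, where `(λ_{jkm})_{k,m} = D⁻¹ H_j D⁻¹`. -/
def U3 (S : ScoreModel s) (x : Param s) (j k l m n : Fin s) : ℝ :=
  ∫ y, (S.H x y j k m / (S.d k * S.d m)) * (S.score x y l / S.d l) * (S.score x y n / S.d n)
    ∂S.law x

/-- The box `S_δ(σ) = {σ̃ : |σ̃_i - σ_i| ≤ δ d_* / d_i for all i}`. -/
def box (S : ScoreModel s) (σ : Param s) (δ : ℝ) : Set (Param s) :=
  {x | ∀ i, |x i - σ i| ≤ δ * S.dStar / S.d i}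

/-- `C`, the matrix whose `i`-th row is `a' A⁻¹ H_i`. -/
def C (S : ScoreModel s) (x : Param s) (y : S.Y) : Matrix (Fin s) (Fin s) ℝ :=
  Matrix.of fun i => (S.score x y ᵥ* (S.A x)⁻¹) ᵥ* S.H x y i

/-- `Δ₀ = -2 b' A⁻¹ E(a)`, where `b = ∂η/∂σ`. -/
def Δ0 (S : ScoreModel s) (η : Param s → ℝ) (x : Param s) : ℝ :=
  -2 * (grad η x ⬝ᵥ ((S.A x)⁻¹ *ᵥ S.meanScore x))

/-- `Δ₁ = b' A⁻¹ E(F A⁻¹ a)`. -/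
def Δ1 (S : ScoreModel s) (η : Param s → ℝ) (x : Param s) : ℝ :=
  grad η x ⬝ᵥ ((S.A x)⁻¹ *ᵥ
    fun i => ∫ y, (S.F x y *ᵥ ((S.A x)⁻¹ *ᵥ S.score x y)) i ∂S.law x)

/-- `Δ₂ = (1/2) E(a' A⁻¹ B A⁻¹ a)`, where `B = ∂²η/∂σ²`. -/
def Δ2 (S : ScoreModel s) (η : Param s → ℝ) (x : Param s) : ℝ :=
  (1 / 2) * ∫ y, S.score x y ⬝ᵥ
    ((S.A x)⁻¹ *ᵥ (hessian η x *ᵥ ((S.A x)⁻¹ *ᵥ S.score x y))) ∂S.law x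

/-- `Δ₃ = -(1/2) b' A⁻¹ E(C A⁻¹ a)`. -/
def Δ3 (S : ScoreModel s) (η : Param s → ℝ) (x : Param s) : ℝ :=
  -(1 / 2) * (grad η x ⬝ᵥ ((S.A x)⁻¹ *ᵥ
    fun i => ∫ y, (S.C x y *ᵥ ((S.A x)⁻¹ *ᵥ S.score x y)) i ∂S.law x))

/-- The bias-corrected plug-in value `η - ∑_{j=0}^3 Δ_j`. -/
def corrected (S : ScoreModel s) (η : Param s → ℝ) (x : Param s) : ℝ :=
  η x - (S.Δ0 η x + S.Δ1 η x + S.Δ2 η x + S.Δ3 η x)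

open Classical in
/-- The estimator `η̂ = η(σ̂) - ∑_{j=0}^3 Δ_j(σ̂)`, replaced by `η(σ*)` when its absolute value
exceeds `c₀ d_*^lam`, or when `σ̂` lies outside the interior of the parameter space, where the
derivatives in the formula need not exist. -/
def etaHat (S : ScoreModel s) (η : Param s → ℝ) (c₀ lam : ℝ) (σstar : Param s)
    (σhat : S.Y → Param s) (y : S.Y) : ℝ :=
  if σhat y ∈ interior S.Θ ∧ |S.corrected η (σhat y)| ≤ c₀ * S.dStar ^ lam then
    S.corrected η (σhat y)
  else η σstar

/-- The expectations which enter `E(a)`, `A`, `U₁`, `U₂`, `U₃` and the `Δ_j` exist at `x`. -/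
structure ExpectationsExist (S : ScoreModel s) (x : Param s) : Prop where
  prob : IsProbabilityMeasure (S.law x)
  score : ∀ i, Integrable (fun y => S.score x y i) (S.law x)
  hess : ∀ i j, Integrable (fun y => S.F x y i j) (S.law x)
  third : ∀ i j k, Integrable (fun y => S.H x y i j k) (S.law x)
  score_score : ∀ i j, Integrable (fun y => S.score x y i * S.score x y j) (S.law x)
  hess_score : ∀ i j k, Integrable (fun y => S.F x y i j * S.score x y k) (S.law x)
  third_score_score : ∀ i j k l m,
    Integrable (fun y => S.H x y i j k * S.score x y l * S.score x y m) (S.law x)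

end ScoreModel

variable {s : ℕ}

/-- The `g`-th moments, at the parameter `σ`, of the nonnegative random variables `f t` are bounded
as `t → ∞`. -/
def BoundedMoment (S : ℕ → ScoreModel s) (σ : Param s) (g : ℝ)
    (f : ∀ t, (S t).Y → ℝ≥0∞) : Prop :=
  ∃ K : ℝ≥0, ∀ᶠ t in atTop,
    AEMeasurable (f t) ((S t).law σ) ∧ ∫⁻ y, f t y ^ g ∂(S t).law σ ≤ K

/-- The regularity conditions, with moment order `g` and box size `δ`, for the asymptotic
representation `σ̂ = σ - A⁻¹ a + r` of a root of the score equation; `σ` is the true parameter. -/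
structure RepresentationConditions (S : ℕ → ScoreModel s) (σ : Param s) (g δ : ℝ) : Prop where
  g_pos : 0 < g
  δ_pos : 0 < δ
  smooth : ∀ᶠ t in atTop, ∀ y, ContDiffOn ℝ 3 (fun x => (S t).l x y) (interior (S t).Θ)
  true_interior : ∀ᶠ t in atTop, σ ∈ interior (S t).Θ
  box_subset : ∀ᶠ t in atTop, (S t).box σ δ ⊆ interior (S t).Θ
  expectations : ∀ᶠ t in atTop, (S t).ExpectationsExist σ
  d_pos : ∀ᶠ t in atTop, ∀ i, 0 < (S t).d i
  d_tendsto : Tendsto (fun t => (S t).dStar) atTop atTop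
  limsup_gt : ⊥ < limsup (fun t => ((lambdaMax ((S t).Q σ) : ℝ) : EReal)) atTop
  limsup_lt : limsup (fun t => ((lambdaMax ((S t).Q σ) : ℝ) : EReal)) atTop < 0
  moment_score : ∀ i, BoundedMoment S σ g fun t y => ‖(S t).score σ y i / (S t).d i‖ₑ
  moment_hess : ∀ i j, BoundedMoment S σ g fun t y =>
    ‖((S t).F σ y i j - (S t).A σ i j) / √((S t).d i * (S t).d j)‖ₑ
  moment_third : ∀ i j k, BoundedMoment S σ g fun t y =>
    ENNReal.ofReal ((S t).dStar / ((S t).d i * (S t).d j * (S t).d k)) *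
      ⨆ x ∈ (S t).box σ δ, ‖(S t).H x y i j k‖ₑ

/-- The regularity conditions, with moment order `g` and truncation exponent `lam`, under which the
estimator `etaHat` of `η` is correct to second order. -/
def MSEConditions (S : ℕ → ScoreModel s) (η : ℕ → Param s → ℝ) (σ : Param s) (g lam : ℝ) : Prop :=
  ∃ δ > 0,
    -- smoothness and boundedness of `η` and its derivatives
    ((∀ᶠ t in atTop, ContDiffOn ℝ 3 (η t) (interior (S t).Θ)) ∧
      ∃ K : ℝ, ∀ᶠ t in atTop, |η t σ| ≤ K ∧ ‖WithLp.toLp 2 (grad (η t) σ)‖ ≤ K ∧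
        ‖hessian (η t) σ‖ ≤ K ∧
        ∀ x ∈ (S t).box σ δ, ∀ i j k, |deriv3 (η t) x i j k| ≤ K) ∧
    -- conditions for the asymptotic representation
    (RepresentationConditions S σ g δ ∧ 8 + 4 * lam < g ∧
      ∀ᶠ t in atTop, ∀ y, ContDiffOn ℝ 4 (fun x => (S t).l x y) (interior (S t).Θ)) ∧
    -- moments of the third and fourth derivatives
    ((∀ i j k, BoundedMoment S σ g fun t y =>
        ‖((S t).H σ y i j k - ∫ y', (S t).H σ y' i j k ∂(S t).law σ) /
          √((S t).d j * (S t).d k)‖ₑ) ∧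
      (∀ i j k, BoundedMoment S σ g fun t y =>
        ‖(S t).H σ y i j k / ((S t).d j * (S t).d k)‖ₑ) ∧
      (∀ i j k l, BoundedMoment S σ g fun t y =>
        ENNReal.ofReal ((S t).dStar ^ 2 / ((S t).d i * (S t).d j * (S t).d k * (S t).d l)) *
          ⨆ x ∈ (S t).box σ δ, ‖deriv4 (fun x' => (S t).l x' y) x i j k l‖ₑ)) ∧
    -- equicontinuity of `Q`, `U₁`, `U₂`, `U₃`
    ((∀ᶠ t in atTop, ∀ x ∈ (S t).box σ δ, (S t).ExpectationsExist x) ∧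
      ∃ N, ∀ ε > 0, ∃ δ' > 0, ∀ t ≥ N, ∀ x ∈ (S t).box σ δ',
        ‖(S t).Q x - (S t).Q σ‖ ≤ ε ∧ ‖(S t).U1 x - (S t).U1 σ‖ ≤ ε ∧
        (∀ j k l, |(S t).U2 x j k l - (S t).U2 σ j k l| ≤ ε) ∧
        (∀ j k l m n, |(S t).U3 x j k l m n - (S t).U3 σ j k l m n| ≤ ε)) ∧
    -- boundedness and equicontinuity of `E(a)`
    ((∃ K : ℝ, ∀ᶠ t in atTop, ‖WithLp.toLp 2 ((S t).meanScore σ)‖ ≤ K) ∧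
      ∃ N, ∀ ε > 0, ∃ δ' > 0, ∀ t ≥ N, ∀ x ∈ (S t).box σ δ',
        ‖WithLp.toLp 2 ((S t).meanScore x - (S t).meanScore σ)‖ ≤ ε)

/-- `σ̂` is a consistent root of the score equation with the asymptotic representation: for every
`0 < ρ < 1` there are events `ℬ` with `P(ℬᶜ) ≤ c d_*^{-τ g}`, `τ = (1/4) ∧ (1 - ρ)`, such that for
large `t`, on `ℬ`, `σ̂ ∈ Θ`, `∂l(σ̂)/∂σ = 0`, `|D(σ̂ - σ)| < d_*^{1-ρ}` and
`σ̂ = σ - A⁻¹ a + r` with `|r| ≤ d_*^{-2ρ} u` and `E(u^g)` bounded. -/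
def IsConsistentRoot (S : ℕ → ScoreModel s) (σ : Param s) (g : ℝ)
    (σhat : ∀ t, (S t).Y → Param s) : Prop :=
  ∀ ρ : ℝ, 0 < ρ → ρ < 1 →
    ∃ (ℬ : ∀ t, Set (S t).Y) (u : ∀ t, (S t).Y → ℝ≥0) (c : ℝ),
      BoundedMoment S σ g (fun t y => (u t y : ℝ≥0∞)) ∧
      ∀ᶠ t in atTop, MeasurableSet (ℬ t) ∧
        (S t).law σ (ℬ t)ᶜ ≤ ENNReal.ofReal (c * (S t).dStar ^ (-(min (1 / 4) (1 - ρ) * g))) ∧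
        ∀ y ∈ ℬ t, σhat t y ∈ (S t).Θ ∧ (S t).score (σhat t y) y = 0 ∧
          ‖WithLp.toLp 2 (fun i => (S t).d i * (σhat t y i - σ i))‖ < (S t).dStar ^ (1 - ρ) ∧
          ‖σhat t y - σ + WithLp.toLp 2 (((S t).A σ)⁻¹ *ᵥ (S t).score σ y)‖ ≤
            (S t).dStar ^ (-(2 * ρ)) * u t y

/-! ### The longitudinal model -/

/-- The longitudinal mixed model `y_i = X_i β + Z_i v_i + e_i`, `i = 1, …, t`, with independent
`v_i ~ N(0, G_i)`, `e_i ~ N(0, R_i)`, where `G_i` and `R_i` are (affine) linear functions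
`G_i = G0_i + ∑_j σ_j G_{ij}`, `R_i = R0_i + ∑_j σ_j R_{ij}` of `σ = (σ_0, …, σ_q)` with symmetric
coefficients, and the coefficient vectors `l`, `m = (m_1, …, m_t)` of the mixed effect
`μ = l'β + ∑_i m_i'v_i`. -/
structure LongitudinalModel (q t : ℕ) where
  p : ℕ
  n : Fin t → ℕ
  r : Fin t → ℕ
  X : ∀ i, Matrix (Fin (n i)) (Fin p) ℝ
  Z : ∀ i, Matrix (Fin (n i)) (Fin (r i)) ℝ
  G0 : ∀ i, Matrix (Fin (r i)) (Fin (r i)) ℝ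
  Gc : ∀ i, Fin (q + 1) → Matrix (Fin (r i)) (Fin (r i)) ℝ
  R0 : ∀ i, Matrix (Fin (n i)) (Fin (n i)) ℝ
  Rc : ∀ i, Fin (q + 1) → Matrix (Fin (n i)) (Fin (n i)) ℝ
  G0_symm : ∀ i, (G0 i).IsSymm
  Gc_symm : ∀ i j, (Gc i j).IsSymm
  R0_symm : ∀ i, (R0 i).IsSymm
  Rc_symm : ∀ i j, (Rc i j).IsSymm
  l : EuclideanSpace ℝ (Fin p)
  m : ∀ i, EuclideanSpace ℝ (Fin (r i))

namespace LongitudinalModel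

variable {q t : ℕ} (M : LongitudinalModel q t)

/-- The index set of the stacked data vector `y = (y_1', …, y_t')'`. -/
abbrev Obs : Type := Σ i : Fin t, Fin (M.n i)

/-- `G_i(σ)`. -/
def G (i : Fin t) (x : Param (q + 1)) : Matrix (Fin (M.r i)) (Fin (M.r i)) ℝ :=
  M.G0 i + ∑ j, x j • M.Gc i j

/-- `R_i(σ)`. -/
def R (i : Fin t) (x : Param (q + 1)) : Matrix (Fin (M.n i)) (Fin (M.n i)) ℝ :=
  M.R0 i + ∑ j, x j • M.Rc i j

/-- `Σ_i = R_i + Z_i G_i Z_i'`. -/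
def V (i : Fin t) (x : Param (q + 1)) : Matrix (Fin (M.n i)) (Fin (M.n i)) ℝ :=
  M.R i x + M.Z i * M.G i x * (M.Z i)ᵀ

/-- `Σ_{i,j} = ∂Σ_i/∂σ_j`. -/
def dV (i : Fin t) (j : Fin (q + 1)) : Matrix (Fin (M.n i)) (Fin (M.n i)) ℝ :=
  M.Rc i j + M.Z i * M.Gc i j * (M.Z i)ᵀ

/-- `X = (X_1', …, X_t')'`. -/
def stackedX : Matrix M.Obs (Fin M.p) ℝ := Matrix.of fun a k => M.X a.1 a.2 k

/-- `Σ = diag(Σ_1, …, Σ_t)`. -/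
def cov (x : Param (q + 1)) : Matrix M.Obs M.Obs ℝ := Matrix.blockDiagonal' fun i => M.V i x

/-- `Θ = {σ : Σ_i is nonnegative definite, i = 1, …, t}`. -/
def Θ : Set (Param (q + 1)) := {x | ∀ i, (M.V i x).PosSemidef}

/-- The matrix `B_i`, with entries `tr(Σ_i⁻¹ Σ_{i,j} Σ_i⁻¹ Σ_{i,k})`. -/
def B (i : Fin t) (x : Param (q + 1)) : Matrix (Fin (q + 1)) (Fin (q + 1)) ℝ :=
  Matrix.of fun j k => ((M.V i x)⁻¹ * M.dV i j * (M.V i x)⁻¹ * M.dV i k).trace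

/-- `∑_i X_i' Σ_i⁻¹ X_i`. -/
def XVX (x : Param (q + 1)) : Matrix (Fin M.p) (Fin M.p) ℝ :=
  ∑ i, (M.X i)ᵀ * (M.V i x)⁻¹ * M.X i

/-- `s_i(σ) = Σ_i⁻¹ Z_i G_i m_i`. -/
def sVec (i : Fin t) (x : Param (q + 1)) : Fin (M.n i) → ℝ :=
  ((M.V i x)⁻¹ * M.Z i * M.G i x) *ᵥ M.m i

/-- `∂s_i/∂σ_j`. -/
def dsVec (i : Fin t) (j : Fin (q + 1)) (x : Param (q + 1)) : Fin (M.n i) → ℝ :=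
  fun a => pderiv j (fun x' => M.sVec i x' a) x

/-- The law of the data, `y ~ N(Xβ, Σ(σ))`. -/
def law (β : Fin M.p → ℝ) (x : Param (q + 1)) : Measure (EuclideanSpace ℝ M.Obs) :=
  multivariateGaussian (WithLp.toLp 2 (M.stackedX *ᵥ β)) (M.cov x)

/-- The number `n - p` of error contrasts, `n = ∑_i n_i`. -/
abbrev contrasts : ℕ := ∑ i, M.n i - M.p

/-- `T` is an `n × (n - p)` matrix of rank `n - p` with `T'X = 0`. -/
def IsContrast (T : Matrix M.Obs (Fin M.contrasts) ℝ) : Prop :=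
  T.rank = M.contrasts ∧ Tᵀ * M.stackedX = 0

/-- The restricted log-likelihood (up to an additive constant)
`l_R(σ) = -(1/2) [log |T'ΣT| + y'Py]`, `P = T (T'ΣT)⁻¹ T'`. -/
def restrictedLogLik (T : Matrix M.Obs (Fin M.contrasts) ℝ) (x : Param (q + 1))
    (y : EuclideanSpace ℝ M.Obs) : ℝ :=
  -(1 / 2) * (Real.log (Tᵀ * M.cov x * T).det +
    (y : M.Obs → ℝ) ⬝ᵥ ((T * (Tᵀ * M.cov x * T)⁻¹ * Tᵀ) *ᵥ (y : M.Obs → ℝ)))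

/-- REML estimation in the longitudinal model, with `d_0 = ⋯ = d_q = √t`. -/
def reml (T : Matrix M.Obs (Fin M.contrasts) ℝ) (β : Fin M.p → ℝ) : ScoreModel (q + 1) where
  Y := EuclideanSpace ℝ M.Obs
  law := M.law β
  Θ := M.Θ
  l := M.restrictedLogLik T
  d := fun _ => √(t : ℝ)

/-- `g₁ = ∑_i m_i' (G_i - G_i Z_i' Σ_i⁻¹ Z_i G_i) m_i`. -/
def g1 (x : Param (q + 1)) : ℝ :=
  ∑ i, (M.m i : Fin (M.r i) → ℝ) ⬝ᵥ
    ((M.G i x - M.G i x * (M.Z i)ᵀ * (M.V i x)⁻¹ * M.Z i * M.G i x) *ᵥ M.m i)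

/-- `l - ∑_i X_i' Σ_i⁻¹ Z_i G_i m_i`. -/
def g2Vec (x : Param (q + 1)) : Fin M.p → ℝ :=
  (M.l : Fin M.p → ℝ) - ∑ i, (M.X i)ᵀ *ᵥ M.sVec i x

/-- `g₂ = (l - ∑ X_i' Σ_i⁻¹ Z_i G_i m_i)' (∑ X_i' Σ_i⁻¹ X_i)⁻¹ (l - ∑ X_i' Σ_i⁻¹ Z_i G_i m_i)`. -/
def g2 (x : Param (q + 1)) : ℝ := M.g2Vec x ⬝ᵥ ((M.XVX x)⁻¹ *ᵥ M.g2Vec x)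

/-- The matrix `[∇s]' Σ [∇s] = ∑_i (∂s_i/∂σ)' Σ_i (∂s_i/∂σ)`. -/
def sSensitivity (x : Param (q + 1)) : Matrix (Fin (q + 1)) (Fin (q + 1)) ℝ :=
  Matrix.of fun j k => ∑ i, M.dsVec i j x ⬝ᵥ (M.V i x *ᵥ M.dsVec i k x)

/-- `g₃ = tr{[∇s]' Σ [∇s] (-A)⁻¹}`, where `-A` is the information matrix of REML. -/
def g3 (T : Matrix M.Obs (Fin M.contrasts) ℝ) (β : Fin M.p → ℝ) (x : Param (q + 1)) : ℝ :=
  (M.sSensitivity x * (-(M.reml T β).A x)⁻¹).trace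

/-- `η = g₁ + g₂ + g₃`, the second-order approximation to the mean squared error of the EBLUP. -/
def eta (T : Matrix M.Obs (Fin M.contrasts) ℝ) (β : Fin M.p → ℝ) (x : Param (q + 1)) : ℝ :=
  M.g1 x + M.g2 x + M.g3 T β x

end LongitudinalModel

end

end EmpiricalPredictor

namespace EmpiricalPredictor

noncomputable section

/-! ### The spectral norm -/

section SpectralNorm

set_option linter.unusedSectionVars false

variable {ι κ : Type*} [Fintype ι] [DecidableEq ι] [Fintype κ] [DecidableEq κ]

/-! The proof transfers every object to a Gaussian vector of error contrasts. Let `C` be the true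
covariance matrix and `W = (T'CT)^{-1/2} T'`. Since `T'X = 0`, the fixed effects disappear, and at
the parameter `x` the vector `Wy` has law `N(0, S(x))` with `S(x) = 1 + ∑ (x_j - σ_j) K_j` and `K_j
= W C_j W'`, where `C_j = ∂Σ/∂σ_j`. Up to a constant the restricted log-likelihood is `-(log det S +
z'S⁻¹z)/2` at `z = Wy`. Hence all its derivatives have the form `c(x) + z'M(x)z` with deterministic
coefficients. The `K_j` are bounded in norm and the number of contrasts is `O(t)`. The information
is at least a multiple of `t`, because removing at most `p` dimensions, with `p` bounded, costs only
a bounded amount. The structure `REMLReduction` records these facts;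
`UniformBounds.exists_remlReduction` produces them.

Two estimates then carry the argument. The deterministic one says that the coefficients `M`, and
`c/t`, have derivatives of every order bounded on a fixed ball around `σ`, uniformly in `t`
(`BddDeriv`, `exists_bddDeriv_redForm`). The probabilistic one is a dimension-free moment bound: in
`N` dimensions `E(z'Mz - tr M)^{2k} ≤ C_k (N ‖M‖²)^k`, from the exponential moments of a
diagonalized form (`exists_integral_cqf_pow_le`). So the score, the centred second and the centred
third derivatives, divided by `√t`, have bounded moments of all orders, and the uncentred higher
derivatives are `t` times such a variable.

For (a), the moment conditions follow at once. For equicontinuity the expectations at `x` are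
written over one fixed standard Gaussian space by means of `S(x)^{1/2}`; the integrands are then
Lipschitz at `σ` in `L⁴`, hence `Q`, `U₁`, `U₂`, `U₃` are uniformly Lipschitz at `σ`. The mean score
vanishes identically. The bounds for `η` come from `UniformBounds.etaBdd`, where the bound on `∑
|m_i|` controls the sums over `i`.

For (b), the simplified Newton map `x ↦ x - A(σ)⁻¹ a(x)` is a contraction of a fixed ball whenever
the variable `Ψ`, which has all moments, is small compared with `√t`. Its limit is a root, it is
measurable as a limit of measurable iterates, and a Taylor expansion of the score gives the linear
representation. Markov's inequality makes the exceptional event as small as any required power.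

For (c), a second order expansion of `η` at a root close to `σ` has an explicit stochastic part plus
an error `O(t^{-3/2})` with bounded moments (`exists_expansion_error`). The linear term has mean
zero and the mean of the quadratic terms is exactly `∑ Δ_j(σ)` (`integral_expansion`). The map `x ↦
t ∑ Δ_j(x)` is uniformly Lipschitz at `σ`, so subtracting the correction at `σ̂` instead of `σ`
costs again `O(t^{-3/2})`. Off the good event, of probability complement `O(d_*^{-g/4})`, truncation
keeps the estimator `O(d_*^λ)`, and `g > 8 + 4λ` makes this contribution `o(d_*^{-2})`. -/

lemma norm_toLp_mulVec_le (A : Matrix ι κ ℝ) (v : κ → ℝ) :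
    ‖WithLp.toLp 2 (A *ᵥ v)‖ ≤ ‖A‖ * ‖WithLp.toLp 2 v‖ :=
  Matrix.l2_opNorm_mulVec A (WithLp.toLp 2 v)

lemma norm_le_of_mulVec_le (A : Matrix ι κ ℝ) {c : ℝ} (hc : 0 ≤ c)
    (h : ∀ v : κ → ℝ, ‖WithLp.toLp 2 (A *ᵥ v)‖ ≤ c * ‖WithLp.toLp 2 v‖) : ‖A‖ ≤ c := by
  rw [Matrix.l2_opNorm_def]
  exact ContinuousLinearMap.opNorm_le_bound _ hc fun v => h v

lemma abs_dotProduct_le (x y : ι → ℝ) :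
    |x ⬝ᵥ y| ≤ ‖WithLp.toLp 2 x‖ * ‖WithLp.toLp 2 y‖ := by
  have := abs_real_inner_le_norm (WithLp.toLp 2 x : EuclideanSpace ℝ ι) (WithLp.toLp 2 y)
  simpa [PiLp.inner_apply, dotProduct, mul_comm] using this

lemma abs_dotProduct_mulVec_le (A : Matrix ι κ ℝ) (x : ι → ℝ) (y : κ → ℝ) :
    |x ⬝ᵥ (A *ᵥ y)| ≤ ‖A‖ * ‖WithLp.toLp 2 x‖ * ‖WithLp.toLp 2 y‖ := by
  refine (abs_dotProduct_le _ _).trans ?_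
  have := mul_le_mul_of_nonneg_left (norm_toLp_mulVec_le A y) (norm_nonneg (WithLp.toLp 2 x))
  linarith

lemma dotProduct_self_eq_norm_sq (x : ι → ℝ) : x ⬝ᵥ x = ‖WithLp.toLp 2 x‖ ^ 2 := by
  rw [EuclideanSpace.real_norm_sq_eq]; simp [dotProduct, sq]

lemma abs_entry_le_norm (A : Matrix ι κ ℝ) (i : ι) (j : κ) : |A i j| ≤ ‖A‖ := by
  have := abs_dotProduct_mulVec_le A (Pi.single i 1) (Pi.single j 1)
  simpa [Matrix.mulVec_single_one] using this

lemma abs_trace_le (A : Matrix ι ι ℝ) : |A.trace| ≤ Fintype.card ι * ‖A‖ := by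
  calc |A.trace| ≤ ∑ i, |A i i| := Finset.abs_sum_le_sum_abs _ _
    _ ≤ ∑ _i : ι, ‖A‖ := Finset.sum_le_sum fun i _ => abs_entry_le_norm A i i
    _ = _ := by simp

lemma norm_toLp_le_sum_abs (v : ι → ℝ) : ‖WithLp.toLp 2 v‖ ≤ ∑ i, |v i| := by
  rw [EuclideanSpace.norm_eq]
  refine Real.sqrt_le_iff.2 ⟨by positivity, ?_⟩
  simpa using Finset.sum_sq_le_sq_sum_of_nonneg (s := Finset.univ)
    (f := fun i => |v i|) (fun i _ => abs_nonneg _)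

lemma norm_le_sum_abs (A : Matrix ι κ ℝ) : ‖A‖ ≤ ∑ i, ∑ j, |A i j| := by
  refine norm_le_of_mulVec_le A (by positivity) fun v => ?_
  refine (norm_toLp_le_sum_abs _).trans ?_
  rw [Finset.sum_mul]
  refine Finset.sum_le_sum fun i _ => ?_
  rw [Finset.sum_mul]
  refine (Finset.abs_sum_le_sum_abs _ _).trans (Finset.sum_le_sum fun j _ => ?_)
  rw [abs_mul]
  refine mul_le_mul_of_nonneg_left ?_ (abs_nonneg _)
  simpa using PiLp.norm_apply_le (WithLp.toLp 2 v : EuclideanSpace ℝ κ) j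

lemma norm_transpose_eq (A : Matrix ι κ ℝ) : ‖Aᵀ‖ = ‖A‖ := by
  simpa [Matrix.conjTranspose_eq_transpose_of_trivial] using Matrix.l2_opNorm_conjTranspose A

lemma norm_one_le : ‖(1 : Matrix ι ι ℝ)‖ ≤ 1 :=
  norm_le_of_mulVec_le _ zero_le_one fun v => by simp

/-- This turns the natural variance scale `tr(W²)` of a Gaussian quadratic form into dimension times
squared norm, the quantity controlled later. -/
lemma trace_mul_self_le (W : Matrix ι ι ℝ) : (W * W).trace ≤ Fintype.card ι * ‖W‖ ^ 2 := by
  refine (le_abs_self _).trans ((abs_trace_le _).trans ?_)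
  gcongr
  rw [sq]; exact norm_mul_le _ _

end SpectralNorm

/-! ### Quadratic forms in Gaussian vectors -/

/-- The quadratic form `z ↦ z'Wz`. -/
def qf {ι : Type*} [Fintype ι] (W : Matrix ι ι ℝ) (z : EuclideanSpace ℝ ι) : ℝ :=
  (z : ι → ℝ) ⬝ᵥ (W *ᵥ (z : ι → ℝ))

/-- The centred quadratic form `z ↦ z'Wz - tr W`. -/
def cqf {ι : Type*} [Fintype ι] (W : Matrix ι ι ℝ) (z : EuclideanSpace ℝ ι) : ℝ :=
  qf W z - W.trace

section QuadraticForms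

variable {ι : Type*} [Fintype ι]

lemma qf_add (V W : Matrix ι ι ℝ) (z : EuclideanSpace ℝ ι) : qf (V + W) z = qf V z + qf W z := by
  simp [qf, Matrix.add_mulVec, dotProduct_add]

lemma qf_sub (V W : Matrix ι ι ℝ) (z : EuclideanSpace ℝ ι) : qf (V - W) z = qf V z - qf W z := by
  simp [qf, Matrix.sub_mulVec, dotProduct_sub]

lemma qf_smul (c : ℝ) (W : Matrix ι ι ℝ) (z : EuclideanSpace ℝ ι) :
    qf (c • W) z = c * qf W z := by
  simp [qf, Matrix.smul_mulVec, dotProduct_smul]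

lemma qf_neg (W : Matrix ι ι ℝ) (z : EuclideanSpace ℝ ι) : qf (-W) z = -qf W z := by
  simp [qf, Matrix.neg_mulVec, dotProduct_neg]

lemma qf_transpose (W : Matrix ι ι ℝ) (z : EuclideanSpace ℝ ι) : qf Wᵀ z = qf W z := by
  simp only [qf]
  rw [Matrix.mulVec_transpose, Matrix.dotProduct_mulVec, dotProduct_comm]

lemma cqf_sub (V W : Matrix ι ι ℝ) (z : EuclideanSpace ℝ ι) :
    cqf (V - W) z = cqf V z - cqf W z := by
  simp [cqf, qf_sub, Matrix.trace_sub]; ring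

lemma cqf_smul (c : ℝ) (W : Matrix ι ι ℝ) (z : EuclideanSpace ℝ ι) :
    cqf (c • W) z = c * cqf W z := by
  simp [cqf, qf_smul, Matrix.trace_smul]; ring

lemma continuous_qf (W : Matrix ι ι ℝ) : Continuous (qf W) := by
  unfold qf
  simp only [dotProduct, Matrix.mulVec]
  fun_prop

lemma continuous_cqf (W : Matrix ι ι ℝ) : Continuous (cqf W) :=
  (continuous_qf W).sub continuous_const

variable [DecidableEq ι]

lemma abs_qf_le (W : Matrix ι ι ℝ) (z : EuclideanSpace ℝ ι) : |qf W z| ≤ ‖W‖ * ‖z‖ ^ 2 := by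
  have := abs_dotProduct_mulVec_le W z z
  simp only [WithLp.toLp_ofLp] at this
  rw [qf]; nlinarith

lemma qf_one (z : EuclideanSpace ℝ ι) : qf (1 : Matrix ι ι ℝ) z = ‖z‖ ^ 2 := by
  rw [qf, Matrix.one_mulVec, dotProduct_self_eq_norm_sq]

/-- Moves a change of covariance from the Gaussian vector into the matrix of the form, so that all
parameters can share one standard Gaussian space. -/
lemma qf_toEuclideanCLM (W R : Matrix ι ι ℝ) (z : EuclideanSpace ℝ ι) :
    qf W (Matrix.toEuclideanCLM (𝕜 := ℝ) R z) = qf (Rᵀ * W * R) z := by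
  simp only [qf, Matrix.ofLp_toEuclideanCLM]
  rw [← Matrix.mulVec_mulVec, ← Matrix.mulVec_mulVec, Matrix.dotProduct_mulVec (z : ι → ℝ),
    Matrix.vecMul_transpose]

end QuadraticForms

/-! ### Functions of polynomial growth -/

/-- Continuous functions of at most polynomial growth. -/
def PolyGrowth {E : Type*} [NormedAddCommGroup E] (f : E → ℝ) : Prop :=
  Continuous f ∧ ∃ C, ∃ m : ℕ, 0 ≤ C ∧ ∀ z, |f z| ≤ C * (1 + ‖z‖) ^ m

namespace PolyGrowth

variable {E : Type*} [NormedAddCommGroup E] {f g : E → ℝ}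

lemma const (c : ℝ) : PolyGrowth (fun _ : E => c) :=
  ⟨continuous_const, |c|, 0, abs_nonneg _, fun z => by simp⟩

lemma mul (hf : PolyGrowth f) (hg : PolyGrowth g) : PolyGrowth (fun z => f z * g z) := by
  obtain ⟨hfc, C, m, hC, hf⟩ := hf
  obtain ⟨hgc, C', m', hC', hg⟩ := hg
  refine ⟨hfc.mul hgc, C * C', m + m', by positivity, fun z => ?_⟩
  rw [abs_mul, pow_add]
  calc |f z| * |g z| ≤ (C * (1 + ‖z‖) ^ m) * (C' * (1 + ‖z‖) ^ m') :=
        mul_le_mul (hf z) (hg z) (abs_nonneg _) (by positivity)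
    _ = _ := by ring

lemma add (hf : PolyGrowth f) (hg : PolyGrowth g) : PolyGrowth (fun z => f z + g z) := by
  obtain ⟨hfc, C, m, hC, hf⟩ := hf
  obtain ⟨hgc, C', m', hC', hg⟩ := hg
  refine ⟨hfc.add hgc, C + C', max m m', by positivity, fun z => ?_⟩
  have h1 : (1:ℝ) ≤ 1 + ‖z‖ := by linarith [norm_nonneg z]
  calc |f z + g z| ≤ |f z| + |g z| := abs_add_le _ _
    _ ≤ C * (1 + ‖z‖) ^ m + C' * (1 + ‖z‖) ^ m' := add_le_add (hf z) (hg z)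
    _ ≤ C * (1 + ‖z‖) ^ (max m m') + C' * (1 + ‖z‖) ^ (max m m') := by
        gcongr <;> first | exact h1 | simp
    _ = _ := by ring

lemma const_mul (c : ℝ) (hf : PolyGrowth f) : PolyGrowth (fun z => c * f z) := (const c).mul hf

lemma sub (hf : PolyGrowth f) (hg : PolyGrowth g) : PolyGrowth (fun z => f z - g z) := by
  simpa [sub_eq_add_neg] using hf.add (hg.const_mul (-1))

lemma abs (hf : PolyGrowth f) : PolyGrowth (fun z => |f z|) := by
  obtain ⟨hfc, C, m, hC, hf⟩ := hf
  exact ⟨hfc.abs, C, m, hC, fun z => by simpa using hf z⟩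

lemma pow (hf : PolyGrowth f) (k : ℕ) : PolyGrowth (fun z => f z ^ k) := by
  induction k with
  | zero => simpa using const (E := E) 1
  | succ k ih => simpa [pow_succ] using ih.mul hf

/-- The norm has moments of every order under a Gaussian measure, so the polynomial bound is an
integrable majorant. -/
lemma integrable [NormedSpace ℝ E] [MeasurableSpace E] [BorelSpace E] [CompleteSpace E]
    [SecondCountableTopology E] (hf : PolyGrowth f) (μ : Measure E) [IsGaussian μ] :
    Integrable f μ := by
  obtain ⟨hfc, C, m, hC, hf⟩ := hf
  have hm : MemLp (fun z : E => (1 + ‖z‖)) m μ := by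
    refine MemLp.add (memLp_const 1) (MemLp.norm ?_)
    exact IsGaussian.memLp_id μ m (by simp)
  have := (hm.integrable_norm_pow').const_mul C
  refine this.mono' hfc.aestronglyMeasurable (Eventually.of_forall fun z => ?_)
  rw [Real.norm_eq_abs, Real.norm_of_nonneg (by positivity)]
  exact hf z

end PolyGrowth

lemma polyGrowth_qf {ι : Type*} [Fintype ι] [DecidableEq ι] (W : Matrix ι ι ℝ) :
    PolyGrowth (qf W) := by
  refine ⟨continuous_qf W, ‖W‖, 2, norm_nonneg _, fun z => (abs_qf_le W z).trans ?_⟩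
  gcongr
  linarith

lemma polyGrowth_cqf {ι : Type*} [Fintype ι] [DecidableEq ι] (W : Matrix ι ι ℝ) :
    PolyGrowth (cqf W) := (polyGrowth_qf W).sub (.const _)

/-! ### Moments of centred Gaussian quadratic forms -/

/-- The linear term is kept separate because it will integrate to zero. For `|y| ≤ 1` this is the
Taylor estimate; for larger `|y|` the factor `y² ≥ 1` lets the last term absorb everything. -/
lemma exp_le_one_add_add_sq_mul_exp_abs (y : ℝ) :
    Real.exp y ≤ 1 + y + y ^ 2 * Real.exp |y| := by
  have h0 : 1 ≤ Real.exp |y| := Real.one_le_exp (abs_nonneg y)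
  by_cases h : |y| ≤ 1
  · have := Real.abs_exp_sub_one_sub_id_le h
    have h2 := (abs_le.1 this).2
    nlinarith [sq_nonneg y]
  · push Not at h
    rcases le_total 0 y with hy | hy
    · rw [abs_of_nonneg hy] at h h0 ⊢
      have : 1 * Real.exp y ≤ y ^ 2 * Real.exp y := by
        gcongr
        nlinarith
      linarith
    · rw [abs_of_nonpos hy] at h h0 ⊢
      have : Real.exp y ≤ 1 := Real.exp_le_one_iff.2 hy
      nlinarith

lemma integral_sq_gaussianReal : ∫ x : ℝ, x ^ 2 ∂gaussianReal 0 1 = 1 := by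
  have h := variance_id_gaussianReal (μ := 0) (v := 1)
  rw [variance_eq_integral (by fun_prop)] at h
  simpa using h

/-- Since `E x² = 1`, the linear term of the exponential has mean zero, and the quadratic remainder
is integrable because some `exp(c x²)` is. Then `1 + u ≤ exp u` gives a sub-Gaussian bound near the
origin. -/
lemma exists_mgf_sq_sub_one_le : ∃ a₀ > 0, ∃ C ≥ 0, ∀ a : ℝ, |a| ≤ a₀ →
    Integrable (fun x : ℝ => Real.exp (a * (x ^ 2 - 1))) (gaussianReal 0 1) ∧
    ∫ x : ℝ, Real.exp (a * (x ^ 2 - 1)) ∂gaussianReal 0 1 ≤ Real.exp (C * a ^ 2) := by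
  obtain ⟨c, hc, hint⟩ := IsGaussian.exists_integrable_exp_sq (gaussianReal 0 1)
  have hint1 : Integrable (fun x : ℝ => Real.exp (c * |x ^ 2 - 1|)) (gaussianReal 0 1) := by
    refine (hint.const_mul (Real.exp c)).mono' (by fun_prop) (Eventually.of_forall fun x => ?_)
    rw [Real.norm_of_nonneg (Real.exp_pos _).le, ← Real.exp_add]
    refine Real.exp_le_exp.2 ?_
    have : |x ^ 2 - 1| ≤ x ^ 2 + 1 := by
      rw [abs_le]; constructor <;> nlinarith [sq_nonneg x]
    rw [Real.norm_eq_abs, sq_abs]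
    nlinarith
  have hint2 : Integrable (fun x : ℝ => (x ^ 2 - 1)) (gaussianReal 0 1) := by
    refine Integrable.sub ?_ (integrable_const _)
    have := (IsGaussian.memLp_id (gaussianReal 0 1) 2 (by simp)).integrable_sq
    simpa using this
  set J := ∫ x : ℝ, Real.exp (c * |x ^ 2 - 1|) ∂gaussianReal 0 1 with hJ
  have hJ0 : 0 ≤ J := integral_nonneg fun x => (Real.exp_pos _).le
  -- Restricting to `|a| ≤ c/2` leaves half of the exponent `c |x² - 1|` to dominate `exp |a(x² -
  -- 1)|` and the other half to absorb `(x² - 1)²`; the factor `8/c²` is `u²/2 ≤ exp u` at `u =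
  -- (c/2)|x² - 1|`.
  have key : ∀ a : ℝ, |a| ≤ c / 2 → ∀ x : ℝ, Real.exp (a * (x ^ 2 - 1)) ≤
      1 + a * (x ^ 2 - 1) + a ^ 2 * (8 / c ^ 2) * Real.exp (c * |x ^ 2 - 1|) := by
    intro a ha x
    refine (exp_le_one_add_add_sq_mul_exp_abs _).trans ?_
    have h1 : (c / 2 * |x ^ 2 - 1|) ^ 2 / 2 ≤ Real.exp (c / 2 * |x ^ 2 - 1|) := by
      have := Real.pow_div_factorial_le_exp (c / 2 * |x ^ 2 - 1|) (by positivity) 2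
      simpa using this
    have h2 : Real.exp |a * (x ^ 2 - 1)| ≤ Real.exp (c / 2 * |x ^ 2 - 1|) := by
      rw [abs_mul]; gcongr
    have h3 : Real.exp (c * |x ^ 2 - 1|) =
        Real.exp (c / 2 * |x ^ 2 - 1|) * Real.exp (c / 2 * |x ^ 2 - 1|) := by
      rw [← Real.exp_add]; ring_nf
    have h4 : (x ^ 2 - 1) ^ 2 ≤ 8 / c ^ 2 * Real.exp (c / 2 * |x ^ 2 - 1|) := by
      rw [mul_pow, sq_abs] at h1
      rw [div_mul_eq_mul_div, le_div_iff₀ (by positivity)]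
      nlinarith
    rw [h3]
    have : (a * (x ^ 2 - 1)) ^ 2 * Real.exp |a * (x ^ 2 - 1)| ≤
        a ^ 2 * (8 / c ^ 2) * (Real.exp (c / 2 * |x ^ 2 - 1|) * Real.exp (c / 2 * |x ^ 2 - 1|)) := by
      calc (a * (x ^ 2 - 1)) ^ 2 * Real.exp |a * (x ^ 2 - 1)|
          = a ^ 2 * ((x ^ 2 - 1) ^ 2 * Real.exp |a * (x ^ 2 - 1)|) := by ring
        _ ≤ a ^ 2 * ((8 / c ^ 2 * Real.exp (c / 2 * |x ^ 2 - 1|)) *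
              Real.exp (c / 2 * |x ^ 2 - 1|)) := by gcongr
        _ = _ := by ring
    linarith
  refine ⟨c / 2, by positivity, 8 / c ^ 2 * J, by positivity, fun a ha => ?_⟩
  have hint3 : Integrable (fun x : ℝ => 1 + a * (x ^ 2 - 1) +
      a ^ 2 * (8 / c ^ 2) * Real.exp (c * |x ^ 2 - 1|)) (gaussianReal 0 1) :=
    ((integrable_const _).add (hint2.const_mul a)).add (hint1.const_mul _)
  have hint4 : Integrable (fun x : ℝ => Real.exp (a * (x ^ 2 - 1))) (gaussianReal 0 1) := by
    refine hint3.mono' (by fun_prop) (Eventually.of_forall fun x => ?_)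
    rw [Real.norm_of_nonneg (Real.exp_pos _).le]
    exact key a ha x
  refine ⟨hint4, (integral_mono hint4 hint3 (key a ha)).trans ?_⟩
  rw [integral_add (by fun_prop) (by fun_prop), integral_add (by fun_prop) (by fun_prop),
    integral_const_mul, integral_const_mul]
  have h5 : ∫ x : ℝ, (x ^ 2 - 1) ∂gaussianReal 0 1 = 0 := by
    rw [integral_sub _ (integrable_const _), integral_sq_gaussianReal]
    · simp
    · have := hint2.add (integrable_const (1 : ℝ))
      exact this.congr (Eventually.of_forall fun x => by simp)
  rw [h5, ← hJ]
  have := Real.add_one_le_exp (8 / c ^ 2 * J * a ^ 2)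
  simp only [integral_const, probReal_univ, smul_eq_mul, mul_one, mul_zero, add_zero]
  linarith

section CentredForms

variable {ι : Type*} [Fintype ι] [DecidableEq ι]

lemma qf_sum_eigenvectorBasis {W : Matrix ι ι ℝ} (hW : W.IsHermitian) (x : ι → ℝ) :
    qf W (∑ i, x i • hW.eigenvectorBasis i) = ∑ i, hW.eigenvalues i * x i ^ 2 := by
  have h1 : W *ᵥ (∑ i, x i • hW.eigenvectorBasis i : EuclideanSpace ℝ ι) =
      (∑ i, (x i * hW.eigenvalues i) • hW.eigenvectorBasis i : EuclideanSpace ℝ ι) := by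
    rw [← Matrix.ofLp_toEuclideanCLM (𝕜 := ℝ), map_sum]
    congr 1
    refine Finset.sum_congr rfl fun i _ => ?_
    rw [map_smul, mul_smul]
    congr 1
    ext j
    rw [Matrix.ofLp_toEuclideanCLM, hW.mulVec_eigenvectorBasis]
    simp
  have h2 : qf W (∑ i, x i • hW.eigenvectorBasis i) =
      inner ℝ (∑ i, (x i * hW.eigenvalues i) • hW.eigenvectorBasis i)
        (∑ i, x i • hW.eigenvectorBasis i) := by
    rw [qf, h1, PiLp.inner_apply]
    simp [dotProduct]
  rw [h2, hW.eigenvectorBasis.orthonormal.inner_sum]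
  simp only [conj_trivial]
  exact Finset.sum_congr rfl fun i _ => by ring

lemma trace_mul_self_eq_sum_sq {W : Matrix ι ι ℝ} (hW : W.IsHermitian) :
    (W * W).trace = ∑ i, hW.eigenvalues i ^ 2 := by
  conv_lhs => rw [hW.spectral_theorem]
  rw [← map_mul, Unitary.conjStarAlgAut_apply, Matrix.trace_mul_cycle]
  simp [Matrix.diagonal_mul_diagonal, Matrix.trace_diagonal, sq]

/-- In an orthonormal eigenbasis the centred form is `∑ λ_i (x_i² - 1)` with independent standard
coordinates, so the exponential moment factorizes. The normalization `∑ λ_i² ≤ 1` keeps every `a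
λ_i` in the admissible range and makes the exponents add up to at most `C a²`, whatever the
dimension. -/
lemma exists_mgf_cqf_le : ∃ a₀ > 0, ∃ C ≥ 0, ∀ {ι : Type} [Fintype ι] [DecidableEq ι]
    (W : Matrix ι ι ℝ), W.IsHermitian → (W * W).trace ≤ 1 → ∀ a : ℝ, |a| ≤ a₀ →
    Integrable (fun z => Real.exp (a * cqf W z)) (stdGaussian (EuclideanSpace ℝ ι)) ∧
    ∫ z, Real.exp (a * cqf W z) ∂stdGaussian (EuclideanSpace ℝ ι) ≤ Real.exp (C * a ^ 2) := by
  obtain ⟨a₀, ha₀, C, hC, h⟩ := exists_mgf_sq_sub_one_le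
  refine ⟨a₀, ha₀, C, hC, fun {ι} _ _ W hW htr a ha => ?_⟩
  have hmeas : Measurable fun x : ι → ℝ => ∑ i, x i • hW.eigenvectorBasis i := by fun_prop
  have hcont : Continuous fun z => Real.exp (a * cqf W z) :=
    Real.continuous_exp.comp (continuous_const.mul (continuous_cqf W))
  have hlam : ∀ i, |a * hW.eigenvalues i| ≤ a₀ := by
    intro i
    have h1 : hW.eigenvalues i ^ 2 ≤ 1 := by
      rw [trace_mul_self_eq_sum_sq hW] at htr
      exact (Finset.single_le_sum (f := fun i => hW.eigenvalues i ^ 2)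
        (fun j _ => sq_nonneg _) (Finset.mem_univ i)).trans htr
    have h2 : |hW.eigenvalues i| ≤ 1 := (sq_le_one_iff_abs_le_one _).1 h1
    rw [abs_mul]
    nlinarith [abs_nonneg a, abs_nonneg (hW.eigenvalues i)]
  have hform : ∀ x : ι → ℝ, Real.exp (a * cqf W (∑ i, x i • hW.eigenvectorBasis i)) =
      ∏ i, Real.exp (a * hW.eigenvalues i * (x i ^ 2 - 1)) := by
    intro x
    rw [← Real.exp_sum, cqf, qf_sum_eigenvectorBasis hW, hW.trace_eq_sum_eigenvalues]
    congr 1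
    simp only [RCLike.ofReal_real_eq_id, id]
    rw [← Finset.sum_sub_distrib, Finset.mul_sum]
    exact Finset.sum_congr rfl fun i _ => by ring
  rw [stdGaussian_eq_map_pi_orthonormalBasis hW.eigenvectorBasis]
  constructor
  · rw [integrable_map_measure hcont.aestronglyMeasurable hmeas.aemeasurable]
    simp only [Function.comp_def, hform]
    exact Integrable.fintype_prod (f := fun i x => Real.exp (a * hW.eigenvalues i * (x ^ 2 - 1)))
      fun i => (h _ (hlam i)).1
  · rw [integral_map hmeas.aemeasurable hcont.aestronglyMeasurable]
    simp only [hform]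
    rw [integral_fintype_prod_eq_prod
      (f := fun i x => Real.exp (a * hW.eigenvalues i * (x ^ 2 - 1)))]
    calc ∏ i, ∫ x : ℝ, Real.exp (a * hW.eigenvalues i * (x ^ 2 - 1)) ∂gaussianReal 0 1
        ≤ ∏ i, Real.exp (C * (a * hW.eigenvalues i) ^ 2) :=
          Finset.prod_le_prod (fun i _ => integral_nonneg fun x => (Real.exp_pos _).le)
            fun i _ => (h _ (hlam i)).2
      _ = Real.exp (C * a ^ 2 * (W * W).trace) := by
          rw [← Real.exp_sum, trace_mul_self_eq_sum_sq hW, Finset.mul_sum]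
          congr 1
          exact Finset.sum_congr rfl fun i _ => by ring
      _ ≤ Real.exp (C * a ^ 2) := Real.exp_le_exp.2 (mul_le_of_le_one_right (by positivity) htr)

lemma pow_two_mul_le_exp_add_exp {a : ℝ} (ha : 0 < a) (k : ℕ) (x : ℝ) :
    x ^ (2 * k) ≤ (2 * k).factorial / a ^ (2 * k) * (Real.exp (a * x) + Real.exp (-a * x)) := by
  have h1 : (a * |x|) ^ (2 * k) / (2 * k).factorial ≤ Real.exp (a * |x|) :=
    Real.pow_div_factorial_le_exp _ (by positivity) _
  have h2 : Real.exp (a * |x|) ≤ Real.exp (a * x) + Real.exp (-a * x) := by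
    rcases abs_cases x with ⟨h, _⟩ | ⟨h, _⟩ <;> rw [h]
    · linarith [Real.exp_pos (-a * x)]
    · have : a * -x = -a * x := by ring
      rw [this]; linarith [Real.exp_pos (a * x)]
  have h3 : (a * |x|) ^ (2 * k) = a ^ (2 * k) * x ^ (2 * k) := by
    rw [mul_pow, pow_mul |x|, sq_abs, ← pow_mul]
  rw [h3, div_le_iff₀ (by positivity)] at h1
  rw [div_mul_eq_mul_div, le_div_iff₀ (by positivity)]
  have : (0:ℝ) < (2 * k).factorial := by positivity
  nlinarith

/-- The constant depends on `k` alone. Even moments are bounded by the exponential moments at `±a`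
when `tr W² ≤ 1`; the general case follows by scaling and symmetrizing. -/
theorem exists_integral_cqf_pow_le (k : ℕ) : ∃ C ≥ 0, ∀ {ι : Type} [Fintype ι] [DecidableEq ι]
    (W : Matrix ι ι ℝ), ∫ z, cqf W z ^ (2 * k) ∂stdGaussian (EuclideanSpace ℝ ι) ≤
      C * (Fintype.card ι * ‖W‖ ^ 2) ^ k := by
  obtain ⟨a, ha, C, hC, h⟩ := exists_mgf_cqf_le
  refine ⟨(2 * k).factorial / a ^ (2 * k) * (2 * Real.exp (C * a ^ 2)), by positivity,
    fun {ι} _ _ => ?_⟩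
  have unit : ∀ W : Matrix ι ι ℝ, W.IsHermitian → (W * W).trace ≤ 1 →
      ∫ z, cqf W z ^ (2 * k) ∂stdGaussian (EuclideanSpace ℝ ι) ≤
        (2 * k).factorial / a ^ (2 * k) * (2 * Real.exp (C * a ^ 2)) := by
    intro W hW htr
    have h1 := h W hW htr a (abs_of_pos ha).le
    have h2 := h W hW htr (-a) (by rw [abs_neg, abs_of_pos ha])
    calc ∫ z, cqf W z ^ (2 * k) ∂stdGaussian (EuclideanSpace ℝ ι)
        ≤ ∫ z, (2 * k).factorial / a ^ (2 * k) *
            (Real.exp (a * cqf W z) + Real.exp (-a * cqf W z))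
              ∂stdGaussian (EuclideanSpace ℝ ι) := by
          refine integral_mono (((polyGrowth_cqf W).pow _).integrable _)
            ((h1.1.add h2.1).const_mul _) fun z => pow_two_mul_le_exp_add_exp ha k _
      _ ≤ _ := by
          rw [integral_const_mul, integral_add h1.1 h2.1]
          have := h1.2
          have := h2.2
          rw [neg_sq] at this
          gcongr
          linarith
  have symm : ∀ W : Matrix ι ι ℝ, W.IsHermitian →
      ∫ z, cqf W z ^ (2 * k) ∂stdGaussian (EuclideanSpace ℝ ι) ≤
        (2 * k).factorial / a ^ (2 * k) * (2 * Real.exp (C * a ^ 2)) *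
          (Fintype.card ι * ‖W‖ ^ 2) ^ k := by
    intro W hW
    set m : ℝ := Fintype.card ι * ‖W‖ ^ 2 with hm
    have hm0 : 0 ≤ m := by positivity
    rcases hm0.eq_or_lt with hm0 | hm0
    · have hcqf : ∀ z : EuclideanSpace ℝ ι, cqf W z = 0 := by
        intro z
        rcases mul_eq_zero.1 (hm.symm.trans hm0.symm) with h0 | h0
        · have : IsEmpty ι := Fintype.card_eq_zero_iff.1 (by exact_mod_cast h0)
          simp [cqf, qf, Matrix.trace]
        · have : W = 0 := norm_eq_zero.1 (pow_eq_zero_iff (two_ne_zero) |>.1 h0)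
          simp [cqf, qf, this]
      simp only [hcqf]
      -- For `k = 0` both sides contain `0 ^ 0 = 1`, so the inequality has to come from the
      -- normalized case at the zero matrix.
      rcases Nat.eq_zero_or_pos k with rfl | hk
      · have := unit 0 (by simp [Matrix.IsHermitian]) (by simp)
        simpa [cqf, qf] using this
      · rw [zero_pow (by omega), integral_zero, ← hm0, zero_pow (by omega), mul_zero]
    · have h3 := unit ((√m)⁻¹ • W) (by
        rw [Matrix.IsHermitian, Matrix.conjTranspose_smul, hW]; simp) (by
        rw [smul_mul_smul_comm, Matrix.trace_smul, smul_eq_mul, ← mul_inv,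
          Real.mul_self_sqrt hm0.le, inv_mul_le_iff₀ hm0, mul_one]
        exact trace_mul_self_le W)
      simp only [cqf_smul, mul_pow] at h3
      rw [integral_const_mul, pow_mul, inv_pow, Real.sq_sqrt hm0.le, inv_pow,
        inv_mul_le_iff₀ (by positivity)] at h3
      linarith
  intro W
  -- Replacing `W` by its symmetric part changes neither the form nor the trace and does not
  -- increase the norm.
  have hsym := symm ((1 / 2 : ℝ) • (W + Wᵀ)) (by
    rw [Matrix.IsHermitian, Matrix.conjTranspose_eq_transpose_of_trivial, Matrix.transpose_smul,
      Matrix.transpose_add, Matrix.transpose_transpose, add_comm])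
  have heq : ∀ z : EuclideanSpace ℝ ι, cqf ((1 / 2 : ℝ) • (W + Wᵀ)) z = cqf W z := by
    intro z
    simp only [cqf, qf_smul, qf_add, qf_transpose, Matrix.trace_smul, Matrix.trace_add,
      Matrix.trace_transpose, smul_eq_mul]
    ring
  simp only [heq] at hsym
  refine hsym.trans ?_
  have : ‖(1 / 2 : ℝ) • (W + Wᵀ)‖ ≤ ‖W‖ := by
    rw [norm_smul]
    have := norm_add_le W Wᵀ
    rw [norm_transpose_eq] at this
    norm_num
    linarith
  gcongr

lemma integral_qf_stdGaussian (W : Matrix ι ι ℝ) :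
    ∫ z, qf W z ∂stdGaussian (EuclideanSpace ℝ ι) = W.trace := by
  have symm : ∀ W : Matrix ι ι ℝ, W.IsHermitian →
      ∫ z, qf W z ∂stdGaussian (EuclideanSpace ℝ ι) = W.trace := by
    intro W hW
    have hmeas : Measurable fun x : ι → ℝ => ∑ i, x i • hW.eigenvectorBasis i := by fun_prop
    rw [stdGaussian_eq_map_pi_orthonormalBasis hW.eigenvectorBasis,
      integral_map hmeas.aemeasurable (continuous_qf W).aestronglyMeasurable]
    simp only [qf_sum_eigenvectorBasis hW]
    have hi : ∀ i : ι, Integrable (fun x : ι → ℝ => x i ^ 2)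
        (Measure.pi fun _ : ι => gaussianReal 0 1) := fun i => by
      have h1 : Integrable (fun x : ℝ => x ^ 2) (gaussianReal 0 1) := by
        simpa using (IsGaussian.memLp_id (gaussianReal 0 1) 2 (by simp)).integrable_sq
      exact integrable_comp_eval (μ := fun _ : ι => gaussianReal 0 1) (i := i) h1
    rw [integral_finsetSum _ fun i _ => (hi i).const_mul _, hW.trace_eq_sum_eigenvalues]
    refine Finset.sum_congr rfl fun i _ => ?_
    rw [integral_const_mul]
    have h2 : ∫ x : ι → ℝ, x i ^ 2 ∂(Measure.pi fun _ : ι => gaussianReal 0 1) = 1 := by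
      rw [integral_comp_eval (μ := fun _ : ι => gaussianReal 0 1) (i := i)
        (f := fun x : ℝ => x ^ 2) (by fun_prop), integral_sq_gaussianReal]
    rw [h2]; simp
  have hsym := symm ((1 / 2 : ℝ) • (W + Wᵀ)) (by
    rw [Matrix.IsHermitian, Matrix.conjTranspose_eq_transpose_of_trivial, Matrix.transpose_smul,
      Matrix.transpose_add, Matrix.transpose_transpose, add_comm])
  have heq : ∀ z : EuclideanSpace ℝ ι, qf ((1 / 2 : ℝ) • (W + Wᵀ)) z = qf W z := by
    intro z
    simp only [qf_smul, qf_add, qf_transpose]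
    ring
  simp only [heq] at hsym
  rw [hsym, Matrix.trace_smul, Matrix.trace_add, Matrix.trace_transpose, smul_eq_mul]
  ring

lemma integral_cqf_stdGaussian (W : Matrix ι ι ℝ) :
    ∫ z, cqf W z ∂stdGaussian (EuclideanSpace ℝ ι) = 0 := by
  simp only [cqf]
  rw [integral_sub ((polyGrowth_qf W).integrable _) (integrable_const _), integral_qf_stdGaussian]
  simp

end CentredForms

end

end EmpiricalPredictor

namespace EmpiricalPredictor

noncomputable section

/-! ### Uniform bounds for partial derivatives -/

section BddDeriv

variable {s : ℕ} {E F G : Type*} [NormedAddCommGroup E] [NormedSpace ℝ E]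
  [NormedAddCommGroup F] [NormedSpace ℝ F] [NormedAddCommGroup G] [NormedSpace ℝ G]

/-- The partial derivative `∂f/∂σ_i` of a vector-valued function. -/
def vpd (i : Fin s) (f : Param s → E) (x : Param s) : E := fderiv ℝ f x (EuclideanSpace.single i 1)

lemma pderiv_eq_vpd (i : Fin s) (f : Param s → ℝ) : pderiv i f = vpd i f := rfl

/-- On `U`, the function `f` and its partial derivatives up to order `k` exist and are bounded
by `C`. -/
def BddDeriv (U : Set (Param s)) : ℕ → (Param s → E) → ℝ → Prop
  | 0, f, C => ∀ x ∈ U, ‖f x‖ ≤ C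
  | k + 1, f, C => (∀ x ∈ U, ‖f x‖ ≤ C) ∧ (∀ x ∈ U, DifferentiableAt ℝ f x) ∧
      ∀ i, BddDeriv U k (vpd i f) C

lemma vpd_congr {U : Set (Param s)} (hU : IsOpen U) {f g : Param s → E} (h : Set.EqOn f g U)
    (i : Fin s) : Set.EqOn (vpd i f) (vpd i g) U := fun x hx => by
  have : f =ᶠ[𝓝 x] g := Filter.eventuallyEq_of_mem (hU.mem_nhds hx) h
  rw [vpd, vpd, this.fderiv_eq]

namespace BddDeriv

variable {U : Set (Param s)} {k : ℕ} {f g : Param s → E} {C C' : ℝ}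

lemma norm_le (h : BddDeriv U k f C) {x : Param s} (hx : x ∈ U) : ‖f x‖ ≤ C := by
  cases k with
  | zero => exact h x hx
  | succ k => exact h.1 x hx

lemma differentiableAt (h : BddDeriv U (k + 1) f C) {x : Param s} (hx : x ∈ U) :
    DifferentiableAt ℝ f x := h.2.1 x hx

lemma vpd (h : BddDeriv U (k + 1) f C) (i : Fin s) : BddDeriv U k (vpd i f) C := h.2.2 i

lemma of_succ (h : BddDeriv U (k + 1) f C) : BddDeriv U k f C := by
  induction k generalizing f with
  | zero => exact h.1
  | succ k ih => exact ⟨h.1, h.2.1, fun i => ih (h.2.2 i)⟩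

lemma mono (h : BddDeriv U k f C) (hC : C ≤ C') : BddDeriv U k f C' := by
  induction k generalizing f with
  | zero => exact fun x hx => (h x hx).trans hC
  | succ k ih => exact ⟨fun x hx => (h.1 x hx).trans hC, h.2.1, fun i => ih (h.2.2 i)⟩

lemma congr (hU : IsOpen U) (h : BddDeriv U k f C) (hfg : Set.EqOn f g U) : BddDeriv U k g C := by
  induction k generalizing f g with
  | zero => exact fun x hx => by rw [← hfg hx]; exact h x hx
  | succ k ih =>
    refine ⟨fun x hx => by rw [← hfg hx]; exact h.1 x hx, fun x hx => ?_,
      fun i => ih (h.2.2 i) (vpd_congr hU hfg i)⟩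
    exact (h.2.1 x hx).congr_of_eventuallyEq
      (Filter.eventuallyEq_of_mem (hU.mem_nhds hx) hfg).symm

lemma zero (U : Set (Param s)) (k : ℕ) : BddDeriv U k (fun _ => (0 : E)) 0 := by
  induction k with
  | zero => exact fun x hx => by simp
  | succ k ih =>
    refine ⟨fun x hx => by simp, fun x hx => differentiableAt_const _, fun i => ?_⟩
    have : EmpiricalPredictor.vpd i (fun _ : Param s => (0 : E)) = fun _ => 0 := by
      ext x; simp [EmpiricalPredictor.vpd]
    rw [this]; exact ih

lemma const (U : Set (Param s)) (k : ℕ) (c : E) : BddDeriv U k (fun _ => c) ‖c‖ := by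
  cases k with
  | zero => exact fun x hx => le_rfl
  | succ k =>
    refine ⟨fun x hx => le_rfl, fun x hx => differentiableAt_const _, fun i => ?_⟩
    have : EmpiricalPredictor.vpd i (fun _ : Param s => c) = fun _ => 0 := by
      ext x; simp [EmpiricalPredictor.vpd]
    rw [this]; exact (zero U k).mono (norm_nonneg _)

lemma add (hU : IsOpen U) (hf : BddDeriv U k f C) (hg : BddDeriv U k g C') :
    BddDeriv U k (fun x => f x + g x) (C + C') := by
  induction k generalizing f g with
  | zero => exact fun x hx => (norm_add_le _ _).trans (add_le_add (hf x hx) (hg x hx))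
  | succ k ih =>
    refine ⟨fun x hx => (norm_add_le _ _).trans (add_le_add (hf.1 x hx) (hg.1 x hx)),
      fun x hx => (hf.2.1 x hx).add (hg.2.1 x hx), fun i => ?_⟩
    refine (ih (hf.2.2 i) (hg.2.2 i)).congr hU fun x hx => ?_
    simp only [EmpiricalPredictor.vpd]
    rw [fderiv_fun_add (hf.2.1 x hx) (hg.2.1 x hx)]
    rfl

lemma clm (hU : IsOpen U) (hf : BddDeriv U k f C) (L : E →L[ℝ] F) {c : ℝ} (hc : 0 ≤ c)
    (hL : ∀ v, ‖L v‖ ≤ c * ‖v‖) : BddDeriv U k (fun x => L (f x)) (c * C) := by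
  induction k generalizing f with
  | zero => exact fun x hx => (hL _).trans (mul_le_mul_of_nonneg_left (hf x hx) hc)
  | succ k ih =>
    refine ⟨fun x hx => (hL _).trans (mul_le_mul_of_nonneg_left (hf.1 x hx) hc),
      fun x hx => L.differentiableAt.comp x (hf.2.1 x hx), fun i => ?_⟩
    refine (ih (hf.2.2 i)).congr hU fun x hx => ?_
    have h : fderiv ℝ (fun x => L (f x)) x = _ :=
      (L.hasFDerivAt.comp x (hf.2.1 x hx).hasFDerivAt).fderiv
    simp only [EmpiricalPredictor.vpd, h]
    rfl

lemma const_smul (hU : IsOpen U) (hf : BddDeriv U k f C) (c : ℝ) :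
    BddDeriv U k (fun x => c • f x) (|c| * C) := by
  refine hf.clm hU (c • ContinuousLinearMap.id ℝ E) (abs_nonneg c) fun v => ?_
  simp [norm_smul]

lemma neg (hU : IsOpen U) (hf : BddDeriv U k f C) : BddDeriv U k (fun x => - f x) C := by
  simpa using hf.const_smul hU (-1)

lemma sub (hU : IsOpen U) (hf : BddDeriv U k f C) (hg : BddDeriv U k g C') :
    BddDeriv U k (fun x => f x - g x) (C + C') := by
  simpa [sub_eq_add_neg] using hf.add hU (hg.neg hU)

lemma sum {κ : Type*} (hU : IsOpen U) (t : Finset κ) {f : κ → Param s → E} {C : κ → ℝ}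
    (h : ∀ i ∈ t, BddDeriv U k (f i) (C i)) :
    BddDeriv U k (fun x => ∑ i ∈ t, f i x) (∑ i ∈ t, C i) := by
  classical
  induction t using Finset.induction_on with
  | empty => simpa using zero U k
  | insert a t ha ih =>
    simp only [Finset.sum_insert ha]
    exact (h a (by simp)).add hU (ih fun i hi => h i (by simp [hi]))

end BddDeriv

lemma vpd_bilin (B : E →L[ℝ] F →L[ℝ] G) {f : Param s → E} {g : Param s → F} {x : Param s}
    (hf : DifferentiableAt ℝ f x) (hg : DifferentiableAt ℝ g x) (i : Fin s) :
    vpd i (fun x => B (f x) (g x)) x = B (f x) (vpd i g x) + B (vpd i f x) (g x) := by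
  simp only [vpd]
  rw [(B.hasFDerivAt_of_bilinear hf.hasFDerivAt hg.hasFDerivAt).fderiv]
  simp

/-- Each differentiation splits the product into two terms, whence the factor `2 ^ k`. -/
lemma BddDeriv.bilin {U : Set (Param s)} (hU : IsOpen U) {k : ℕ} {f : Param s → E}
    {g : Param s → F} {C C' c : ℝ} (hf : BddDeriv U k f C) (hg : BddDeriv U k g C')
    (B : E →L[ℝ] F →L[ℝ] G) (hc : 0 ≤ c) (hC : 0 ≤ C) (hB : ∀ v w, ‖B v w‖ ≤ c * ‖v‖ * ‖w‖) :
    BddDeriv U k (fun x => B (f x) (g x)) (2 ^ k * c * C * C') := by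
  have key : ∀ {f : Param s → E} {g : Param s → F}, ∀ x ∈ U, ‖f x‖ ≤ C → ‖g x‖ ≤ C' →
      ‖B (f x) (g x)‖ ≤ c * C * C' := fun x hx h1 h2 => (hB _ _).trans (by gcongr)
  induction k generalizing f g with
  | zero => exact fun x hx => (key x hx (hf x hx) (hg x hx)).trans (le_of_eq (by ring))
  | succ k ih =>
    refine ⟨fun x hx => (key x hx (hf.1 x hx) (hg.1 x hx)).trans ?_, fun x hx => ?_, fun i => ?_⟩
    · have hC' : 0 ≤ C' := (norm_nonneg _).trans (hg.1 x hx)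
      have : (1:ℝ) ≤ 2 ^ (k + 1) := one_le_pow₀ (by norm_num)
      have h2 : 0 ≤ c * C * C' := by positivity
      nlinarith
    · exact (B.hasFDerivAt_of_bilinear (hf.2.1 x hx).hasFDerivAt
        (hg.2.1 x hx).hasFDerivAt).differentiableAt
    · refine (((ih hf.of_succ (hg.2.2 i)).add hU (ih (hf.2.2 i) hg.of_succ)).congr hU
        fun x hx => (vpd_bilin B (hf.2.1 x hx) (hg.2.1 x hx) i).symm).mono ?_
      rw [pow_succ]; linarith

/-! #### Matrix-valued functions -/

section MatrixValued

variable {l m n : Type} [Fintype l] [Fintype m] [Fintype n] [DecidableEq l] [DecidableEq m]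
  [DecidableEq n]

/-- Matrix multiplication as a continuous bilinear map. -/
def mulCLM (l m n : Type) [Fintype l] [Fintype m] [Fintype n] [DecidableEq l] [DecidableEq m]
    [DecidableEq n] : Matrix l m ℝ →L[ℝ] Matrix m n ℝ →L[ℝ] Matrix l n ℝ :=
  LinearMap.mkContinuous₂ (LinearMap.mk₂ ℝ (fun A B => A * B) (fun _ _ _ => Matrix.add_mul _ _ _)
    (fun _ _ _ => Matrix.smul_mul _ _ _) (fun _ _ _ => Matrix.mul_add _ _ _)
    (fun _ _ _ => Matrix.mul_smul _ _ _)) 1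
    (fun A B => by simpa using Matrix.l2_opNorm_mul A B)

@[simp] lemma mulCLM_apply (A : Matrix l m ℝ) (B : Matrix m n ℝ) : mulCLM l m n A B = A * B := rfl

/-- The matrix-vector product as a continuous linear function of the matrix. -/
def mulVecCLM (v : n → ℝ) : Matrix m n ℝ →L[ℝ] EuclideanSpace ℝ m :=
  LinearMap.mkContinuous
    { toFun := fun A => WithLp.toLp 2 (A *ᵥ v)
      map_add' := fun A B => by rw [Matrix.add_mulVec]; rfl
      map_smul' := fun c A => by rw [Matrix.smul_mulVec]; rfl } ‖WithLp.toLp 2 v‖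
    (fun A => by simpa [mul_comm] using norm_toLp_mulVec_le A v)

@[simp] lemma mulVecCLM_apply (v : n → ℝ) (A : Matrix m n ℝ) :
    mulVecCLM v A = WithLp.toLp 2 (A *ᵥ v) := rfl

/-- The matrix-vector product as a continuous bilinear map. -/
def mulVecCLM₂ (m n : Type) [Fintype m] [Fintype n] [DecidableEq m] [DecidableEq n] :
    Matrix m n ℝ →L[ℝ] EuclideanSpace ℝ n →L[ℝ] EuclideanSpace ℝ m :=
  LinearMap.mkContinuous₂ (LinearMap.mk₂ ℝ
    (fun A (v : EuclideanSpace ℝ n) => WithLp.toLp 2 (A *ᵥ (v : n → ℝ)))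
    (fun A B v => by rw [Matrix.add_mulVec]; rfl)
    (fun c A v => by rw [Matrix.smul_mulVec]; rfl)
    (fun A v w => by rw [WithLp.ofLp_add, Matrix.mulVec_add]; rfl)
    (fun c A v => by rw [WithLp.ofLp_smul, Matrix.mulVec_smul]; rfl)) 1
    (fun A v => by simpa using norm_toLp_mulVec_le A v)

@[simp] lemma mulVecCLM₂_apply (A : Matrix m n ℝ) (v : EuclideanSpace ℝ n) :
    mulVecCLM₂ m n A v = WithLp.toLp 2 (A *ᵥ (v : n → ℝ)) := rfl

/-- The trace as a continuous linear map. -/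
def traceCLM (n : Type) [Fintype n] [DecidableEq n] : Matrix n n ℝ →L[ℝ] ℝ :=
  LinearMap.mkContinuous (Matrix.traceLinearMap n ℝ ℝ) (Fintype.card n)
    (fun A => by simpa using abs_trace_le A)

@[simp] lemma traceCLM_apply (A : Matrix n n ℝ) : traceCLM n A = A.trace := rfl

/-- The quadratic form as a continuous linear function of the matrix. -/
def qfCLM (z : EuclideanSpace ℝ n) : Matrix n n ℝ →L[ℝ] ℝ :=
  LinearMap.mkContinuous
    { toFun := fun A => qf A z
      map_add' := fun A B => qf_add A B z
      map_smul' := fun c A => qf_smul c A z } (‖z‖ ^ 2)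
    (fun A => by simpa [mul_comm] using abs_qf_le A z)

@[simp] lemma qfCLM_apply (z : EuclideanSpace ℝ n) (A : Matrix n n ℝ) : qfCLM z A = qf A z := rfl

namespace BddDeriv

variable {U : Set (Param s)} {k : ℕ} {C C' : ℝ}

lemma matMul (hU : IsOpen U) {f : Param s → Matrix l m ℝ} {g : Param s → Matrix m n ℝ}
    (hf : BddDeriv U k f C) (hg : BddDeriv U k g C') (hC : 0 ≤ C) :
    BddDeriv U k (fun x => f x * g x) (2 ^ k * C * C') := by
  simpa using hf.bilin hU hg (mulCLM l m n) zero_le_one hC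
    (fun v w => by simpa using Matrix.l2_opNorm_mul v w)

lemma trace (hU : IsOpen U) {f : Param s → Matrix n n ℝ} (hf : BddDeriv U k f C) :
    BddDeriv U k (fun x => (f x).trace) (Fintype.card n * C) :=
  hf.clm hU (traceCLM n) (by positivity) (fun A => abs_trace_le A)

lemma qf (hU : IsOpen U) {f : Param s → Matrix n n ℝ} (hf : BddDeriv U k f C)
    (z : EuclideanSpace ℝ n) :
    BddDeriv U k (fun x => EmpiricalPredictor.qf (f x) z) (‖z‖ ^ 2 * C) :=
  hf.clm hU (qfCLM z) (by positivity) (fun A => by simpa [mul_comm] using abs_qf_le A z)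

lemma mulVec (hU : IsOpen U) {f : Param s → Matrix m n ℝ} {g : Param s → EuclideanSpace ℝ n}
    (hf : BddDeriv U k f C) (hg : BddDeriv U k g C') (hC : 0 ≤ C) :
    BddDeriv U k (fun x => WithLp.toLp 2 (f x *ᵥ (g x : n → ℝ))) (2 ^ k * C * C') := by
  simpa using hf.bilin hU hg (mulVecCLM₂ m n) zero_le_one hC
    (fun v w => by simpa using norm_toLp_mulVec_le v w)

lemma mulVec_const (hU : IsOpen U) {f : Param s → Matrix m n ℝ} (hf : BddDeriv U k f C)
    (v : n → ℝ) :
    BddDeriv U k (fun x => WithLp.toLp 2 (f x *ᵥ v)) (‖WithLp.toLp 2 v‖ * C) :=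
  hf.clm hU (mulVecCLM v) (norm_nonneg _)
    (fun A => by simpa [mul_comm] using norm_toLp_mulVec_le A v)

lemma dotProduct (hU : IsOpen U) {f g : Param s → EuclideanSpace ℝ n}
    (hf : BddDeriv U k f C) (hg : BddDeriv U k g C') (hC : 0 ≤ C) :
    BddDeriv U k (fun x => (f x : n → ℝ) ⬝ᵥ (g x : n → ℝ)) (2 ^ k * C * C') := by
  have := hf.bilin hU hg (innerSL ℝ) zero_le_one hC
    (fun v w => by simpa [innerSL_apply_apply ℝ] using abs_real_inner_le_norm v w)
  rw [mul_one] at this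
  refine this.congr hU fun x _ => ?_
  simp [innerSL_apply_apply ℝ, PiLp.inner_apply, _root_.dotProduct, mul_comm]

lemma apply (hU : IsOpen U) {f : Param s → Matrix m n ℝ} (hf : BddDeriv U k f C) (i : m) (j : n) :
    BddDeriv U k (fun x => f x i j) C := by
  have := hf.clm hU (LinearMap.mkContinuous (Matrix.entryLinearMap ℝ ℝ i j) 1
    (fun A => by simpa using abs_entry_le_norm A i j)) zero_le_one
    (fun A => by simpa using abs_entry_le_norm A i j)
  simpa using this

lemma of_apply (hU : IsOpen U) {f : Param s → Matrix m n ℝ}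
    (hf : ∀ i j, BddDeriv U k (fun x => f x i j) C) :
    BddDeriv U k f (Fintype.card m * (Fintype.card n * C)) := by
  have h : ∀ i j, BddDeriv U k (fun x => f x i j • Matrix.single i j (1 : ℝ)) C := by
    intro i j
    have hb : ∀ v : ℝ, ‖v • Matrix.single i j (1 : ℝ)‖ ≤ 1 * ‖v‖ := fun v => by
      rw [norm_smul, one_mul]
      refine mul_le_of_le_one_right (norm_nonneg _) ((norm_le_sum_abs _).trans (le_of_eq ?_))
      rw [Finset.sum_eq_single i, Finset.sum_eq_single j] <;>
        simp +contextual [Matrix.single_apply, eq_comm]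
    have := (hf i j).clm hU ((ContinuousLinearMap.id ℝ ℝ).smulRight (Matrix.single i j (1 : ℝ)))
      zero_le_one hb
    simpa using this
  have h2 := sum hU Finset.univ fun i _ => sum hU Finset.univ fun j _ => h i j
  simp only [Finset.sum_const, Finset.card_univ, nsmul_eq_mul] at h2
  refine h2.congr hU fun x _ => ?_
  conv_rhs => rw [Matrix.matrix_eq_sum_single (f x)]
  simp [Matrix.smul_single]

end BddDeriv

lemma hasFDerivAt_inv_matrix {A : Matrix n n ℝ} (hA : IsUnit A.det) :
    HasFDerivAt (fun A : Matrix n n ℝ => A⁻¹)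
      (-ContinuousLinearMap.mulLeftRight ℝ (Matrix n n ℝ) A⁻¹ A⁻¹) A := by
  have hu : IsUnit A := (Matrix.isUnit_iff_isUnit_det A).2 hA
  obtain ⟨u, rfl⟩ := hu
  have h := hasFDerivAt_ringInverse (𝕜 := ℝ) u
  have h1 : (fun A : Matrix n n ℝ => A⁻¹) = Ring.inverse := by
    funext A; exact Matrix.nonsing_inv_eq_ringInverse A
  rw [h1, Matrix.coe_units_inv] at *
  exact h

lemma vpd_inv {f : Param s → Matrix n n ℝ} {x : Param s} (hf : DifferentiableAt ℝ f x)
    (hu : IsUnit (f x).det) (i : Fin s) :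
    vpd i (fun x => (f x)⁻¹) x = -((f x)⁻¹ * vpd i f x * (f x)⁻¹) := by
  have h := (hasFDerivAt_inv_matrix hu).comp x hf.hasFDerivAt
  simp only [vpd]
  have h2 : fderiv ℝ (fun x => (f x)⁻¹) x = _ := h.fderiv
  rw [h2]
  simp [mul_assoc]

/-- The identity `∂(f⁻¹) = -f⁻¹ (∂f) f⁻¹` reduces order `k + 1` to order `k`. The constant is chosen
before the size of the matrices, which is essential since that size grows with `t`. -/
lemma BddDeriv.exists_inv (k : ℕ) (C C₀ : ℝ) (hC : 0 ≤ C) (hC₀ : 0 ≤ C₀) : ∃ C' ≥ 0,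
    ∀ {n : Type} [Fintype n] [DecidableEq n] {U : Set (Param s)} (_ : IsOpen U)
      {f : Param s → Matrix n n ℝ}, BddDeriv U k f C →
      (∀ x ∈ U, IsUnit (f x).det) → (∀ x ∈ U, ‖(f x)⁻¹‖ ≤ C₀) →
      BddDeriv U k (fun x => (f x)⁻¹) C' := by
  induction k with
  | zero => exact ⟨C₀, hC₀, fun hU f _ _ h => h⟩
  | succ k ih =>
    obtain ⟨C', hC', ih⟩ := ih
    refine ⟨max C₀ (2 ^ k * (2 ^ k * C' * C) * C'), le_max_of_le_left hC₀,
      fun {n} _ _ U hU f hf hu hb => ?_⟩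
    refine ⟨fun x hx => (hb x hx).trans (le_max_left _ _), fun x hx =>
      (hasFDerivAt_inv_matrix (hu x hx)).differentiableAt.comp x (hf.2.1 x hx), fun i => ?_⟩
    have h1 := ih hU hf.of_succ hu hb
    have h2 := ((h1.matMul hU (hf.2.2 i) hC').matMul hU h1 (by positivity)).neg hU
    exact (h2.congr hU fun x hx => (vpd_inv (hf.2.1 x hx) (hu x hx) i).symm).mono
      (le_max_right _ _)

end MatrixValued

/-! #### Taylor expansions -/

lemma fderiv_apply_eq_sum (f : Param s → E) (x v : Param s) :
    fderiv ℝ f x v = ∑ i, v i • vpd i f x := by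
  have hv : v = ∑ i, v i • EuclideanSpace.single i (1 : ℝ) := by
    have := (EuclideanSpace.basisFun (Fin s) ℝ).sum_repr v
    simpa using this.symm
  conv_lhs => rw [hv, map_sum]
  simp [vpd]

lemma norm_fderiv_le_of_vpd {f : Param s → E} {x : Param s} {C : ℝ}
    (h : ∀ i, ‖vpd i f x‖ ≤ C) : ‖fderiv ℝ f x‖ ≤ s * C := by
  have hC : s ≠ 0 → 0 ≤ C := fun hs =>
    (norm_nonneg _).trans (h ⟨0, Nat.pos_of_ne_zero hs⟩)
  have hsC : 0 ≤ s * C := by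
    rcases eq_or_ne s 0 with h0 | h0
    · simp [h0]
    · have := hC h0; positivity
  refine ContinuousLinearMap.opNorm_le_bound _ hsC fun v => ?_
  rw [fderiv_apply_eq_sum]
  calc ‖∑ i, v i • vpd i f x‖ ≤ ∑ i, ‖v i • vpd i f x‖ := norm_sum_le _ _
    _ ≤ ∑ _i : Fin s, ‖v‖ * C := Finset.sum_le_sum fun i _ => by
        rw [norm_smul]
        exact mul_le_mul (PiLp.norm_apply_le v i) (h i) (norm_nonneg _) (norm_nonneg _)
    _ = _ := by simp; ring

lemma norm_image_sub_le_of_vpd {f : Param s → E} {V : Set (Param s)} (hV : Convex ℝ V) {C : ℝ}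
    (hd : ∀ x ∈ V, DifferentiableAt ℝ f x) (h : ∀ x ∈ V, ∀ i, ‖vpd i f x‖ ≤ C)
    {x y : Param s} (hx : x ∈ V) (hy : y ∈ V) : ‖f y - f x‖ ≤ s * C * ‖y - x‖ :=
  hV.norm_image_sub_le_of_norm_fderiv_le hd
    (fun z hz => norm_fderiv_le_of_vpd (h z hz)) hx hy

namespace BddDeriv

variable {σ : Param s} {r C : ℝ}

lemma norm_sub_le {k : ℕ} {f : Param s → E} (hf : BddDeriv (Metric.ball σ r) (k + 1) f C)
    {x y : Param s} (hx : x ∈ Metric.ball σ r) (hy : y ∈ Metric.ball σ r) :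
    ‖f y - f x‖ ≤ s * C * ‖y - x‖ :=
  norm_image_sub_le_of_vpd (convex_ball σ r) hf.2.1 (fun _ hz i => (hf.2.2 i).norm_le hz) hx hy

/-- Subtract the linear part and apply the mean value inequality on the closed ball through `x`:
there the partial derivatives of the remainder are at most `s C ‖x - σ‖`. The second factor `s` is
the price of passing from partial derivatives to the full one. -/
lemma taylor_one {f : Param s → ℝ} {k : ℕ} (hf : BddDeriv (Metric.ball σ r) (k + 2) f C)
    {x : Param s} (hx : x ∈ Metric.ball σ r) :
    |f x - f σ - ∑ i, (x i - σ i) * pderiv i f σ| ≤ s ^ 2 * C * ‖x - σ‖ ^ 2 := by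
  have hxr : ‖x - σ‖ < r := by simpa [dist_eq_norm] using hx
  have hσ : σ ∈ Metric.ball σ r := Metric.mem_ball_self ((norm_nonneg _).trans_lt hxr)
  have hsub : Metric.closedBall σ ‖x - σ‖ ⊆ Metric.ball σ r := Metric.closedBall_subset_ball hxr
  have hC : 0 ≤ C := (norm_nonneg _).trans (hf.norm_le hσ)
  set g : Param s → ℝ := fun z => f z - fderiv ℝ f σ (z - σ) with hg
  have hgd : ∀ z ∈ Metric.closedBall σ ‖x - σ‖, HasFDerivAt g (fderiv ℝ f z - fderiv ℝ f σ) z :=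
    fun z hz => by
      have h1 := (hf.differentiableAt (hsub hz)).hasFDerivAt
      have h2 := ((fderiv ℝ f σ).hasFDerivAt (x := z - σ)).comp z ((hasFDerivAt_id z).sub_const σ)
      exact h1.sub h2
  have key := norm_image_sub_le_of_vpd (f := g) (C := s * C * ‖x - σ‖)
    (convex_closedBall σ ‖x - σ‖) (fun z hz => (hgd z hz).differentiableAt)
    (fun z hz i => by
      rw [EmpiricalPredictor.vpd, (hgd z hz).fderiv]
      refine ((hf.vpd i).norm_sub_le hσ (hsub hz)).trans ?_
      have : ‖z - σ‖ ≤ ‖x - σ‖ := by simpa [dist_eq_norm] using hz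
      gcongr)
    (Metric.mem_closedBall_self (norm_nonneg _)) (y := x) (by simp [dist_eq_norm])
  have h3 : g x - g σ = f x - f σ - ∑ i, (x i - σ i) * pderiv i f σ := by
    simp only [hg, sub_self, map_zero, sub_zero]
    rw [fderiv_apply_eq_sum]
    simp only [PiLp.sub_apply, smul_eq_mul, pderiv_eq_vpd]
    ring
  rw [h3, Real.norm_eq_abs] at key
  exact key.trans (le_of_eq (by ring))

/-- `BddDeriv` speaks only of partial derivatives; the full derivative is recovered as a finite
combination of them with the coordinate functionals. This is what gives access to the symmetry of
second derivatives. -/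
lemma differentiableAt_fderiv {U : Set (Param s)} {f : Param s → ℝ} {k : ℕ}
    (hf : BddDeriv U (k + 2) f C) {x : Param s} (hx : x ∈ U) :
    DifferentiableAt ℝ (fderiv ℝ f) x := by
  have h : fderiv ℝ f = fun z => ∑ i, EmpiricalPredictor.vpd i f z •
      (EuclideanSpace.proj i : Param s →L[ℝ] ℝ) := by
    funext z
    ext v
    rw [fderiv_apply_eq_sum]
    simp [mul_comm]
  rw [h]
  exact DifferentiableAt.fun_sum fun i _ => ((hf.vpd i).differentiableAt hx).smul_const _

lemma pderiv_comm {U : Set (Param s)} {f : Param s → ℝ} {k : ℕ} (hU : IsOpen U)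
    (hf : BddDeriv U (k + 2) f C) {x : Param s} (hx : x ∈ U) (i j : Fin s) :
    pderiv i (pderiv j f) x = pderiv j (pderiv i f) x := by
  have hd := (hf.differentiableAt_fderiv hx)
  have h : ∀ i j : Fin s, pderiv i (pderiv j f) x = fderiv ℝ (fderiv ℝ f) x
      (EuclideanSpace.single i 1) (EuclideanSpace.single j 1) := fun i j => by
    have h1 := hd.hasFDerivAt.clm_apply (hasFDerivAt_const (EuclideanSpace.single j (1:ℝ)) x)
    have h2 : fderiv ℝ (pderiv j f) x = _ := h1.fderiv
    rw [pderiv, h2]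
    simp
  rw [h, h]
  exact second_derivative_symmetric_of_eventually
    (Filter.eventually_of_mem (hU.mem_nhds hx) fun y hy => (hf.differentiableAt hy).hasFDerivAt)
    hd.hasFDerivAt _ _

/-- After the quadratic polynomial is removed, the partial derivatives of the remainder are the
first order remainders of the partial derivatives of `f`, by symmetry of the Hessian at `σ`. So
`taylor_one` and one more mean value inequality suffice. -/
lemma taylor_two {f : Param s → ℝ} {k : ℕ} (hf : BddDeriv (Metric.ball σ r) (k + 3) f C)
    {x : Param s} (hx : x ∈ Metric.ball σ r) :
    |f x - f σ - ∑ i, (x i - σ i) * pderiv i f σ -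
      1 / 2 * ∑ i, ∑ j, (x i - σ i) * (x j - σ j) * pderiv i (pderiv j f) σ| ≤
      s ^ 3 * C * ‖x - σ‖ ^ 3 := by
  have hxr : ‖x - σ‖ < r := by simpa [dist_eq_norm] using hx
  have hσ : σ ∈ Metric.ball σ r := Metric.mem_ball_self ((norm_nonneg _).trans_lt hxr)
  have hsub : Metric.closedBall σ ‖x - σ‖ ⊆ Metric.ball σ r := Metric.closedBall_subset_ball hxr
  have hC : 0 ≤ C := (norm_nonneg _).trans (hf.norm_le hσ)
  set g : Param s → ℝ := fun z => f z - ∑ i, (z i - σ i) * pderiv i f σ -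
      1 / 2 * ∑ i, ∑ j, (z i - σ i) * (z j - σ j) * pderiv i (pderiv j f) σ with hg
  have hcoord : ∀ (i : Fin s) (z : Param s), HasFDerivAt (fun z : Param s => z i - σ i)
      (EuclideanSpace.proj i : Param s →L[ℝ] ℝ) z := fun i z =>
    ((EuclideanSpace.proj i : Param s →L[ℝ] ℝ).hasFDerivAt).sub_const _
  have hgd : ∀ z ∈ Metric.closedBall σ ‖x - σ‖, HasFDerivAt g (fderiv ℝ f z -
      ∑ i, pderiv i f σ • (EuclideanSpace.proj i : Param s →L[ℝ] ℝ) -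
      (1 / 2 : ℝ) • ∑ i, ∑ j, pderiv i (pderiv j f) σ •
        ((z i - σ i) • (EuclideanSpace.proj j : Param s →L[ℝ] ℝ) +
          (z j - σ j) • (EuclideanSpace.proj i : Param s →L[ℝ] ℝ))) z := fun z hz => by
    refine ((hf.differentiableAt (hsub hz)).hasFDerivAt.sub ?_).sub ?_
    · exact HasFDerivAt.fun_sum fun i _ => (hcoord i z).mul_const _
    · refine HasFDerivAt.const_mul ?_ _
      exact HasFDerivAt.fun_sum fun i _ => HasFDerivAt.fun_sum fun j _ =>
        ((hcoord i z).mul (hcoord j z)).mul_const _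
  have hpd : ∀ z ∈ Metric.closedBall σ ‖x - σ‖, ∀ m, EmpiricalPredictor.vpd m g z =
      pderiv m f z - pderiv m f σ - ∑ j, (z j - σ j) * pderiv j (pderiv m f) σ := by
    intro z hz m
    rw [EmpiricalPredictor.vpd, (hgd z hz).fderiv]
    -- Differentiating the symmetric double sum produces two equal halves, which cancel the factor
    -- `1/2`.
    have e1 : ∑ i, ∑ j, pderiv i (pderiv j f) σ * ((z i - σ i) * (if j = m then (1:ℝ) else 0) +
        (z j - σ j) * (if i = m then (1:ℝ) else 0)) =
        2 * ∑ j, (z j - σ j) * pderiv j (pderiv m f) σ := by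
      simp only [mul_add, Finset.sum_add_distrib, mul_ite, mul_one, mul_zero]
      rw [two_mul]
      congr 1
      · refine Finset.sum_congr rfl fun i _ => ?_
        rw [Finset.sum_ite_eq' ]
        simp [mul_comm]
      · rw [Finset.sum_comm]
        refine Finset.sum_congr rfl fun j _ => ?_
        rw [Finset.sum_ite_eq']
        simp only [Finset.mem_univ, if_true]
        rw [hf.pderiv_comm Metric.isOpen_ball hσ m j, mul_comm]
    have e2 : ∀ i : Fin s, (EuclideanSpace.single m (1:ℝ) : Param s) i = if i = m then 1 else 0 :=
      fun i => by simp
    simp only [_root_.sub_apply, _root_.sum_apply,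
      _root_.smul_apply, _root_.add_apply, EuclideanSpace.coe_proj,
      smul_eq_mul, e2]
    rw [e1]
    simp [pderiv]
  have key := norm_image_sub_le_of_vpd (f := g) (C := s ^ 2 * C * ‖x - σ‖ ^ 2)
    (convex_closedBall σ ‖x - σ‖) (fun z hz => (hgd z hz).differentiableAt)
    (fun z hz m => by
      rw [hpd z hz m, Real.norm_eq_abs]
      refine ((hf.vpd m).taylor_one (hsub hz)).trans ?_
      have : ‖z - σ‖ ≤ ‖x - σ‖ := by simpa [dist_eq_norm] using hz
      gcongr)
    (Metric.mem_closedBall_self (norm_nonneg _)) (y := x) (by simp [dist_eq_norm])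
  have h3 : g x - g σ = f x - f σ - ∑ i, (x i - σ i) * pderiv i f σ -
      1 / 2 * ∑ i, ∑ j, (x i - σ i) * (x j - σ j) * pderiv i (pderiv j f) σ := by
    simp only [hg, sub_self, zero_mul, Finset.sum_const_zero, mul_zero]
    ring
  rw [h3, Real.norm_eq_abs] at key
  exact key.trans (le_of_eq (by ring))

end BddDeriv

end BddDeriv

end

end EmpiricalPredictor

namespace EmpiricalPredictor

noncomputable section

/-! ### Smooth matrix-valued functions -/

section Smooth

open scoped ContDiff

variable {s : ℕ} {E : Type*} [NormedAddCommGroup E] [NormedSpace ℝ E] {O : Set (Param s)}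
  {l m n : Type} [Fintype l] [Fintype m] [Fintype n] [DecidableEq l] [DecidableEq m]
  [DecidableEq n] {k : WithTop ℕ∞}

lemma _root_.ContDiffOn.matMul {f : Param s → Matrix l m ℝ} {g : Param s → Matrix m n ℝ}
    (hf : ContDiffOn ℝ k f O) (hg : ContDiffOn ℝ k g O) :
    ContDiffOn ℝ k (fun x => f x * g x) O :=
  ContDiff.comp_contDiffOn (ContinuousLinearMap.isBoundedBilinearMap (mulCLM l m n)).contDiff
    (hf.prodMk hg)

lemma _root_.ContDiffOn.trace {f : Param s → Matrix n n ℝ} (hf : ContDiffOn ℝ k f O) :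
    ContDiffOn ℝ k (fun x => (f x).trace) O :=
  (traceCLM n).contDiff.comp_contDiffOn hf

lemma _root_.ContDiffOn.mulVec_const {f : Param s → Matrix m n ℝ} (hf : ContDiffOn ℝ k f O)
    (v : n → ℝ) : ContDiffOn ℝ k (fun x => WithLp.toLp 2 (f x *ᵥ v)) O :=
  (mulVecCLM v).contDiff.comp_contDiffOn hf

lemma _root_.ContDiffOn.mulVec {f : Param s → Matrix m n ℝ} {g : Param s → EuclideanSpace ℝ n}
    (hf : ContDiffOn ℝ k f O) (hg : ContDiffOn ℝ k g O) :
    ContDiffOn ℝ k (fun x => WithLp.toLp 2 (f x *ᵥ (g x : n → ℝ))) O :=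
  ((mulVecCLM₂ m n).contDiff.comp_contDiffOn hf).clm_apply hg

lemma _root_.ContDiffOn.qf {f : Param s → Matrix n n ℝ} (hf : ContDiffOn ℝ k f O)
    (z : EuclideanSpace ℝ n) : ContDiffOn ℝ k (fun x => EmpiricalPredictor.qf (f x) z) O :=
  (qfCLM z).contDiff.comp_contDiffOn hf

lemma _root_.ContDiffOn.matInv {f : Param s → Matrix n n ℝ} (hf : ContDiffOn ℝ k f O)
    (hu : ∀ x ∈ O, IsUnit (f x).det) : ContDiffOn ℝ k (fun x => (f x)⁻¹) O := by
  intro x hx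
  obtain ⟨u, hu'⟩ := (Matrix.isUnit_iff_isUnit_det _).2 (hu x hx)
  have h := contDiffAt_ringInverse ℝ (n := k) u
  rw [hu'] at h
  have h1 : (fun x => (f x)⁻¹) = Ring.inverse ∘ f := by
    funext y; exact Matrix.nonsing_inv_eq_ringInverse _
  rw [h1]
  exact h.comp_contDiffWithinAt x (hf x hx)

lemma _root_.ContDiffOn.matrix_apply {f : Param s → Matrix m n ℝ} (hf : ContDiffOn ℝ k f O)
    (i : m) (j : n) : ContDiffOn ℝ k (fun x => f x i j) O := by
  have := (LinearMap.mkContinuous (Matrix.entryLinearMap ℝ ℝ i j : Matrix m n ℝ →ₗ[ℝ] ℝ) 1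
    (fun A => by simpa using abs_entry_le_norm A i j)).contDiff.comp_contDiffOn hf
  exact this

lemma _root_.ContDiffOn.matrix_of_apply {f : Param s → Matrix m n ℝ}
    (hf : ∀ i j, ContDiffOn ℝ k (fun x => f x i j) O) : ContDiffOn ℝ k f O := by
  have h : f = fun x => ∑ i, ∑ j, f x i j • Matrix.single i j (1 : ℝ) := by
    funext x
    conv_lhs => rw [Matrix.matrix_eq_sum_single (f x)]
    simp [Matrix.smul_single]
  rw [h]
  exact ContDiffOn.sum fun i _ => ContDiffOn.sum fun j _ => (hf i j).smul contDiffOn_const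

lemma _root_.ContDiffOn.det {f : Param s → Matrix n n ℝ} (hf : ContDiffOn ℝ k f O) :
    ContDiffOn ℝ k (fun x => (f x).det) O := by
  simp only [Matrix.det_apply]
  refine ContDiffOn.sum fun τ _ => ContDiffOn.const_smul _ ?_
  exact contDiffOn_prod fun i _ => hf.matrix_apply _ _

lemma _root_.ContDiffOn.vpd {f : Param s → E} (hO : IsOpen O) {k k' : WithTop ℕ∞}
    (hf : ContDiffOn ℝ k f O) (hk : k' + 1 ≤ k) (i : Fin s) :
    ContDiffOn ℝ k' (EmpiricalPredictor.vpd i f) O :=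
  (hf.fderiv_of_isOpen hO hk).clm_apply contDiffOn_const

lemma _root_.ContDiffOn.differentiableAt_of_isOpen {f : Param s → E} (hO : IsOpen O)
    (hf : ContDiffOn ℝ k f O) (hk : k ≠ 0) {x : Param s} (hx : x ∈ O) : DifferentiableAt ℝ f x :=
  (hf.contDiffAt (hO.mem_nhds hx)).differentiableAt hk

lemma vpd_clm (L : E →L[ℝ] ℝ) {f : Param s → E} {x : Param s} (hf : DifferentiableAt ℝ f x)
    (i : Fin s) : vpd i (fun x => L (f x)) x = L (vpd i f x) := by
  have h : fderiv ℝ (fun x => L (f x)) x = _ := (L.hasFDerivAt.comp x hf.hasFDerivAt).fderiv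
  rw [vpd, h]
  rfl

lemma vpd_matMul {f : Param s → Matrix l m ℝ} {g : Param s → Matrix m n ℝ} {x : Param s}
    (hf : DifferentiableAt ℝ f x) (hg : DifferentiableAt ℝ g x) (i : Fin s) :
    vpd i (fun x => f x * g x) x = f x * vpd i g x + vpd i f x * g x :=
  vpd_bilin (mulCLM l m n) hf hg i

lemma vpd_const_smul {f : Param s → E} {x : Param s} (hf : DifferentiableAt ℝ f x) (c : ℝ)
    (i : Fin s) : vpd i (fun x => c • f x) x = c • vpd i f x := by
  rw [vpd, fderiv_fun_const_smul hf]
  rfl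

lemma vpd_const_mul {f : Param s → ℝ} {x : Param s} (hf : DifferentiableAt ℝ f x) (c : ℝ)
    (i : Fin s) : vpd i (fun x => c * f x) x = c * vpd i f x := vpd_const_smul hf c i

lemma vpd_add_qf {c : Param s → ℝ} {f : Param s → Matrix n n ℝ} {x : Param s}
    (hc : DifferentiableAt ℝ c x) (hf : DifferentiableAt ℝ f x) (z : EuclideanSpace ℝ n)
    (i : Fin s) : vpd i (fun x => c x + qf (f x) z) x = vpd i c x + qf (vpd i f x) z := by
  have h2 : DifferentiableAt ℝ (fun x => qf (f x) z) x :=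
    (qfCLM z).differentiableAt.comp x hf
  have h3 := vpd_clm (qfCLM z) hf i
  simp only [qfCLM_apply] at h3
  rw [← h3]
  simp only [vpd]
  rw [fderiv_fun_add hc h2]
  rfl

end Smooth

/-! ### The covariance matrix of the standardized error contrasts -/

section RedCov

open scoped ContDiff

variable {s N : ℕ} (K : Fin s → Matrix (Fin N) (Fin N) ℝ) (σ : Param s)

/-- The covariance matrix `1 + ∑_j (x_j - σ_j) K_j`. -/
def redCov (x : Param s) : Matrix (Fin N) (Fin N) ℝ := 1 + ∑ j, (x j - σ j) • K j

lemma redCov_self : redCov K σ σ = 1 := by simp [redCov]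

lemma hasFDerivAt_redCov (x : Param s) : HasFDerivAt (redCov K σ)
    (∑ j, (EuclideanSpace.proj j : Param s →L[ℝ] ℝ).smulRight (K j)) x := by
  unfold redCov
  refine HasFDerivAt.const_add _ (HasFDerivAt.fun_sum fun j _ => ?_)
  exact (((EuclideanSpace.proj j : Param s →L[ℝ] ℝ).hasFDerivAt).sub_const _).smul_const _

lemma vpd_redCov (j : Fin s) : vpd j (redCov K σ) = fun _ => K j := by
  funext x
  rw [vpd, (hasFDerivAt_redCov K σ x).fderiv]
  simp [_root_.sum_apply]

lemma contDiff_redCov {k : WithTop ℕ∞} : ContDiff ℝ k (redCov K σ) := by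
  unfold redCov
  refine contDiff_const.add (ContDiff.sum fun j _ => ?_)
  exact (((EuclideanSpace.proj j : Param s →L[ℝ] ℝ).contDiff).sub contDiff_const).smul
    contDiff_const

/-- The gradient of `-(1/2) log |S|`, where `S = redCov K σ`. -/
def redConst (j : Fin s) (x : Param s) : ℝ := -(1 / 2) * ((redCov K σ x)⁻¹ * K j).trace

/-- The gradient of `-(1/2) S⁻¹`, where `S = redCov K σ`. -/
def redForm (j : Fin s) (x : Param s) : Matrix (Fin N) (Fin N) ℝ :=
  (1 / 2 : ℝ) • ((redCov K σ x)⁻¹ * K j * (redCov K σ x)⁻¹)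

variable {K σ} {O : Set (Param s)}

lemma contDiffOn_inv_redCov (h : ∀ x ∈ O, (redCov K σ x).PosDef) :
    ContDiffOn ℝ ∞ (fun x => (redCov K σ x)⁻¹) O :=
  (contDiff_redCov K σ).contDiffOn.matInv fun x hx => (h x hx).det_pos.ne'.isUnit

lemma contDiffOn_redConst (h : ∀ x ∈ O, (redCov K σ x).PosDef) (j : Fin s) :
    ContDiffOn ℝ ∞ (redConst K σ j) O :=
  contDiffOn_const.mul ((contDiffOn_inv_redCov h).matMul contDiffOn_const).trace

lemma contDiffOn_redForm (h : ∀ x ∈ O, (redCov K σ x).PosDef) (j : Fin s) :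
    ContDiffOn ℝ ∞ (redForm K σ j) O :=
  (((contDiffOn_inv_redCov h).matMul contDiffOn_const).matMul
    (contDiffOn_inv_redCov h)).const_smul _

lemma contDiffOn_log_det_redCov (h : ∀ x ∈ O, (redCov K σ x).PosDef) :
    ContDiffOn ℝ ∞ (fun x => Real.log (redCov K σ x).det) O :=
  ((contDiff_redCov K σ).contDiffOn.det).log fun x hx => (h x hx).det_pos.ne'

lemma differentiableAt_inv_redCov {x : Param s} (h : (redCov K σ x).PosDef) :
    DifferentiableAt ℝ (fun x => (redCov K σ x)⁻¹) x :=
  (hasFDerivAt_inv_matrix h.det_pos.ne'.isUnit).differentiableAt.comp x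
    (hasFDerivAt_redCov K σ x).differentiableAt

lemma vpd_inv_redCov {x : Param s} (h : (redCov K σ x).PosDef) (j : Fin s) :
    vpd j (fun x => (redCov K σ x)⁻¹) x = -((redCov K σ x)⁻¹ * K j * (redCov K σ x)⁻¹) := by
  rw [vpd_inv (hasFDerivAt_redCov K σ x).differentiableAt h.det_pos.ne'.isUnit, vpd_redCov]

lemma redCov_add_single (x : Param s) (j : Fin s) (a : ℝ) :
    redCov K σ (x + a • EuclideanSpace.single j 1) = redCov K σ x + a • K j := by
  simp [redCov, add_sub_right_comm, add_smul, Finset.sum_add_distrib, add_assoc]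

/-- Jacobi's formula: along a coordinate line `det(S + aK) = det S · det(1 + a S⁻¹K)`, and the
second factor is a polynomial in `a` with linear coefficient `tr(S⁻¹K)`. -/
lemma vpd_log_det_redCov {x : Param s} (h : (redCov K σ x).PosDef) (j : Fin s) :
    vpd j (fun x => Real.log (redCov K σ x).det) x = ((redCov K σ x)⁻¹ * K j).trace := by
  have hdet := h.det_pos
  have hu : IsUnit (redCov K σ x).det := hdet.ne'.isUnit
  have hdiff : DifferentiableAt ℝ (fun x => Real.log (redCov K σ x).det) x := by
    have h1 : ContDiff ℝ 1 (fun x => (redCov K σ x).det) :=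
      contDiffOn_univ.1 (contDiff_redCov K σ).contDiffOn.det
    exact ((h1.differentiable one_ne_zero) x).log hdet.ne'
  rw [vpd, ← hdiff.lineDeriv_eq_fderiv, lineDeriv]
  have heq : ∀ a : ℝ, (redCov K σ (x + a • EuclideanSpace.single j 1)).det =
      (redCov K σ x).det * (1 + a • ((redCov K σ x)⁻¹ * K j)).det := by
    intro a
    rw [redCov_add_single, ← Matrix.det_mul, mul_add, mul_one, Matrix.mul_smul,
      Matrix.mul_nonsing_inv_cancel_left _ _ hu]
  obtain ⟨P, hP⟩ : ∃ P : Polynomial ℝ, ∀ a : ℝ, (1 + a • ((redCov K σ x)⁻¹ * K j)).det =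
      1 + ((redCov K σ x)⁻¹ * K j).trace * a + P.eval a * a ^ 2 :=
    ⟨_, fun a => Matrix.det_one_add_smul a _⟩
  simp only [heq, hP]
  set τ := ((redCov K σ x)⁻¹ * K j).trace
  have hd : HasDerivAt (fun a : ℝ => (redCov K σ x).det * (1 + τ * a + P.eval a * a ^ 2))
      ((redCov K σ x).det * τ) 0 := by
    have h1 := ((P.hasDerivAt 0).mul (hasDerivAt_pow 2 (0:ℝ)))
    have h2 := (((hasDerivAt_id (0:ℝ)).const_mul τ).const_add 1).add h1
    have h3 := h2.const_mul (redCov K σ x).det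
    exact h3.congr_deriv (by simp)
  have := (hd.log (by simp [hdet.ne'])).deriv
  rw [this]
  simp [mul_div_cancel_left₀ _ hdet.ne']

/-- The log-likelihood of the standardized error contrasts. -/
lemma vpd_redLik {x : Param s} (h : (redCov K σ x).PosDef) (c : ℝ)
    (z : EuclideanSpace ℝ (Fin N)) (j : Fin s) :
    vpd j (fun x => c - 1 / 2 * (Real.log (redCov K σ x).det + qf (redCov K σ x)⁻¹ z)) x =
      redConst K σ j x + qf (redForm K σ j x) z := by
  have hdiff : DifferentiableAt ℝ (fun x => Real.log (redCov K σ x).det) x := by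
    have h1 : ContDiff ℝ 1 (fun x => (redCov K σ x).det) :=
      contDiffOn_univ.1 (contDiff_redCov K σ).contDiffOn.det
    exact ((h1.differentiable one_ne_zero) x).log h.det_pos.ne'
  have hi := differentiableAt_inv_redCov h
  have h2 := vpd_add_qf hdiff hi z j
  have h3 : DifferentiableAt ℝ
      (fun x => Real.log (redCov K σ x).det + qf (redCov K σ x)⁻¹ z) x :=
    hdiff.add ((qfCLM z).differentiableAt.comp x hi)
  have h4 : vpd j (fun x => c - 1 / 2 * (Real.log (redCov K σ x).det + qf (redCov K σ x)⁻¹ z)) x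
      = -(1 / 2 * vpd j (fun x => Real.log (redCov K σ x).det + qf (redCov K σ x)⁻¹ z) x) := by
    rw [← vpd_const_mul h3]
    simp only [vpd]
    rw [fderiv_const_sub]
    rfl
  rw [h4, h2, vpd_log_det_redCov h, vpd_inv_redCov h, redConst, redForm, qf_smul, qf_neg]
  ring

lemma vpd_redConst {x : Param s} (h : (redCov K σ x).PosDef) (i j : Fin s) :
    vpd i (redConst K σ j) x =
      1 / 2 * ((redCov K σ x)⁻¹ * K i * (redCov K σ x)⁻¹ * K j).trace := by
  have hi := differentiableAt_inv_redCov h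
  have h1 : DifferentiableAt ℝ (fun x => (redCov K σ x)⁻¹ * K j) x :=
    (((mulCLM _ _ _).hasFDerivAt_of_bilinear hi.hasFDerivAt
      (hasFDerivAt_const (K j) x))).differentiableAt
  have h2 : DifferentiableAt ℝ (fun x => traceCLM (Fin N) ((redCov K σ x)⁻¹ * K j)) x :=
    (traceCLM (Fin N)).differentiableAt.comp x h1
  simp only [traceCLM_apply] at h2
  unfold redConst
  rw [vpd_const_mul h2]
  have h3 := vpd_clm (traceCLM _) h1 i
  simp only [traceCLM_apply] at h3
  rw [h3, vpd_matMul hi (differentiableAt_const _), vpd_inv_redCov h]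
  have h4 : vpd i (fun _ : Param s => K j) x = 0 := by simp [vpd]
  rw [h4, mul_zero, zero_add, Matrix.neg_mul, Matrix.trace_neg]
  ring

lemma vpd_redForm {x : Param s} (h : (redCov K σ x).PosDef) (i j : Fin s) :
    vpd i (redForm K σ j) x = -(1 / 2 : ℝ) •
      ((redCov K σ x)⁻¹ * K j * (redCov K σ x)⁻¹ * K i * (redCov K σ x)⁻¹ +
        (redCov K σ x)⁻¹ * K i * (redCov K σ x)⁻¹ * K j * (redCov K σ x)⁻¹) := by
  have hi := differentiableAt_inv_redCov h
  have h1 : DifferentiableAt ℝ (fun x => (redCov K σ x)⁻¹ * K j) x :=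
    (((mulCLM _ _ _).hasFDerivAt_of_bilinear hi.hasFDerivAt
      (hasFDerivAt_const (K j) x))).differentiableAt
  have h2 : DifferentiableAt ℝ (fun x => (redCov K σ x)⁻¹ * K j * (redCov K σ x)⁻¹) x :=
    (((mulCLM _ _ _).hasFDerivAt_of_bilinear h1.hasFDerivAt hi.hasFDerivAt)).differentiableAt
  unfold redForm
  rw [vpd_const_smul h2, vpd_matMul h1 hi, vpd_matMul hi (differentiableAt_const _),
    vpd_inv_redCov h]
  have h4 : vpd i (fun _ : Param s => K j) x = 0 := by simp [vpd]
  rw [h4, mul_zero, zero_add, neg_smul, ← smul_neg, neg_add]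
  simp only [neg_mul, mul_neg, mul_assoc]

lemma norm_redCov_sub_one_le {κ : ℝ} (hK : ∀ j, ‖K j‖ ≤ κ) (x : Param s) :
    ‖redCov K σ x - 1‖ ≤ s * κ * ‖x - σ‖ := by
  rw [redCov, add_sub_cancel_left]
  calc ‖∑ j, (x j - σ j) • K j‖ ≤ ∑ j, ‖(x j - σ j) • K j‖ := norm_sum_le _ _
    _ ≤ ∑ _j : Fin s, ‖x - σ‖ * κ := Finset.sum_le_sum fun j _ => by
        rw [norm_smul]
        exact mul_le_mul (PiLp.norm_apply_le (x - σ) j) (hK j) (norm_nonneg _) (norm_nonneg _)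
    _ = _ := by simp; ring

section Bounds

variable {κ r : ℝ} (hK : ∀ j, ‖K j‖ ≤ κ) (hr : s * κ * r ≤ 1 / 2) (hκ : 0 ≤ κ)

include hK hr hκ

lemma norm_redCov_sub_one_le_half {x : Param s} (hx : x ∈ Metric.ball σ r) :
    ‖redCov K σ x - 1‖ ≤ 1 / 2 := by
  refine (norm_redCov_sub_one_le hK x).trans (le_trans ?_ hr)
  have : ‖x - σ‖ ≤ r := by simpa [dist_eq_norm] using (Metric.mem_ball.1 hx).le
  gcongr

lemma norm_redCov_le {x : Param s} (hx : x ∈ Metric.ball σ r) : ‖redCov K σ x‖ ≤ 2 := by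
  have h1 := norm_redCov_sub_one_le_half hK hr hκ hx
  have h2 := norm_add_le (redCov K σ x - 1) 1
  rw [sub_add_cancel] at h2
  have := norm_one_le (ι := Fin N)
  linarith

/-- From `S⁻¹ = 1 - S⁻¹(S - 1)` and `‖S - 1‖ ≤ 1/2`, half of `‖S⁻¹‖` can be absorbed on the left. -/
lemma norm_inv_redCov_le {x : Param s} (hx : x ∈ Metric.ball σ r)
    (h : (redCov K σ x).PosDef) : ‖(redCov K σ x)⁻¹‖ ≤ 2 := by
  have h1 := norm_redCov_sub_one_le_half hK hr hκ hx
  have hu : IsUnit (redCov K σ x).det := h.det_pos.ne'.isUnit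
  have h2 : (redCov K σ x)⁻¹ = 1 - (redCov K σ x)⁻¹ * (redCov K σ x - 1) := by
    rw [mul_sub, Matrix.nonsing_inv_mul _ hu, mul_one]; abel
  have h3 : ‖(redCov K σ x)⁻¹‖ ≤ 1 + ‖(redCov K σ x)⁻¹‖ * (1 / 2) := by
    calc ‖(redCov K σ x)⁻¹‖ = ‖1 - (redCov K σ x)⁻¹ * (redCov K σ x - 1)‖ := by rw [← h2]
      _ ≤ ‖(1 : Matrix (Fin N) (Fin N) ℝ)‖ + ‖(redCov K σ x)⁻¹ * (redCov K σ x - 1)‖ :=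
        norm_sub_le _ _
      _ ≤ 1 + ‖(redCov K σ x)⁻¹‖ * (1 / 2) := by
        refine add_le_add norm_one_le ((norm_mul_le _ _).trans ?_)
        gcongr
  linarith

lemma bddDeriv_redCov (k : ℕ) : BddDeriv (Metric.ball σ r) k (redCov K σ) (max 2 κ) := by
  cases k with
  | zero => exact fun x hx => (norm_redCov_le hK hr hκ hx).trans (le_max_left _ _)
  | succ k =>
    refine ⟨fun x hx => (norm_redCov_le hK hr hκ hx).trans (le_max_left _ _),
      fun x hx => (hasFDerivAt_redCov K σ x).differentiableAt, fun i => ?_⟩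
    rw [vpd_redCov]
    exact (BddDeriv.const _ _ _).mono ((hK i).trans (le_max_right _ _))

end Bounds

/-- Uniform bounds for the score function and its derivatives. -/
lemma exists_bddDeriv_redForm (s : ℕ) (κ : ℝ) (hκ : 0 ≤ κ) (k : ℕ) : ∃ C ≥ 0,
    ∀ {N : ℕ} {K : Fin s → Matrix (Fin N) (Fin N) ℝ} {σ : Param s} {r : ℝ},
      (∀ j, ‖K j‖ ≤ κ) → s * κ * r ≤ 1 / 2 → (∀ x ∈ Metric.ball σ r, (redCov K σ x).PosDef) →
      BddDeriv (Metric.ball σ r) k (fun x => (redCov K σ x)⁻¹) C ∧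
      ∀ j, BddDeriv (Metric.ball σ r) k (redForm K σ j) C ∧
        BddDeriv (Metric.ball σ r) k (redConst K σ j) (C * N) := by
  obtain ⟨C, hC, h⟩ := BddDeriv.exists_inv (s := s) k (max 2 κ) 2 (by positivity) zero_le_two
  refine ⟨C + (2 ^ k * C * κ + 2 ^ k * (2 ^ k * C * κ) * C), by positivity,
    fun {N K σ r} hK hr hpd => ?_⟩
  have hU : IsOpen (Metric.ball σ r) := Metric.isOpen_ball
  have h1 : BddDeriv (Metric.ball σ r) k (fun x => (redCov K σ x)⁻¹) C :=
    h hU (bddDeriv_redCov hK hr hκ k) (fun x hx => (hpd x hx).det_pos.ne'.isUnit)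
      fun x hx => norm_inv_redCov_le hK hr hκ hx (hpd x hx)
  refine ⟨h1.mono (le_add_of_nonneg_right (by positivity)), fun j => ?_⟩
  have h2 := h1.matMul hU ((BddDeriv.const (Metric.ball σ r) k (K j)).mono (hK j)) hC
  constructor
  · refine ((h2.matMul hU h1 (by positivity)).const_smul hU (1 / 2)).mono ?_
    rw [abs_of_pos (by norm_num)]
    have : 0 ≤ 2 ^ k * C * κ := by positivity
    have : 0 ≤ 2 ^ k * (2 ^ k * C * κ) * C := by positivity
    linarith
  -- The trace of a bounded `N × N` matrix is only `O(N)`; this is why the bound for the scalar part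
  -- carries the factor `N`.
  · refine ((h2.trace hU).const_smul hU (-(1 / 2))).mono ?_
    rw [abs_neg, abs_of_pos (by norm_num), Fintype.card_fin]
    have h3 : 0 ≤ 2 ^ k * (2 ^ k * C * κ) * C := by positivity
    have h4 : 0 ≤ 2 ^ k * C * κ := by positivity
    have h5 : (0:ℝ) ≤ N := by positivity
    have h6 : 2 ^ k * C * κ ≤ C + (2 ^ k * C * κ + 2 ^ k * (2 ^ k * C * κ) * C) := by linarith
    nlinarith [mul_le_mul_of_nonneg_right h6 h5, mul_nonneg h5 h4]

end RedCov

/-! ### The square root of the covariance matrix -/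

section Sqrt

open scoped MatrixOrder

variable {n : Type} [Fintype n] [DecidableEq n]

lemma isHermitian_sqrt (S : Matrix n n ℝ) : (CFC.sqrt S).IsHermitian :=
  (Matrix.nonneg_iff_posSemidef.1 (CFC.sqrt_nonneg S)).isHermitian

lemma transpose_sqrt (S : Matrix n n ℝ) : (CFC.sqrt S)ᵀ = CFC.sqrt S :=
  (Matrix.conjTranspose_eq_transpose_of_trivial _).symm.trans (isHermitian_sqrt S)

lemma sqrt_mul_sqrt {S : Matrix n n ℝ} (hS : S.PosSemidef) :
    CFC.sqrt S * CFC.sqrt S = S := CFC.sqrt_mul_sqrt_self S hS.nonneg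

/-- With `R` the square root, `S - 1 = (R + 1)(R - 1)` and `R + 1 ≥ 1`, so `|(R - 1)v| ≤ |(S -
1)v|`. Hence the square root is Lipschitz at the identity with a constant independent of the
dimension. -/
lemma norm_sqrt_sub_one_le {S : Matrix n n ℝ} (hS : S.PosSemidef) :
    ‖CFC.sqrt S - 1‖ ≤ ‖S - 1‖ := by
  set R := CFC.sqrt S with hR
  have hRp : R.PosSemidef := Matrix.nonneg_iff_posSemidef.1 (CFC.sqrt_nonneg S)
  refine norm_le_of_mulVec_le _ (norm_nonneg _) fun v => ?_
  set u := (R - 1) *ᵥ v with hu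
  have h1 : (S - 1) *ᵥ v = (R + 1) *ᵥ u := by
    rw [hu, Matrix.mulVec_mulVec]
    congr 1
    rw [add_mul, one_mul, mul_sub, mul_one, hR, sqrt_mul_sqrt hS]
    abel
  have h2 : ‖WithLp.toLp 2 u‖ ^ 2 ≤ u ⬝ᵥ ((R + 1) *ᵥ u) := by
    rw [Matrix.add_mulVec, Matrix.one_mulVec, dotProduct_add, dotProduct_self_eq_norm_sq]
    have := hRp.dotProduct_mulVec_nonneg u
    simp only [star_trivial] at this
    linarith
  rw [← h1] at h2
  have h3 := (le_abs_self _).trans (abs_dotProduct_le u ((S - 1) *ᵥ v))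
  have h4 := norm_toLp_mulVec_le (S - 1) v
  by_contra! hlt
  have h5 : 0 < ‖WithLp.toLp 2 u‖ := lt_of_le_of_lt (by positivity) hlt
  nlinarith

/-- The trace equals that of `A^{1/2} B A^{1/2}`, a nonnegative definite matrix. -/
lemma trace_mul_nonneg {A B : Matrix n n ℝ} (hA : A.PosSemidef) (hB : B.PosSemidef) :
    0 ≤ (A * B).trace := by
  have h := (hB.mul_mul_conjTranspose_same (CFC.sqrt A)).trace_nonneg
  rwa [Matrix.conjTranspose_eq_transpose_of_trivial, transpose_sqrt, Matrix.trace_mul_comm,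
    ← mul_assoc, sqrt_mul_sqrt hA] at h

/-- Apply the norm bound for the form of `A⁻¹` to the vector `A^{1/2}v`, using `A^{1/2} A⁻¹ A^{1/2}
= 1`. -/
lemma norm_sq_le_of_posDef {A : Matrix n n ℝ} (hA : A.PosDef) (v : n → ℝ) :
    ‖WithLp.toLp 2 v‖ ^ 2 ≤ ‖A⁻¹‖ * (v ⬝ᵥ (A *ᵥ v)) := by
  set R := CFC.sqrt A with hR
  have hRR : R * R = A := sqrt_mul_sqrt hA.posSemidef
  have hu : IsUnit R.det := by
    have := hA.det_pos.ne'
    rw [← hRR, Matrix.det_mul] at this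
    exact (left_ne_zero_of_mul this).isUnit
  have h1 : R * A⁻¹ * R = 1 := by
    rw [← hRR, Matrix.mul_inv_rev, ← mul_assoc, Matrix.mul_nonsing_inv _ hu, one_mul,
      Matrix.nonsing_inv_mul _ hu]
  have h2 : ∀ M : Matrix n n ℝ, (R *ᵥ v) ⬝ᵥ (M *ᵥ (R *ᵥ v)) = v ⬝ᵥ ((R * M * R) *ᵥ v) := by
    intro M
    rw [← Matrix.mulVec_mulVec, ← Matrix.mulVec_mulVec, Matrix.dotProduct_mulVec v,
      ← Matrix.mulVec_transpose, transpose_sqrt]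
  have h3 := (le_abs_self _).trans (abs_dotProduct_mulVec_le A⁻¹ (R *ᵥ v) (R *ᵥ v))
  rw [h2, h1, Matrix.one_mulVec, dotProduct_self_eq_norm_sq, mul_assoc, ← sq,
    ← dotProduct_self_eq_norm_sq (R *ᵥ v)] at h3
  have h4 := h2 1
  rw [Matrix.one_mulVec, mul_one, hRR] at h4
  rwa [h4] at h3

lemma posSemidef_sub_smul_one {A : Matrix n n ℝ} (hA : A.PosDef) {c : ℝ} (hc : c * ‖A⁻¹‖ ≤ 1)
    (hc0 : 0 ≤ c) : (A - c • (1 : Matrix n n ℝ)).PosSemidef := by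
  refine .of_dotProduct_mulVec_nonneg ?_ fun v => ?_
  · exact hA.isHermitian.sub (by simp [Matrix.IsHermitian])
  · rw [star_trivial, Matrix.sub_mulVec, dotProduct_sub, Matrix.smul_mulVec, Matrix.one_mulVec,
      dotProduct_smul, dotProduct_self_eq_norm_sq, smul_eq_mul]
    have h1 := norm_sq_le_of_posDef hA v
    have h2 := hA.posSemidef.dotProduct_mulVec_nonneg v
    rw [star_trivial] at h2
    nlinarith [mul_le_mul_of_nonneg_left h1 hc0]

/-- A lower bound for `tr(A K A K)` in terms of `tr(K K)`. -/
lemma trace_mul_mul_mul_ge {A K : Matrix n n ℝ} (hA : A.PosDef) (hK : K.IsSymm) {c : ℝ}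
    (hc : c * ‖A⁻¹‖ ≤ 1) (hc0 : 0 ≤ c) :
    c ^ 2 * (K * K).trace ≤ (A * K * A * K).trace := by
  have hps := posSemidef_sub_smul_one hA hc hc0
  have hKt : Kᴴ = K := (Matrix.conjTranspose_eq_transpose_of_trivial _).trans hK
  have h1 : (K * A * K).PosSemidef := by
    have := hA.posSemidef.mul_mul_conjTranspose_same K
    rwa [hKt] at this
  have h2 : (K * K).PosSemidef := by
    have := Matrix.posSemidef_self_mul_conjTranspose K
    rwa [hKt] at this
  -- The matrix `A` is replaced by the smaller `c · 1` in one position at a time: first `tr(AKAK) ≥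
  -- c tr(KAK)`, then `tr(A KK) ≥ c tr(KK)`.
  have h3 := trace_mul_nonneg hps h1
  have h4 := trace_mul_nonneg hps h2
  rw [sub_mul, Matrix.trace_sub, Matrix.smul_mul, Matrix.trace_smul, one_mul, smul_eq_mul] at h3 h4
  have h5 : (K * A * K).trace = (A * (K * K)).trace := by
    rw [mul_assoc, Matrix.trace_mul_comm, mul_assoc]
  have h6 : (A * (K * A * K)).trace = (A * K * A * K).trace := by simp only [mul_assoc]
  rw [h5, h6] at h3
  nlinarith

end Sqrt

end

end EmpiricalPredictor

/-! ### The reduced model: Gaussian contrasts with a covariance affine in the parameter -/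

namespace EmpiricalPredictor

noncomputable section

open scoped ContDiff MatrixOrder

/-- A family of score models whose criterion functions are the log-likelihoods of standardized error
contrasts `L y ~ N(0, 1 + ∑_j (x_j - σ_j) K_j)`, with information growing linearly in `t`. -/
structure REMLReduction {s : ℕ} (S : ℕ → ScoreModel s) (σ : Param s) where
  t₀ : ℕ
  one_le_t₀ : 1 ≤ t₀
  N : ℕ → ℕ
  K : ∀ t, Fin s → Matrix (Fin (N t)) (Fin (N t)) ℝ
  L : ∀ t, (S t).Y → EuclideanSpace ℝ (Fin (N t))
  c₀ : ℕ → ℝ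
  κ : ℝ
  c : ℝ
  r : ℝ
  κ_nonneg : 0 ≤ κ
  c_pos : 0 < c
  r_pos : 0 < r
  r_le : s * κ * r ≤ 1 / 2
  K_symm : ∀ t j, (K t j).IsSymm
  K_norm : ∀ t ≥ t₀, ∀ j, ‖K t j‖ ≤ κ
  N_le : ∀ t ≥ t₀, (N t : ℝ) ≤ κ * t
  info : ∀ t ≥ t₀, ∀ v : Fin s → ℝ, c * t * ‖WithLp.toLp 2 v‖ ^ 2 ≤
    ((∑ j, v j • K t j) * (∑ j, v j • K t j)).trace
  L_meas : ∀ t, Measurable (L t)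
  d_eq : ∀ t i, (S t).d i = √(t : ℝ)
  ball_subset : ∀ t ≥ t₀, Metric.ball σ r ⊆ interior (S t).Θ
  posDef : ∀ t ≥ t₀, ∀ x ∈ interior (S t).Θ, (redCov (K t) σ x).PosDef
  l_eq : ∀ t ≥ t₀, ∀ x ∈ interior (S t).Θ, ∀ y, (S t).l x y =
    c₀ t - 1 / 2 * (Real.log (redCov (K t) σ x).det + qf (redCov (K t) σ x)⁻¹ (L t y))
  law_map : ∀ t ≥ t₀, ∀ x ∈ interior (S t).Θ, ((S t).law x).map (L t) =
    (stdGaussian (EuclideanSpace ℝ (Fin (N t)))).map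
      (Matrix.toEuclideanCLM (𝕜 := ℝ) (CFC.sqrt (redCov (K t) σ x)))
  prob : ∀ t x, IsProbabilityMeasure ((S t).law x)

namespace REMLReduction

variable {s : ℕ} {S : ℕ → ScoreModel s} {σ : Param s} (D : REMLReduction S σ)

/-- The covariance matrix of the standardized error contrasts. -/
abbrev cov (t : ℕ) (x : Param s) : Matrix (Fin (D.N t)) (Fin (D.N t)) ℝ := redCov (D.K t) σ x

/-- The standard Gaussian law of the standardized error contrasts at the true parameter. -/
abbrev γ (t : ℕ) : Measure (EuclideanSpace ℝ (Fin (D.N t))) := stdGaussian _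

/-- The symmetric square root of the covariance matrix. -/
def R (t : ℕ) (x : Param s) : Matrix (Fin (D.N t)) (Fin (D.N t)) ℝ := CFC.sqrt (D.cov t x)

variable {D} {t : ℕ} {x : Param s}

lemma one_le_cast (ht : D.t₀ ≤ t) : (1 : ℝ) ≤ t := by
  exact_mod_cast D.one_le_t₀.trans ht

lemma cast_pos (ht : D.t₀ ≤ t) : (0 : ℝ) < t := zero_lt_one.trans_le (one_le_cast ht)

lemma mem_interior (ht : D.t₀ ≤ t) (hx : x ∈ Metric.ball σ D.r) : x ∈ interior (S t).Θ :=
  D.ball_subset t ht hx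

lemma self_mem_ball : σ ∈ Metric.ball σ D.r := Metric.mem_ball_self D.r_pos

lemma self_mem_interior (ht : D.t₀ ≤ t) : σ ∈ interior (S t).Θ := mem_interior ht self_mem_ball

lemma contDiffOn_l (ht : D.t₀ ≤ t) (y : (S t).Y) :
    ContDiffOn ℝ ∞ (fun x => (S t).l x y) (interior (S t).Θ) := by
  have h : ContDiffOn ℝ ∞ (fun x => D.c₀ t - 1 / 2 * (Real.log (D.cov t x).det +
      qf (D.cov t x)⁻¹ (D.L t y))) (interior (S t).Θ) :=
    contDiffOn_const.sub (contDiffOn_const.mul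
      ((contDiffOn_log_det_redCov (D.posDef t ht)).add
        ((contDiffOn_inv_redCov (D.posDef t ht)).qf _)))
  exact h.congr fun x hx => D.l_eq t ht x hx y

lemma contDiffOn_redConst (ht : D.t₀ ≤ t) (j : Fin s) :
    ContDiffOn ℝ ∞ (redConst (D.K t) σ j) (interior (S t).Θ) :=
  EmpiricalPredictor.contDiffOn_redConst (D.posDef t ht) j

lemma contDiffOn_redForm (ht : D.t₀ ≤ t) (j : Fin s) :
    ContDiffOn ℝ ∞ (redForm (D.K t) σ j) (interior (S t).Θ) :=
  EmpiricalPredictor.contDiffOn_redForm (D.posDef t ht) j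

lemma score_eqOn (ht : D.t₀ ≤ t) (y : (S t).Y) (j : Fin s) :
    Set.EqOn (pderiv j fun x => (S t).l x y)
      (fun x => redConst (D.K t) σ j x + qf (redForm (D.K t) σ j x) (D.L t y))
      (interior (S t).Θ) := fun x hx => by
  have h := vpd_congr isOpen_interior (fun x hx => D.l_eq t ht x hx y) j hx
  rw [pderiv_eq_vpd, h, vpd_redLik (D.posDef t ht x hx)]

lemma score_eq (ht : D.t₀ ≤ t) (hx : x ∈ interior (S t).Θ) (y : (S t).Y) (j : Fin s) :
    (S t).score x y j = redConst (D.K t) σ j x + qf (redForm (D.K t) σ j x) (D.L t y) :=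
  score_eqOn ht y j hx

lemma vpd_eqOn_of_eqOn {O : Set (Param s)} (hO : IsOpen O) {N : ℕ} {f : Param s → ℝ}
    {c : Param s → ℝ} {W : Param s → Matrix (Fin N) (Fin N) ℝ} (z : EuclideanSpace ℝ (Fin N))
    (h : Set.EqOn f (fun x => c x + qf (W x) z) O) (hc : ContDiffOn ℝ ∞ c O)
    (hW : ContDiffOn ℝ ∞ W O) (i : Fin s) :
    Set.EqOn (vpd i f) (fun x => vpd i c x + qf (vpd i W x) z) O := fun x hx => by
  rw [vpd_congr hO h i hx]
  exact vpd_add_qf (hc.differentiableAt_of_isOpen hO (by simp) hx)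
    (hW.differentiableAt_of_isOpen hO (by simp) hx) z i

lemma F_eqOn (ht : D.t₀ ≤ t) (y : (S t).Y) (i j : Fin s) :
    Set.EqOn (pderiv i (pderiv j fun x => (S t).l x y))
      (fun x => vpd i (redConst (D.K t) σ j) x + qf (vpd i (redForm (D.K t) σ j) x) (D.L t y))
      (interior (S t).Θ) :=
  vpd_eqOn_of_eqOn isOpen_interior _ (score_eqOn ht y j) (contDiffOn_redConst ht j)
    (contDiffOn_redForm ht j) i

lemma F_eq (ht : D.t₀ ≤ t) (hx : x ∈ interior (S t).Θ) (y : (S t).Y) (i j : Fin s) :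
    (S t).F x y i j = vpd i (redConst (D.K t) σ j) x +
      qf (vpd i (redForm (D.K t) σ j) x) (D.L t y) :=
  F_eqOn ht y i j hx

lemma H_eqOn (ht : D.t₀ ≤ t) (y : (S t).Y) (i j k : Fin s) :
    Set.EqOn (pderiv i (pderiv j (pderiv k fun x => (S t).l x y)))
      (fun x => vpd i (vpd j (redConst (D.K t) σ k)) x +
        qf (vpd i (vpd j (redForm (D.K t) σ k)) x) (D.L t y))
      (interior (S t).Θ) :=
  vpd_eqOn_of_eqOn isOpen_interior _ (F_eqOn ht y j k)
    ((contDiffOn_redConst ht k).vpd isOpen_interior (by simp) j)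
    ((contDiffOn_redForm ht k).vpd isOpen_interior (by simp) j) i

lemma H_eq (ht : D.t₀ ≤ t) (hx : x ∈ interior (S t).Θ) (y : (S t).Y) (i j k : Fin s) :
    (S t).H x y i j k = vpd i (vpd j (redConst (D.K t) σ k)) x +
      qf (vpd i (vpd j (redForm (D.K t) σ k)) x) (D.L t y) :=
  H_eqOn ht y i j k hx

lemma deriv4_eq (ht : D.t₀ ≤ t) (hx : x ∈ interior (S t).Θ) (y : (S t).Y) (i j k l : Fin s) :
    deriv4 (fun x => (S t).l x y) x i j k l = vpd i (vpd j (vpd k (redConst (D.K t) σ l))) x +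
      qf (vpd i (vpd j (vpd k (redForm (D.K t) σ l))) x) (D.L t y) :=
  vpd_eqOn_of_eqOn isOpen_interior _ (H_eqOn ht y j k l)
    (((contDiffOn_redConst ht l).vpd isOpen_interior (k' := ∞) (by simp) k).vpd
      isOpen_interior (by simp) j)
    (((contDiffOn_redForm ht l).vpd isOpen_interior (k' := ∞) (by simp) k).vpd
      isOpen_interior (by simp) j) i hx

/-! #### Expectations -/

lemma integral_law (ht : D.t₀ ≤ t) (hx : x ∈ interior (S t).Θ)
    {f : EuclideanSpace ℝ (Fin (D.N t)) → ℝ} (hf : Continuous f) :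
    ∫ y, f (D.L t y) ∂(S t).law x =
      ∫ z, f (Matrix.toEuclideanCLM (𝕜 := ℝ) (D.R t x) z) ∂D.γ t := by
  rw [← integral_map (D.L_meas t).aemeasurable hf.aestronglyMeasurable, D.law_map t ht x hx,
    integral_map (by fun_prop) hf.aestronglyMeasurable]
  rfl

lemma integrable_law (ht : D.t₀ ≤ t) (hx : x ∈ interior (S t).Θ)
    {f : EuclideanSpace ℝ (Fin (D.N t)) → ℝ} (hf : PolyGrowth f) :
    Integrable (fun y => f (D.L t y)) ((S t).law x) := by
  have h := hf.integrable ((D.γ t).map (Matrix.toEuclideanCLM (𝕜 := ℝ) (D.R t x)))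
  have h2 := D.law_map t ht x hx
  rw [R, cov, ← h2] at h
  exact h.comp_measurable (D.L_meas t)

lemma law_self_map (ht : D.t₀ ≤ t) : ((S t).law σ).map (D.L t) = D.γ t := by
  rw [D.law_map t ht σ (self_mem_interior ht), redCov_self]
  have : CFC.sqrt (1 : Matrix (Fin (D.N t)) (Fin (D.N t)) ℝ) = 1 := by
    simp
  rw [this]
  simp

lemma R_self (t : ℕ) : D.R t σ = 1 := by
  rw [R, cov, redCov_self]
  simp

lemma R_transpose (t : ℕ) (x : Param s) : (D.R t x)ᵀ = D.R t x := transpose_sqrt _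

lemma R_mul_R (ht : D.t₀ ≤ t) (hx : x ∈ interior (S t).Θ) : D.R t x * D.R t x = D.cov t x :=
  sqrt_mul_sqrt (D.posDef t ht x hx).posSemidef

lemma qf_R (W : Matrix (Fin (D.N t)) (Fin (D.N t)) ℝ) (z : EuclideanSpace ℝ (Fin (D.N t))) :
    qf W (Matrix.toEuclideanCLM (𝕜 := ℝ) (D.R t x) z) = qf (D.R t x * W * D.R t x) z := by
  rw [qf_toEuclideanCLM, R_transpose]

lemma trace_R_mul_mul_R (ht : D.t₀ ≤ t) (hx : x ∈ interior (S t).Θ)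
    (W : Matrix (Fin (D.N t)) (Fin (D.N t)) ℝ) :
    (D.R t x * W * D.R t x).trace = (W * D.cov t x).trace := by
  rw [mul_assoc, Matrix.trace_mul_comm, mul_assoc, R_mul_R ht hx]

/-- The part of the score coming from the standardized Gaussian vector. -/
def T1 (D : REMLReduction S σ) (t : ℕ) (j : Fin s) (x : Param s) :
    Matrix (Fin (D.N t)) (Fin (D.N t)) ℝ :=
  D.R t x * redForm (D.K t) σ j x * D.R t x

/-- The analogue of `T1` for the second derivatives. -/
def T2 (D : REMLReduction S σ) (t : ℕ) (i j : Fin s) (x : Param s) :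
    Matrix (Fin (D.N t)) (Fin (D.N t)) ℝ :=
  D.R t x * vpd i (redForm (D.K t) σ j) x * D.R t x

/-- The analogue of `T1` for the third derivatives. -/
def T3 (D : REMLReduction S σ) (t : ℕ) (i j k : Fin s) (x : Param s) :
    Matrix (Fin (D.N t)) (Fin (D.N t)) ℝ :=
  D.R t x * vpd i (vpd j (redForm (D.K t) σ k)) x * D.R t x

/-- The mean of the third derivatives. -/
def mean3 (D : REMLReduction S σ) (t : ℕ) (i j k : Fin s) (x : Param s) : ℝ :=
  vpd i (vpd j (redConst (D.K t) σ k)) x +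
    (vpd i (vpd j (redForm (D.K t) σ k)) x * D.cov t x).trace

/-- The closed form of `A = E(∂²l/∂σ²)`. -/
def info₂ (D : REMLReduction S σ) (t : ℕ) (x : Param s) : Matrix (Fin s) (Fin s) ℝ :=
  Matrix.of fun i j => -(1 / 2) * ((D.cov t x)⁻¹ * D.K t i * (D.cov t x)⁻¹ * D.K t j).trace

/-- Since `E z'Wz = tr(WS)` under `N(0, S)`, this is the exact vanishing of the mean score, at every
interior parameter and not only at `σ`. It makes `Δ₀` zero. -/
lemma mean_score_form (ht : D.t₀ ≤ t) (hx : x ∈ interior (S t).Θ) (j : Fin s) :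
    redConst (D.K t) σ j x + (redForm (D.K t) σ j x * D.cov t x).trace = 0 := by
  have hu : IsUnit (D.cov t x).det := (D.posDef t ht x hx).det_pos.ne'.isUnit
  rw [redConst, redForm, Matrix.smul_mul, mul_assoc _ (redCov (D.K t) σ x)⁻¹,
    Matrix.nonsing_inv_mul _ hu, mul_one, Matrix.trace_smul, smul_eq_mul]
  ring

lemma mean_hess_form (ht : D.t₀ ≤ t) (hx : x ∈ interior (S t).Θ) (i j : Fin s) :
    vpd i (redConst (D.K t) σ j) x + (vpd i (redForm (D.K t) σ j) x * D.cov t x).trace =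
      D.info₂ t x i j := by
  have hpd := D.posDef t ht x hx
  have hu : IsUnit (D.cov t x).det := hpd.det_pos.ne'.isUnit
  rw [vpd_redConst hpd, vpd_redForm hpd, Matrix.smul_mul, add_mul,
    Matrix.nonsing_inv_mul_cancel_right _ _ hu, Matrix.nonsing_inv_mul_cancel_right _ _ hu, Matrix.trace_smul, Matrix.trace_add, smul_eq_mul, info₂, Matrix.of_apply]
  have h1 : ((D.cov t x)⁻¹ * D.K t j * (D.cov t x)⁻¹ * D.K t i).trace =
      ((D.cov t x)⁻¹ * D.K t i * (D.cov t x)⁻¹ * D.K t j).trace := by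
    rw [mul_assoc ((D.cov t x)⁻¹ * D.K t j), Matrix.trace_mul_comm]
    simp only [mul_assoc]
  rw [h1]
  ring

/-- Decomposes the variable, under the law at `x`, into its mean and a centred form in a standard
Gaussian vector; all expectations below are read off from this. -/
lemma add_qf_R (ht : D.t₀ ≤ t) (hx : x ∈ interior (S t).Θ) (c : ℝ)
    (W : Matrix (Fin (D.N t)) (Fin (D.N t)) ℝ) (z : EuclideanSpace ℝ (Fin (D.N t))) :
    c + qf W (Matrix.toEuclideanCLM (𝕜 := ℝ) (D.R t x) z) =
      c + (W * D.cov t x).trace + cqf (D.R t x * W * D.R t x) z := by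
  rw [qf_R, cqf, trace_R_mul_mul_R ht hx]; ring

lemma integral_add_qf (ht : D.t₀ ≤ t) (hx : x ∈ interior (S t).Θ) (c : ℝ)
    (W : Matrix (Fin (D.N t)) (Fin (D.N t)) ℝ) :
    ∫ y, (c + qf W (D.L t y)) ∂(S t).law x = c + (W * D.cov t x).trace := by
  rw [integral_law ht hx (f := fun w => c + qf W w) (continuous_const.add (continuous_qf W))]
  simp only [add_qf_R ht hx]
  rw [integral_add (integrable_const _) ((polyGrowth_cqf _).integrable _),
    integral_cqf_stdGaussian]
  simp

lemma meanScore_eq (ht : D.t₀ ≤ t) (hx : x ∈ interior (S t).Θ) : (S t).meanScore x = 0 := by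
  funext j
  simp only [ScoreModel.meanScore, score_eq ht hx, integral_add_qf ht hx, mean_score_form ht hx,
    Pi.zero_apply]

lemma A_eq (ht : D.t₀ ≤ t) (hx : x ∈ interior (S t).Θ) : (S t).A x = D.info₂ t x := by
  ext i j
  simp only [ScoreModel.A, Matrix.of_apply, F_eq ht hx, integral_add_qf ht hx,
    mean_hess_form ht hx]

lemma integral_H (ht : D.t₀ ≤ t) (hx : x ∈ interior (S t).Θ) (i j k : Fin s) :
    ∫ y, (S t).H x y i j k ∂(S t).law x = D.mean3 t i j k x := by
  simp only [H_eq ht hx, integral_add_qf ht hx, mean3]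

lemma polyGrowth_add_qf (c : ℝ) {N : ℕ} (W : Matrix (Fin N) (Fin N) ℝ) :
    PolyGrowth (fun w => c + qf W w) := (PolyGrowth.const c).add (polyGrowth_qf W)

lemma expectationsExist (ht : D.t₀ ≤ t) (hx : x ∈ interior (S t).Θ) :
    (S t).ExpectationsExist x where
  prob := D.prob t x
  score i := by
    simp only [score_eq ht hx]
    exact integrable_law ht hx (polyGrowth_add_qf _ _)
  hess i j := by
    simp only [F_eq ht hx]
    exact integrable_law ht hx (polyGrowth_add_qf _ _)
  third i j k := by
    simp only [H_eq ht hx]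
    exact integrable_law ht hx (polyGrowth_add_qf _ _)
  score_score i j := by
    simp only [score_eq ht hx]
    exact integrable_law ht hx ((polyGrowth_add_qf _ _).mul (polyGrowth_add_qf _ _))
  hess_score i j k := by
    simp only [score_eq ht hx, F_eq ht hx]
    exact integrable_law ht hx ((polyGrowth_add_qf _ _).mul (polyGrowth_add_qf _ _))
  third_score_score i j k l m := by
    simp only [score_eq ht hx, H_eq ht hx]
    exact integrable_law ht hx
      (((polyGrowth_add_qf _ _).mul (polyGrowth_add_qf _ _)).mul (polyGrowth_add_qf _ _))

/-- The trailing factor `1` gives the two-factor moments the same triple-product shape as `U3`, so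
that `LipMom.unifLip` treats all three. -/
lemma U1_eq (ht : D.t₀ ≤ t) (hx : x ∈ interior (S t).Θ) (i l : Fin s) :
    (S t).U1 x i l = ∫ z, (cqf (D.T1 t i x) z / √t) * (cqf (D.T1 t l x) z / √t) * 1 ∂D.γ t := by
  simp only [ScoreModel.U1, Matrix.of_apply, score_eq ht hx, D.d_eq, mul_one]
  rw [integral_law ht hx (f := fun w =>
    (redConst (D.K t) σ i x + qf (redForm (D.K t) σ i x) w) / √t *
      ((redConst (D.K t) σ l x + qf (redForm (D.K t) σ l x) w) / √t))
    ((((polyGrowth_add_qf _ _).1).div_const _).mul (((polyGrowth_add_qf _ _).1).div_const _))]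
  simp only [add_qf_R ht hx, mean_score_form ht hx, zero_add, T1]

lemma U2_eq (ht : D.t₀ ≤ t) (hx : x ∈ interior (S t).Θ) (j k l : Fin s) :
    (S t).U2 x j k l =
      ∫ z, (cqf (D.T2 t j k x) z / √t) * (cqf (D.T1 t l x) z / √t) * 1 ∂D.γ t := by
  simp only [ScoreModel.U2, score_eq ht hx, F_eq ht hx, D.d_eq, mul_one, A_eq ht hx,
    Real.sqrt_mul_self (Real.sqrt_nonneg _)]
  rw [integral_law ht hx (f := fun w =>
    (vpd j (redConst (D.K t) σ k) x + qf (vpd j (redForm (D.K t) σ k) x) w - D.info₂ t x j k) / √t *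
      ((redConst (D.K t) σ l x + qf (redForm (D.K t) σ l x) w) / √t))
    (((((polyGrowth_add_qf _ _).1).sub continuous_const).div_const _).mul
      (((polyGrowth_add_qf _ _).1).div_const _))]
  simp only [add_qf_R ht hx, mean_score_form ht hx, mean_hess_form ht hx, zero_add, T1, T2,
    add_sub_cancel_left]

lemma U3_eq (ht : D.t₀ ≤ t) (hx : x ∈ interior (S t).Θ) (j k l m n : Fin s) :
    (S t).U3 x j k l m n = ∫ z, ((D.mean3 t j k m x + cqf (D.T3 t j k m x) z) / t) *
      (cqf (D.T1 t l x) z / √t) * (cqf (D.T1 t n x) z / √t) ∂D.γ t := by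
  have h0 : (0:ℝ) ≤ t := by positivity
  simp only [ScoreModel.U3, score_eq ht hx, H_eq ht hx, D.d_eq, Real.mul_self_sqrt h0]
  rw [integral_law ht hx (f := fun w =>
    (vpd j (vpd k (redConst (D.K t) σ m)) x + qf (vpd j (vpd k (redForm (D.K t) σ m)) x) w) / t *
      ((redConst (D.K t) σ l x + qf (redForm (D.K t) σ l x) w) / √t) *
      ((redConst (D.K t) σ n x + qf (redForm (D.K t) σ n x) w) / √t))
    (((((polyGrowth_add_qf _ _).1)).div_const _).mul
      (((polyGrowth_add_qf _ _).1).div_const _) |>.mul (((polyGrowth_add_qf _ _).1).div_const _))]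
  simp only [add_qf_R ht hx, mean_score_form ht hx, zero_add, T1, T3, mean3]

/-! #### Uniform bounds near the true parameter -/

lemma exists_bddDeriv (D : REMLReduction S σ) (k : ℕ) : ∃ C ≥ 0, ∀ t ≥ D.t₀,
    BddDeriv (Metric.ball σ D.r) k (fun x => (D.cov t x)⁻¹) C ∧
    ∀ j, BddDeriv (Metric.ball σ D.r) k (redForm (D.K t) σ j) C ∧
      BddDeriv (Metric.ball σ D.r) k (redConst (D.K t) σ j) (C * t) := by
  obtain ⟨C, hC, h⟩ := exists_bddDeriv_redForm s D.κ D.κ_nonneg k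
  refine ⟨C + C * D.κ, by have := D.κ_nonneg; positivity, fun t ht => ?_⟩
  obtain ⟨h1, h2⟩ := h (D.K_norm t ht) D.r_le fun x hx => D.posDef t ht x (mem_interior ht hx)
  have hCκ : 0 ≤ C * D.κ := mul_nonneg hC D.κ_nonneg
  refine ⟨h1.mono (by linarith), fun j => ⟨(h2 j).1.mono (by linarith), (h2 j).2.mono ?_⟩⟩
  have := mul_le_mul_of_nonneg_left (D.N_le t ht) hC
  have h0 : (0:ℝ) ≤ t := by positivity
  nlinarith

lemma norm_R_sub_one_le (ht : D.t₀ ≤ t) (hx : x ∈ Metric.ball σ D.r) :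
    ‖D.R t x - 1‖ ≤ s * D.κ * ‖x - σ‖ :=
  (norm_sqrt_sub_one_le (D.posDef t ht x (mem_interior ht hx)).posSemidef).trans
    (norm_redCov_sub_one_le (D.K_norm t ht) x)

lemma norm_R_le (ht : D.t₀ ≤ t) (hx : x ∈ Metric.ball σ D.r) : ‖D.R t x‖ ≤ 2 := by
  have h1 := (norm_sqrt_sub_one_le (D.posDef t ht x (mem_interior ht hx)).posSemidef).trans
    (norm_redCov_sub_one_le_half (D.K_norm t ht) D.r_le D.κ_nonneg hx)
  have h2 := norm_add_le (D.R t x - 1) 1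
  rw [sub_add_cancel] at h2
  have := norm_one_le (ι := Fin (D.N t))
  have h3 : ‖D.R t x - 1‖ ≤ 1 / 2 := h1
  linarith

/-- Families of functions of the parameter which are uniformly bounded near `σ` and uniformly
Lipschitz at `σ`. -/
def UnifLip (D : REMLReduction S σ) (f : ℕ → Param s → ℝ) : Prop :=
  ∃ C ≥ 0, ∀ t ≥ D.t₀, ∀ x ∈ Metric.ball σ D.r, |f t x| ≤ C ∧ |f t x - f t σ| ≤ C * ‖x - σ‖

namespace UnifLip

variable {f g : ℕ → Param s → ℝ}

lemma const (c : ℝ) : UnifLip D fun _ _ => c :=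
  ⟨|c|, abs_nonneg c, fun t _ x _ => ⟨le_rfl, by simp; positivity⟩⟩

lemma congr (hf : UnifLip D f) (h : ∀ t ≥ D.t₀, ∀ x ∈ Metric.ball σ D.r, f t x = g t x) :
    UnifLip D g := by
  obtain ⟨C, hC, hf⟩ := hf
  refine ⟨C, hC, fun t ht x hx => ?_⟩
  rw [← h t ht x hx, ← h t ht σ self_mem_ball]
  exact hf t ht x hx

lemma add (hf : UnifLip D f) (hg : UnifLip D g) : UnifLip D fun t x => f t x + g t x := by
  obtain ⟨C, hC, hf⟩ := hf
  obtain ⟨C', hC', hg⟩ := hg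
  refine ⟨C + C', by positivity, fun t ht x hx => ⟨?_, ?_⟩⟩
  · exact (abs_add_le _ _).trans (add_le_add (hf t ht x hx).1 (hg t ht x hx).1)
  · have h : f t x + g t x - (f t σ + g t σ) = (f t x - f t σ) + (g t x - g t σ) := by ring
    rw [h, add_mul]
    exact (abs_add_le _ _).trans (add_le_add (hf t ht x hx).2 (hg t ht x hx).2)

lemma mul (hf : UnifLip D f) (hg : UnifLip D g) : UnifLip D fun t x => f t x * g t x := by
  obtain ⟨C, hC, hf⟩ := hf
  obtain ⟨C', hC', hg⟩ := hg
  refine ⟨C * C' + C * C', by positivity, fun t ht x hx => ⟨?_, ?_⟩⟩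
  · rw [abs_mul]
    have := mul_le_mul (hf t ht x hx).1 (hg t ht x hx).1 (abs_nonneg _) hC
    have : 0 ≤ C * C' := by positivity
    linarith
  · have h : f t x * g t x - f t σ * g t σ =
        (f t x - f t σ) * g t x + f t σ * (g t x - g t σ) := by ring
    rw [h]
    refine (abs_add_le _ _).trans ?_
    rw [abs_mul, abs_mul]
    have h1 := mul_le_mul (hf t ht x hx).2 (hg t ht x hx).1 (abs_nonneg _) (by positivity)
    have h2 := mul_le_mul (hf t ht σ self_mem_ball).1 (hg t ht x hx).2 (abs_nonneg _) hC
    nlinarith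

lemma sum {ι : Type*} (u : Finset ι) {f : ι → ℕ → Param s → ℝ} (h : ∀ i ∈ u, UnifLip D (f i)) :
    UnifLip D fun t x => ∑ i ∈ u, f i t x := by
  classical
  induction u using Finset.induction_on with
  | empty => simpa using const (D := D) 0
  | insert a u ha ih =>
    simp only [Finset.sum_insert ha]
    exact (h a (by simp)).add (ih fun i hi => h i (by simp [hi]))

lemma const_mul (c : ℝ) (hf : UnifLip D f) : UnifLip D fun t x => c * f t x := (const c).mul hf

end UnifLip

lemma UnifLip.of_bddDeriv {f : ℕ → Param s → ℝ} {C : ℝ} (hC : 0 ≤ C) {k : ℕ}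
    (h : ∀ t ≥ D.t₀, BddDeriv (Metric.ball σ D.r) (k + 1) (f t) C) : UnifLip D f := by
  refine ⟨C + s * C, by positivity, fun t ht x hx => ⟨?_, ?_⟩⟩
  · have := (h t ht).norm_le hx
    rw [Real.norm_eq_abs] at this
    have : 0 ≤ s * C := by positivity
    linarith
  · have := (h t ht).norm_sub_le self_mem_ball hx
    rw [Real.norm_eq_abs] at this
    have h2 : 0 ≤ C * ‖x - σ‖ := by positivity
    linarith

/-- Families of matrix-valued functions of the parameter which are uniformly bounded near `σ` and
uniformly Lipschitz at `σ`. -/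
def MatLip (D : REMLReduction S σ)
    (T : ∀ t, Param s → Matrix (Fin (D.N t)) (Fin (D.N t)) ℝ) : Prop :=
  ∃ C ≥ 0, ∀ t ≥ D.t₀, ∀ x ∈ Metric.ball σ D.r, ‖T t x‖ ≤ C ∧ ‖T t x - T t σ‖ ≤ C * ‖x - σ‖

/-- Because `R(σ) = 1` and `R(x) - 1 = O(‖x - σ‖)`, conjugation by the square root preserves
boundedness and the Lipschitz estimate. Only increments from `σ` are needed, so the square root need
not be differentiated. -/
lemma matLip_of_bddDeriv {M : ∀ t, Param s → Matrix (Fin (D.N t)) (Fin (D.N t)) ℝ} {C : ℝ}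
    (hC : 0 ≤ C) {k : ℕ} (h : ∀ t ≥ D.t₀, BddDeriv (Metric.ball σ D.r) (k + 1) (M t) C) :
    MatLip D fun t x => D.R t x * M t x * D.R t x := by
  have hκ := D.κ_nonneg
  refine ⟨4 * C + (3 * (s * D.κ) * C + s * C), by positivity, fun t ht x hx => ?_⟩
  have h1 := norm_R_le ht hx
  have h2 := norm_R_sub_one_le ht hx
  have h3 := (h t ht).norm_le hx
  have h4 := (h t ht).norm_sub_le self_mem_ball hx
  have hx0 : 0 ≤ ‖x - σ‖ := norm_nonneg _
  constructor
  · calc ‖D.R t x * M t x * D.R t x‖ ≤ ‖D.R t x‖ * ‖M t x‖ * ‖D.R t x‖ :=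
        (norm_mul_le _ _).trans (mul_le_mul_of_nonneg_right (norm_mul_le _ _) (norm_nonneg _))
      _ ≤ 2 * C * 2 := by gcongr
      _ ≤ _ := by
        have : 0 ≤ 3 * (s * D.κ) * C + s * C := by positivity
        linarith
  · have h5 : D.R t x * M t x * D.R t x - D.R t σ * M t σ * D.R t σ =
        (D.R t x - 1) * M t x * D.R t x + M t x * (D.R t x - 1) + (M t x - M t σ) := by
      rw [R_self]; noncomm_ring
    rw [h5]
    calc _ ≤ ‖(D.R t x - 1) * M t x * D.R t x‖ + ‖M t x * (D.R t x - 1)‖ + ‖M t x - M t σ‖ :=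
          norm_add₃_le
      _ ≤ s * D.κ * ‖x - σ‖ * C * 2 + C * (s * D.κ * ‖x - σ‖) + s * C * ‖x - σ‖ := by
          gcongr
          · exact ((norm_mul_le _ _).trans (mul_le_mul_of_nonneg_right (norm_mul_le _ _)
              (norm_nonneg _))).trans (by gcongr)
          · exact (norm_mul_le _ _).trans (by gcongr)
      _ ≤ _ := by
          have : 0 ≤ 4 * C * ‖x - σ‖ := by positivity
          linarith

lemma matLip_T1 (j : Fin s) : MatLip D fun t => D.T1 t j := by
  obtain ⟨C, hC, h⟩ := D.exists_bddDeriv 1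
  exact matLip_of_bddDeriv hC fun t ht => ((h t ht).2 j).1

lemma matLip_T2 (i j : Fin s) : MatLip D fun t => D.T2 t i j := by
  obtain ⟨C, hC, h⟩ := D.exists_bddDeriv 2
  exact matLip_of_bddDeriv hC fun t ht => ((h t ht).2 j).1.vpd i

lemma matLip_T3 (i j k : Fin s) : MatLip D fun t => D.T3 t i j k := by
  obtain ⟨C, hC, h⟩ := D.exists_bddDeriv 3
  exact matLip_of_bddDeriv hC fun t ht => (((h t ht).2 k).1.vpd j).vpd i

/-- Both parts of the mean are of order `t`: the trace runs over `N ≤ κ t` coordinates of a bounded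
matrix. Division by `t` therefore leaves a bounded family. -/
lemma unifLip_mean3 (i j k : Fin s) : UnifLip D fun t x => D.mean3 t i j k x / t := by
  obtain ⟨C, hC, h⟩ := D.exists_bddDeriv 3
  have hκ := D.κ_nonneg
  refine UnifLip.of_bddDeriv (C := C + D.κ * (2 * C * max 2 D.κ)) (k := 0) (by positivity)
    fun t ht => ?_
  have h0 := cast_pos ht
  have hU : IsOpen (Metric.ball σ D.r) := Metric.isOpen_ball
  have h1 := (((h t ht).2 k).2.vpd j).vpd i
  have h2 := ((((h t ht).2 k).1.vpd j).vpd i).matMul hU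
    (bddDeriv_redCov (D.K_norm t ht) D.r_le D.κ_nonneg 1) hC |>.trace hU
  have h3 := (h1.add hU h2).const_smul hU (t : ℝ)⁻¹
  rw [abs_of_pos (by positivity)] at h3
  refine (h3.congr hU fun x _ => ?_).mono ?_
  · simp only [mean3, smul_eq_mul]; ring
  · rw [inv_mul_le_iff₀ h0, Fintype.card_fin]
    have := mul_le_mul_of_nonneg_right (D.N_le t ht)
      (by positivity : (0:ℝ) ≤ 2 ^ 1 * C * max 2 D.κ)
    nlinarith

lemma exists_bddDeriv_info₂ (D : REMLReduction S σ) (k : ℕ) : ∃ C ≥ 0, ∀ t ≥ D.t₀,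
    BddDeriv (Metric.ball σ D.r) k (fun x => (t : ℝ)⁻¹ • D.info₂ t x) C := by
  obtain ⟨C, hC, h⟩ := D.exists_bddDeriv k
  have hκ := D.κ_nonneg
  refine ⟨s * (s * (D.κ * (2 ^ k * (2 ^ k * (2 ^ k * C * D.κ) * C) * D.κ))), by positivity,
    fun t ht => ?_⟩
  have h0 := cast_pos ht
  have hU : IsOpen (Metric.ball σ D.r) := Metric.isOpen_ball
  have hK := fun i => (BddDeriv.const (Metric.ball σ D.r) k (D.K t i)).mono (D.K_norm t ht i)
  have h1 := (h t ht).1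
  have h3 := BddDeriv.of_apply hU (f := fun x => (t : ℝ)⁻¹ • D.info₂ t x)
    (C := D.κ * (2 ^ k * (2 ^ k * (2 ^ k * C * D.κ) * C) * D.κ)) fun i j => by
    have h2 := (((h1.matMul hU (hK i) hC).matMul hU h1 (by positivity)).matMul hU (hK j)
      (by positivity)).trace hU
    have h3 := h2.const_smul hU (-(1 / 2) * (t : ℝ)⁻¹)
    rw [abs_mul, abs_neg, abs_of_pos (by positivity : (0:ℝ) < (t : ℝ)⁻¹),
      abs_of_pos (by norm_num : (0:ℝ) < 1 / 2)] at h3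
    refine (h3.congr hU fun x _ => ?_).mono ?_
    · simp only [info₂, smul_eq_mul, Matrix.smul_apply, Matrix.of_apply]; ring
    · rw [Fintype.card_fin, mul_assoc, mul_left_comm, inv_mul_le_iff₀ h0]
      have := mul_le_mul_of_nonneg_right (D.N_le t ht)
        (by positivity : (0:ℝ) ≤ 2 ^ k * (2 ^ k * (2 ^ k * C * D.κ) * C) * D.κ)
      have h4 : 0 ≤ (D.N t : ℝ) * (2 ^ k * (2 ^ k * (2 ^ k * C * D.κ) * C) * D.κ) := by positivity
      nlinarith
  simpa using h3

end REMLReduction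

end

end EmpiricalPredictor

namespace EmpiricalPredictor

noncomputable section

open scoped ContDiff MatrixOrder

/-! ### Extreme eigenvalues -/

section Eigenvalues

variable {s : ℕ}

lemma spectrum_eq_range_eigenvalues {M : Matrix (Fin s) (Fin s) ℝ} (hM : M.IsHermitian) :
    spectrum ℝ M = Set.range hM.eigenvalues := hM.spectrum_real_eq_range_eigenvalues

lemma eigenvalues_eq_dotProduct {M : Matrix (Fin s) (Fin s) ℝ} (hM : M.IsHermitian) (i : Fin s) :
    hM.eigenvalues i =
      (hM.eigenvectorBasis i : Fin s → ℝ) ⬝ᵥ (M *ᵥ (hM.eigenvectorBasis i : Fin s → ℝ)) := by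
  have h := dotProduct_self_eq_norm_sq (hM.eigenvectorBasis i : Fin s → ℝ)
  rw [WithLp.toLp_ofLp, hM.eigenvectorBasis.orthonormal.1 i] at h
  rw [hM.mulVec_eigenvectorBasis]
  simp [dotProduct_smul, h]

lemma lambdaMax_le [NeZero s] {M : Matrix (Fin s) (Fin s) ℝ} (hM : M.IsHermitian) {a : ℝ}
    (h : ∀ v : Fin s → ℝ, v ⬝ᵥ (M *ᵥ v) ≤ a * ‖WithLp.toLp 2 v‖ ^ 2) : lambdaMax M ≤ a := by
  rw [lambdaMax, spectrum_eq_range_eigenvalues hM]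
  refine csSup_le (Set.range_nonempty _) ?_
  rintro _ ⟨i, rfl⟩
  rw [eigenvalues_eq_dotProduct hM]
  refine (h _).trans (le_of_eq ?_)
  rw [WithLp.toLp_ofLp, hM.eigenvectorBasis.orthonormal.1 i]
  ring

lemma neg_norm_le_lambdaMax [NeZero s] {M : Matrix (Fin s) (Fin s) ℝ} (hM : M.IsHermitian) :
    -‖M‖ ≤ lambdaMax M := by
  rw [lambdaMax, spectrum_eq_range_eigenvalues hM]
  have hfin : (Set.range hM.eigenvalues).Finite := Set.finite_range _
  refine le_trans ?_ (le_csSup hfin.bddAbove (Set.mem_range_self (0 : Fin s)))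
  rw [eigenvalues_eq_dotProduct hM]
  have := abs_dotProduct_mulVec_le M (hM.eigenvectorBasis 0) (hM.eigenvectorBasis 0)
  rw [WithLp.toLp_ofLp, hM.eigenvectorBasis.orthonormal.1 0, mul_one, mul_one] at this
  exact (abs_le.1 this).1

lemma lambdaMin_mul_le {M : Matrix (Fin s) (Fin s) ℝ} (hM : M.IsHermitian) (v : Fin s → ℝ) :
    lambdaMin M * ‖WithLp.toLp 2 v‖ ^ 2 ≤ v ⬝ᵥ (M *ᵥ v) := by
  have h1 : ∀ i, lambdaMin M ≤ hM.eigenvalues i := fun i => by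
    rw [lambdaMin, spectrum_eq_range_eigenvalues hM]
    exact csInf_le (Set.finite_range _).bddBelow (Set.mem_range_self i)
  set b := hM.eigenvectorBasis
  have h2 : WithLp.toLp 2 v = ∑ i, (b.repr (WithLp.toLp 2 v) i) • b i :=
    (b.sum_repr (WithLp.toLp 2 v)).symm
  have h3 : v ⬝ᵥ (M *ᵥ v) = qf M (WithLp.toLp 2 v) := rfl
  rw [h3, h2, qf_sum_eigenvectorBasis hM, b.sum_repr, ← b.repr.norm_map,
    EuclideanSpace.real_norm_sq_eq, Finset.mul_sum]
  exact Finset.sum_le_sum fun i _ => mul_le_mul_of_nonneg_right (h1 i) (sq_nonneg _)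

/-- A lower bound for a positive definite matrix bounds its inverse. -/
lemma norm_inv_le_of_lower_bound {n : Type} [Fintype n] [DecidableEq n] {M : Matrix n n ℝ}
    {a : ℝ} (ha : 0 < a)
    (h : ∀ v : n → ℝ, a * ‖WithLp.toLp 2 v‖ ^ 2 ≤ v ⬝ᵥ (M *ᵥ v)) :
    IsUnit M.det ∧ ‖M⁻¹‖ ≤ a⁻¹ := by
  have hu : IsUnit M.det := by
    refine (Matrix.isUnit_iff_isUnit_det M).1 (Matrix.mulVec_injective_iff_isUnit.1 ?_)
    refine (injective_iff_map_eq_zero (Matrix.mulVecLin M)).2 fun v hv => ?_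
    have h1 := h v
    have h2 : M *ᵥ v = 0 := hv
    rw [h2, dotProduct_zero] at h1
    have h3 : ‖WithLp.toLp 2 v‖ ^ 2 ≤ 0 := by nlinarith
    have h4 : WithLp.toLp 2 v = 0 := norm_eq_zero.1 (by nlinarith [norm_nonneg (WithLp.toLp 2 v)])
    simpa using congrArg WithLp.ofLp h4
  refine ⟨hu, norm_le_of_mulVec_le _ (by positivity) fun v => ?_⟩
  have h1 := h (M⁻¹ *ᵥ v)
  rw [Matrix.mulVec_mulVec, Matrix.mul_nonsing_inv _ hu, Matrix.one_mulVec] at h1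
  have h2 := (le_abs_self _).trans (abs_dotProduct_le (M⁻¹ *ᵥ v) v)
  rw [inv_mul_eq_div, le_div_iff₀ ha]
  by_contra! hlt
  have h3 : 0 < ‖WithLp.toLp 2 (M⁻¹ *ᵥ v)‖ := by
    by_contra! h0
    have : ‖WithLp.toLp 2 (M⁻¹ *ᵥ v)‖ = 0 := le_antisymm h0 (norm_nonneg _)
    rw [this, zero_mul] at hlt
    exact absurd hlt (not_lt.2 (norm_nonneg _))
  nlinarith

end Eigenvalues

/-- Lets fourth moments control the mean of a triple product without Hölder's inequality. -/
lemma abs_mul_mul_le (a b c : ℝ) : |a * b * c| ≤ a ^ 4 + b ^ 4 + c ^ 4 + 1 := by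
  have h1 : |a * b * c| = |a| * |b * c| := by rw [mul_assoc, abs_mul]
  have h2 : |b * c| ≤ (b ^ 2 + c ^ 2) / 2 := by
    rw [abs_mul]; nlinarith [sq_nonneg (|b| - |c|), sq_abs b, sq_abs c]
  have h3 : |a| * |b * c| ≤ (a ^ 2 + |b * c| ^ 2) / 2 := by
    nlinarith [sq_nonneg (|a| - |b * c|), sq_abs a]
  have h4 : |b * c| ^ 2 ≤ (b ^ 4 + c ^ 4) / 2 := by
    rw [sq_abs]; nlinarith [sq_nonneg (b ^ 2 - c ^ 2)]
  rw [h1]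
  nlinarith [sq_nonneg (a ^ 2 - 1), sq_nonneg (b ^ 2), sq_nonneg (c ^ 2), sq_nonneg (a ^ 2)]

namespace REMLReduction

variable {s : ℕ} {S : ℕ → ScoreModel s} {σ : Param s} {D : REMLReduction S σ}
  {t : ℕ} {x : Param s}

/-! #### The information matrix -/

lemma info₂_symm (t : ℕ) (x : Param s) : (D.info₂ t x).IsSymm := by
  ext i j
  simp only [info₂, Matrix.transpose_apply, Matrix.of_apply]
  congr 1
  rw [mul_assoc ((D.cov t x)⁻¹ * D.K t j), Matrix.trace_mul_comm]
  simp only [mul_assoc]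

lemma dotProduct_info₂ (v : Fin s → ℝ) : v ⬝ᵥ (-(D.info₂ t x) *ᵥ v) =
    1 / 2 * ((D.cov t x)⁻¹ * (∑ j, v j • D.K t j) * (D.cov t x)⁻¹ *
      (∑ j, v j • D.K t j)).trace := by
  simp only [dotProduct, Matrix.mulVec, Matrix.neg_apply, info₂, Matrix.of_apply, Finset.mul_sum,
    Finset.sum_mul, Matrix.trace_sum, Matrix.mul_smul, Matrix.smul_mul, Matrix.trace_smul,
    smul_eq_mul]
  rw [Finset.sum_comm]
  refine Finset.sum_congr rfl fun i _ => Finset.sum_congr rfl fun j _ => ?_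
  ring

/-- `S⁻¹` is bounded below by `(1 + ‖S‖)⁻¹`, so the information at `x` is comparable with `tr(KK)`,
which is of order `t`. The added `1` avoids dividing by a zero norm. The bound holds on the whole
interior, where it gives invertibility of `A`. -/
lemma info₂_lower (ht : D.t₀ ≤ t) (hx : x ∈ interior (S t).Θ) (v : Fin s → ℝ) :
    1 / 2 * (1 + ‖D.cov t x‖)⁻¹ ^ 2 * (D.c * t) * ‖WithLp.toLp 2 v‖ ^ 2 ≤
      v ⬝ᵥ (-(D.info₂ t x) *ᵥ v) := by
  have hpd := D.posDef t ht x hx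
  have hu : IsUnit (D.cov t x).det := hpd.det_pos.ne'.isUnit
  have hsym : (∑ j, v j • D.K t j).IsSymm := by
    rw [Matrix.IsSymm, Matrix.transpose_sum]
    exact Finset.sum_congr rfl fun j _ => by rw [Matrix.transpose_smul, D.K_symm t j]
  have h1 := trace_mul_mul_mul_ge hpd.inv hsym (c := (1 + ‖D.cov t x‖)⁻¹) (by
    rw [Matrix.nonsing_inv_nonsing_inv _ hu, inv_mul_le_iff₀ (by positivity)]
    linarith) (by positivity)
  have h2 := mul_le_mul_of_nonneg_left (D.info t ht v)
    (by positivity : 0 ≤ (1 + ‖D.cov t x‖)⁻¹ ^ 2)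
  rw [dotProduct_info₂]
  linarith

lemma isUnit_det_info₂ (ht : D.t₀ ≤ t) (hx : x ∈ interior (S t).Θ) :
    IsUnit (D.info₂ t x).det := by
  have h0 := cast_pos ht
  have hc := D.c_pos
  have h := (norm_inv_le_of_lower_bound (by positivity) (info₂_lower ht hx)).1
  rw [Matrix.det_neg] at h
  exact isUnit_of_mul_isUnit_right h

/-- On the ball `‖S‖ ≤ 2`, so the factor of `info₂_lower` is at least `(1/2) · 3⁻² = 1/18`. -/
lemma info₂_lower_ball (ht : D.t₀ ≤ t) (hx : x ∈ Metric.ball σ D.r) (v : Fin s → ℝ) :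
    D.c / 18 * ‖WithLp.toLp 2 v‖ ^ 2 ≤ v ⬝ᵥ (-((t : ℝ)⁻¹ • D.info₂ t x) *ᵥ v) := by
  have h0 := cast_pos ht
  have hc := D.c_pos
  have h1 := info₂_lower ht (mem_interior ht hx) v
  have h2 : (3 : ℝ)⁻¹ ≤ (1 + ‖D.cov t x‖)⁻¹ := by
    refine inv_anti₀ (by positivity) ?_
    have := norm_redCov_le (D.K_norm t ht) D.r_le D.κ_nonneg hx
    linarith
  have h3 : (3 : ℝ)⁻¹ ^ 2 ≤ (1 + ‖D.cov t x‖)⁻¹ ^ 2 := by gcongr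
  have h4 := mul_le_mul_of_nonneg_right h3
    (by positivity : 0 ≤ D.c * t * ‖WithLp.toLp 2 v‖ ^ 2)
  rw [← smul_neg, Matrix.smul_mulVec, dotProduct_smul, smul_eq_mul, le_inv_mul_iff₀ h0]
  nlinarith

lemma inv_smul_info₂ (ht : D.t₀ ≤ t) (hx : x ∈ Metric.ball σ D.r) :
    IsUnit ((t : ℝ)⁻¹ • D.info₂ t x).det ∧ ‖((t : ℝ)⁻¹ • D.info₂ t x)⁻¹‖ ≤ 18 / D.c := by
  have hc := D.c_pos
  have h := norm_inv_le_of_lower_bound (by positivity) (info₂_lower_ball ht hx)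
  rw [Matrix.det_neg] at h
  have hu := isUnit_of_mul_isUnit_right h.1
  refine ⟨hu, ?_⟩
  have h2 := h.2
  have h3 : (-((t : ℝ)⁻¹ • D.info₂ t x))⁻¹ = -((t : ℝ)⁻¹ • D.info₂ t x)⁻¹ :=
    Matrix.inv_eq_right_inv (by rw [neg_mul_neg, Matrix.mul_nonsing_inv _ hu])
  rwa [h3, norm_neg, inv_div] at h2

lemma exists_bddDeriv_inv_info₂ (D : REMLReduction S σ) (k : ℕ) : ∃ C ≥ 0, ∀ t ≥ D.t₀,
    BddDeriv (Metric.ball σ D.r) k (fun x => ((t : ℝ)⁻¹ • D.info₂ t x)⁻¹) C := by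
  have hc := D.c_pos
  obtain ⟨C, hC, h⟩ := D.exists_bddDeriv_info₂ k
  obtain ⟨C', hC', h'⟩ := BddDeriv.exists_inv (s := s) k C (18 / D.c) hC (by positivity)
  exact ⟨C', hC', fun t ht => h' Metric.isOpen_ball (h t ht)
    (fun x hx => (inv_smul_info₂ ht hx).1) fun x hx => (inv_smul_info₂ ht hx).2⟩

lemma unifLip_info₂ (i j : Fin s) : UnifLip D fun t x => ((t : ℝ)⁻¹ • D.info₂ t x) i j := by
  obtain ⟨C, hC, h⟩ := D.exists_bddDeriv_info₂ 1
  exact UnifLip.of_bddDeriv hC fun t ht => (h t ht).apply Metric.isOpen_ball i j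

lemma unifLip_inv_info₂ (i j : Fin s) :
    UnifLip D fun t x => ((t : ℝ)⁻¹ • D.info₂ t x)⁻¹ i j := by
  obtain ⟨C, hC, h⟩ := D.exists_bddDeriv_inv_info₂ 1
  exact UnifLip.of_bddDeriv hC fun t ht => (h t ht).apply Metric.isOpen_ball i j

lemma Q_eq (ht : D.t₀ ≤ t) (hx : x ∈ interior (S t).Θ) :
    (S t).Q x = (t : ℝ)⁻¹ • D.info₂ t x := by
  have h : (S t).Dinv = (√(t : ℝ))⁻¹ • (1 : Matrix (Fin s) (Fin s) ℝ) := by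
    rw [ScoreModel.Dinv, Matrix.smul_one_eq_diagonal]
    simp only [D.d_eq]
  rw [ScoreModel.Q, h, A_eq ht hx]
  simp only [Matrix.smul_mul, Matrix.mul_smul, one_mul, mul_one, smul_smul]
  rw [← mul_inv, Real.mul_self_sqrt (by positivity)]

/-! #### Lipschitz families of random variables -/

/-- Families of functions of the parameter and a Gaussian vector with uniformly bounded fourth
moments, uniformly Lipschitz at `σ` in `L⁴`. -/
def LipMom (D : REMLReduction S σ)
    (f : ∀ t, Param s → EuclideanSpace ℝ (Fin (D.N t)) → ℝ) : Prop :=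
  (∀ t x, PolyGrowth (f t x)) ∧ ∃ C ≥ 0, ∀ t ≥ D.t₀, ∀ x ∈ Metric.ball σ D.r,
    ∫ z, f t x z ^ 4 ∂D.γ t ≤ C ∧ ∫ z, (f t x z - f t σ z) ^ 4 ∂D.γ t ≤ C * ‖x - σ‖ ^ 4

lemma LipMom.of_unifLip {f : ℕ → Param s → ℝ} (hf : UnifLip D f) :
    LipMom D fun t x _ => f t x := by
  obtain ⟨C, hC, hf⟩ := hf
  refine ⟨fun t x => .const _, C ^ 4, by positivity, fun t ht x hx => ?_⟩
  obtain ⟨h1, h2⟩ := hf t ht x hx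
  simp only [integral_const, probReal_univ, one_smul]
  rw [← mul_pow, ← Even.pow_abs (by decide : Even 4), ← Even.pow_abs (by decide : Even 4)
    (f t x - f t σ)]
  exact ⟨by gcongr, by gcongr⟩

lemma LipMom.add {f g : ∀ t, Param s → EuclideanSpace ℝ (Fin (D.N t)) → ℝ} (hf : LipMom D f)
    (hg : LipMom D g) : LipMom D fun t x z => f t x z + g t x z := by
  obtain ⟨hfp, C, hC, hf⟩ := hf
  obtain ⟨hgp, C', hC', hg⟩ := hg
  have key : ∀ a b : ℝ, (a + b) ^ 4 ≤ 8 * (a ^ 4 + b ^ 4) := fun a b => by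
    nlinarith [sq_nonneg (a - b), sq_nonneg (a + b), sq_nonneg (a ^ 2 - b ^ 2),
      mul_nonneg (sq_nonneg (a - b)) (sq_nonneg (a + b)), sq_nonneg ((a - b) ^ 2)]
  refine ⟨fun t x => (hfp t x).add (hgp t x), 8 * (C + C'), by positivity, fun t ht x hx => ?_⟩
  have int : ∀ {u v : EuclideanSpace ℝ (Fin (D.N t)) → ℝ} {a b : ℝ}, PolyGrowth u → PolyGrowth v →
      ∫ z, u z ^ 4 ∂D.γ t ≤ a → ∫ z, v z ^ 4 ∂D.γ t ≤ b →
      ∫ z, (u z + v z) ^ 4 ∂D.γ t ≤ 8 * (a + b) := fun {u v a b} hu hv ha hb => by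
    calc ∫ z, (u z + v z) ^ 4 ∂D.γ t ≤ ∫ z, 8 * (u z ^ 4 + v z ^ 4) ∂D.γ t :=
          integral_mono (((hu.add hv).pow 4).integrable _)
            ((((hu.pow 4).add (hv.pow 4)).const_mul 8).integrable _) fun z => key _ _
      _ ≤ _ := by
          rw [integral_const_mul, integral_add ((hu.pow 4).integrable _) ((hv.pow 4).integrable _)]
          linarith
  refine ⟨int (hfp t x) (hgp t x) (hf t ht x hx).1 (hg t ht x hx).1, ?_⟩
  have h1 := int ((hfp t x).sub (hfp t σ)) ((hgp t x).sub (hgp t σ)) (hf t ht x hx).2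
    (hg t ht x hx).2
  refine (le_of_eq ?_).trans (h1.trans (le_of_eq (by ring)))
  exact integral_congr_ae (Eventually.of_forall fun z => by ring)

lemma LipMom.scale {f : ∀ t, Param s → EuclideanSpace ℝ (Fin (D.N t)) → ℝ} (hf : LipMom D f)
    {a : ℕ → ℝ} (ha : ∀ t ≥ D.t₀, |a t| ≤ 1) : LipMom D fun t x z => a t * f t x z := by
  obtain ⟨hfp, C, hC, hf⟩ := hf
  refine ⟨fun t x => (hfp t x).const_mul _, C, hC, fun t ht x hx => ?_⟩
  have h4 : a t ^ 4 ≤ 1 := by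
    rw [← Even.pow_abs (by decide : Even 4)]
    exact pow_le_one₀ (abs_nonneg _) (ha t ht)
  have h5 : 0 ≤ a t ^ 4 := Even.pow_nonneg (by decide) _
  have int : ∀ {u : EuclideanSpace ℝ (Fin (D.N t)) → ℝ} {b : ℝ},
      ∫ z, u z ^ 4 ∂D.γ t ≤ b → ∫ z, (a t * u z) ^ 4 ∂D.γ t ≤ b := fun {u b} hb => by
    simp only [mul_pow]
    rw [integral_const_mul]
    have h6 : 0 ≤ ∫ z, u z ^ 4 ∂D.γ t := integral_nonneg fun z => Even.pow_nonneg (by decide) _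
    nlinarith
  refine ⟨int (hf t ht x hx).1, ?_⟩
  simp only [← mul_sub]
  exact int (hf t ht x hx).2

/-- The dimension is at most `κ t`, so `√t` is the right normalization of a centred form. -/
lemma exists_integral_cqf_div_sqrt_pow_le (D : REMLReduction S σ) (k : ℕ) : ∃ C ≥ 0,
    ∀ t ≥ D.t₀, ∀ W : Matrix (Fin (D.N t)) (Fin (D.N t)) ℝ,
      ∫ z, (cqf W z / √t) ^ (2 * k) ∂D.γ t ≤ C * ‖W‖ ^ (2 * k) := by
  obtain ⟨C, hC, h⟩ := exists_integral_cqf_pow_le k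
  have hκ := D.κ_nonneg
  refine ⟨C * D.κ ^ k, by positivity, fun t ht W => ?_⟩
  have h0 := cast_pos ht
  simp only [div_pow]
  rw [integral_div, pow_mul √(t : ℝ), Real.sq_sqrt h0.le, div_le_iff₀ (by positivity)]
  refine (h W).trans ?_
  rw [Fintype.card_fin, mul_pow, ← pow_mul]
  have h1 : (D.N t : ℝ) ^ k ≤ (D.κ * t) ^ k := by gcongr; exact D.N_le t ht
  rw [mul_pow] at h1
  have := mul_le_mul_of_nonneg_right h1 (by positivity : 0 ≤ C * ‖W‖ ^ (2 * k))
  linarith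

lemma LipMom.of_matLip {T : ∀ t, Param s → Matrix (Fin (D.N t)) (Fin (D.N t)) ℝ}
    (hT : MatLip D T) : LipMom D fun t x z => cqf (T t x) z / √t := by
  obtain ⟨C, hC, hT⟩ := hT
  obtain ⟨C', hC', h⟩ := D.exists_integral_cqf_div_sqrt_pow_le 2
  refine ⟨fun t x => ?_, C' * C ^ 4, by positivity, fun t ht x hx => ⟨?_, ?_⟩⟩
  · simpa [div_eq_inv_mul] using (polyGrowth_cqf (T t x)).const_mul (√t)⁻¹
  · refine (h t ht (T t x)).trans ?_
    have := (hT t ht x hx).1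
    gcongr
  · have h1 := h t ht (T t x - T t σ)
    simp only [cqf_sub, sub_div] at h1
    refine h1.trans ?_
    have := (hT t ht x hx).2
    rw [mul_assoc, ← mul_pow]
    gcongr

/-- The increment of a triple product telescopes into three products, each containing one increment,
which is small in `L⁴`. -/
lemma LipMom.unifLip {f g h : ∀ t, Param s → EuclideanSpace ℝ (Fin (D.N t)) → ℝ}
    (hf : LipMom D f) (hg : LipMom D g) (hh : LipMom D h) :
    UnifLip D fun t x => ∫ z, f t x z * g t x z * h t x z ∂D.γ t := by
  obtain ⟨hfp, C₁, hC₁, hf⟩ := hf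
  obtain ⟨hgp, C₂, hC₂, hg⟩ := hg
  obtain ⟨hhp, C₃, hC₃, hh⟩ := hh
  have bound : ∀ t, ∀ {u v w : EuclideanSpace ℝ (Fin (D.N t)) → ℝ} {a b c : ℝ}, PolyGrowth u →
      PolyGrowth v → PolyGrowth w → ∫ z, u z ^ 4 ∂D.γ t ≤ a → ∫ z, v z ^ 4 ∂D.γ t ≤ b →
      ∫ z, w z ^ 4 ∂D.γ t ≤ c → |∫ z, u z * v z * w z ∂D.γ t| ≤ a + b + c + 1 := by
    intro t u v w a b c hu hv hw ha hb hc
    refine (abs_integral_le_integral_abs).trans ?_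
    calc ∫ z, |u z * v z * w z| ∂D.γ t ≤ ∫ z, (u z ^ 4 + v z ^ 4 + w z ^ 4 + 1) ∂D.γ t :=
          integral_mono ((((hu.mul hv).mul hw).abs).integrable _)
            (((((hu.pow 4).add (hv.pow 4)).add (hw.pow 4)).add (.const 1)).integrable _)
            fun z => abs_mul_mul_le _ _ _
      _ ≤ _ := by
          rw [integral_add ((((hu.pow 4).add (hv.pow 4)).add (hw.pow 4)).integrable _)
            (integrable_const _), integral_add (((hu.pow 4).add (hv.pow 4)).integrable _)
            ((hw.pow 4).integrable _), integral_add ((hu.pow 4).integrable _)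
            ((hv.pow 4).integrable _)]
          simp only [integral_const, probReal_univ, one_smul]
          linarith
  -- The small factor is divided by `w₀` before the fourth-power inequality is applied; otherwise
  -- that inequality, not being homogeneous, would lose the linear dependence on `w₀`.
  have dbound : ∀ t, ∀ {u v w : EuclideanSpace ℝ (Fin (D.N t)) → ℝ} {a b c w₀ : ℝ}, 0 < w₀ →
      PolyGrowth u → PolyGrowth v → PolyGrowth w → ∫ z, u z ^ 4 ∂D.γ t ≤ a * w₀ ^ 4 →
      ∫ z, v z ^ 4 ∂D.γ t ≤ b → ∫ z, w z ^ 4 ∂D.γ t ≤ c →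
      |∫ z, u z * v z * w z ∂D.γ t| ≤ (a + b + c + 1) * w₀ := by
    intro t u v w a b c w₀ hw₀ hu hv hw ha hb hc
    have h1 : ∫ z, (w₀⁻¹ * u z) ^ 4 ∂D.γ t ≤ a := by
      simp only [mul_pow]
      rw [integral_const_mul, inv_pow, inv_mul_le_iff₀ (by positivity), mul_comm]
      exact ha
    have h2 := bound t (hu.const_mul w₀⁻¹) hv hw h1 hb hc
    simp only [mul_assoc] at h2 ⊢
    rw [integral_const_mul, abs_mul, abs_of_pos (by positivity), inv_mul_le_iff₀ hw₀] at h2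
    linarith
  refine ⟨3 * (C₁ + C₂ + C₃ + 1), by positivity, fun t ht x hx => ⟨?_, ?_⟩⟩
  · refine (bound t (hfp t x) (hgp t x) (hhp t x) (hf t ht x hx).1 (hg t ht x hx).1
      (hh t ht x hx).1).trans ?_
    linarith
  · rcases eq_or_ne x σ with rfl | hne
    · simp
    have hw₀ : 0 < ‖x - σ‖ := norm_pos_iff.2 (sub_ne_zero.2 hne)
    have e1 := dbound t hw₀ ((hfp t x).sub (hfp t σ)) (hgp t x) (hhp t x) (hf t ht x hx).2
      (hg t ht x hx).1 (hh t ht x hx).1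
    have e2 := dbound t hw₀ ((hgp t x).sub (hgp t σ)) (hfp t σ) (hhp t x) (hg t ht x hx).2
      (hf t ht σ self_mem_ball).1 (hh t ht x hx).1
    have e3 := dbound t hw₀ ((hhp t x).sub (hhp t σ)) (hfp t σ) (hgp t σ) (hh t ht x hx).2
      (hf t ht σ self_mem_ball).1 (hg t ht σ self_mem_ball).1
    have i1 := ((((hfp t x).sub (hfp t σ)).mul (hgp t x)).mul (hhp t x)).integrable (D.γ t)
    have i2 := ((((hgp t x).sub (hgp t σ)).mul (hfp t σ)).mul (hhp t x)).integrable (D.γ t)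
    have i3 := ((((hhp t x).sub (hhp t σ)).mul (hfp t σ)).mul (hgp t σ)).integrable (D.γ t)
    have e : ∫ z, f t x z * g t x z * h t x z ∂D.γ t - ∫ z, f t σ z * g t σ z * h t σ z ∂D.γ t =
        ∫ z, (f t x z - f t σ z) * g t x z * h t x z ∂D.γ t +
        ∫ z, (g t x z - g t σ z) * f t σ z * h t x z ∂D.γ t +
        ∫ z, (h t x z - h t σ z) * f t σ z * g t σ z ∂D.γ t := by
      rw [← integral_add i1 i2, ← integral_add (by exact i1.add i2) i3,
        ← integral_sub ((((hfp t x).mul (hgp t x)).mul (hhp t x)).integrable _)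
          ((((hfp t σ).mul (hgp t σ)).mul (hhp t σ)).integrable _)]
      exact integral_congr_ae (Eventually.of_forall fun z => by ring)
    rw [e]
    refine (abs_add_three _ _ _).trans ?_
    linarith

lemma lipMom_one : LipMom D fun _ _ _ => (1 : ℝ) := .of_unifLip (.const 1)

lemma lipMom_T1 (j : Fin s) : LipMom D fun t x z => cqf (D.T1 t j x) z / √t :=
  .of_matLip (matLip_T1 j)

lemma unifLip_U1 (i l : Fin s) : UnifLip D fun t x => (S t).U1 x i l :=
  ((lipMom_T1 i).unifLip (lipMom_T1 l) lipMom_one).congr fun _ ht _ hx =>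
    (U1_eq ht (mem_interior ht hx) i l).symm

lemma unifLip_U2 (j k l : Fin s) : UnifLip D fun t x => (S t).U2 x j k l :=
  ((LipMom.of_matLip (matLip_T2 j k)).unifLip (lipMom_T1 l) lipMom_one).congr fun _ ht _ hx =>
    (U2_eq ht (mem_interior ht hx) j k l).symm

lemma inv_sqrt_le_one (ht : D.t₀ ≤ t) : |(√(t : ℝ))⁻¹| ≤ 1 := by
  rw [abs_of_nonneg (by positivity)]
  exact inv_le_one_of_one_le₀ (Real.one_le_sqrt.2 (one_le_cast ht))

/-- Divided by `t`, the third derivative is its normalized mean plus `t^{-1/2}` times a normalized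
centred form; the mean does not vanish and has to be carried along. -/
lemma unifLip_U3 (j k l m n : Fin s) : UnifLip D fun t x => (S t).U3 x j k l m n := by
  have h := ((LipMom.of_unifLip (unifLip_mean3 j k m)).add
    ((LipMom.of_matLip (matLip_T3 (D := D) j k m)).scale (a := fun t => (√(t : ℝ))⁻¹)
      fun t ht => inv_sqrt_le_one ht)).unifLip (lipMom_T1 l) (lipMom_T1 n)
  refine h.congr fun t ht x hx => ?_
  rw [U3_eq ht (mem_interior ht hx)]
  refine integral_congr_ae (Eventually.of_forall fun z => ?_)
  simp only
  congr 2
  rw [inv_mul_eq_div, div_div, Real.mul_self_sqrt (by positivity), ← add_div]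

end REMLReduction

end

end EmpiricalPredictor

namespace EmpiricalPredictor

noncomputable section

open scoped ContDiff MatrixOrder

namespace REMLReduction

variable {s : ℕ} {S : ℕ → ScoreModel s} {σ : Param s} {D : REMLReduction S σ}
  {t : ℕ} {x : Param s}

/-! #### Random variables with uniformly bounded moments of all orders -/

/-- Families of functions of the standardized error contrasts whose moments of all orders are
uniformly bounded at the true parameter. -/
def AllMom (D : REMLReduction S σ) (Y : ∀ t, EuclideanSpace ℝ (Fin (D.N t)) → ℝ) : Prop :=
  (∀ t, PolyGrowth (Y t)) ∧ ∀ k : ℕ, ∃ C ≥ 0, ∀ t ≥ D.t₀, ∫ z, Y t z ^ (2 * k) ∂D.γ t ≤ C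

namespace AllMom

variable {Y Z : ∀ t, EuclideanSpace ℝ (Fin (D.N t)) → ℝ}

lemma of_bdd {c : ℕ → ℝ} {C : ℝ} (h : ∀ t ≥ D.t₀, |c t| ≤ C) : AllMom D fun t _ => c t := by
  refine ⟨fun t => .const _, fun k => ⟨C ^ (2 * k), Even.pow_nonneg (by simp) _,
    fun t ht => ?_⟩⟩
  simp only [integral_const, probReal_univ, one_smul]
  rw [← Even.pow_abs (by simp : Even (2 * k))]
  exact pow_le_pow_left₀ (abs_nonneg _) (h t ht) _

lemma const (c : ℝ) : AllMom D fun _ _ => c := of_bdd (c := fun _ => c) fun _ _ => le_rfl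

lemma add (hY : AllMom D Y) (hZ : AllMom D Z) : AllMom D fun t z => Y t z + Z t z := by
  refine ⟨fun t => (hY.1 t).add (hZ.1 t), fun k => ?_⟩
  obtain ⟨C, hC, h⟩ := hY.2 k
  obtain ⟨C', hC', h'⟩ := hZ.2 k
  refine ⟨2 ^ (2 * k - 1) * (C + C'), by positivity, fun t ht => ?_⟩
  calc ∫ z, (Y t z + Z t z) ^ (2 * k) ∂D.γ t
      ≤ ∫ z, 2 ^ (2 * k - 1) * (Y t z ^ (2 * k) + Z t z ^ (2 * k)) ∂D.γ t :=
        integral_mono ((((hY.1 t).add (hZ.1 t)).pow _).integrable _)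
          (((((hY.1 t).pow _).add ((hZ.1 t).pow _)).const_mul _).integrable _)
          fun z => Even.add_pow_le (by simp)
    _ ≤ _ := by
        rw [integral_const_mul, integral_add (((hY.1 t).pow _).integrable _)
          (((hZ.1 t).pow _).integrable _)]
        have := h t ht
        have := h' t ht
        gcongr

lemma mul (hY : AllMom D Y) (hZ : AllMom D Z) : AllMom D fun t z => Y t z * Z t z := by
  refine ⟨fun t => (hY.1 t).mul (hZ.1 t), fun k => ?_⟩
  obtain ⟨C, hC, h⟩ := hY.2 (2 * k)
  obtain ⟨C', hC', h'⟩ := hZ.2 (2 * k)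
  refine ⟨C + C', by positivity, fun t ht => ?_⟩
  calc ∫ z, (Y t z * Z t z) ^ (2 * k) ∂D.γ t
      ≤ ∫ z, (Y t z ^ (2 * (2 * k)) + Z t z ^ (2 * (2 * k))) ∂D.γ t :=
        integral_mono ((((hY.1 t).mul (hZ.1 t)).pow _).integrable _)
          ((((hY.1 t).pow _).add ((hZ.1 t).pow _)).integrable _) fun z => by
            simp only
            have e : ∀ u : ℝ, u ^ (2 * (2 * k)) = (u ^ (2 * k)) ^ 2 := fun u => by
              rw [← pow_mul, mul_comm 2 (2 * k)]
            rw [mul_pow, e, e]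
            nlinarith [sq_nonneg (Y t z ^ (2 * k) - Z t z ^ (2 * k)),
              sq_nonneg (Y t z ^ (2 * k)), sq_nonneg (Z t z ^ (2 * k))]
    _ ≤ _ := by
        rw [integral_add (((hY.1 t).pow _).integrable _) (((hZ.1 t).pow _).integrable _)]
        exact add_le_add (h t ht) (h' t ht)

lemma const_mul (c : ℝ) (hY : AllMom D Y) : AllMom D fun t z => c * Y t z := (const c).mul hY

lemma pow (hY : AllMom D Y) (k : ℕ) : AllMom D fun t z => Y t z ^ k := by
  induction k with
  | zero => simpa using const (D := D) 1
  | succ k ih => simpa only [pow_succ] using ih.mul hY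

lemma abs (hY : AllMom D Y) : AllMom D fun t z => |Y t z| := by
  refine ⟨fun t => (hY.1 t).abs, fun k => ?_⟩
  obtain ⟨C, hC, h⟩ := hY.2 k
  refine ⟨C, hC, fun t ht => ?_⟩
  simp only [Even.pow_abs (by simp : Even (2 * k))]
  exact h t ht

lemma sum {ι : Type*} (u : Finset ι) {Y : ι → ∀ t, EuclideanSpace ℝ (Fin (D.N t)) → ℝ}
    (h : ∀ i ∈ u, AllMom D (Y i)) : AllMom D fun t z => ∑ i ∈ u, Y i t z := by
  classical
  induction u using Finset.induction_on with
  | empty => simpa using const (D := D) 0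
  | insert a u ha ih =>
    simp only [Finset.sum_insert ha]
    exact (h a (by simp)).add (ih fun i hi => h i (by simp [hi]))

lemma cqf_div_sqrt {W : ∀ t, Matrix (Fin (D.N t)) (Fin (D.N t)) ℝ} {C : ℝ}
    (h : ∀ t ≥ D.t₀, ‖W t‖ ≤ C) : AllMom D fun t z => cqf (W t) z / √t := by
  refine ⟨fun t => ?_, fun k => ?_⟩
  · simpa [div_eq_inv_mul] using (polyGrowth_cqf (W t)).const_mul (√t)⁻¹
  · obtain ⟨C', hC', h'⟩ := D.exists_integral_cqf_div_sqrt_pow_le k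
    refine ⟨C' * C ^ (2 * k), mul_nonneg hC' (Even.pow_nonneg (by simp) _), fun t ht => ?_⟩
    refine (h' t ht (W t)).trans ?_
    have := h t ht
    gcongr

/-- The centred form of the identity matrix is `‖z‖² - N`, so `‖z‖²/t` is the bounded number `N/t`
plus a small fluctuation. -/
lemma norm_sq_div (D : REMLReduction S σ) : AllMom D fun t z => ‖z‖ ^ 2 / t := by
  have h1 : AllMom D fun t z => cqf (1 : Matrix (Fin (D.N t)) (Fin (D.N t)) ℝ) z / √t :=
    cqf_div_sqrt fun t _ => norm_one_le
  have h2 : AllMom D fun t _ => (√(t : ℝ))⁻¹ := of_bdd fun t ht => inv_sqrt_le_one ht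
  have h3 : AllMom D fun t _ => (D.N t : ℝ) / t := of_bdd (C := D.κ) fun t ht => by
    have h0 := cast_pos ht
    rw [abs_of_nonneg (by positivity), div_le_iff₀ h0]
    exact D.N_le t ht
  have h4 := (h1.mul h2).add h3
  have h5 : (fun (t : ℕ) (z : EuclideanSpace ℝ (Fin (D.N t))) => ‖z‖ ^ 2 / (t : ℝ)) =
      fun t z => cqf (1 : Matrix (Fin (D.N t)) (Fin (D.N t)) ℝ) z / √t * (√(t : ℝ))⁻¹ +
        (D.N t : ℝ) / t := by
    funext t z
    rw [div_eq_mul_inv (cqf _ _), mul_assoc, ← mul_inv, Real.mul_self_sqrt (by positivity), cqf,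
      qf_one, Matrix.trace_one, Fintype.card_fin]
    ring
  rw [h5]
  exact h4

end AllMom

lemma lintegral_law_self (ht : D.t₀ ≤ t) {f : EuclideanSpace ℝ (Fin (D.N t)) → ℝ≥0∞}
    (hf : Measurable f) : ∫⁻ y, f (D.L t y) ∂(S t).law σ = ∫⁻ z, f z ∂D.γ t := by
  rw [← law_self_map ht, lintegral_map hf (D.L_meas t)]

/-- A real order `g` is dominated by an even integer order through `|u|^g ≤ 1 + u^{2k}` with `k ≥
g`. At `σ` the law of the contrasts is standard Gaussian, which transfers the bound to the data. -/
lemma AllMom.boundedMoment {Y : ∀ t, EuclideanSpace ℝ (Fin (D.N t)) → ℝ} (hY : AllMom D Y) {g : ℝ}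
    (hg : 0 < g) {f : ∀ t, (S t).Y → ℝ≥0∞} (hf : ∀ t ≥ D.t₀, Measurable (f t))
    (h : ∀ t ≥ D.t₀, ∀ y, f t y ≤ ENNReal.ofReal |Y t (D.L t y)|) : BoundedMoment S σ g f := by
  obtain ⟨k, hk⟩ := exists_nat_ge g
  obtain ⟨C, hC, hYk⟩ := hY.2 k
  refine ⟨Real.toNNReal (1 + C), (eventually_ge_atTop D.t₀).mono fun t ht =>
    ⟨(hf t ht).aemeasurable, ?_⟩⟩
  have key : ∀ u : ℝ, |u| ^ g ≤ 1 + u ^ (2 * k) := fun u => by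
    rw [← Even.pow_abs (by simp : Even (2 * k))]
    rcases le_total |u| 1 with h1 | h1
    · have := Real.rpow_le_one (abs_nonneg u) h1 hg.le
      have : 0 ≤ |u| ^ (2 * k) := by positivity
      linarith
    · have h2 : |u| ^ g ≤ |u| ^ ((2 * k : ℕ) : ℝ) := by
        refine Real.rpow_le_rpow_of_exponent_le h1 (hk.trans ?_)
        push_cast; linarith [(Nat.cast_nonneg k : (0:ℝ) ≤ k)]
      rw [Real.rpow_natCast] at h2
      linarith
  have hint : Integrable (fun z => 1 + Y t z ^ (2 * k)) (D.γ t) :=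
    ((PolyGrowth.const 1).add ((hY.1 t).pow _)).integrable _
  have hpos : ∀ z, 0 ≤ 1 + Y t z ^ (2 * k) := fun z => by
    have : 0 ≤ Y t z ^ (2 * k) := Even.pow_nonneg (by simp) _
    linarith
  calc ∫⁻ y, f t y ^ g ∂(S t).law σ
      ≤ ∫⁻ y, ENNReal.ofReal (1 + Y t (D.L t y) ^ (2 * k)) ∂(S t).law σ := by
        refine lintegral_mono fun y => (ENNReal.rpow_le_rpow (h t ht y) hg.le).trans ?_
        rw [ENNReal.ofReal_rpow_of_nonneg (abs_nonneg _) hg.le]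
        exact ENNReal.ofReal_le_ofReal (key _)
    _ = ∫⁻ z, ENNReal.ofReal (1 + Y t z ^ (2 * k)) ∂D.γ t :=
        lintegral_law_self ht (f := fun z => ENNReal.ofReal (1 + Y t z ^ (2 * k)))
          (ENNReal.measurable_ofReal.comp
            (continuous_const.add ((hY.1 t).pow (2 * k)).1).measurable)
    _ = ENNReal.ofReal (∫ z, (1 + Y t z ^ (2 * k)) ∂D.γ t) :=
        (ofReal_integral_eq_lintegral_ofReal hint (Eventually.of_forall hpos)).symm
    _ ≤ (Real.toNNReal (1 + C) : ℝ≥0∞) := by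
        rw [← ENNReal.ofReal.eq_1]
        refine ENNReal.ofReal_le_ofReal ?_
        rw [integral_add (integrable_const _) (((hY.1 t).pow _).integrable _)]
        simp only [integral_const, probReal_univ, one_smul]
        have := hYk t ht
        linarith

/-- Markov's inequality for families with bounded moments. -/
lemma AllMom.exists_measure_le {Y : ∀ t, EuclideanSpace ℝ (Fin (D.N t)) → ℝ} (hY : AllMom D Y)
    {ε : ℝ} (hε : 0 < ε) (a : ℕ → ℝ) (ha : ∀ t ≥ D.t₀, 0 ≤ a t) (k : ℕ) : ∃ C ≥ 0, ∀ t ≥ D.t₀,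
    (S t).law σ {y | ε < a t * |Y t (D.L t y)|} ≤ ENNReal.ofReal (C * a t ^ (2 * k)) := by
  obtain ⟨C, hC, h⟩ := hY.2 k
  refine ⟨C / ε ^ (2 * k), by positivity, fun t ht => ?_⟩
  have hm : Measurable (Y t) := (hY.1 t).1.measurable
  have h1 : (S t).law σ {y | ε < a t * |Y t (D.L t y)|} = D.γ t {z | ε < a t * |Y t z|} := by
    rw [← law_self_map ht, Measure.map_apply (D.L_meas t)]
    · rfl
    · exact measurableSet_lt measurable_const (hm.abs.const_mul _)
  rw [h1]
  have hint : Integrable (fun z => (a t * Y t z) ^ (2 * k)) (D.γ t) :=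
    (((hY.1 t).const_mul (a t)).pow _).integrable _
  have h2 := mul_meas_ge_le_integral_of_nonneg (μ := D.γ t)
    (f := fun z => (a t * Y t z) ^ (2 * k))
    (Eventually.of_forall fun z => Even.pow_nonneg (by simp) _) hint (ε ^ (2 * k))
  have h3 : {z | ε < a t * |Y t z|} ⊆ {z | ε ^ (2 * k) ≤ (a t * Y t z) ^ (2 * k)} := fun z hz => by
    have hz : ε < a t * |Y t z| := hz
    rw [Set.mem_ofPred_eq, ← Even.pow_abs (by simp : Even (2 * k)) (a t * Y t z), abs_mul, abs_of_nonneg (ha t ht)]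
    exact pow_le_pow_left₀ hε.le hz.le _
  refine (measure_mono h3).trans ?_
  rw [← ENNReal.ofReal_toReal (measure_ne_top (D.γ t) _)]
  refine ENNReal.ofReal_le_ofReal ?_
  rw [div_mul_eq_mul_div, le_div_iff₀ (by positivity), mul_comm]
  refine h2.trans ?_
  simp only [mul_pow]
  rw [integral_const_mul, mul_comm C]
  have h4 := ha t ht
  exact mul_le_mul_of_nonneg_left (h t ht) (by positivity)

/-! #### The derivatives of the criterion function at the true parameter -/

lemma cov_self (t : ℕ) : D.cov t σ = 1 := redCov_self _ _

lemma score_self (ht : D.t₀ ≤ t) (y : (S t).Y) (j : Fin s) :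
    (S t).score σ y j = cqf (redForm (D.K t) σ j σ) (D.L t y) := by
  have h := mean_score_form ht (self_mem_interior (D := D) ht) j
  rw [cov_self, mul_one] at h
  rw [score_eq ht (self_mem_interior ht), cqf]
  linarith

lemma F_sub_A_self (ht : D.t₀ ≤ t) (y : (S t).Y) (i j : Fin s) :
    (S t).F σ y i j - (S t).A σ i j =
      cqf (vpd i (redForm (D.K t) σ j) σ) (D.L t y) := by
  have h := mean_hess_form ht (self_mem_interior (D := D) ht) i j
  rw [cov_self, mul_one] at h
  rw [F_eq ht (self_mem_interior ht), A_eq ht (self_mem_interior ht), cqf]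
  linarith

lemma H_self (ht : D.t₀ ≤ t) (y : (S t).Y) (i j k : Fin s) :
    (S t).H σ y i j k = D.mean3 t i j k σ +
      cqf (vpd i (vpd j (redForm (D.K t) σ k)) σ) (D.L t y) := by
  rw [H_eq ht (self_mem_interior ht), cqf, mean3, cov_self, mul_one]
  ring

/-- The normalized score `t^{-1/2} ∂l/∂σ_j` at the true parameter. -/
def α (D : REMLReduction S σ) (j : Fin s) (t : ℕ) (z : EuclideanSpace ℝ (Fin (D.N t))) : ℝ :=
  cqf (redForm (D.K t) σ j σ) z / √t

/-- The normalized centred second derivative at the true parameter. -/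
def Φ (D : REMLReduction S σ) (i j : Fin s) (t : ℕ) (z : EuclideanSpace ℝ (Fin (D.N t))) : ℝ :=
  cqf (vpd i (redForm (D.K t) σ j) σ) z / √t

/-- The normalized centred third derivative at the true parameter. -/
def χ (D : REMLReduction S σ) (i j k : Fin s) (t : ℕ) (z : EuclideanSpace ℝ (Fin (D.N t))) : ℝ :=
  cqf (vpd i (vpd j (redForm (D.K t) σ k)) σ) z / √t

lemma allMom_α (j : Fin s) : AllMom D (D.α j) := by
  obtain ⟨C, hC, h⟩ := D.exists_bddDeriv 0
  exact .cqf_div_sqrt fun t ht => ((h t ht).2 j).1.norm_le self_mem_ball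

lemma allMom_Φ (i j : Fin s) : AllMom D (D.Φ i j) := by
  obtain ⟨C, hC, h⟩ := D.exists_bddDeriv 1
  exact .cqf_div_sqrt fun t ht => (((h t ht).2 j).1.vpd i).norm_le self_mem_ball

lemma allMom_χ (i j k : Fin s) : AllMom D (D.χ i j k) := by
  obtain ⟨C, hC, h⟩ := D.exists_bddDeriv 2
  exact .cqf_div_sqrt fun t ht => ((((h t ht).2 k).1.vpd j).vpd i).norm_le self_mem_ball

lemma sqrt_pos (ht : D.t₀ ≤ t) : 0 < √(t : ℝ) := Real.sqrt_pos.2 (cast_pos ht)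

lemma score_self_eq (ht : D.t₀ ≤ t) (y : (S t).Y) (j : Fin s) :
    (S t).score σ y j = √t * D.α j t (D.L t y) := by
  rw [score_self ht, α, mul_div_cancel₀ _ (sqrt_pos ht).ne']

lemma F_self_eq (ht : D.t₀ ≤ t) (y : (S t).Y) (i j : Fin s) :
    (S t).F σ y i j = (S t).A σ i j + √t * D.Φ i j t (D.L t y) := by
  have := F_sub_A_self ht y i j
  rw [Φ, mul_div_cancel₀ _ (sqrt_pos ht).ne']
  linarith

lemma H_self_eq (ht : D.t₀ ≤ t) (y : (S t).Y) (i j k : Fin s) :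
    (S t).H σ y i j k = D.mean3 t i j k σ + √t * D.χ i j k t (D.L t y) := by
  rw [H_self ht, χ, mul_div_cancel₀ _ (sqrt_pos ht).ne']

/-- `1 + |w|² / t`, which dominates the normalized higher derivatives of the criterion function. -/
def dom (D : REMLReduction S σ) (t : ℕ) (z : EuclideanSpace ℝ (Fin (D.N t))) : ℝ :=
  1 + ‖z‖ ^ 2 / t

lemma allMom_dom : AllMom D D.dom := (AllMom.const 1).add (.norm_sq_div D)

lemma one_le_dom (z : EuclideanSpace ℝ (Fin (D.N t))) : 1 ≤ D.dom t z := by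
  have : 0 ≤ ‖z‖ ^ 2 / t := by positivity
  rw [dom]; linarith

/-- The criterion function has derivatives of every order bounded by a multiple of
`t (1 + |L y|² / t)` near the true parameter. -/
lemma exists_bddDeriv_score (D : REMLReduction S σ) (k : ℕ) : ∃ C ≥ 0, ∀ t ≥ D.t₀, ∀ y j,
    BddDeriv (Metric.ball σ D.r) k (fun x => (S t).score x y j) (C * t * D.dom t (D.L t y)) := by
  obtain ⟨C, hC, h⟩ := D.exists_bddDeriv k
  refine ⟨C, hC, fun t ht y j => ?_⟩
  have hU : IsOpen (Metric.ball σ D.r) := Metric.isOpen_ball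
  have h1 := ((h t ht).2 j).2.add hU (((h t ht).2 j).1.qf hU (D.L t y))
  refine (h1.congr hU fun x hx => (score_eq ht (mem_interior ht hx) y j).symm).mono
    (le_of_eq ?_)
  have h0 := cast_pos ht
  rw [dom]
  field_simp

lemma exists_abs_H_le (D : REMLReduction S σ) : ∃ C ≥ 0, ∀ t ≥ D.t₀, ∀ y,
    ∀ x ∈ Metric.ball σ D.r, ∀ i j k, |(S t).H x y i j k| ≤ C * t * D.dom t (D.L t y) := by
  obtain ⟨C, hC, h⟩ := D.exists_bddDeriv_score 2
  exact ⟨C, hC, fun t ht y x hx i j k => (((h t ht y k).vpd j).vpd i).norm_le hx⟩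

lemma exists_abs_deriv4_le (D : REMLReduction S σ) : ∃ C ≥ 0, ∀ t ≥ D.t₀, ∀ y,
    ∀ x ∈ Metric.ball σ D.r, ∀ i j k l,
      |deriv4 (fun x => (S t).l x y) x i j k l| ≤ C * t * D.dom t (D.L t y) := by
  obtain ⟨C, hC, h⟩ := D.exists_bddDeriv_score 3
  exact ⟨C, hC, fun t ht y x hx i j k l => ((((h t ht y l).vpd k).vpd j).vpd i).norm_le hx⟩

lemma measurable_score_self (ht : D.t₀ ≤ t) (j : Fin s) :
    Measurable fun y => (S t).score σ y j := by
  simp only [score_self ht]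
  exact (continuous_cqf _).measurable.comp (D.L_meas t)

/-- The supremum runs over an uncountable set, but each function is continuous in the Gaussian
vector, so the supremum is lower semicontinuous. -/
lemma measurable_iSup_add_qf {Ω : Type*} [MeasurableSpace Ω] {N : ℕ}
    {f : Ω → EuclideanSpace ℝ (Fin N)} (hf : Measurable f) (B : Set (Param s)) (c : Param s → ℝ)
    (W : Param s → Matrix (Fin N) (Fin N) ℝ) :
    Measurable fun y => ⨆ x ∈ B, ‖c x + qf (W x) (f y)‖ₑ := by
  have h : LowerSemicontinuous fun w => ⨆ x ∈ B, ‖c x + qf (W x) w‖ₑ :=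
    lowerSemicontinuous_biSup fun x _ =>
      (continuous_enorm.comp (continuous_const.add (continuous_qf (W x)))).lowerSemicontinuous
  exact h.measurable.comp hf

end REMLReduction

end

end EmpiricalPredictor

/-! ### Verification of the moment and equicontinuity conditions -/

namespace EmpiricalPredictor

noncomputable section

open scoped ContDiff MatrixOrder

namespace REMLReduction

variable {s : ℕ} {S : ℕ → ScoreModel s} {σ : Param s} {D : REMLReduction S σ}
  {t : ℕ} {x : Param s}

/-- Families of functions of the parameter which are `C³` on the parameter space and have uniformly
bounded derivatives up to order three near `σ`. -/
def EtaBdd (D : REMLReduction S σ) (η : ℕ → Param s → ℝ) : Prop :=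
  ∃ C ≥ 0, ∀ t ≥ D.t₀, ContDiffOn ℝ 3 (η t) (interior (S t).Θ) ∧
    BddDeriv (Metric.ball σ D.r) 3 (η t) C

lemma UnifLip.exists_common {ι : Type*} [Fintype ι] {f : ι → ℕ → Param s → ℝ}
    (h : ∀ i, UnifLip D (f i)) : ∃ C ≥ 0, ∀ t ≥ D.t₀, ∀ x ∈ Metric.ball σ D.r, ∀ i,
      |f i t x| ≤ C ∧ |f i t x - f i t σ| ≤ C * ‖x - σ‖ := by
  choose C hC h using h
  refine ⟨∑ i, C i, Finset.sum_nonneg fun i _ => hC i, fun t ht x hx i => ?_⟩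
  have h1 : C i ≤ ∑ i, C i := Finset.single_le_sum (fun i _ => hC i) (Finset.mem_univ i)
  exact ⟨(h i t ht x hx).1.trans h1,
    (h i t ht x hx).2.trans (mul_le_mul_of_nonneg_right h1 (norm_nonneg _))⟩

lemma norm_sub_le_of_entries {M₁ M₂ : Matrix (Fin s) (Fin s) ℝ} {a : ℝ}
    (h : ∀ i j, |M₁ i j - M₂ i j| ≤ a) : ‖M₁ - M₂‖ ≤ s * (s * a) := by
  refine (norm_le_sum_abs _).trans ?_
  calc ∑ i, ∑ j, |(M₁ - M₂) i j| ≤ ∑ _i : Fin s, ∑ _j : Fin s, a :=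
        Finset.sum_le_sum fun i _ => Finset.sum_le_sum fun j _ => h i j
    _ = _ := by simp

lemma enorm_le_ofReal_abs {a b : ℝ} (h : |a| ≤ |b|) : ‖a‖ₑ ≤ ENNReal.ofReal |b| := by
  rw [← ofReal_norm, Real.norm_eq_abs]
  exact ENNReal.ofReal_le_ofReal h

lemma ofReal_mul_iSup_le {B : Set (Param s)} {f : Param s → ℝ} {a b C : ℝ} (ha : 0 ≤ a)
    (h : ∀ x ∈ B, |f x| ≤ b) (hb : a * b ≤ C) :
    ENNReal.ofReal a * ⨆ x ∈ B, ‖f x‖ₑ ≤ ENNReal.ofReal |C| := by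
  have h1 : ⨆ x ∈ B, ‖f x‖ₑ ≤ ENNReal.ofReal b := iSup₂_le fun x hx => by
    rw [← ofReal_norm, Real.norm_eq_abs]
    exact ENNReal.ofReal_le_ofReal (h x hx)
  refine (mul_le_mul_right h1 _).trans ?_
  rw [← ENNReal.ofReal_mul ha]
  exact ENNReal.ofReal_le_ofReal (hb.trans (le_abs_self _))

lemma dom_nonneg (z : EuclideanSpace ℝ (Fin (D.N t))) : 0 ≤ D.dom t z :=
  zero_le_one.trans (one_le_dom z)

lemma H_sub_integral_self (ht : D.t₀ ≤ t) (y : (S t).Y) (i j k : Fin s) :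
    (S t).H σ y i j k - ∫ y', (S t).H σ y' i j k ∂(S t).law σ =
      cqf (vpd i (vpd j (redForm (D.K t) σ k)) σ) (D.L t y) := by
  rw [integral_H ht (self_mem_interior ht), H_self ht]
  ring

lemma boundedMoment_centred_third (D : REMLReduction S σ) {g : ℝ} (hg : 0 < g) (i j k : Fin s) :
    BoundedMoment S σ g fun t y =>
      ‖((S t).H σ y i j k - ∫ y', (S t).H σ y' i j k ∂(S t).law σ) / √((S t).d j * (S t).d k)‖ₑ := by
  refine (allMom_χ (D := D) i j k).boundedMoment hg (fun t ht => ?_) fun t ht y => ?_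
  · have e := fun y => H_sub_integral_self ht y i j k
    simp only [e]
    exact (((continuous_cqf _).measurable.comp (D.L_meas t)).div_const _).enorm
  · rw [H_sub_integral_self ht y i j k, D.d_eq, D.d_eq, Real.sqrt_mul_self (Real.sqrt_nonneg _)]
    exact enorm_le_ofReal_abs le_rfl

lemma boundedMoment_third (D : REMLReduction S σ) {g : ℝ} (hg : 0 < g) (i j k : Fin s) :
    BoundedMoment S σ g fun t y => ‖(S t).H σ y i j k / ((S t).d j * (S t).d k)‖ₑ := by
  obtain ⟨C, hC, h⟩ := D.exists_abs_H_le
  refine ((allMom_dom (D := D)).const_mul C).boundedMoment hg (fun t ht => ?_) fun t ht y => ?_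
  · simp only [H_self ht]
    exact ((measurable_const.add
      ((continuous_cqf _).measurable.comp (D.L_meas t))).div_const _).enorm
  · have h0 := cast_pos ht
    have h1 := h t ht y σ self_mem_ball i j k
    have h2 := dom_nonneg (D.L t y)
    rw [D.d_eq, D.d_eq, Real.mul_self_sqrt h0.le]
    refine enorm_le_ofReal_abs ?_
    rw [abs_div, abs_of_pos h0, div_le_iff₀ h0, abs_of_nonneg (mul_nonneg hC h2)]
    linarith

variable [NeZero s]

/-- Needs at least one coordinate: over an empty index set the real infimum takes the default value
`0`. -/
lemma dStar_eq (D : REMLReduction S σ) (t : ℕ) : (S t).dStar = √(t : ℝ) := by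
  rw [ScoreModel.dStar]
  simp only [D.d_eq, ciInf_const]

lemma mem_box_iff (ht : D.t₀ ≤ t) {δ : ℝ} :
    x ∈ (S t).box σ δ ↔ ∀ i, |x i - σ i| ≤ δ := by
  rw [ScoreModel.box, Set.mem_ofPred_eq]
  simp only [dStar_eq D, D.d_eq, mul_div_cancel_right₀ _ (sqrt_pos ht).ne']

lemma norm_sub_le_of_mem_box (ht : D.t₀ ≤ t) {δ : ℝ} (hx : x ∈ (S t).box σ δ) :
    ‖x - σ‖ ≤ s * δ := by
  have h := norm_toLp_le_sum_abs (x - σ : Param s).ofLp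
  rw [WithLp.toLp_ofLp] at h
  refine h.trans ?_
  calc ∑ i, |(x - σ) i| ≤ ∑ _i : Fin s, δ :=
        Finset.sum_le_sum fun i _ => (mem_box_iff ht).1 hx i
    _ = _ := by simp

variable (D) in
/-- The half-width of a box contained in the ball of radius `D.r`. -/
def δ₀ : ℝ := D.r / (2 * s)

lemma card_pos : (0 : ℝ) < s := by exact_mod_cast Nat.pos_of_ne_zero (NeZero.ne s)

lemma δ₀_pos : 0 < D.δ₀ := div_pos D.r_pos (mul_pos two_pos card_pos)

lemma box_subset_ball (ht : D.t₀ ≤ t) {δ : ℝ} (hδ : δ ≤ D.δ₀) :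
    (S t).box σ δ ⊆ Metric.ball σ D.r := fun x hx => by
  have h := norm_sub_le_of_mem_box ht hx
  have hs := card_pos (s := s)
  have h2 : s * δ ≤ D.r / 2 := by
    refine (mul_le_mul_of_nonneg_left hδ hs.le).trans (le_of_eq ?_)
    rw [δ₀]; field_simp
  rw [Metric.mem_ball, dist_eq_norm]
  linarith [D.r_pos]

/-- Equicontinuity on shrinking boxes from a uniform Lipschitz bound. -/
lemma exists_box_of_lipschitz (D : REMLReduction S σ) {P : ℕ → Param s → ℝ → Prop} {C : ℝ}
    (hC : 0 ≤ C) (hP : ∀ t x a b, a ≤ b → P t x a → P t x b)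
    (h : ∀ t ≥ D.t₀, ∀ x ∈ Metric.ball σ D.r, P t x (C * ‖x - σ‖)) :
    ∃ N, ∀ ε > 0, ∃ δ' > 0, ∀ t ≥ N, ∀ x ∈ (S t).box σ δ', P t x ε := by
  have hs := card_pos (s := s)
  -- A point of the box is within `s δ'` of `σ`, so `δ' ≤ ε / (C s)` would do; the `+ 1` covers `C =
  -- 0`, and the minimum keeps the box inside the ball.
  refine ⟨D.t₀, fun ε hε => ⟨min D.δ₀ (ε / (C * s + 1)), lt_min δ₀_pos (by positivity),
    fun t ht x hx => hP t x _ _ ?_ (h t ht x (box_subset_ball ht (min_le_left _ _) hx))⟩⟩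
  calc C * ‖x - σ‖ ≤ C * (s * (ε / (C * s + 1))) := by
        refine mul_le_mul_of_nonneg_left ((norm_sub_le_of_mem_box ht hx).trans ?_) hC
        exact mul_le_mul_of_nonneg_left (min_le_right _ _) hs.le
    _ = ε * (C * s / (C * s + 1)) := by ring
    _ ≤ ε * 1 := by
        refine mul_le_mul_of_nonneg_left ?_ hε.le
        rw [div_le_one (by positivity)]; linarith
    _ = ε := mul_one ε

lemma equicontinuity (D : REMLReduction S σ) :
    ∃ N, ∀ ε > 0, ∃ δ' > 0, ∀ t ≥ N, ∀ x ∈ (S t).box σ δ',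
      ‖(S t).Q x - (S t).Q σ‖ ≤ ε ∧ ‖(S t).U1 x - (S t).U1 σ‖ ≤ ε ∧
      (∀ j k l, |(S t).U2 x j k l - (S t).U2 σ j k l| ≤ ε) ∧
      (∀ j k l m n, |(S t).U3 x j k l m n - (S t).U3 σ j k l m n| ≤ ε) := by
  obtain ⟨C₁, hC₁, h₁⟩ := UnifLip.exists_common (D := D)
    (f := fun (p : Fin s × Fin s) t x => ((t : ℝ)⁻¹ • D.info₂ t x) p.1 p.2)
    fun p => unifLip_info₂ p.1 p.2
  obtain ⟨C₂, hC₂, h₂⟩ := UnifLip.exists_common (D := D)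
    (f := fun (p : Fin s × Fin s) t x => (S t).U1 x p.1 p.2) fun p => unifLip_U1 p.1 p.2
  obtain ⟨C₃, hC₃, h₃⟩ := UnifLip.exists_common (D := D)
    (f := fun (p : Fin s × Fin s × Fin s) t x => (S t).U2 x p.1 p.2.1 p.2.2)
    fun p => unifLip_U2 p.1 p.2.1 p.2.2
  obtain ⟨C₄, hC₄, h₄⟩ := UnifLip.exists_common (D := D)
    (f := fun (p : Fin s × Fin s × Fin s × Fin s × Fin s) t x =>
      (S t).U3 x p.1 p.2.1 p.2.2.1 p.2.2.2.1 p.2.2.2.2)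
    fun p => unifLip_U3 _ _ _ _ _
  refine D.exists_box_of_lipschitz (C := s * (s * C₁) + s * (s * C₂) + C₃ + C₄)
    (P := fun t x ε => ‖(S t).Q x - (S t).Q σ‖ ≤ ε ∧ ‖(S t).U1 x - (S t).U1 σ‖ ≤ ε ∧
      (∀ j k l, |(S t).U2 x j k l - (S t).U2 σ j k l| ≤ ε) ∧
      (∀ j k l m n, |(S t).U3 x j k l m n - (S t).U3 σ j k l m n| ≤ ε)) (by positivity)
    (fun t x a b hab h => ⟨h.1.trans hab, h.2.1.trans hab, fun j k l => (h.2.2.1 j k l).trans hab,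
      fun j k l m n => (h.2.2.2 j k l m n).trans hab⟩) fun t ht x hx => ?_
  have hn := norm_nonneg (x - σ)
  have n₁ : 0 ≤ s * (s * C₁) * ‖x - σ‖ := by positivity
  have n₂ : 0 ≤ s * (s * C₂) * ‖x - σ‖ := by positivity
  have n₃ : 0 ≤ C₃ * ‖x - σ‖ := by positivity
  have n₄ : 0 ≤ C₄ * ‖x - σ‖ := by positivity
  refine ⟨?_, ?_, fun j k l => ?_, fun j k l m n => ?_⟩
  · rw [Q_eq ht (mem_interior ht hx), Q_eq ht (self_mem_interior ht)]
    refine (norm_sub_le_of_entries fun i j => (h₁ t ht x hx (i, j)).2).trans ?_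
    linarith
  · refine (norm_sub_le_of_entries fun i j => (h₂ t ht x hx (i, j)).2).trans ?_
    linarith
  · exact ((h₃ t ht x hx (j, k, l)).2).trans (by linarith)
  · exact ((h₄ t ht x hx (j, k, l, m, n)).2).trans (by linarith)

/-- The norm bound on `A/t` keeps the largest eigenvalue away from `-∞`, and the lower bound `c/18`
on the information keeps it below a negative constant. -/
lemma limsup_lambdaMax (D : REMLReduction S σ) :
    ⊥ < limsup (fun t => ((lambdaMax ((S t).Q σ) : ℝ) : EReal)) atTop ∧
    limsup (fun t => ((lambdaMax ((S t).Q σ) : ℝ) : EReal)) atTop < 0 := by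
  obtain ⟨C, hC, h⟩ := D.exists_bddDeriv_info₂ 0
  have hsym : ∀ t : ℕ, ((t : ℝ)⁻¹ • D.info₂ t σ).IsHermitian := fun t => by
    have := info₂_symm (D := D) t σ
    rw [Matrix.IsHermitian, Matrix.conjTranspose_eq_transpose_of_trivial, Matrix.transpose_smul,
      this]
  constructor
  · have h1 : ∀ᶠ t : ℕ in atTop, ((-C : ℝ) : EReal) ≤ (lambdaMax ((S t).Q σ) : ℝ) :=
      (eventually_ge_atTop D.t₀).mono fun t ht => by
        rw [EReal.coe_le_coe_iff, Q_eq ht (self_mem_interior ht)]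
        have h1 := neg_norm_le_lambdaMax (hsym t)
        have h2 := (h t ht).norm_le self_mem_ball
        linarith
    exact (EReal.bot_lt_coe (-C)).trans_le (le_limsup_of_frequently_le h1.frequently)
  · have h1 : ∀ᶠ t : ℕ in atTop, ((lambdaMax ((S t).Q σ) : ℝ) : EReal) ≤ ((-(D.c / 18) : ℝ) : EReal) :=
      (eventually_ge_atTop D.t₀).mono fun t ht => by
        rw [EReal.coe_le_coe_iff, Q_eq ht (self_mem_interior ht)]
        refine lambdaMax_le (hsym t) fun v => ?_
        have h2 := info₂_lower_ball ht (self_mem_ball (D := D)) v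
        rw [Matrix.neg_mulVec, dotProduct_neg] at h2
        linarith
    refine (limsup_le_of_le (by isBoundedDefault) h1).trans_lt ?_
    have hc := D.c_pos
    exact_mod_cast (by linarith : -(D.c / 18) < 0)

lemma iSup_congr_box (ht : D.t₀ ≤ t) {f g : Param s → (S t).Y → ℝ}
    (h : ∀ x ∈ Metric.ball σ D.r, ∀ y, f x y = g x y) (y : (S t).Y) :
    ⨆ x ∈ (S t).box σ D.δ₀, ‖f x y‖ₑ = ⨆ x ∈ (S t).box σ D.δ₀, ‖g x y‖ₑ :=
  iSup_congr fun x => iSup_congr fun hx => by rw [h x (box_subset_ball ht le_rfl hx)]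

lemma representationConditions (D : REMLReduction S σ) {g : ℝ} (hg : 0 < g) :
    RepresentationConditions S σ g D.δ₀ where
  g_pos := hg
  δ_pos := δ₀_pos
  smooth := (eventually_ge_atTop D.t₀).mono fun t ht y =>
    (contDiffOn_l ht y).of_le (by norm_cast)
  true_interior := (eventually_ge_atTop D.t₀).mono fun t ht => self_mem_interior ht
  box_subset := (eventually_ge_atTop D.t₀).mono fun t ht =>
    (box_subset_ball ht le_rfl).trans (D.ball_subset t ht)
  expectations := (eventually_ge_atTop D.t₀).mono fun t ht =>
    expectationsExist ht (self_mem_interior ht)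
  d_pos := (eventually_ge_atTop D.t₀).mono fun t ht i => by
    rw [D.d_eq]; exact sqrt_pos ht
  d_tendsto := by
    simp only [dStar_eq D]
    exact Real.tendsto_sqrt_atTop.comp tendsto_natCast_atTop_atTop
  limsup_gt := D.limsup_lambdaMax.1
  limsup_lt := D.limsup_lambdaMax.2
  moment_score i := by
    refine (allMom_α (D := D) i).boundedMoment hg (fun t ht => ?_) fun t ht y => ?_
    · simp only [D.d_eq]
      exact ((measurable_score_self ht i).div_const _).enorm
    · simp only [D.d_eq, score_self ht]
      exact enorm_le_ofReal_abs le_rfl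
  moment_hess i j := by
    refine (allMom_Φ (D := D) i j).boundedMoment hg (fun t ht => ?_) fun t ht y => ?_
    · simp only [F_sub_A_self ht]
      exact (((continuous_cqf _).measurable.comp (D.L_meas t)).div_const _).enorm
    · simp only [D.d_eq, F_sub_A_self ht, Real.sqrt_mul_self (Real.sqrt_nonneg _)]
      exact enorm_le_ofReal_abs le_rfl
  moment_third i j k := by
    obtain ⟨C, hC, h⟩ := D.exists_abs_H_le
    refine ((allMom_dom (D := D)).const_mul C).boundedMoment hg (fun t ht => ?_) fun t ht y => ?_
    · refine Measurable.const_mul ?_ _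
      have e := fun y => iSup_congr_box ht (f := fun x y => (S t).H x y i j k)
        (fun x hx y => H_eq ht (mem_interior ht hx) y i j k) y
      simp only [e]
      exact measurable_iSup_add_qf (D.L_meas t) _ _ _
    · have h0 := cast_pos ht
      have h1 := sqrt_pos ht
      have h2 := dom_nonneg (D.L t y)
      simp only [D.d_eq, dStar_eq D]
      refine ofReal_mul_iSup_le (by positivity)
        (fun x hx => h t ht y x (box_subset_ball ht le_rfl hx) i j k) (le_of_eq ?_)
      have h3 : √(t : ℝ) * √t = t := Real.mul_self_sqrt h0.le
      rw [h3]
      field_simp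

lemma boundedMoment_fourth (D : REMLReduction S σ) {g : ℝ} (hg : 0 < g) (i j k l : Fin s) :
    BoundedMoment S σ g fun t y =>
      ENNReal.ofReal ((S t).dStar ^ 2 / ((S t).d i * (S t).d j * (S t).d k * (S t).d l)) *
        ⨆ x ∈ (S t).box σ D.δ₀, ‖deriv4 (fun x' => (S t).l x' y) x i j k l‖ₑ := by
  obtain ⟨C, hC, h⟩ := D.exists_abs_deriv4_le
  refine ((allMom_dom (D := D)).const_mul C).boundedMoment hg (fun t ht => ?_) fun t ht y => ?_
  · refine Measurable.const_mul ?_ _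
    have e := fun y => iSup_congr_box ht
      (f := fun x y => deriv4 (fun x => (S t).l x y) x i j k l)
      (fun x hx y => deriv4_eq ht (mem_interior ht hx) y i j k l) y
    simp only [e]
    exact measurable_iSup_add_qf (D.L_meas t) _ _ _
  · have h0 := cast_pos ht
    have h1 := sqrt_pos ht
    have h2 := dom_nonneg (D.L t y)
    simp only [D.d_eq, dStar_eq D]
    refine ofReal_mul_iSup_le (by positivity)
      (fun x hx => h t ht y x (box_subset_ball ht le_rfl hx) i j k l) (le_of_eq ?_)
    have h3 : √(t : ℝ) * √t = t := Real.mul_self_sqrt h0.le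
    rw [mul_assoc (√(t : ℝ) * √t), h3, Real.sq_sqrt h0.le]
    field_simp

/-- Moments of every order are available, so `g` is free. The conditions on `E(a)` are trivial
because it vanishes on the ball. -/
lemma mseConditions (D : REMLReduction S σ) {η : ℕ → Param s → ℝ} (hη : EtaBdd D η) {g lam : ℝ}
    (hlam : 0 < lam) (hg : 8 + 4 * lam < g) : MSEConditions S η σ g lam := by
  have hg0 : 0 < g := by linarith
  refine ⟨D.δ₀, δ₀_pos, ?_, ⟨D.representationConditions hg0, hg, ?_⟩, ⟨D.boundedMoment_centred_third hg0,
    D.boundedMoment_third hg0, D.boundedMoment_fourth hg0⟩, ⟨?_, D.equicontinuity⟩, ?_⟩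
  · obtain ⟨C, hC, hη⟩ := hη
    refine ⟨(eventually_ge_atTop D.t₀).mono fun t ht => (hη t ht).1, C + s * C + s * (s * C),
      (eventually_ge_atTop D.t₀).mono fun t ht => ?_⟩
    have hB := (hη t ht).2
    have n₁ : 0 ≤ s * C := by positivity
    have n₂ : 0 ≤ s * (s * C) := by positivity
    refine ⟨(hB.norm_le self_mem_ball).trans (by linarith), ?_, ?_, fun x hx i j k => ?_⟩
    · refine (norm_toLp_le_sum_abs _).trans ?_
      calc ∑ i, |grad (η t) σ i| ≤ ∑ _i : Fin s, C :=
            Finset.sum_le_sum fun i _ => (hB.vpd i).norm_le self_mem_ball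
        _ ≤ _ := by simp; linarith
    · refine (norm_le_sum_abs _).trans ?_
      calc ∑ i, ∑ j, |hessian (η t) σ i j| ≤ ∑ _i : Fin s, ∑ _j : Fin s, C :=
            Finset.sum_le_sum fun i _ => Finset.sum_le_sum fun j _ =>
              ((hB.vpd j).vpd i).norm_le self_mem_ball
        _ ≤ _ := by simp; linarith
    · exact ((((hB.vpd k).vpd j).vpd i).norm_le (box_subset_ball ht le_rfl hx)).trans (by linarith)
  · exact (eventually_ge_atTop D.t₀).mono fun t ht y =>
      (contDiffOn_l ht y).of_le (by norm_cast)
  · exact (eventually_ge_atTop D.t₀).mono fun t ht x hx =>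
      expectationsExist ht (mem_interior ht (box_subset_ball ht le_rfl hx))
  · refine ⟨⟨0, (eventually_ge_atTop D.t₀).mono fun t ht => ?_⟩, ?_⟩
    · rw [meanScore_eq ht (self_mem_interior ht)]; simp
    · refine D.exists_box_of_lipschitz (C := 0)
        (P := fun t x ε => ‖WithLp.toLp 2 ((S t).meanScore x - (S t).meanScore σ)‖ ≤ ε) le_rfl
        (fun t x a b hab h => h.trans hab) fun t ht x hx => ?_
      rw [meanScore_eq ht (self_mem_interior ht), meanScore_eq ht (mem_interior ht hx)]
      simp

end REMLReduction

end

end EmpiricalPredictor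

namespace EmpiricalPredictor

noncomputable section

open scoped ContDiff MatrixOrder

/-- A limit of measurable functions is measurable, also with the conventional value of `limUnder`
where the sequence diverges. This replaces a measurable selection among the roots. -/
lemma measurable_limUnder_iterate {Ω : Type*} [MeasurableSpace Ω] {s : ℕ}
    {f : Ω → Param s → Param s} (hf : Measurable fun p : Ω × Param s => f p.1 p.2) (a : Param s) :
    Measurable fun w => limUnder atTop fun n => (f w)^[n] a := by
  have hn : ∀ n, Measurable fun w => (f w)^[n] a := fun n => by
    induction n with
    | zero => exact measurable_const
    | succ n ih =>
      simp only [Function.iterate_succ_apply']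
      exact hf.comp (measurable_id.prodMk ih)
  exact (StronglyMeasurable.limUnder fun n => (hn n).stronglyMeasurable).measurable

namespace REMLReduction

variable {s : ℕ} {S : ℕ → ScoreModel s} {σ : Param s} {D : REMLReduction S σ}
  {t : ℕ} {x : Param s}

/-! #### A root of the score equation -/

/-- The normalized inverse information matrix `(t⁻¹ A)⁻¹`. -/
abbrev J (D : REMLReduction S σ) (t : ℕ) (x : Param s) : Matrix (Fin s) (Fin s) ℝ :=
  ((t : ℝ)⁻¹ • D.info₂ t x)⁻¹

lemma inv_info₂_eq (ht : D.t₀ ≤ t) (hx : x ∈ interior (S t).Θ) :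
    (D.info₂ t x)⁻¹ = (t : ℝ)⁻¹ • D.J t x := by
  have h0 := cast_pos ht
  have hu := isUnit_det_info₂ ht hx
  have h : D.J t x = (t : ℝ) • (D.info₂ t x)⁻¹ := Matrix.inv_eq_right_inv (by
    rw [Matrix.smul_mul, Matrix.mul_smul, Matrix.mul_nonsing_inv _ hu, smul_smul,
      inv_mul_cancel₀ h0.ne', one_smul])
  rw [h, smul_smul, inv_mul_cancel₀ h0.ne', one_smul]

lemma norm_J_le (ht : D.t₀ ≤ t) (hx : x ∈ Metric.ball σ D.r) : ‖D.J t x‖ ≤ 18 / D.c :=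
  (inv_smul_info₂ ht hx).2

lemma norm_inv_info₂_mulVec_le (ht : D.t₀ ≤ t) (v : Fin s → ℝ) :
    ‖WithLp.toLp 2 ((D.info₂ t σ)⁻¹ *ᵥ v)‖ ≤ 18 / D.c * ((t : ℝ)⁻¹ * ∑ j, |v j|) := by
  have h0 := cast_pos ht
  have hc := D.c_pos
  refine (norm_toLp_mulVec_le _ _).trans ?_
  rw [inv_info₂_eq ht (self_mem_interior ht), norm_smul, Real.norm_eq_abs,
    abs_of_pos (by positivity)]
  calc (t : ℝ)⁻¹ * ‖D.J t σ‖ * ‖WithLp.toLp 2 v‖ ≤ (t : ℝ)⁻¹ * (18 / D.c) * ∑ j, |v j| := by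
        gcongr
        · exact norm_J_le ht self_mem_ball
        · exact norm_toLp_le_sum_abs v
    _ = _ := by ring

open Classical in
/-- One step of the simplified Newton iteration for the score equation. -/
def newtonStep (D : REMLReduction S σ) (t : ℕ) (w : EuclideanSpace ℝ (Fin (D.N t)))
    (x : Param s) : Param s :=
  if x ∈ Metric.ball σ D.r then
    x - WithLp.toLp 2 ((D.info₂ t σ)⁻¹ *ᵥ
      fun j => redConst (D.K t) σ j x + qf (redForm (D.K t) σ j x) w)
  else σ

open Classical in
/-- The limit of the simplified Newton iteration started at the true parameter. -/
def root (D : REMLReduction S σ) (t : ℕ) (y : (S t).Y) : Param s :=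
  if D.t₀ ≤ t then limUnder atTop fun n => (D.newtonStep t (D.L t y))^[n] σ else σ

lemma newtonStep_eq (ht : D.t₀ ≤ t) (y : (S t).Y) (hx : x ∈ Metric.ball σ D.r) :
    D.newtonStep t (D.L t y) x =
      x - WithLp.toLp 2 ((D.info₂ t σ)⁻¹ *ᵥ (S t).score x y) := by
  rw [newtonStep, if_pos hx]
  congr 3
  funext j
  rw [score_eq ht (mem_interior ht hx)]

lemma continuousOn_score_form (ht : D.t₀ ≤ t) (j : Fin s) :
    ContinuousOn (fun p : EuclideanSpace ℝ (Fin (D.N t)) × Param s =>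
      redConst (D.K t) σ j p.2 + qf (redForm (D.K t) σ j p.2) p.1)
      (Set.univ ×ˢ interior (S t).Θ) := by
  have hsnd : Set.MapsTo (fun p : EuclideanSpace ℝ (Fin (D.N t)) × Param s => p.2)
      (Set.univ ×ˢ interior (S t).Θ) (interior (S t).Θ) := fun p hp => hp.2
  refine ((contDiffOn_redConst ht j).continuousOn.comp continuousOn_snd hsnd).add ?_
  simp only [qf, dotProduct, Matrix.mulVec]
  refine continuousOn_finsetSum _ fun a _ => ContinuousOn.mul (by fun_prop) ?_
  refine continuousOn_finsetSum _ fun b _ => ContinuousOn.mul ?_ (by fun_prop)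
  exact ((contDiffOn_redForm ht j).matrix_apply a b).continuousOn.comp continuousOn_snd hsnd

/-- Joint measurability in data and parameter is required for iteration: the step is continuous over
the open ball and constant outside it. -/
lemma measurable_newtonStep (ht : D.t₀ ≤ t) :
    Measurable fun p : EuclideanSpace ℝ (Fin (D.N t)) × Param s => D.newtonStep t p.1 p.2 := by
  classical
  have h : (fun p : EuclideanSpace ℝ (Fin (D.N t)) × Param s => D.newtonStep t p.1 p.2) =
      (Set.univ ×ˢ Metric.ball σ D.r).piecewise
        (fun p => p.2 - WithLp.toLp 2 ((D.info₂ t σ)⁻¹ *ᵥ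
          fun j => redConst (D.K t) σ j p.2 + qf (redForm (D.K t) σ j p.2) p.1))
        (fun _ => σ) := by
    funext p
    by_cases hp : p.2 ∈ Metric.ball σ D.r
    · rw [Set.piecewise_eq_of_mem _ _ _ (Set.mk_mem_prod (Set.mem_univ _) hp), newtonStep,
        if_pos hp]
    · rw [Set.piecewise_eq_of_notMem _ _ _ fun h => hp h.2, newtonStep, if_neg hp]
  rw [h]
  refine ContinuousOn.measurable_piecewise ?_ continuousOn_const
    (MeasurableSet.univ.prod measurableSet_ball)
  refine continuousOn_snd.sub ((mulVecCLM₂ (Fin s) (Fin s) (D.info₂ t σ)⁻¹).continuous.comp_continuousOn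
    ((PiLp.continuous_toLp 2 _).comp_continuousOn (continuousOn_pi.2 fun j => ?_)))
  exact (continuousOn_score_form ht j).mono (Set.prod_mono le_rfl (D.ball_subset t ht))

lemma measurable_root (D : REMLReduction S σ) (t : ℕ) : Measurable (D.root t) := by
  by_cases ht : D.t₀ ≤ t
  · have h : D.root t =
        fun y => limUnder atTop fun n => (D.newtonStep t (D.L t y))^[n] σ := by
      funext y; rw [root, if_pos ht]
    rw [h]
    exact (measurable_limUnder_iterate (measurable_newtonStep ht) σ).comp (D.L_meas t)
  · have h : D.root t = fun _ => σ := by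
      funext y; rw [root, if_neg ht]
    rw [h]
    exact measurable_const

/-- A random variable which dominates the normalized score, the centred second derivatives, and the
deviation of `|L y|²`. -/
def Ψ (D : REMLReduction S σ) (t : ℕ) (z : EuclideanSpace ℝ (Fin (D.N t))) : ℝ :=
  ∑ j, |D.α j t z| + ∑ i, ∑ j, |D.Φ i j t z| +
    |cqf (1 : Matrix (Fin (D.N t)) (Fin (D.N t)) ℝ) z / √t|

lemma allMom_Ψ : AllMom D D.Ψ :=
  ((AllMom.sum _ fun j _ => (allMom_α j).abs).add
    (AllMom.sum _ fun i _ => AllMom.sum _ fun j _ => (allMom_Φ i j).abs)).add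
    (AllMom.cqf_div_sqrt fun _ _ => norm_one_le).abs

lemma sum_abs_α_le (z : EuclideanSpace ℝ (Fin (D.N t))) : ∑ j, |D.α j t z| ≤ D.Ψ t z := by
  have h1 : 0 ≤ ∑ i, ∑ j, |D.Φ i j t z| := by positivity
  exact (le_add_of_nonneg_right h1).trans (le_add_of_nonneg_right (abs_nonneg _))

lemma Ψ_nonneg (z : EuclideanSpace ℝ (Fin (D.N t))) : 0 ≤ D.Ψ t z :=
  (Finset.sum_nonneg fun _ _ => abs_nonneg _).trans (sum_abs_α_le z)

lemma abs_Φ_le (i j : Fin s) (z : EuclideanSpace ℝ (Fin (D.N t))) : |D.Φ i j t z| ≤ D.Ψ t z := by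
  have h1 : |D.Φ i j t z| ≤ ∑ j, |D.Φ i j t z| :=
    Finset.single_le_sum (f := fun j => |D.Φ i j t z|) (fun _ _ => abs_nonneg _)
      (Finset.mem_univ j)
  have h2 : ∑ j, |D.Φ i j t z| ≤ ∑ i, ∑ j, |D.Φ i j t z| :=
    Finset.single_le_sum (f := fun i => ∑ j, |D.Φ i j t z|)
      (fun _ _ => Finset.sum_nonneg fun _ _ => abs_nonneg _) (Finset.mem_univ i)
  have h4 : 0 ≤ ∑ j, |D.α j t z| := Finset.sum_nonneg fun _ _ => abs_nonneg _
  exact (h1.trans h2).trans ((le_add_of_nonneg_left h4).trans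
    (le_add_of_nonneg_right (abs_nonneg _)))

/-- Where `Ψ/√t` is bounded, `dom` is bounded by a constant; this makes the random bounds on third
derivatives deterministic on the good event. -/
lemma dom_le (ht : D.t₀ ≤ t) (z : EuclideanSpace ℝ (Fin (D.N t))) :
    D.dom t z ≤ 1 + D.κ + (√t)⁻¹ * D.Ψ t z := by
  have h0 := cast_pos ht
  have h1 : ‖z‖ ^ 2 / (t : ℝ) = D.N t / t +
      (√t)⁻¹ * (cqf (1 : Matrix (Fin (D.N t)) (Fin (D.N t)) ℝ) z / √t) := by
    rw [inv_mul_eq_div, div_div, Real.mul_self_sqrt h0.le, cqf, qf_one, Matrix.trace_one,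
      Fintype.card_fin]
    ring
  have h2 : (D.N t : ℝ) / t ≤ D.κ := by
    rw [div_le_iff₀ h0]; exact D.N_le t ht
  have h3 : cqf (1 : Matrix (Fin (D.N t)) (Fin (D.N t)) ℝ) z / √t ≤ D.Ψ t z := by
    have h4 : 0 ≤ ∑ j, |D.α j t z| := Finset.sum_nonneg fun _ _ => abs_nonneg _
    have h5 : 0 ≤ ∑ i, ∑ j, |D.Φ i j t z| :=
      Finset.sum_nonneg fun _ _ => Finset.sum_nonneg fun _ _ => abs_nonneg _
    exact (le_abs_self _).trans (le_add_of_nonneg_left (add_nonneg h4 h5))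
  have h4 := mul_le_mul_of_nonneg_left h3 (by positivity : 0 ≤ (√(t : ℝ))⁻¹)
  rw [dom]
  linarith

lemma sum_abs_score_self (ht : D.t₀ ≤ t) (y : (S t).Y) :
    ∑ j, |(S t).score σ y j| ≤ √t * D.Ψ t (D.L t y) := by
  have h0 := sqrt_pos ht
  simp only [score_self_eq ht, abs_mul, abs_of_pos h0, ← Finset.mul_sum]
  exact mul_le_mul_of_nonneg_left (sum_abs_α_le _) h0.le

lemma norm_inv_info₂_score_le (ht : D.t₀ ≤ t) (y : (S t).Y) :
    ‖WithLp.toLp 2 ((D.info₂ t σ)⁻¹ *ᵥ (S t).score σ y)‖ ≤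
      18 / D.c * ((√t)⁻¹ * D.Ψ t (D.L t y)) := by
  have h0 := cast_pos ht
  have hc := D.c_pos
  refine (norm_inv_info₂_mulVec_le ht _).trans ?_
  have h1 := sum_abs_score_self ht y
  have h2 : (t : ℝ)⁻¹ * √t = (√t)⁻¹ := by
    have := sqrt_pos ht
    rw [inv_mul_eq_iff_eq_mul₀ h0.ne', ← div_eq_mul_inv, eq_div_iff this.ne',
      Real.mul_self_sqrt h0.le]
  rw [← h2, mul_assoc]
  gcongr

/-- Uniform control of the second derivatives of the criterion function near the true parameter. -/
lemma exists_abs_F_sub_A_le (D : REMLReduction S σ) : ∃ M ≥ 0, ∀ t ≥ D.t₀, ∀ y,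
    ∀ x ∈ Metric.ball σ D.r, ∀ i j, |(S t).F x y i j - D.info₂ t σ i j| ≤
      t * ((√t)⁻¹ * D.Ψ t (D.L t y) + M * D.dom t (D.L t y) * ‖x - σ‖) := by
  obtain ⟨C, hC, h⟩ := D.exists_bddDeriv_score 2
  refine ⟨s * C, by positivity, fun t ht y x hx i j => ?_⟩
  have h0 := cast_pos ht
  have h1 := ((h t ht y j).vpd i).norm_sub_le self_mem_ball hx
  have h2 := F_self_eq ht y i j
  rw [A_eq ht (self_mem_interior ht)] at h2
  have h3 := abs_Φ_le i j (D.L t y)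
  have h4 : (S t).F x y i j - D.info₂ t σ i j =
      ((S t).F x y i j - (S t).F σ y i j) + √t * D.Φ i j t (D.L t y) := by rw [h2]; ring
  have h5 : (t : ℝ) * (√t)⁻¹ = √t := by
    rw [← div_eq_mul_inv, Real.div_sqrt]
  rw [h4, mul_add, ← mul_assoc (t : ℝ), h5]
  refine (abs_add_le _ _).trans ?_
  rw [abs_mul, abs_of_pos (sqrt_pos ht), add_comm]
  refine add_le_add (mul_le_mul_of_nonneg_left h3 (sqrt_pos ht).le) ?_
  refine h1.trans (le_of_eq ?_)
  ring

/-- The score is close to its linearization with slope `A`. -/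
lemma score_sub_score_sub_le (ht : D.t₀ ≤ t) {y : (S t).Y} {ρ β : ℝ} (hρ : ρ < D.r)
    (h : ∀ x ∈ Metric.closedBall σ ρ, ∀ i j, |(S t).F x y i j - D.info₂ t σ i j| ≤ β)
    {x x' : Param s} (hx : x ∈ Metric.closedBall σ ρ) (hx' : x' ∈ Metric.closedBall σ ρ)
    (j : Fin s) :
    |(S t).score x y j - (S t).score x' y j - (D.info₂ t σ *ᵥ (x - x').ofLp) j| ≤
      s * β * ‖x - x'‖ := by
  obtain ⟨C, hC, hS⟩ := D.exists_bddDeriv_score 1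
  have hsub := Metric.closedBall_subset_ball (x := σ) hρ
  set Λ : Param s →L[ℝ] ℝ := ∑ i, D.info₂ t σ j i • (EuclideanSpace.proj i : Param s →L[ℝ] ℝ)
    with hΛ
  have hΛa : ∀ v : Param s, Λ v = (D.info₂ t σ *ᵥ v.ofLp) j := fun v => by
    simp [hΛ, Matrix.mulVec, dotProduct]
  have hd : ∀ z ∈ Metric.closedBall σ ρ,
      DifferentiableAt ℝ (fun z => (S t).score z y j) z := fun z hz =>
    (hS t ht y j).differentiableAt (hsub hz)
  -- The linear map `Λ` is the `j`-th row of `A(σ)`; the partial derivatives of the score minus `Λ`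
  -- are exactly the deviations bounded by the hypothesis.
  have h1 := norm_image_sub_le_of_vpd (f := fun z => (S t).score z y j - Λ z)
    (convex_closedBall σ ρ) (fun z hz => (hd z hz).sub Λ.differentiableAt)
    (C := β) (fun z hz i => by
      have e : vpd i (fun z => (S t).score z y j - Λ z) z =
          (S t).F z y i j - D.info₂ t σ i j := by
        rw [vpd, fderiv_fun_sub (hd z hz) Λ.differentiableAt, ContinuousLinearMap.fderiv,
          _root_.sub_apply, hΛa, (info₂_symm (D := D) t σ).apply i j |>.symm]
        simp [ScoreModel.F, hessian, pderiv]
        rfl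
      rw [e]
      exact h z hz i j) hx' hx
  rw [← hΛa, map_sub]
  rw [Real.norm_eq_abs] at h1
  refine (le_of_eq ?_).trans h1
  congr 1
  ring

/-- The frozen slope `A(σ)` cancels the linear part, leaving `-A⁻¹` times the linearization error of
the score. One factor `s` comes from the mean value inequality, the other from summing the
coordinates of that error. -/
lemma newtonStep_sub_newtonStep_le (ht : D.t₀ ≤ t) {y : (S t).Y} {ρ β : ℝ} (hρ : ρ < D.r)
    (h : ∀ x ∈ Metric.closedBall σ ρ, ∀ i j, |(S t).F x y i j - D.info₂ t σ i j| ≤ t * β)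
    {x x' : Param s} (hx : x ∈ Metric.closedBall σ ρ) (hx' : x' ∈ Metric.closedBall σ ρ) :
    ‖D.newtonStep t (D.L t y) x - D.newtonStep t (D.L t y) x'‖ ≤
      18 / D.c * s ^ 2 * β * ‖x - x'‖ := by
  have h0 := cast_pos ht
  have hc := D.c_pos
  have hsub := Metric.closedBall_subset_ball (x := σ) hρ
  have hu := isUnit_det_info₂ ht (self_mem_interior (D := D) ht)
  set v : Fin s → ℝ := fun j =>
    (S t).score x y j - (S t).score x' y j - (D.info₂ t σ *ᵥ (x - x').ofLp) j with hv
  have e : D.newtonStep t (D.L t y) x - D.newtonStep t (D.L t y) x' =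
      -WithLp.toLp 2 ((D.info₂ t σ)⁻¹ *ᵥ v) := by
    have hv2 : v = (S t).score x y - (S t).score x' y - D.info₂ t σ *ᵥ (x - x').ofLp := rfl
    rw [newtonStep_eq ht y (hsub hx), newtonStep_eq ht y (hsub hx'), hv2, Matrix.mulVec_sub,
      Matrix.mulVec_sub, Matrix.mulVec_mulVec, Matrix.nonsing_inv_mul _ hu, Matrix.one_mulVec,
      WithLp.toLp_sub, WithLp.toLp_sub, WithLp.toLp_ofLp 2 (x - x')]
    abel
  rw [e, norm_neg]
  refine (norm_inv_info₂_mulVec_le ht _).trans ?_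
  have h1 : ∑ j, |v j| ≤ ∑ _j : Fin s, s * (t * β) * ‖x - x'‖ :=
    Finset.sum_le_sum fun j _ => score_sub_score_sub_le ht hρ h hx hx' j
  calc 18 / D.c * ((t : ℝ)⁻¹ * ∑ j, |v j|)
      ≤ 18 / D.c * ((t : ℝ)⁻¹ * ∑ _j : Fin s, s * (t * β) * ‖x - x'‖) := by gcongr
    _ = _ := by
      simp only [Finset.sum_const, Finset.card_univ, Fintype.card_fin, nsmul_eq_mul]
      field_simp

/-- The Newton iteration converges to a root of the score equation if it is a contraction and its
first step is small. -/
lemma root_spec_of_contraction (ht : D.t₀ ≤ t) {y : (S t).Y} {ρ β : ℝ} (hρ0 : 0 ≤ ρ) (hρ : ρ < D.r)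
    (h : ∀ x ∈ Metric.closedBall σ ρ, ∀ i j, |(S t).F x y i j - D.info₂ t σ i j| ≤ t * β)
    (hβ : 18 / D.c * s ^ 2 * β ≤ 1 / 2)
    (ha : ‖WithLp.toLp 2 ((D.info₂ t σ)⁻¹ *ᵥ (S t).score σ y)‖ ≤ ρ / 2) :
    D.root t y ∈ Metric.closedBall σ ρ ∧ (S t).score (D.root t y) y = 0 ∧
      ‖D.root t y - σ‖ ≤ 2 * ‖WithLp.toLp 2 ((D.info₂ t σ)⁻¹ *ᵥ (S t).score σ y)‖ := by
  set G := D.newtonStep t (D.L t y) with hG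
  have hsub := Metric.closedBall_subset_ball (x := σ) hρ
  have hσ : σ ∈ Metric.closedBall σ ρ := Metric.mem_closedBall_self hρ0
  have hcontr : ∀ x ∈ Metric.closedBall σ ρ, ∀ x' ∈ Metric.closedBall σ ρ,
      ‖G x - G x'‖ ≤ 1 / 2 * ‖x - x'‖ := fun x hx x' hx' =>
    (newtonStep_sub_newtonStep_le ht hρ h hx hx').trans
      (mul_le_mul_of_nonneg_right hβ (norm_nonneg _))
  have hGσ : G σ - σ = -WithLp.toLp 2 ((D.info₂ t σ)⁻¹ *ᵥ (S t).score σ y) := by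
    rw [hG, newtonStep_eq ht y self_mem_ball]; abel
  -- The contraction uses at most `ρ/2` of the radius and the first Newton step at most the other
  -- `ρ/2`.
  have hmaps : Set.MapsTo G (Metric.closedBall σ ρ) (Metric.closedBall σ ρ) := fun x hx => by
    have h1 := hcontr x hx σ hσ
    rw [mem_closedBall_iff_norm] at hx ⊢
    calc ‖G x - σ‖ = ‖(G x - G σ) + (G σ - σ)‖ := by congr 1; abel
      _ ≤ ‖G x - G σ‖ + ‖G σ - σ‖ := norm_add_le _ _
      _ ≤ ρ := by rw [hGσ, norm_neg]; linarith
  have hC : ContractingWith (1 / 2) (hmaps.restrict G _ _) := by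
    refine ⟨by rw [← NNReal.coe_lt_coe]; norm_num, LipschitzWith.of_dist_le_mul fun a b => ?_⟩
    have := hcontr a.1 a.2 b.1 b.2
    rw [Subtype.dist_eq, Subtype.dist_eq, dist_eq_norm, dist_eq_norm]
    simpa using this
  obtain ⟨z, hz, hfix, hlim, -⟩ := hC.exists_fixedPoint' Metric.isClosed_closedBall.isComplete
    hmaps hσ (edist_ne_top _ _)
  have hroot : D.root t y = z := by
    rw [root, if_pos ht]
    exact hlim.limUnder_eq
  rw [hroot]
  refine ⟨hz, ?_, ?_⟩
  · have h1 : G z = z := hfix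
    rw [hG, newtonStep_eq ht y (hsub hz), sub_eq_self] at h1
    have h2 : (D.info₂ t σ)⁻¹ *ᵥ (S t).score z y = 0 := by
      simpa using congrArg WithLp.ofLp h1
    have hu := isUnit_det_info₂ ht (self_mem_interior (D := D) ht)
    have h3 := congrArg (fun v => D.info₂ t σ *ᵥ v) h2
    simpa [Matrix.mulVec_mulVec, Matrix.mul_nonsing_inv _ hu] using h3
  -- At the fixed point `‖z - σ‖ ≤ ‖z - σ‖/2 + ‖A⁻¹a‖`; absorbing the first term gives the factor
  -- `2`.
  · have h1 := hcontr z hz σ hσ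
    have h2 : z - σ = (G z - G σ) + (G σ - σ) := by
      have h3 : G z = z := hfix
      rw [h3]; abel
    have h4 := norm_add_le (G z - G σ) (G σ - σ)
    rw [← h2, hGσ, norm_neg] at h4
    linarith

/-- The remainder in the linear expansion of a root of the score equation. -/
lemma exists_remainder (D : REMLReduction S σ) : ∃ C ≥ 0, ∀ t ≥ D.t₀, ∀ y,
    ∀ x ∈ Metric.ball σ D.r, (S t).score x y = 0 →
      ‖x - σ + WithLp.toLp 2 ((D.info₂ t σ)⁻¹ *ᵥ (S t).score σ y)‖ ≤
        C * ((√t)⁻¹ * D.Ψ t (D.L t y) * ‖x - σ‖ + D.dom t (D.L t y) * ‖x - σ‖ ^ 2) := by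
  obtain ⟨C, hC, h⟩ := D.exists_bddDeriv_score 2
  have hc := D.c_pos
  refine ⟨18 / D.c * (s * (s + s ^ 2 * C)), by positivity, fun t ht y x hx h0 => ?_⟩
  have ht0 := cast_pos ht
  have hu := isUnit_det_info₂ ht (self_mem_interior (D := D) ht)
  set w := D.L t y
  have hΨ := Ψ_nonneg w
  have hdom := dom_nonneg w
  -- The remainder of the linear representation is `A⁻¹v`. As `x` is a root, `v` consists of the
  -- first order Taylor error of the score and the contribution of the centred second derivatives.
  set v : Fin s → ℝ := D.info₂ t σ *ᵥ (x - σ).ofLp + (S t).score σ y with hv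
  have e : x - σ + WithLp.toLp 2 ((D.info₂ t σ)⁻¹ *ᵥ (S t).score σ y) =
      WithLp.toLp 2 ((D.info₂ t σ)⁻¹ *ᵥ v) := by
    rw [hv, Matrix.mulVec_add, Matrix.mulVec_mulVec, Matrix.nonsing_inv_mul _ hu,
      Matrix.one_mulVec, WithLp.toLp_add, WithLp.toLp_ofLp]
  rw [e]
  refine (norm_inv_info₂_mulVec_le ht _).trans ?_
  have hvj : ∀ j, |v j| ≤ t * ((s + s ^ 2 * C) *
      ((√t)⁻¹ * D.Ψ t w * ‖x - σ‖ + D.dom t w * ‖x - σ‖ ^ 2)) := fun j => by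
    have h1 := (h t ht y j).taylor_one hx
    rw [h0] at h1
    have h2 : ∀ i, pderiv i (fun x => (S t).score x y j) σ =
        D.info₂ t σ i j + √t * D.Φ i j t w := fun i => by
      have := F_self_eq ht y i j
      rw [A_eq ht (self_mem_interior ht)] at this
      exact this
    have h3 : v j = -(((0 : Fin s → ℝ) j - (S t).score σ y j -
        ∑ i, (x i - σ i) * pderiv i (fun x => (S t).score x y j) σ) +
        ∑ i, (x i - σ i) * (√t * D.Φ i j t w)) := by
      simp only [h2, mul_add, Finset.sum_add_distrib, hv, Pi.add_apply, Matrix.mulVec, dotProduct,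
        Pi.zero_apply]
      have h4 : ∑ i, D.info₂ t σ j i * (x - σ).ofLp i = ∑ i, (x i - σ i) * D.info₂ t σ i j :=
        Finset.sum_congr rfl fun i _ => by
          rw [(info₂_symm (D := D) t σ).apply i j, mul_comm]; rfl
      rw [h4]; ring
    have h5 : |∑ i, (x i - σ i) * (√t * D.Φ i j t w)| ≤ s * (‖x - σ‖ * (√t * D.Ψ t w)) := by
      calc _ ≤ ∑ i, |(x i - σ i) * (√t * D.Φ i j t w)| := Finset.abs_sum_le_sum_abs _ _
        _ ≤ ∑ _i : Fin s, ‖x - σ‖ * (√t * D.Ψ t w) := by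
          refine Finset.sum_le_sum fun i _ => ?_
          rw [abs_mul, abs_mul, abs_of_pos (sqrt_pos ht)]
          have h6 : |x i - σ i| ≤ ‖x - σ‖ := PiLp.norm_apply_le (x - σ) i
          have h7 := abs_Φ_le i j w
          gcongr
        _ = _ := by simp
    rw [h3, abs_neg]
    refine (abs_add_le _ _).trans ((add_le_add h1 h5).trans ?_)
    have h8 : √(t : ℝ) = t * (√t)⁻¹ := by rw [← div_eq_mul_inv, Real.div_sqrt]
    have n₁ : 0 ≤ t * (s ^ 2 * C * ((√t)⁻¹ * D.Ψ t w * ‖x - σ‖)) := by positivity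
    have n₂ : 0 ≤ t * (s * (D.dom t w * ‖x - σ‖ ^ 2)) := by positivity
    calc _ = t * (s ^ 2 * C * (D.dom t w * ‖x - σ‖ ^ 2)) +
          s * (‖x - σ‖ * (t * (√t)⁻¹ * D.Ψ t w)) := by rw [← h8]; ring
      _ ≤ _ := by linarith
  calc 18 / D.c * ((t : ℝ)⁻¹ * ∑ j, |v j|) ≤ 18 / D.c * ((t : ℝ)⁻¹ * ∑ _j : Fin s,
        t * ((s + s ^ 2 * C) * ((√t)⁻¹ * D.Ψ t w * ‖x - σ‖ + D.dom t w * ‖x - σ‖ ^ 2))) := by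
        gcongr with j
        exact hvj j
    _ = _ := by
      simp only [Finset.sum_const, Finset.card_univ, Fintype.card_fin, nsmul_eq_mul]
      field_simp

end REMLReduction

end

end EmpiricalPredictor

/-! ### Convergence of the Newton iteration and consistency of its limit -/

namespace EmpiricalPredictor

noncomputable section

open scoped ContDiff MatrixOrder

namespace REMLReduction

variable {s : ℕ} {S : ℕ → ScoreModel s} {σ : Param s} {D : REMLReduction S σ}
  {t : ℕ} {x : Param s}

/-- On the event that `Ψ` is small compared to `√t`, the Newton iteration converges to a root of the
score equation with a linear expansion. -/
lemma exists_root_spec (D : REMLReduction S σ) : ∃ ε > 0, ∃ C ≥ 0, ∀ t ≥ D.t₀, ∀ y,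
    (√t)⁻¹ * D.Ψ t (D.L t y) ≤ ε → D.root t y ∈ Metric.ball σ D.r ∧
      (S t).score (D.root t y) y = 0 ∧ ‖D.root t y - σ‖ ≤ C * ((√t)⁻¹ * D.Ψ t (D.L t y)) ∧
      ‖D.root t y - σ + WithLp.toLp 2 ((D.info₂ t σ)⁻¹ *ᵥ (S t).score σ y)‖ ≤
        (t : ℝ)⁻¹ * (C * (D.dom t (D.L t y) * D.Ψ t (D.L t y) ^ 2)) := by
  obtain ⟨M, hM, hF⟩ := D.exists_abs_F_sub_A_le
  obtain ⟨C, hC, hR⟩ := D.exists_remainder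
  have hc := D.c_pos
  have hκ := D.κ_nonneg
  have hr := D.r_pos
  set E : ℝ := 18 / D.c * s ^ 2 with hE
  have hE0 : 0 ≤ E := by positivity
  -- `E` is the factor in the contraction constant. On the good event `dom ≤ 2 + κ`, and this radius
  -- makes the share of the third derivatives in the contraction constant at most `1/4`.
  set ρ : ℝ := min (D.r / 2) (1 / (4 * (E * (M * (2 + D.κ)) + 1))) with hρ
  have hρ0 : 0 < ρ := lt_min (by positivity) (by positivity)
  have hρr : ρ < D.r := (min_le_left _ _).trans_lt (by linarith)
  -- The three bounds give `dom ≤ 2 + κ`, a stochastic share of at most `1/4` in the contraction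
  -- constant, and a first Newton step of length at most `ρ/2`.
  set ε : ℝ := min 1 (min (1 / (4 * (E + 1))) (ρ * D.c / 36)) with hε
  have hε0 : 0 < ε := lt_min one_pos (lt_min (by positivity) (by positivity))
  have hε1 : ε ≤ 1 := min_le_left _ _
  have hεE : E * ε ≤ 1 / 4 := by
    have h1 : ε ≤ 1 / (4 * (E + 1)) := (min_le_right _ _).trans (min_le_left _ _)
    rw [le_div_iff₀ (by positivity)] at h1
    linarith
  have hερ : ε ≤ ρ * D.c / 36 := (min_le_right _ _).trans (min_le_right _ _)
  have hρE : E * (M * (2 + D.κ) * ρ) ≤ 1 / 4 := by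
    have h1 : ρ ≤ 1 / (4 * (E * (M * (2 + D.κ)) + 1)) := min_le_right _ _
    rw [le_div_iff₀ (by positivity)] at h1
    linarith
  refine ⟨ε, hε0, 36 / D.c + C * (36 / D.c + (36 / D.c) ^ 2), by positivity,
    fun t ht y hy => ?_⟩
  have h0 := cast_pos ht
  have hΨ := Ψ_nonneg (D := D) (D.L t y)
  have hdom1 := one_le_dom (D := D) (D.L t y)
  have hs := sqrt_pos ht
  have hdom : D.dom t (D.L t y) ≤ 2 + D.κ := (dom_le ht _).trans (by linarith)
  have hball := Metric.closedBall_subset_ball (x := σ) hρr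
  have ha := norm_inv_info₂_score_le ht y
  obtain ⟨h1, h2, h3⟩ := root_spec_of_contraction ht hρ0.le hρr
    (β := ε + M * (2 + D.κ) * ρ) (fun x hx i j => (hF t ht y x (hball hx) i j).trans (by
      have : ‖x - σ‖ ≤ ρ := mem_closedBall_iff_norm.1 hx
      gcongr)) (by rw [mul_add]; linarith) (ha.trans (by
      calc 18 / D.c * ((√t)⁻¹ * D.Ψ t (D.L t y)) ≤ 18 / D.c * (ρ * D.c / 36) := by
            gcongr; exact hy.trans hερ
        _ = ρ / 2 := by field_simp; norm_num))
  have h4 : ‖D.root t y - σ‖ ≤ 36 / D.c * ((√t)⁻¹ * D.Ψ t (D.L t y)) := by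
    refine h3.trans ((mul_le_mul_of_nonneg_left ha two_pos.le).trans (le_of_eq ?_))
    ring
  refine ⟨hball h1, h2, h4.trans ?_, (hR t ht y _ (hball h1) h2).trans ?_⟩
  · refine mul_le_mul_of_nonneg_right ?_ (by positivity)
    have : 0 ≤ C * (36 / D.c + (36 / D.c) ^ 2) := by positivity
    linarith
  · have hinv : (t : ℝ)⁻¹ = (√t)⁻¹ * (√t)⁻¹ := by rw [← mul_inv, Real.mul_self_sqrt h0.le]
    set P := D.Ψ t (D.L t y)
    set d := D.dom t (D.L t y)
    calc C * ((√t)⁻¹ * P * ‖D.root t y - σ‖ + d * ‖D.root t y - σ‖ ^ 2)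
        ≤ C * ((√t)⁻¹ * P * (36 / D.c * ((√t)⁻¹ * P)) + d * (36 / D.c * ((√t)⁻¹ * P)) ^ 2) := by
          gcongr
      _ = (√(t : ℝ))⁻¹ * (√t)⁻¹ *
          (C * (36 / D.c * (1 * P ^ 2) + (36 / D.c) ^ 2 * (d * P ^ 2))) := by ring
      -- The inequality `dom ≥ 1` brings the cross term and the quadratic term under the single
      -- majorant `dom · Ψ²`.
      _ ≤ (√(t : ℝ))⁻¹ * (√t)⁻¹ *
          (36 / D.c * (d * P ^ 2) +
            C * (36 / D.c * (d * P ^ 2) + (36 / D.c) ^ 2 * (d * P ^ 2))) := by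
          have : 0 ≤ 36 / D.c * (d * P ^ 2) := by positivity
          have h5 : C * (36 / D.c * (1 * P ^ 2) + (36 / D.c) ^ 2 * (d * P ^ 2)) ≤
              C * (36 / D.c * (d * P ^ 2) + (36 / D.c) ^ 2 * (d * P ^ 2)) := by gcongr
          gcongr
          linarith
      _ = _ := by rw [hinv]; ring

lemma one_le_sqrt (ht : D.t₀ ≤ t) : 1 ≤ √(t : ℝ) := Real.one_le_sqrt.2 (one_le_cast ht)

lemma norm_d_mul (D : REMLReduction S σ) (t : ℕ) (v : Param s) :
    ‖WithLp.toLp 2 (fun i => (S t).d i * v i)‖ = √t * ‖v‖ := by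
  have h : WithLp.toLp 2 (fun i => (S t).d i * v i) = √(t : ℝ) • v := by
    ext i
    simp [D.d_eq]
  rw [h, norm_smul, Real.norm_of_nonneg (Real.sqrt_nonneg _)]

/-- The good event is `Ψ ≤ ε d_*^{1-ρ}`. Since `Ψ` has all moments, Markov's inequality of order `2k
≥ g` bounds the complement by a power at least as small as `d_*^{-τg}`. The estimator itself depends
neither on `ρ` nor on `g`. -/
theorem isConsistentRoot_root [NeZero s] (D : REMLReduction S σ) {g : ℝ} (hg : 0 < g) :
    IsConsistentRoot S σ g D.root := by
  intro ρ hρ0 hρ1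
  obtain ⟨ε₁, hε₁, C, hC, hspec⟩ := D.exists_root_spec
  -- The second entry gives `C ε < 1`, which yields the strict inequality for `|D(σ̂ - σ)|`.
  set ε : ℝ := min ε₁ (1 / (C + 1)) with hε
  have hε0 : 0 < ε := lt_min hε₁ (by positivity)
  have hCε : C * ε < 1 := by
    have h1 : ε ≤ 1 / (C + 1) := min_le_right _ _
    rw [le_div_iff₀ (by positivity)] at h1
    linarith
  obtain ⟨k, hk⟩ := exists_nat_ge g
  set a : ℕ → ℝ := fun t => √(t : ℝ) ^ (-(1 - ρ)) with ha
  have ha0 : ∀ t ≥ D.t₀, 0 ≤ a t := fun t ht => by positivity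
  obtain ⟨c, hc, hmeas⟩ := (allMom_Ψ (D := D)).exists_measure_le hε0 a ha0 k
  have hu : AllMom D fun t z => C * (D.dom t z * D.Ψ t z ^ 2) :=
    (allMom_dom.mul (allMom_Ψ.pow 2)).const_mul C
  refine ⟨fun t => {y | ε < a t * |D.Ψ t (D.L t y)|}ᶜ,
    fun t y => Real.toNNReal (C * (D.dom t (D.L t y) * D.Ψ t (D.L t y) ^ 2)), c,
    hu.boundedMoment hg (fun t ht => ?_) (fun t ht y => ?_),
    (eventually_ge_atTop D.t₀).mono fun t ht => ⟨?_, ?_, fun y hy => ?_⟩⟩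
  · exact (((hu.1 t).1.measurable.comp (D.L_meas t)).real_toNNReal).coe_nnreal_ennreal
  · exact ENNReal.ofReal_le_ofReal (le_abs_self _)
  · refine (measurableSet_lt measurable_const (Measurable.const_mul ?_ _)).compl
    exact ((allMom_Ψ.1 t).1.measurable.comp (D.L_meas t)).abs
  · rw [compl_compl]
    refine (hmeas t ht).trans (ENNReal.ofReal_le_ofReal (mul_le_mul_of_nonneg_left ?_ hc))
    rw [ha, dStar_eq D, ← Real.rpow_mul_natCast (Real.sqrt_nonneg _)]
    refine Real.rpow_le_rpow_of_exponent_le (one_le_sqrt ht) ?_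
    have h1 : min (1 / 4) (1 - ρ) * g ≤ (1 - ρ) * k :=
      mul_le_mul (min_le_right _ _) hk hg.le (by linarith)
    have h2 : 0 ≤ (1 - ρ) * k := mul_nonneg (by linarith) (Nat.cast_nonneg _)
    push_cast
    linarith
  · have hΨ := Ψ_nonneg (D := D) (D.L t y)
    have hdom := dom_nonneg (D := D) (D.L t y)
    have h0 := cast_pos ht
    have hs := sqrt_pos ht
    have hs1 := one_le_sqrt (D := D) ht
    have hy1 : a t * D.Ψ t (D.L t y) ≤ ε := by
      have : ¬ ε < a t * |D.Ψ t (D.L t y)| := hy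
      rwa [abs_of_nonneg hΨ, not_lt] at this
    have hinv : (√(t : ℝ))⁻¹ = √t ^ (-1 : ℝ) := by rw [Real.rpow_neg_one]
    have h1 : (√(t : ℝ))⁻¹ ≤ a t := by
      rw [hinv]
      exact Real.rpow_le_rpow_of_exponent_le hs1 (by linarith)
    obtain ⟨e1, e2, e3, e4⟩ := hspec t ht y
      (((mul_le_mul_of_nonneg_right h1 hΨ).trans hy1).trans (min_le_left _ _))
    refine ⟨interior_subset (D.ball_subset t ht e1), e2, ?_, ?_⟩
    · have h2 := norm_d_mul D t (D.root t y - σ)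
      have h3 : (fun i => (S t).d i * (D.root t y i - σ i)) =
        fun i => (S t).d i * (D.root t y - σ) i := rfl
      rw [h3, h2, dStar_eq D]
      have h4 : D.Ψ t (D.L t y) ≤ ε * √t ^ (1 - ρ) := by
        have h5 : a t * √(t : ℝ) ^ (1 - ρ) = 1 := by
          rw [ha, ← Real.rpow_add hs, neg_add_cancel, Real.rpow_zero]
        have h6 : (0:ℝ) < √(t : ℝ) ^ (1 - ρ) := by positivity
        calc D.Ψ t (D.L t y) = a t * D.Ψ t (D.L t y) * √(t : ℝ) ^ (1 - ρ) := by
              rw [mul_right_comm, h5, one_mul]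
          _ ≤ _ := by gcongr
      calc √(t : ℝ) * ‖D.root t y - σ‖ ≤ √t * (C * ((√t)⁻¹ * D.Ψ t (D.L t y))) := by gcongr
        _ = C * D.Ψ t (D.L t y) := by field_simp
        _ ≤ C * (ε * √t ^ (1 - ρ)) := by gcongr
        _ = C * ε * √t ^ (1 - ρ) := by ring
        _ < 1 * √t ^ (1 - ρ) := by gcongr
        _ = _ := one_mul _
    · rw [A_eq ht (self_mem_interior ht), dStar_eq D]
      refine e4.trans ?_
      rw [Real.coe_toNNReal _ (by positivity)]
      refine mul_le_mul_of_nonneg_right ?_ (by positivity)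
      -- The remainder is really of order `d_*^{-2}`, which is better than `d_*^{-2ρ}` because `ρ <
      -- 1`.
      have h2 : (t : ℝ)⁻¹ = √t ^ (-(2:ℝ)) := by
        rw [Real.rpow_neg hs.le, Real.rpow_two, Real.sq_sqrt h0.le]
      rw [h2]
      exact Real.rpow_le_rpow_of_exponent_le hs1 (by linarith)

end REMLReduction

end

end EmpiricalPredictor

namespace EmpiricalPredictor

noncomputable section

open scoped ContDiff MatrixOrder

namespace REMLReduction

variable {s : ℕ} {S : ℕ → ScoreModel s} {σ : Param s} {D : REMLReduction S σ}
  {t : ℕ} {x : Param s}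

/-! #### The bias terms -/

lemma J_symm (t : ℕ) (x : Param s) : (D.J t x).IsSymm := by
  rw [Matrix.IsSymm, Matrix.transpose_nonsing_inv, Matrix.transpose_smul, info₂_symm]

lemma integral_score_eq_zero (ht : D.t₀ ≤ t) (hx : x ∈ interior (S t).Θ) (i : Fin s) :
    ∫ y, (S t).score x y i ∂(S t).law x = 0 := congrFun (meanScore_eq ht hx) i

lemma integral_score_score (ht : D.t₀ ≤ t) (i j : Fin s) :
    ∫ y, (S t).score x y i * (S t).score x y j ∂(S t).law x = t * (S t).U1 x i j := by
  have h0 := cast_pos ht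
  simp only [ScoreModel.U1, Matrix.of_apply, D.d_eq, div_mul_div_comm, Real.mul_self_sqrt h0.le]
  rw [integral_div, mul_div_cancel₀ _ h0.ne']

/-- `U2` is defined with the centred second derivatives; as the score has mean zero, the centring
does not change the expectation. -/
lemma integral_F_score (ht : D.t₀ ≤ t) (hx : x ∈ interior (S t).Θ) (i j k : Fin s) :
    ∫ y, (S t).F x y i j * (S t).score x y k ∂(S t).law x = t * (S t).U2 x i j k := by
  have h0 := cast_pos ht
  have hE := expectationsExist ht hx
  simp only [ScoreModel.U2, D.d_eq, div_mul_div_comm, Real.mul_self_sqrt h0.le, sub_mul]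
  rw [integral_div, mul_div_cancel₀ _ h0.ne', integral_sub (hE.hess_score i j k)
    ((hE.score k).const_mul _), integral_const_mul, integral_score_eq_zero ht hx, mul_zero,
    sub_zero]

lemma integral_H_score_score (ht : D.t₀ ≤ t) (i j k l m : Fin s) :
    ∫ y, (S t).H x y i j k * (S t).score x y l * (S t).score x y m ∂(S t).law x =
      t * (t * (S t).U3 x i j l k m) := by
  have h0 := cast_pos ht
  have h1 : ∀ a b c : ℝ, a / (t : ℝ) * (b / √t) * (c / √t) = a * b * c / (t * t) := fun a b c => by
    have h2 : (t : ℝ) * t = t * (√t * √t) := by rw [Real.mul_self_sqrt h0.le]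
    rw [div_mul_div_comm, div_mul_div_comm, h2, mul_assoc (t : ℝ)]
  simp only [ScoreModel.U3, D.d_eq, Real.mul_self_sqrt h0.le, h1]
  rw [integral_div]
  field_simp

/-- `b'(t⁻¹ A)⁻¹`, where `b = ∂η/∂σ`. -/
def gradJ (D : REMLReduction S σ) (η : ℕ → Param s → ℝ) (t : ℕ) (x : Param s) (j : Fin s) : ℝ :=
  ∑ i, pderiv i (η t) x * D.J t x i j

/-- `t ∑_j Δ_j`, in terms of the normalized quantities. -/
def bias (D : REMLReduction S σ) (η : ℕ → Param s → ℝ) (t : ℕ) (x : Param s) : ℝ :=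
  ∑ j, ∑ k, ∑ l, D.gradJ η t x j * D.J t x k l * (S t).U2 x j k l +
  1 / 2 * ∑ i, ∑ j, ∑ k, ∑ l,
    D.J t x i j * pderiv j (pderiv k (η t)) x * D.J t x k l * (S t).U1 x i l -
  1 / 2 * ∑ j, ∑ k, ∑ l, ∑ n, ∑ m,
    D.gradJ η t x j * D.J t x m n * D.J t x k l * (S t).U3 x j n m k l

lemma integral_sum₂ {Ω : Type*} [MeasurableSpace Ω] {μ : Measure Ω} {f : Fin s → Fin s → Ω → ℝ}
    (h : ∀ i j, Integrable (f i j) μ) :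
    ∫ y, ∑ i, ∑ j, f i j y ∂μ = ∑ i, ∑ j, ∫ y, f i j y ∂μ := by
  rw [integral_finsetSum _ fun i _ => integrable_finsetSum _ fun j _ => h i j]
  exact Finset.sum_congr rfl fun i _ => integral_finsetSum _ fun j _ => h i j

lemma grad_dotProduct_inv_mulVec (ht : D.t₀ ≤ t) (hx : x ∈ interior (S t).Θ)
    (η : ℕ → Param s → ℝ) (v : Fin s → ℝ) :
    grad (η t) x ⬝ᵥ (((S t).A x)⁻¹ *ᵥ v) = (t : ℝ)⁻¹ * ∑ j, D.gradJ η t x j * v j := by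
  rw [A_eq ht hx, inv_info₂_eq ht hx, Matrix.smul_mulVec, dotProduct_smul, smul_eq_mul,
    Matrix.dotProduct_mulVec]
  rfl

lemma Δ1_eq (ht : D.t₀ ≤ t) (hx : x ∈ interior (S t).Θ) (η : ℕ → Param s → ℝ) :
    (S t).Δ1 (η t) x = (t : ℝ)⁻¹ *
      ∑ j, ∑ k, ∑ l, D.gradJ η t x j * D.J t x k l * (S t).U2 x j k l := by
  have h0 := cast_pos ht
  have hE := expectationsExist ht hx
  rw [ScoreModel.Δ1, grad_dotProduct_inv_mulVec ht hx]
  congr 1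
  refine Finset.sum_congr rfl fun i _ => ?_
  have h1 : ∀ y, ((S t).F x y *ᵥ (((S t).A x)⁻¹ *ᵥ (S t).score x y)) i =
      ∑ j, ∑ k, (t : ℝ)⁻¹ * D.J t x j k * ((S t).F x y i j * (S t).score x y k) := fun y => by
    rw [A_eq ht hx, inv_info₂_eq ht hx]
    simp only [Matrix.mulVec, dotProduct, Finset.mul_sum, Matrix.smul_apply, smul_eq_mul]
    exact Finset.sum_congr rfl fun j _ => Finset.sum_congr rfl fun k _ => by ring
  simp only [h1]
  rw [integral_sum₂ fun j k => (hE.hess_score i j k).const_mul _]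
  simp only [integral_const_mul, integral_F_score ht hx, Finset.mul_sum]
  refine Finset.sum_congr rfl fun j _ => Finset.sum_congr rfl fun k _ => ?_
  field_simp

lemma Δ2_eq (ht : D.t₀ ≤ t) (hx : x ∈ interior (S t).Θ) (η : ℕ → Param s → ℝ) :
    (S t).Δ2 (η t) x = (t : ℝ)⁻¹ * (1 / 2 * ∑ i, ∑ j, ∑ k, ∑ l,
      D.J t x i j * pderiv j (pderiv k (η t)) x * D.J t x k l * (S t).U1 x i l) := by
  have h0 := cast_pos ht
  have hE := expectationsExist ht hx
  have h1 : ∀ y, (S t).score x y ⬝ᵥ (((S t).A x)⁻¹ *ᵥ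
      (hessian (η t) x *ᵥ (((S t).A x)⁻¹ *ᵥ (S t).score x y))) =
      ∑ i, ∑ j, ∑ k, ∑ l, (t : ℝ)⁻¹ * ((t : ℝ)⁻¹ * (D.J t x i j *
        pderiv j (pderiv k (η t)) x * D.J t x k l)) *
        ((S t).score x y i * (S t).score x y l) := fun y => by
    rw [A_eq ht hx, inv_info₂_eq ht hx]
    simp only [Matrix.mulVec, dotProduct, Finset.mul_sum, Matrix.smul_apply, smul_eq_mul, hessian,
      Matrix.of_apply]
    exact Finset.sum_congr rfl fun i _ => Finset.sum_congr rfl fun j _ =>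
      Finset.sum_congr rfl fun k _ => Finset.sum_congr rfl fun l _ => by ring
  have hint : ∀ i j k l, Integrable (fun y => (t : ℝ)⁻¹ * ((t : ℝ)⁻¹ * (D.J t x i j *
      pderiv j (pderiv k (η t)) x * D.J t x k l)) *
      ((S t).score x y i * (S t).score x y l)) ((S t).law x) := fun i j k l =>
    (hE.score_score i l).const_mul _
  rw [ScoreModel.Δ2]
  simp only [h1]
  rw [integral_sum₂ fun i j => integrable_finsetSum _ fun k _ => integrable_finsetSum _
    fun l _ => hint i j k l, mul_left_comm]
  congr 1
  simp only [Finset.mul_sum]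
  refine Finset.sum_congr rfl fun i _ => Finset.sum_congr rfl fun j _ => ?_
  rw [integral_sum₂ fun k l => hint i j k l]
  simp only [integral_const_mul, integral_score_score ht]
  refine Finset.sum_congr rfl fun k _ => Finset.sum_congr rfl fun l _ => ?_
  field_simp

lemma Δ3_eq (ht : D.t₀ ≤ t) (hx : x ∈ interior (S t).Θ) (η : ℕ → Param s → ℝ) :
    (S t).Δ3 (η t) x = -((t : ℝ)⁻¹ * (1 / 2 * ∑ j, ∑ k, ∑ l, ∑ n, ∑ m,
      D.gradJ η t x j * D.J t x m n * D.J t x k l * (S t).U3 x j n m k l)) := by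
  have h0 := cast_pos ht
  have hE := expectationsExist ht hx
  rw [ScoreModel.Δ3, grad_dotProduct_inv_mulVec ht hx, mul_left_comm, neg_mul, mul_neg]
  congr 3
  refine Finset.sum_congr rfl fun i _ => ?_
  have h1 : ∀ y, ((S t).C x y *ᵥ (((S t).A x)⁻¹ *ᵥ (S t).score x y)) i =
      ∑ k, ∑ l, ∑ n, ∑ m, (t : ℝ)⁻¹ * ((t : ℝ)⁻¹ * (D.J t x m n * D.J t x k l)) *
        ((S t).H x y i n k * (S t).score x y m * (S t).score x y l) := fun y => by
    rw [ScoreModel.C, A_eq ht hx, inv_info₂_eq ht hx]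
    simp only [Matrix.mulVec, dotProduct, Finset.mul_sum, Finset.sum_mul, Matrix.smul_apply,
      smul_eq_mul, Matrix.of_apply, Matrix.vecMul]
    exact Finset.sum_congr rfl fun i _ => Finset.sum_congr rfl fun j _ =>
      Finset.sum_congr rfl fun k _ => Finset.sum_congr rfl fun l _ => by ring
  have hint : ∀ k l n m, Integrable (fun y => (t : ℝ)⁻¹ * ((t : ℝ)⁻¹ *
      (D.J t x m n * D.J t x k l)) *
      ((S t).H x y i n k * (S t).score x y m * (S t).score x y l)) ((S t).law x) :=
    fun k l n m => (hE.third_score_score i n k m l).const_mul _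
  simp only [h1]
  rw [integral_sum₂ fun i j => integrable_finsetSum _ fun k _ => integrable_finsetSum _
    fun l _ => hint i j k l]
  simp only [Finset.mul_sum]
  refine Finset.sum_congr rfl fun k _ => Finset.sum_congr rfl fun l _ => ?_
  rw [integral_sum₂ fun n m => hint k l n m, Finset.mul_sum]
  refine Finset.sum_congr rfl fun n _ => ?_
  rw [Finset.mul_sum]
  refine Finset.sum_congr rfl fun m _ => ?_
  rw [integral_const_mul, integral_H_score_score ht]
  field_simp

/-- `Δ₀` vanishes with the mean score. In the other terms the powers of `t` from `A⁻¹` and from the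
moments combine to one factor `t⁻¹` in front of a bounded quantity. -/
lemma corrected_eq (ht : D.t₀ ≤ t) (hx : x ∈ interior (S t).Θ) (η : ℕ → Param s → ℝ) :
    (S t).corrected (η t) x = η t x - (t : ℝ)⁻¹ * D.bias η t x := by
  have h : (S t).Δ0 (η t) x = 0 := by simp [ScoreModel.Δ0, meanScore_eq ht hx]
  rw [ScoreModel.corrected, h, Δ1_eq ht hx, Δ2_eq ht hx, Δ3_eq ht hx, bias]
  ring

lemma EtaBdd.unifLip_pderiv {η : ℕ → Param s → ℝ} (hη : EtaBdd D η) (i : Fin s) :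
    UnifLip D fun t x => pderiv i (η t) x := by
  obtain ⟨C, hC, h⟩ := hη
  exact UnifLip.of_bddDeriv hC fun t ht => (h t ht).2.vpd i

lemma EtaBdd.unifLip_pderiv₂ {η : ℕ → Param s → ℝ} (hη : EtaBdd D η) (i j : Fin s) :
    UnifLip D fun t x => pderiv i (pderiv j (η t)) x := by
  obtain ⟨C, hC, h⟩ := hη
  exact UnifLip.of_bddDeriv hC fun t ht => ((h t ht).2.vpd j).vpd i

lemma unifLip_gradJ {η : ℕ → Param s → ℝ} (hη : EtaBdd D η) (j : Fin s) :
    UnifLip D fun t x => D.gradJ η t x j :=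
  UnifLip.sum _ fun i _ => (hη.unifLip_pderiv i).mul (unifLip_inv_info₂ i j)

/-- The normalized bias is a polynomial in families that are bounded and Lipschitz at `σ`. This is
what permits its evaluation at the estimator instead of the true parameter. -/
lemma unifLip_bias {η : ℕ → Param s → ℝ} (hη : EtaBdd D η) : UnifLip D (D.bias η) := by
  have h1 := UnifLip.sum Finset.univ fun j _ => UnifLip.sum Finset.univ fun k _ =>
    UnifLip.sum Finset.univ fun l _ =>
      ((unifLip_gradJ hη j).mul (unifLip_inv_info₂ k l)).mul (unifLip_U2 (D := D) j k l)
  have h2 := UnifLip.sum Finset.univ fun i _ => UnifLip.sum Finset.univ fun j _ =>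
    UnifLip.sum Finset.univ fun k _ => UnifLip.sum Finset.univ fun l _ =>
      (((unifLip_inv_info₂ (D := D) i j).mul (hη.unifLip_pderiv₂ j k)).mul
        (unifLip_inv_info₂ k l)).mul (unifLip_U1 i l)
  have h3 := UnifLip.sum Finset.univ fun j _ => UnifLip.sum Finset.univ fun k _ =>
    UnifLip.sum Finset.univ fun l _ => UnifLip.sum Finset.univ fun n _ =>
      UnifLip.sum Finset.univ fun m _ =>
      (((unifLip_gradJ hη j).mul (unifLip_inv_info₂ m n)).mul (unifLip_inv_info₂ k l)).mul
        (unifLip_U3 (D := D) j n m k l)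
  refine ((h1.add (h2.const_mul (1 / 2))).add (h3.const_mul (-(1 / 2)))).congr fun t _ x _ => ?_
  rw [bias]
  ring

/-! #### Measurability of the bias terms -/

lemma continuousOn_R (ht : D.t₀ ≤ t) : ContinuousOn (D.R t) (interior (S t).Θ) :=
  CFC.continuousOn_sqrt.comp (contDiff_redCov (k := 0) (D.K t) σ).continuous.continuousOn
    fun x hx => (D.posDef t ht x hx).posSemidef.nonneg

lemma continuousOn_R_mul_mul_R (ht : D.t₀ ≤ t)
    {W : Param s → Matrix (Fin (D.N t)) (Fin (D.N t)) ℝ}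
    (hW : ContDiffOn ℝ 0 W (interior (S t).Θ)) (a b : Fin (D.N t)) :
    ContinuousOn (fun x => (D.R t x * W x * D.R t x) a b) (interior (S t).Θ) := by
  have h1 : ContDiffOn ℝ 0 (D.R t) (interior (S t).Θ) := contDiffOn_zero.2 (continuousOn_R ht)
  exact (((h1.matMul hW).matMul h1).matrix_apply a b).continuousOn

lemma continuousOn_cqf {N : ℕ} {O : Set (Param s)} {T : Param s → Matrix (Fin N) (Fin N) ℝ}
    (hT : ∀ a b, ContinuousOn (fun x => T x a b) O) :
    ContinuousOn (fun p : Param s × EuclideanSpace ℝ (Fin N) => cqf (T p.1) p.2)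
      (O ×ˢ Set.univ) := by
  have hfst : Set.MapsTo (fun p : Param s × EuclideanSpace ℝ (Fin N) => p.1) (O ×ˢ Set.univ) O :=
    fun p hp => hp.1
  simp only [cqf, qf, dotProduct, Matrix.mulVec, Matrix.trace, Matrix.diag]
  refine ContinuousOn.sub (continuousOn_finsetSum _ fun a _ => ContinuousOn.mul (by fun_prop) ?_)
    (continuousOn_finsetSum _ fun a _ => (hT a a).comp continuousOn_fst hfst)
  exact continuousOn_finsetSum _ fun b _ =>
    ContinuousOn.mul ((hT a b).comp continuousOn_fst hfst) (by fun_prop)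

/-- The functions concerned are controlled on the interior of the parameter space only, hence the
indicator; measurability of an integral in its parameter does the rest. -/
lemma measurable_indicator_integral {Ω : Type*} [MeasurableSpace Ω] [TopologicalSpace Ω]
    [BorelSpace Ω] [SecondCountableTopology Ω] {μ : Measure Ω} [SFinite μ] {O : Set (Param s)}
    (hO : IsOpen O) {f : Param s × Ω → ℝ} (hf : ContinuousOn f (O ×ˢ Set.univ))
    {u : Param s → ℝ} (hu : ∀ x ∈ O, u x = ∫ z, f (x, z) ∂μ) : Measurable (O.indicator u) := by
  classical
  have h1 : Measurable ((O ×ˢ (Set.univ : Set Ω)).piecewise f fun _ => 0) :=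
    hf.measurable_piecewise continuousOn_const (hO.measurableSet.prod MeasurableSet.univ)
  have h2 := (StronglyMeasurable.integral_prod_right (ν := μ) (f := fun x z =>
    (O ×ˢ (Set.univ : Set Ω)).piecewise f (fun _ => 0) (x, z)) h1.stronglyMeasurable).measurable
  convert h2 using 1
  funext x
  by_cases hx : x ∈ O
  · rw [Set.indicator_of_mem hx, hu x hx]
    refine integral_congr_ae (Eventually.of_forall fun z => ?_)
    exact (Set.piecewise_eq_of_mem _ _ _ (Set.mk_mem_prod hx (Set.mem_univ z))).symm
  · rw [Set.indicator_of_notMem hx]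
    refine (integral_eq_zero_of_ae (Eventually.of_forall fun z => ?_)).symm
    exact Set.piecewise_eq_of_notMem _ _ _ fun h => hx h.1

lemma contDiffOn_info₂ (ht : D.t₀ ≤ t) : ContDiffOn ℝ ∞ (D.info₂ t) (interior (S t).Θ) := by
  have h1 := contDiffOn_inv_redCov (D.posDef t ht)
  refine ContDiffOn.matrix_of_apply fun i j => ?_
  simp only [info₂, Matrix.of_apply]
  exact contDiffOn_const.mul
    (((h1.matMul contDiffOn_const).matMul h1).matMul contDiffOn_const).trace

lemma continuousOn_J (ht : D.t₀ ≤ t) (i j : Fin s) :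
    ContinuousOn (fun x => D.J t x i j) (interior (S t).Θ) := by
  have h0 := cast_pos ht
  have h := ((contDiffOn_info₂ ht).const_smul (t : ℝ)⁻¹).matInv fun x hx => by
    have h1 := isUnit_det_info₂ ht hx
    rw [Matrix.det_smul]
    exact (IsUnit.mk0 _ (by positivity)).mul h1
  exact (h.matrix_apply i j).continuousOn

/-- The ingredients are either continuous on the interior or integrals of continuous integrands over
the fixed Gaussian space; measurability of the indicators passes through finite sums and products.
-/
lemma measurable_indicator_bias (ht : D.t₀ ≤ t) {η : ℕ → Param s → ℝ}
    (hη : ContDiffOn ℝ 3 (η t) (interior (S t).Θ)) :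
    Measurable ((interior (S t).Θ).indicator (D.bias η t)) := by
  set O := interior (S t).Θ with hO'
  have hO : IsOpen O := isOpen_interior
  have hmul : ∀ {f g : Param s → ℝ}, Measurable (O.indicator f) → Measurable (O.indicator g) →
      Measurable (O.indicator fun x => f x * g x) := fun {f g} hf hg => by
    rw [Set.indicator_mul]; exact hf.mul hg
  have hadd : ∀ {f g : Param s → ℝ}, Measurable (O.indicator f) → Measurable (O.indicator g) →
      Measurable (O.indicator fun x => f x + g x) := fun {f g} hf hg => by
    rw [Set.indicator_add]; exact hf.add hg
  have hsum : ∀ {f : Fin s → Param s → ℝ}, (∀ i, Measurable (O.indicator (f i))) →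
      Measurable (O.indicator fun x => ∑ i, f i x) := fun {f} hf => by
    have e : O.indicator (fun x => ∑ i, f i x) = fun x => ∑ i, O.indicator (f i) x := by
      funext x
      by_cases hx : x ∈ O <;> simp [hx]
    rw [e]
    exact Finset.measurable_fun_sum _ fun i _ => hf i
  have hcont : ∀ {f : Param s → ℝ}, ContinuousOn f O → Measurable (O.indicator f) := fun {f} hf => by
    classical
    rw [← Set.piecewise_eq_indicator]
    exact hf.measurable_piecewise continuousOn_const hO.measurableSet
  have hc : ∀ c : ℝ, Measurable (O.indicator fun _ => c) := fun c => hcont continuousOn_const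
  have hb : ∀ i, Measurable (O.indicator fun x => pderiv i (η t) x) := fun i =>
    hcont (ContDiffOn.vpd hO (k' := 2) hη (by norm_num) i).continuousOn
  have hB : ∀ i j, Measurable (O.indicator fun x => pderiv i (pderiv j (η t)) x) := fun i j =>
    hcont (ContDiffOn.vpd hO (k' := 1)
      (ContDiffOn.vpd hO (k' := 2) hη (by norm_num) j) (by norm_num) i).continuousOn
  have hJ : ∀ i j, Measurable (O.indicator fun x => D.J t x i j) := fun i j =>
    hcont (continuousOn_J ht i j)
  have hg : ∀ j, Measurable (O.indicator fun x => D.gradJ η t x j) := fun j =>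
    hsum fun i => hmul (hb i) (hJ i j)
  have c1 : ∀ j, ContinuousOn (fun p : Param s × EuclideanSpace ℝ (Fin (D.N t)) =>
      cqf (D.T1 t j p.1) p.2) (O ×ˢ Set.univ) := fun j => continuousOn_cqf
    (continuousOn_R_mul_mul_R ht ((contDiffOn_redForm ht j).of_le (by simp)))
  have c2 : ∀ i j, ContinuousOn (fun p : Param s × EuclideanSpace ℝ (Fin (D.N t)) =>
      cqf (D.T2 t i j p.1) p.2) (O ×ˢ Set.univ) := fun i j => continuousOn_cqf
    (continuousOn_R_mul_mul_R ht ((contDiffOn_redForm ht j).vpd hO (by simp) i))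
  have c3 : ∀ i j k, ContinuousOn (fun p : Param s × EuclideanSpace ℝ (Fin (D.N t)) =>
      cqf (D.T3 t i j k p.1) p.2) (O ×ˢ Set.univ) := fun i j k => continuousOn_cqf
    (continuousOn_R_mul_mul_R ht
      (((contDiffOn_redForm ht k).vpd hO (k' := ∞) (by simp) j).vpd hO (by simp) i))
  have m3 : ∀ i j k, ContinuousOn (fun p : Param s × EuclideanSpace ℝ (Fin (D.N t)) =>
      D.mean3 t i j k p.1) (O ×ˢ Set.univ) := fun i j k => by
    have h : ContinuousOn (D.mean3 t i j k) O := by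
      have h1 : ContDiffOn ℝ ∞ (vpd i (vpd j (redConst (D.K t) σ k))) O :=
        ((contDiffOn_redConst ht k).vpd hO (k' := ∞) (by simp) j).vpd hO (by simp) i
      have h2 : ContDiffOn ℝ ∞ (vpd i (vpd j (redForm (D.K t) σ k))) O :=
        ((contDiffOn_redForm ht k).vpd hO (k' := ∞) (by simp) j).vpd hO (by simp) i
      exact (h1.add ((h2.matMul (contDiff_redCov (D.K t) σ).contDiffOn).trace)).continuousOn
    exact h.comp continuousOn_fst fun p hp => hp.1
  have hU1 : ∀ i l, Measurable (O.indicator fun x => (S t).U1 x i l) := fun i l =>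
    measurable_indicator_integral hO
      ((((c1 i).div_const √(t : ℝ)).mul ((c1 l).div_const √(t : ℝ))).mul continuousOn_const)
      fun x hx => U1_eq ht hx i l
  have hU2 : ∀ j k l, Measurable (O.indicator fun x => (S t).U2 x j k l) := fun j k l =>
    measurable_indicator_integral hO
      ((((c2 j k).div_const √(t : ℝ)).mul ((c1 l).div_const √(t : ℝ))).mul continuousOn_const)
      fun x hx => U2_eq ht hx j k l
  have hU3 : ∀ j k l m n, Measurable (O.indicator fun x => (S t).U3 x j k l m n) :=
    fun j k l m n => measurable_indicator_integral hO
      (((((m3 j k m).add (c3 j k m)).div_const (t : ℝ)).mul ((c1 l).div_const √(t : ℝ))).mul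
        ((c1 n).div_const √(t : ℝ))) fun x hx => U3_eq ht hx j k l m n
  have e : D.bias η t = fun x =>
      (∑ j, ∑ k, ∑ l, D.gradJ η t x j * D.J t x k l * (S t).U2 x j k l +
      1 / 2 * ∑ i, ∑ j, ∑ k, ∑ l,
        D.J t x i j * pderiv j (pderiv k (η t)) x * D.J t x k l * (S t).U1 x i l) +
      -(1 / 2) * ∑ j, ∑ k, ∑ l, ∑ n, ∑ m,
        D.gradJ η t x j * D.J t x m n * D.J t x k l * (S t).U3 x j n m k l := by
    funext x; rw [bias]; ring
  rw [e]
  refine hadd (hadd (hsum fun j => hsum fun k => hsum fun l => hmul (hmul (hg j) (hJ k l))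
    (hU2 j k l)) (hmul (hc _) (hsum fun i => hsum fun j => hsum fun k => hsum fun l =>
      hmul (hmul (hmul (hJ i j) (hB j k)) (hJ k l)) (hU1 i l)))) (hmul (hc _) (hsum fun j =>
      hsum fun k => hsum fun l => hsum fun n => hsum fun m =>
        hmul (hmul (hmul (hg j) (hJ m n)) (hJ k l)) (hU3 j n m k l)))

/-- The estimator `etaHat` is measurable. -/
lemma measurable_etaHat (ht : D.t₀ ≤ t) {η : ℕ → Param s → ℝ}
    (hη : ContDiffOn ℝ 3 (η t) (interior (S t).Θ)) (c lam : ℝ) (σstar : Param s)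
    {σhat : (S t).Y → Param s} (hσ : Measurable σhat) :
    Measurable ((S t).etaHat (η t) c lam σstar σhat) := by
  classical
  set O := interior (S t).Θ
  set f : Param s → ℝ := fun x => O.indicator (η t) x - (t : ℝ)⁻¹ * O.indicator (D.bias η t) x
  have hf : Measurable f := by
    refine Measurable.sub ?_ ((measurable_indicator_bias ht hη).const_mul _)
    rw [← Set.piecewise_eq_indicator]
    exact hη.continuousOn.measurable_piecewise continuousOn_const isOpen_interior.measurableSet
  have hfc : ∀ x ∈ O, (S t).corrected (η t) x = f x := fun x hx => by
    rw [corrected_eq ht hx]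
    simp only [f, Set.indicator_of_mem hx]
  have e : (S t).etaHat (η t) c lam σstar σhat = fun y =>
      if σhat y ∈ O ∧ |f (σhat y)| ≤ c * (S t).dStar ^ lam then f (σhat y)
      else η t σstar := by
    funext y
    rw [ScoreModel.etaHat]
    by_cases hy : σhat y ∈ O
    · rw [hfc _ hy]
    · rw [if_neg fun h => hy h.1, if_neg fun h => hy h.1]
  rw [e]
  have hfσ : Measurable fun y => f (σhat y) := hf.comp hσ
  refine Measurable.ite ?_ hfσ measurable_const
  exact (hσ isOpen_interior.measurableSet).inter (measurableSet_le hfσ.abs measurable_const)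

end REMLReduction

end

end EmpiricalPredictor

namespace EmpiricalPredictor

noncomputable section

open scoped ContDiff MatrixOrder

lemma pderiv_comm_of_contDiffOn {s : ℕ} {O : Set (Param s)} (hO : IsOpen O) {f : Param s → ℝ}
    (hf : ContDiffOn ℝ 2 f O) {x : Param s} (hx : x ∈ O) (i j : Fin s) :
    pderiv i (pderiv j f) x = pderiv j (pderiv i f) x := by
  have hd : DifferentiableAt ℝ (fderiv ℝ f) x :=
    ((hf.fderiv_of_isOpen hO (m := 1) (by norm_num)).contDiffAt
      (hO.mem_nhds hx)).differentiableAt one_ne_zero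
  have h : ∀ i j : Fin s, pderiv i (pderiv j f) x = fderiv ℝ (fderiv ℝ f) x
      (EuclideanSpace.single i 1) (EuclideanSpace.single j 1) := fun i j => by
    have h1 := hd.hasFDerivAt.clm_apply (hasFDerivAt_const (EuclideanSpace.single j (1:ℝ)) x)
    have h2 : fderiv ℝ (pderiv j f) x = _ := h1.fderiv
    rw [pderiv, h2]
    simp
  rw [h, h]
  exact (hf.contDiffAt (hO.mem_nhds hx)).isSymmSndFDerivAt (by simp) _ _

namespace REMLReduction

variable {s : ℕ} {S : ℕ → ScoreModel s} {σ : Param s} {D : REMLReduction S σ}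
  {t : ℕ} {x : Param s}

lemma F_symm (ht : D.t₀ ≤ t) (hx : x ∈ interior (S t).Θ) (y : (S t).Y) (i j : Fin s) :
    (S t).F x y i j = (S t).F x y j i :=
  pderiv_comm_of_contDiffOn isOpen_interior ((contDiffOn_l ht y).of_le (by norm_cast)) hx i j

lemma H_comm₁₂ (ht : D.t₀ ≤ t) (hx : x ∈ interior (S t).Θ) (y : (S t).Y) (i j k : Fin s) :
    (S t).H x y i j k = (S t).H x y j i k :=
  pderiv_comm_of_contDiffOn isOpen_interior (f := pderiv k fun x => (S t).l x y)
    ((contDiffOn_l ht y).vpd isOpen_interior (by norm_cast) k) hx i j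

lemma H_comm₂₃ (ht : D.t₀ ≤ t) (hx : x ∈ interior (S t).Θ) (y : (S t).Y) (i j k : Fin s) :
    (S t).H x y i j k = (S t).H x y i k j :=
  vpd_congr isOpen_interior (fun _ hz => F_symm ht hz y j k) i hx

/-! #### The second order expansion -/

/-- The normalized leading term of `A⁻¹ a`. -/
def V (D : REMLReduction S σ) (i : Fin s) (t : ℕ) (z : EuclideanSpace ℝ (Fin (D.N t))) : ℝ :=
  ∑ j, D.J t σ i j * D.α j t z

/-- The normalized third derivatives at the true parameter. -/
def hs (D : REMLReduction S σ) (i j k : Fin s) (t : ℕ) (z : EuclideanSpace ℝ (Fin (D.N t))) : ℝ :=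
  (D.mean3 t i j k σ + √t * D.χ i j k t z) / t

/-- The stochastic expansion of `η` at a root of the score equation. -/
def expansion (D : REMLReduction S σ) (η : ℕ → Param s → ℝ) (t : ℕ)
    (z : EuclideanSpace ℝ (Fin (D.N t))) : ℝ :=
  -(√t)⁻¹ * ∑ i, pderiv i (η t) σ * D.V i t z +
  (t : ℝ)⁻¹ * (∑ j, D.gradJ η t σ j * ∑ k, D.Φ j k t z * D.V k t z +
    1 / 2 * ∑ j, ∑ k, pderiv j (pderiv k (η t)) σ * (D.V j t z * D.V k t z) -
    1 / 2 * ∑ j, D.gradJ η t σ j * ∑ n, ∑ k, D.hs j n k t z * (D.V n t z * D.V k t z))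

/-- The algebra behind the second order expansion of a linear function of a root. -/
lemma linear_expansion {b h V g a p p' u u' R α : Fin s → ℝ} {A J : Matrix (Fin s) (Fin s) ℝ}
    {r : ℝ} (hr : 0 < r) (hJA : J * ((r * r)⁻¹ • A) = 1) (hg : ∀ j, g j = ∑ i, b i * J i j)
    (hV : ∀ i, V i = ∑ j, J i j * α j) (ha : ∀ j, a j = r * α j)
    (hA : ∀ j, (A *ᵥ h) j =
      -a j - r * (-r⁻¹ * p j + p' j) - 1 / 2 * ((r * r)⁻¹ * u j + u' j) - R j) :
    ∑ i, b i * h i = -r⁻¹ * ∑ i, b i * V i + (r * r)⁻¹ * (∑ j, g j * p j -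
      1 / 2 * ∑ j, g j * ((r * r)⁻¹ * u j)) -
      (r⁻¹ * ∑ j, g j * p' j + (r * r)⁻¹ * (1 / 2 * ∑ j, g j * u' j + ∑ j, g j * R j)) := by
  have h1 : ∑ i, b i * h i = (r * r)⁻¹ * ∑ j, g j * (A *ᵥ h) j := by
    have e1 : b ⬝ᵥ h = b ⬝ᵥ ((J * ((r * r)⁻¹ • A)) *ᵥ h) := by rw [hJA, Matrix.one_mulVec]
    rw [← Matrix.mulVec_mulVec, Matrix.dotProduct_mulVec, Matrix.smul_mulVec, dotProduct_smul,
      smul_eq_mul] at e1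
    have e2 : g = b ᵥ* J := funext hg
    rw [e2]
    exact e1
  have h2 : ∑ i, b i * V i = ∑ j, g j * α j := by
    simp only [hV, hg, Finset.mul_sum, Finset.sum_mul]
    rw [Finset.sum_comm]
    exact Finset.sum_congr rfl fun j _ => Finset.sum_congr rfl fun i _ => by ring
  rw [h1, h2]
  simp only [hA, ha, Finset.mul_sum, ← Finset.sum_add_distrib, ← Finset.sum_sub_distrib]
  refine Finset.sum_congr rfl fun j _ => ?_
  field_simp
  ring

lemma abs_sum_le_of_le {f : Fin s → ℝ} {M : ℝ} (h : ∀ i, |f i| ≤ M) : |∑ i, f i| ≤ s * M := by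
  refine (Finset.abs_sum_le_sum_abs _ _).trans ((Finset.sum_le_sum fun i _ => h i).trans ?_)
  simp

lemma abs_mul_sub_mul_le {h₁ h₂ w₁ w₂ a b e : ℝ} (ha : |h₁| ≤ a) (hb : |w₂| ≤ b)
    (he₁ : |h₁ - w₁| ≤ e) (he₂ : |h₂ - w₂| ≤ e) : |h₁ * h₂ - w₁ * w₂| ≤ (a + b) * e := by
  have h : h₁ * h₂ - w₁ * w₂ = h₁ * (h₂ - w₂) + (h₁ - w₁) * w₂ := by ring
  rw [h]
  refine (abs_add_le _ _).trans ?_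
  rw [abs_mul, abs_mul, add_mul, mul_comm b]
  have h0 : 0 ≤ e := (abs_nonneg _).trans he₁
  have h1 : 0 ≤ a := (abs_nonneg _).trans ha
  gcongr

lemma J_mul_info₂ (ht : D.t₀ ≤ t) : D.J t σ * ((t : ℝ)⁻¹ • D.info₂ t σ) = 1 :=
  Matrix.nonsing_inv_mul _ (inv_smul_info₂ ht self_mem_ball).1

lemma inv_info₂_mulVec_score (ht : D.t₀ ≤ t) (y : (S t).Y) (i : Fin s) :
    ((D.info₂ t σ)⁻¹ *ᵥ (S t).score σ y) i = (√t)⁻¹ * D.V i t (D.L t y) := by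
  have h0 := sqrt_pos ht
  have h1 : (t : ℝ) = √t * √t := (Real.mul_self_sqrt (cast_pos ht).le).symm
  rw [inv_info₂_eq ht (self_mem_interior ht), Matrix.smul_mulVec, Pi.smul_apply, smul_eq_mul, V,
    Matrix.mulVec, dotProduct, Finset.mul_sum, Finset.mul_sum]
  refine Finset.sum_congr rfl fun j _ => ?_
  rw [score_self_eq ht, h1]
  rw [Real.sqrt_mul_self (Real.sqrt_nonneg _)]
  field_simp

/-- The error of the second order expansion at a root of the score equation. -/
lemma exists_expansion_error {η : ℕ → Param s → ℝ} (hη : EtaBdd D η) {C₀ : ℝ} (hC₀ : 0 ≤ C₀) :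
    ∃ C ≥ 0, ∀ t ≥ D.t₀, ∀ y, ∀ x ∈ Metric.ball σ D.r, (S t).score x y = 0 →
      ‖x - σ‖ ≤ C₀ * ((√t)⁻¹ * D.Ψ t (D.L t y)) →
      |η t x - η t σ - D.expansion η t (D.L t y)| ≤
        C * ((√t)⁻¹ ^ 3 * (D.dom t (D.L t y) ^ 2 * D.Ψ t (D.L t y) ^ 3)) := by
  obtain ⟨G, hG, hgJ⟩ := UnifLip.exists_common (D := D) (unifLip_gradJ hη)
  obtain ⟨Cη, hCη, hηb⟩ := hη
  obtain ⟨CS, hCS, hS⟩ := D.exists_bddDeriv_score 3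
  obtain ⟨CH, hCH, hH⟩ := D.exists_abs_H_le
  obtain ⟨Cr, hCr, hR⟩ := D.exists_remainder
  have hc := D.c_pos
  set C₁ : ℝ := Cr * (C₀ + C₀ ^ 2) with hC₁
  set C₂ : ℝ := (C₀ + 18 / D.c) * C₁ with hC₂
  have hC₁0 : 0 ≤ C₁ := by positivity
  have hC₂0 : 0 ≤ C₂ := by positivity
  refine ⟨s ^ 3 * Cη * C₀ ^ 3 + s * (s * (Cη * C₂)) + s * (G * (s * C₁)) +
    s * (G * (s * (s * (CH * C₂)))) + s * (G * (s ^ 3 * CS * C₀ ^ 3)), by positivity,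
    fun t ht y x hx h0 hh => ?_⟩
  have ht0 := cast_pos ht
  have hs0 := sqrt_pos ht
  have hrr : (t : ℝ) = √t * √t := (Real.mul_self_sqrt ht0.le).symm
  have hI := self_mem_interior (D := D) ht
  have hd1 := one_le_dom (D := D) (D.L t y)
  have hP0 := Ψ_nonneg (D := D) (D.L t y)
  set z := D.L t y with hz
  set P := D.Ψ t z with hP
  set d := D.dom t z with hd
  set q : ℝ := (√t)⁻¹ with hq
  have hq0 : 0 < q := inv_pos.2 hs0
  have hd0 : 0 ≤ d := zero_le_one.trans hd1
  -- `h` is the exact deviation of the root and `w` its leading term `-A⁻¹a`. They differ by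
  -- `O(t⁻¹)`, so replacing `h` by `w` in a product of two coordinates costs `O(t^{-3/2})`.
  set h : Fin s → ℝ := fun i => x i - σ i with hh'
  set w : Fin s → ℝ := fun i => -(q * D.V i t z) with hw
  have b_h : ∀ i, |h i| ≤ C₀ * (q * P) := fun i => (PiLp.norm_apply_le (x - σ) i).trans hh
  have b_w : ∀ i, |w i| ≤ 18 / D.c * (q * P) := fun i => by
    rw [hw, abs_neg, ← inv_info₂_mulVec_score ht y i]
    exact (PiLp.norm_apply_le (WithLp.toLp 2 ((D.info₂ t σ)⁻¹ *ᵥ (S t).score σ y)) i).trans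
      (norm_inv_info₂_score_le ht y)
  have b_e : ∀ i, |h i - w i| ≤ C₁ * (q ^ 2 * d * P ^ 2) := fun i => by
    have e : h i - w i =
        (x - σ + WithLp.toLp 2 ((D.info₂ t σ)⁻¹ *ᵥ (S t).score σ y)) i := by
      change x i - σ i - -(q * D.V i t z) =
        x i - σ i + ((D.info₂ t σ)⁻¹ *ᵥ (S t).score σ y) i
      rw [inv_info₂_mulVec_score ht y i, sub_neg_eq_add]
    rw [e]
    refine (PiLp.norm_apply_le _ i).trans ((hR t ht y x hx h0).trans ?_)
    calc Cr * (q * P * ‖x - σ‖ + d * ‖x - σ‖ ^ 2)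
        ≤ Cr * (q * P * (C₀ * (q * P)) + d * (C₀ * (q * P)) ^ 2) := by gcongr
      _ = Cr * (C₀ * (q ^ 2 * 1 * P ^ 2) + C₀ ^ 2 * (q ^ 2 * d * P ^ 2)) := by ring
      _ ≤ Cr * (C₀ * (q ^ 2 * d * P ^ 2) + C₀ ^ 2 * (q ^ 2 * d * P ^ 2)) := by gcongr
      _ = _ := by rw [hC₁]; ring
  have b_hw : ∀ i k, |h i * h k - w i * w k| ≤ C₂ * (q ^ 3 * d * P ^ 3) := fun i k => by
    refine (abs_mul_sub_mul_le (b_h i) (b_w k) (b_e i) (b_e k)).trans (le_of_eq ?_)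
    rw [hC₂]; ring
  have b_h3 : ‖x - σ‖ ^ 3 ≤ C₀ ^ 3 * (q ^ 3 * 1 * P ^ 3) := by
    refine (pow_le_pow_left₀ (norm_nonneg _) hh 3).trans (le_of_eq ?_)
    ring
  set R : Fin s → ℝ := fun j => (S t).score x y j - (S t).score σ y j -
    ∑ i, (x i - σ i) * pderiv i (fun x => (S t).score x y j) σ -
    1 / 2 * ∑ i, ∑ k, (x i - σ i) * (x k - σ k) *
      pderiv i (pderiv k (fun x => (S t).score x y j)) σ with hRdef
  have b_R : ∀ j, |R j| ≤ t * (s ^ 3 * CS * C₀ ^ 3 * (q ^ 3 * d * P ^ 3)) := fun j => by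
    refine ((hS t ht y j).taylor_two hx).trans ?_
    calc s ^ 3 * (CS * t * d) * ‖x - σ‖ ^ 3 ≤ s ^ 3 * (CS * t * d) *
          (C₀ ^ 3 * (q ^ 3 * 1 * P ^ 3)) := by gcongr
      _ = _ := by ring
  -- The score equation is expanded to second order and solved for `A h`. The unprimed `p` and `u`
  -- collect the terms with `h` replaced by `w`, which enter the expansion; `p'`, `u'` and `R` are
  -- errors.
  have key := linear_expansion (b := fun i => pderiv i (η t) σ) (h := h)
    (V := fun i => D.V i t z) (g := D.gradJ η t σ) (a := (S t).score σ y)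
    (p := fun j => ∑ k, D.Φ j k t z * D.V k t z)
    (p' := fun j => ∑ k, D.Φ j k t z * (h k - w k))
    (u := fun j => ∑ n, ∑ k, (S t).H σ y j n k * (D.V n t z * D.V k t z))
    (u' := fun j => ∑ n, ∑ k, (S t).H σ y j n k * (h n * h k - w n * w k))
    (R := R) (α := fun j => D.α j t z) (A := D.info₂ t σ) (J := D.J t σ) hs0
    (by rw [← hrr]; exact J_mul_info₂ ht) (fun j => rfl) (fun i => rfl)
    (fun j => score_self_eq ht y j) (fun j => by
      have e1 : ∑ i, (x i - σ i) * pderiv i (fun x => (S t).score x y j) σ =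
          (D.info₂ t σ *ᵥ h) j + √t * ∑ k, D.Φ j k t z * h k := by
        rw [Matrix.mulVec, dotProduct, Finset.mul_sum, ← Finset.sum_add_distrib]
        refine Finset.sum_congr rfl fun i _ => ?_
        have e2 : pderiv i (fun x => (S t).score x y j) σ = (S t).F σ y i j := rfl
        rw [e2, F_symm ht hI, F_self_eq ht, A_eq ht hI]
        ring
      have e3 : ∑ i, ∑ k, (x i - σ i) * (x k - σ k) *
          pderiv i (pderiv k (fun x => (S t).score x y j)) σ =
          ∑ i, ∑ k, (S t).H σ y j i k * (h i * h k) := by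
        refine Finset.sum_congr rfl fun i _ => Finset.sum_congr rfl fun k _ => ?_
        have e2 : pderiv i (pderiv k (fun x => (S t).score x y j)) σ = (S t).H σ y i k j := rfl
        rw [e2, H_comm₂₃ ht hI, H_comm₁₂ ht hI, mul_comm]
      have e4 : ∑ k, D.Φ j k t z * h k = -(√t)⁻¹ * ∑ k, D.Φ j k t z * D.V k t z +
          ∑ k, D.Φ j k t z * (h k - w k) := by
        rw [Finset.mul_sum, ← Finset.sum_add_distrib]
        exact Finset.sum_congr rfl fun k _ => by rw [hw]; ring
      have e5 : ∑ n, ∑ k, (S t).H σ y j n k * (h n * h k) =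
          (√(t : ℝ) * √t)⁻¹ * ∑ n, ∑ k, (S t).H σ y j n k * (D.V n t z * D.V k t z) +
          ∑ n, ∑ k, (S t).H σ y j n k * (h n * h k - w n * w k) := by
        simp only [Finset.mul_sum, ← Finset.sum_add_distrib]
        refine Finset.sum_congr rfl fun n _ => Finset.sum_congr rfl fun k _ => ?_
        rw [hw, mul_inv, ← hq]; ring
      rw [← e4, ← e5, hRdef]
      simp only [e1, e3, h0, Pi.zero_apply]
      ring)
  have b_η := (hηb t ht).2.taylor_two hx
  set Rη : ℝ := η t x - η t σ - ∑ i, (x i - σ i) * pderiv i (η t) σ -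
    1 / 2 * ∑ i, ∑ j, (x i - σ i) * (x j - σ j) * pderiv i (pderiv j (η t)) σ with hRη
  set E₁ : ℝ := ∑ j, ∑ k, pderiv j (pderiv k (η t)) σ * (h j * h k - w j * w k) with hE₁
  set E₂ : ℝ := ∑ j, D.gradJ η t σ j * ∑ k, D.Φ j k t z * (h k - w k) with hE₂
  set E₃ : ℝ := ∑ j, D.gradJ η t σ j *
    ∑ n, ∑ k, (S t).H σ y j n k * (h n * h k - w n * w k) with hE₃
  set E₄ : ℝ := ∑ j, D.gradJ η t σ j * R j with hE₄
  have eη : ∑ i, ∑ j, (x i - σ i) * (x j - σ j) * pderiv i (pderiv j (η t)) σ =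
      (t : ℝ)⁻¹ * ∑ j, ∑ k, pderiv j (pderiv k (η t)) σ * (D.V j t z * D.V k t z) + E₁ := by
    rw [hE₁]
    simp only [Finset.mul_sum, ← Finset.sum_add_distrib]
    refine Finset.sum_congr rfl fun n _ => Finset.sum_congr rfl fun k _ => ?_
    rw [hrr, mul_inv, ← hq]
    simp only [hw, hh']
    ring
  have eh : ∀ j, ∑ n, ∑ k, D.hs j n k t z * (D.V n t z * D.V k t z) =
      (√(t : ℝ) * √t)⁻¹ * ∑ n, ∑ k, (S t).H σ y j n k * (D.V n t z * D.V k t z) := fun j => by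
    rw [← hrr]
    simp only [Finset.mul_sum]
    refine Finset.sum_congr rfl fun n _ => Finset.sum_congr rfl fun k _ => ?_
    rw [hs, H_self_eq ht, div_eq_inv_mul]; ring
  -- The error consists of the Taylor remainder of `η`, the replacement errors in its quadratic term
  -- and in the second and third derivatives of the criterion, and the Taylor remainder of the
  -- score. Each is `O(t^{-3/2})`.
  have total : η t x - η t σ - D.expansion η t z =
      Rη + 1 / 2 * E₁ - q * E₂ - 1 / 2 * ((t : ℝ)⁻¹ * E₃) - (t : ℝ)⁻¹ * E₄ := by
    have e0 : ∑ i, (x i - σ i) * pderiv i (η t) σ = ∑ i, pderiv i (η t) σ * h i :=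
      Finset.sum_congr rfl fun i _ => mul_comm _ _
    rw [hRη, e0, key, eη, expansion]
    simp only [eh]
    rw [← hrr]
    ring
  have i₁ : |E₁| ≤ s * (s * (Cη * (C₂ * (q ^ 3 * d * P ^ 3)))) :=
    abs_sum_le_of_le fun j => abs_sum_le_of_le fun k => by
      rw [abs_mul]
      exact mul_le_mul ((((hηb t ht).2.vpd k).vpd j).norm_le self_mem_ball) (b_hw j k)
        (abs_nonneg _) hCη
  have i₂ : |E₂| ≤ s * (G * (s * (P * (C₁ * (q ^ 2 * d * P ^ 2))))) :=
    abs_sum_le_of_le fun j => by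
      rw [abs_mul]
      refine mul_le_mul (hgJ t ht σ self_mem_ball j).1 (abs_sum_le_of_le fun k => ?_)
        (abs_nonneg _) hG
      rw [abs_mul]
      exact mul_le_mul (abs_Φ_le j k z) (b_e k) (abs_nonneg _) hP0
  have i₃ : |E₃| ≤ s * (G * (s * (s * (CH * t * d * (C₂ * (q ^ 3 * d * P ^ 3)))))) :=
    abs_sum_le_of_le fun j => by
      rw [abs_mul]
      refine mul_le_mul (hgJ t ht σ self_mem_ball j).1
        (abs_sum_le_of_le fun n => abs_sum_le_of_le fun k => ?_) (abs_nonneg _) hG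
      rw [abs_mul]
      exact mul_le_mul (hH t ht y σ self_mem_ball j n k) (b_hw n k) (abs_nonneg _)
        (by positivity)
  have i₄ : |E₄| ≤ s * (G * (t * (s ^ 3 * CS * C₀ ^ 3 * (q ^ 3 * d * P ^ 3)))) :=
    abs_sum_le_of_le fun j => by
      rw [abs_mul]
      exact mul_le_mul (hgJ t ht σ self_mem_ball j).1 (b_R j) (abs_nonneg _) hG
  have i₀ : |Rη| ≤ s ^ 3 * Cη * (C₀ ^ 3 * (q ^ 3 * 1 * P ^ 3)) :=
    b_η.trans (by gcongr)
  -- Since `d ≥ 1`, lower powers of `d` are raised to `d²`, giving all errors a common majorant.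
  have hdd : q ^ 3 * d * P ^ 3 ≤ q ^ 3 * (d ^ 2 * P ^ 3) := by
    rw [mul_assoc]
    gcongr
    exact le_self_pow₀ hd1 two_ne_zero
  have hd1' : q ^ 3 * 1 * P ^ 3 ≤ q ^ 3 * (d ^ 2 * P ^ 3) := by
    rw [mul_assoc]
    gcongr
    exact one_le_pow₀ hd1
  set X : ℝ := q ^ 3 * (d ^ 2 * P ^ 3) with hX
  have f₀ : |Rη| ≤ s ^ 3 * Cη * C₀ ^ 3 * X := i₀.trans (by rw [mul_assoc (_ * Cη)]; gcongr)
  have f₁ : |1 / 2 * E₁| ≤ s * (s * (Cη * C₂)) * X := by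
    rw [abs_mul, abs_of_pos (by norm_num : (0:ℝ) < 1 / 2)]
    have : (s : ℝ) * (s * (Cη * (C₂ * (q ^ 3 * d * P ^ 3)))) ≤ s * (s * (Cη * (C₂ * X))) := by
      gcongr
    have := abs_nonneg E₁
    linarith
  have f₂ : |q * E₂| ≤ s * (G * (s * C₁)) * X := by
    rw [abs_mul, abs_of_pos hq0]
    calc q * |E₂| ≤ q * (s * (G * (s * (P * (C₁ * (q ^ 2 * d * P ^ 2)))))) := by gcongr
      _ = s * (G * (s * C₁)) * (q ^ 3 * d * P ^ 3) := by ring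
      _ ≤ _ := by gcongr
  have f₃ : |1 / 2 * ((t : ℝ)⁻¹ * E₃)| ≤ s * (G * (s * (s * (CH * C₂)))) * X := by
    rw [abs_mul, abs_mul, abs_of_pos (by norm_num : (0:ℝ) < 1 / 2), abs_of_pos (inv_pos.2 ht0)]
    have e : (t : ℝ)⁻¹ * |E₃| ≤ s * (G * (s * (s * (CH * C₂)))) * X := by
      rw [inv_mul_le_iff₀ ht0]
      refine i₃.trans (le_of_eq ?_)
      rw [hX]; ring
    have : 0 ≤ (t : ℝ)⁻¹ * |E₃| := by positivity
    linarith
  have f₄ : |(t : ℝ)⁻¹ * E₄| ≤ s * (G * (s ^ 3 * CS * C₀ ^ 3)) * X := by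
    rw [abs_mul, abs_of_pos (inv_pos.2 ht0), inv_mul_le_iff₀ ht0]
    calc |E₄| ≤ s * (G * (t * (s ^ 3 * CS * C₀ ^ 3 * (q ^ 3 * d * P ^ 3)))) := i₄
      _ ≤ s * (G * (t * (s ^ 3 * CS * C₀ ^ 3 * X))) := by gcongr
      _ = _ := by ring
  rw [total]
  have g1 := abs_sub (Rη + 1 / 2 * E₁ - q * E₂ - 1 / 2 * ((t : ℝ)⁻¹ * E₃)) ((t : ℝ)⁻¹ * E₄)
  have g2 := abs_sub (Rη + 1 / 2 * E₁ - q * E₂) (1 / 2 * ((t : ℝ)⁻¹ * E₃))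
  have g3 := abs_sub (Rη + 1 / 2 * E₁) (q * E₂)
  have g4 := abs_add_le Rη (1 / 2 * E₁)
  linarith

end REMLReduction

end

end EmpiricalPredictor

/-! ### The mean of the stochastic expansion -/

namespace EmpiricalPredictor

noncomputable section

open scoped ContDiff MatrixOrder

namespace REMLReduction

variable {s : ℕ} {S : ℕ → ScoreModel s} {σ : Param s} {D : REMLReduction S σ}
  {t : ℕ} {x : Param s}

lemma UnifLip.allMom {f : ℕ → Param s → ℝ} (hf : UnifLip D f) : AllMom D fun t _ => f t σ := by
  obtain ⟨C, -, h⟩ := hf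
  exact .of_bdd fun t ht => (h t ht σ self_mem_ball).1

lemma allMom_inv_sqrt (D : REMLReduction S σ) : AllMom D fun t _ => (√(t : ℝ))⁻¹ :=
  .of_bdd fun _ ht => inv_sqrt_le_one ht

lemma allMom_inv (D : REMLReduction S σ) : AllMom D fun t _ => (t : ℝ)⁻¹ := by
  have h := (allMom_inv_sqrt D).mul (allMom_inv_sqrt D)
  have e : ∀ t : ℕ, (√(t : ℝ))⁻¹ * (√(t : ℝ))⁻¹ = (t : ℝ)⁻¹ := fun t => by
    rw [← mul_inv, Real.mul_self_sqrt (Nat.cast_nonneg t)]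
  simpa only [e] using h

lemma allMom_V (i : Fin s) : AllMom D (D.V i) :=
  AllMom.sum _ fun j _ => (unifLip_inv_info₂ i j).allMom.mul (allMom_α j)

lemma allMom_hs (i j k : Fin s) : AllMom D (D.hs i j k) := by
  have h := (unifLip_mean3 (D := D) i j k).allMom.add ((allMom_inv_sqrt D).mul (allMom_χ i j k))
  convert h using 3 with t z
  rw [hs, add_div, mul_comm √(t : ℝ), mul_div_assoc, Real.sqrt_div_self', mul_comm, one_div]

lemma allMom_expansion {η : ℕ → Param s → ℝ} (hη : EtaBdd D η) : AllMom D (D.expansion η) := by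
  have h1 := AllMom.sum Finset.univ fun i _ => (hη.unifLip_pderiv i).allMom.mul (allMom_V i)
  have h2 := AllMom.sum Finset.univ fun j _ => (unifLip_gradJ hη j).allMom.mul
    (AllMom.sum Finset.univ fun k _ => (allMom_Φ j k).mul (allMom_V k))
  have h3 := AllMom.sum Finset.univ fun j _ => AllMom.sum Finset.univ fun k _ =>
    (hη.unifLip_pderiv₂ j k).allMom.mul ((allMom_V j).mul (allMom_V k))
  have h4 := AllMom.sum Finset.univ fun j _ => (unifLip_gradJ hη j).allMom.mul
    (AllMom.sum Finset.univ fun n _ => AllMom.sum Finset.univ fun k _ =>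
      (allMom_hs j n k).mul ((allMom_V n).mul (allMom_V k)))
  have h := (((allMom_inv_sqrt D).const_mul (-1)).mul h1).add ((allMom_inv D).mul
    ((h2.add (h3.const_mul (1 / 2))).add (h4.const_mul (-(1 / 2)))))
  convert h using 3 with t z
  rw [expansion]
  ring

lemma AllMom.integrable {Y : ∀ t, EuclideanSpace ℝ (Fin (D.N t)) → ℝ} (hY : AllMom D Y)
    (ht : D.t₀ ≤ t) : Integrable (fun y => Y t (D.L t y)) ((S t).law σ) :=
  integrable_law ht (self_mem_interior ht) (hY.1 t)

lemma AllMom.exists_integral_abs_le {Y : ∀ t, EuclideanSpace ℝ (Fin (D.N t)) → ℝ}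
    (hY : AllMom D Y) : ∃ C ≥ 0, ∀ t ≥ D.t₀, ∫ y, |Y t (D.L t y)| ∂(S t).law σ ≤ C := by
  obtain ⟨C, hC, h⟩ := hY.2 1
  refine ⟨1 + C, by positivity, fun t ht => ?_⟩
  have e := integral_law ht (self_mem_interior (D := D) ht) (hY.abs.1 t).1
  rw [R_self] at e
  rw [e]
  simp only [map_one, one_apply_eq_self]
  calc ∫ z, |Y t z| ∂D.γ t ≤ ∫ z, (1 + Y t z ^ (2 * 1)) ∂D.γ t :=
        integral_mono ((hY.abs.1 t).integrable _)
          (((PolyGrowth.const 1).add ((hY.1 t).pow _)).integrable _) fun z => by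
            simp only
            rw [mul_one, ← sq_abs]
            nlinarith [sq_nonneg (|Y t z| - 1 / 2)]
    _ ≤ 1 + C := by
        rw [integral_add (integrable_const _) (((hY.1 t).pow _).integrable _)]
        simp only [integral_const, probReal_univ, one_smul]
        have := h t ht
        gcongr

lemma integral_α (ht : D.t₀ ≤ t) (j : Fin s) :
    ∫ y, D.α j t (D.L t y) ∂(S t).law σ = 0 := by
  have h := integral_score_eq_zero ht (self_mem_interior (D := D) ht) j
  simp only [score_self_eq ht] at h
  rw [integral_const_mul] at h
  exact (mul_eq_zero.1 h).resolve_left (sqrt_pos ht).ne'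

lemma integral_α_mul_α (ht : D.t₀ ≤ t) (i l : Fin s) :
    ∫ y, D.α i t (D.L t y) * D.α l t (D.L t y) ∂(S t).law σ = (S t).U1 σ i l := by
  have h0 := sqrt_pos ht
  simp only [ScoreModel.U1, Matrix.of_apply, D.d_eq, score_self_eq ht,
    mul_div_cancel_left₀ _ h0.ne']

lemma integral_Φ_mul_α (ht : D.t₀ ≤ t) (j k l : Fin s) :
    ∫ y, D.Φ j k t (D.L t y) * D.α l t (D.L t y) ∂(S t).law σ = (S t).U2 σ j k l := by
  have h0 := sqrt_pos ht
  simp only [ScoreModel.U2, D.d_eq, score_self_eq ht, F_self_eq ht, add_sub_cancel_left,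
    Real.sqrt_mul_self h0.le, mul_div_cancel_left₀ _ h0.ne']

lemma integral_hs_mul_α_mul_α (ht : D.t₀ ≤ t) (j n k m l : Fin s) :
    ∫ y, D.hs j n k t (D.L t y) * D.α m t (D.L t y) * D.α l t (D.L t y) ∂(S t).law σ =
      (S t).U3 σ j n m k l := by
  have h0 := sqrt_pos ht
  simp only [ScoreModel.U3, D.d_eq, score_self_eq ht, H_self_eq ht,
    Real.mul_self_sqrt (cast_pos ht).le, mul_div_cancel_left₀ _ h0.ne', hs]

lemma integral_linear_combination {Ω : Type*} [MeasurableSpace Ω] {μ : Measure Ω}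
    {f₁ f₂ f₃ f₄ : Ω → ℝ} (h₁ : Integrable f₁ μ) (h₂ : Integrable f₂ μ) (h₃ : Integrable f₃ μ)
    (h₄ : Integrable f₄ μ) {a b : ℝ} :
    ∫ y, (f₁ y + a * (f₂ y + b * f₃ y - b * f₄ y)) ∂μ =
      ∫ y, f₁ y ∂μ + a * (∫ y, f₂ y ∂μ + b * ∫ y, f₃ y ∂μ - b * ∫ y, f₄ y ∂μ) := by
  have h23 : Integrable (fun y => f₂ y + b * f₃ y) μ := h₂.add (h₃.const_mul b)
  have h : Integrable (fun y => f₂ y + b * f₃ y - b * f₄ y) μ := h23.sub (h₄.const_mul b)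
  rw [integral_add h₁ (h.const_mul a), integral_const_mul, integral_sub h23 (h₄.const_mul b),
    integral_add h₂ (h₃.const_mul b), integral_const_mul, integral_const_mul]

/-- The term of order `t^{-1/2}` is linear in the score and has mean zero; the products in the term
of order `t⁻¹` have means `U1`, `U2`, `U3`. The identity with the total bias is exact, not
asymptotic. -/
lemma integral_expansion (ht : D.t₀ ≤ t) {η : ℕ → Param s → ℝ} :
    ∫ y, D.expansion η t (D.L t y) ∂(S t).law σ = (t : ℝ)⁻¹ * D.bias η t σ := by
  have hI := self_mem_interior (D := D) ht
  have pα : ∀ j, PolyGrowth (D.α j t) := fun j => (allMom_α j).1 t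
  have pΦ : ∀ i j, PolyGrowth (D.Φ i j t) := fun i j => (allMom_Φ i j).1 t
  have ph : ∀ i j k, PolyGrowth (D.hs i j k t) := fun i j k => (allMom_hs i j k).1 t
  have e : ∀ y, D.expansion η t (D.L t y) =
      ∑ i, ∑ j, -(√t)⁻¹ * (pderiv i (η t) σ * D.J t σ i j) * D.α j t (D.L t y) +
      (t : ℝ)⁻¹ * (∑ j, ∑ k, ∑ l, D.gradJ η t σ j * D.J t σ k l *
          (D.Φ j k t (D.L t y) * D.α l t (D.L t y)) +
        1 / 2 * ∑ i, ∑ j, ∑ k, ∑ l, D.J t σ i j * pderiv j (pderiv k (η t)) σ * D.J t σ k l *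
          (D.α i t (D.L t y) * D.α l t (D.L t y)) -
        1 / 2 * ∑ j, ∑ k, ∑ l, ∑ n, ∑ m, D.gradJ η t σ j * D.J t σ m n * D.J t σ k l *
          (D.hs j n k t (D.L t y) * D.α m t (D.L t y) * D.α l t (D.L t y))) := fun y => by
    set z := D.L t y
    -- The leading term uses rows of the inverse information and the bias formula also its columns;
    -- symmetry reconciles them.
    have hJ : ∀ i j, D.J t σ i j = D.J t σ j i := fun i j => ((J_symm t σ).apply i j).symm
    have e1 : -(√t)⁻¹ * ∑ i, pderiv i (η t) σ * D.V i t z =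
        ∑ i, ∑ j, -(√t)⁻¹ * (pderiv i (η t) σ * D.J t σ i j) * D.α j t z := by
      simp only [V, Finset.mul_sum, mul_assoc]
    have e2 : ∑ j, D.gradJ η t σ j * ∑ k, D.Φ j k t z * D.V k t z = ∑ j, ∑ k, ∑ l,
        D.gradJ η t σ j * D.J t σ k l * (D.Φ j k t z * D.α l t z) := by
      simp only [V, Finset.mul_sum]
      exact Finset.sum_congr rfl fun j _ => Finset.sum_congr rfl fun k _ =>
        Finset.sum_congr rfl fun l _ => by ring
    have e3 : ∑ j, ∑ k, pderiv j (pderiv k (η t)) σ * (D.V j t z * D.V k t z) =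
        ∑ i, ∑ j, ∑ k, ∑ l, D.J t σ i j * pderiv j (pderiv k (η t)) σ * D.J t σ k l *
          (D.α i t z * D.α l t z) := by
      rw [Finset.sum_comm (f := fun i j => ∑ k, ∑ l, _)]
      refine Finset.sum_congr rfl fun j _ => ?_
      rw [Finset.sum_comm (f := fun i k => ∑ l, _)]
      refine Finset.sum_congr rfl fun k _ => ?_
      simp only [V, Finset.mul_sum, Finset.sum_mul]
      rw [Finset.sum_comm]
      refine Finset.sum_congr rfl fun i _ => Finset.sum_congr rfl fun l _ => ?_
      rw [hJ i j]; ring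
    have e4 : ∑ j, D.gradJ η t σ j * ∑ n, ∑ k, D.hs j n k t z * (D.V n t z * D.V k t z) =
        ∑ j, ∑ k, ∑ l, ∑ n, ∑ m, D.gradJ η t σ j * D.J t σ m n * D.J t σ k l *
          (D.hs j n k t z * D.α m t z * D.α l t z) := by
      refine Finset.sum_congr rfl fun j _ => ?_
      rw [Finset.sum_comm, Finset.mul_sum]
      refine Finset.sum_congr rfl fun k _ => ?_
      rw [Finset.sum_comm (f := fun l n => ∑ m, _), Finset.mul_sum]
      refine Finset.sum_congr rfl fun n _ => ?_
      simp only [V, Finset.mul_sum, Finset.sum_mul]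
      refine Finset.sum_congr rfl fun l _ => Finset.sum_congr rfl fun m _ => ?_
      rw [hJ m n]; ring
    rw [expansion, e1, e2, e3, e4]
  have i1 : ∀ i j, Integrable (fun y => -(√t)⁻¹ * (pderiv i (η t) σ * D.J t σ i j) *
      D.α j t (D.L t y)) ((S t).law σ) := fun i j =>
    (integrable_law ht hI (pα j)).const_mul _
  have i2 : ∀ j k l, Integrable (fun y => D.gradJ η t σ j * D.J t σ k l *
      (D.Φ j k t (D.L t y) * D.α l t (D.L t y))) ((S t).law σ) := fun j k l =>
    (integrable_law ht hI ((pΦ j k).mul (pα l))).const_mul _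
  have i3 : ∀ i j k l, Integrable (fun y => D.J t σ i j * pderiv j (pderiv k (η t)) σ *
      D.J t σ k l * (D.α i t (D.L t y) * D.α l t (D.L t y))) ((S t).law σ) := fun i j k l =>
    (integrable_law ht hI ((pα i).mul (pα l))).const_mul _
  have i4 : ∀ j k l n m, Integrable (fun y => D.gradJ η t σ j * D.J t σ m n * D.J t σ k l *
      (D.hs j n k t (D.L t y) * D.α m t (D.L t y) * D.α l t (D.L t y))) ((S t).law σ) :=
    fun j k l n m => (integrable_law ht hI (((ph j n k).mul (pα m)).mul (pα l))).const_mul _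
  have s1 := integrable_finsetSum Finset.univ fun i _ =>
    integrable_finsetSum Finset.univ fun j _ => i1 i j
  have s2 := integrable_finsetSum Finset.univ fun j _ => integrable_finsetSum Finset.univ
    fun k _ => integrable_finsetSum Finset.univ fun l _ => i2 j k l
  have s3 := integrable_finsetSum Finset.univ fun i _ => integrable_finsetSum Finset.univ
    fun j _ => integrable_finsetSum Finset.univ fun k _ => integrable_finsetSum Finset.univ
    fun l _ => i3 i j k l
  have s4 := integrable_finsetSum Finset.univ fun j _ => integrable_finsetSum Finset.univ
    fun k _ => integrable_finsetSum Finset.univ fun l _ => integrable_finsetSum Finset.univ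
    fun n _ => integrable_finsetSum Finset.univ fun m _ => i4 j k l n m
  have v1 : ∫ y, ∑ i, ∑ j, -(√t)⁻¹ * (pderiv i (η t) σ * D.J t σ i j) *
      D.α j t (D.L t y) ∂(S t).law σ = 0 := by
    rw [integral_sum₂ i1]
    simp only [integral_const_mul, integral_α ht, mul_zero, Finset.sum_const_zero]
  have v2 : ∫ y, ∑ j, ∑ k, ∑ l, D.gradJ η t σ j * D.J t σ k l *
      (D.Φ j k t (D.L t y) * D.α l t (D.L t y)) ∂(S t).law σ =
      ∑ j, ∑ k, ∑ l, D.gradJ η t σ j * D.J t σ k l * (S t).U2 σ j k l := by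
    rw [integral_sum₂ fun j k => integrable_finsetSum _ fun l _ => i2 j k l]
    refine Finset.sum_congr rfl fun j _ => Finset.sum_congr rfl fun k _ => ?_
    rw [integral_finsetSum _ fun l _ => i2 j k l]
    simp only [integral_const_mul, integral_Φ_mul_α ht]
  have v3 : ∫ y, ∑ i, ∑ j, ∑ k, ∑ l, D.J t σ i j * pderiv j (pderiv k (η t)) σ *
      D.J t σ k l * (D.α i t (D.L t y) * D.α l t (D.L t y)) ∂(S t).law σ =
      ∑ i, ∑ j, ∑ k, ∑ l, D.J t σ i j * pderiv j (pderiv k (η t)) σ *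
        D.J t σ k l * (S t).U1 σ i l := by
    rw [integral_sum₂ fun i j => integrable_finsetSum _ fun k _ =>
      integrable_finsetSum _ fun l _ => i3 i j k l]
    refine Finset.sum_congr rfl fun i _ => Finset.sum_congr rfl fun j _ => ?_
    rw [integral_sum₂ fun k l => i3 i j k l]
    simp only [integral_const_mul, integral_α_mul_α ht]
  have v4 : ∫ y, ∑ j, ∑ k, ∑ l, ∑ n, ∑ m, D.gradJ η t σ j * D.J t σ m n * D.J t σ k l *
      (D.hs j n k t (D.L t y) * D.α m t (D.L t y) * D.α l t (D.L t y)) ∂(S t).law σ =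
      ∑ j, ∑ k, ∑ l, ∑ n, ∑ m, D.gradJ η t σ j * D.J t σ m n * D.J t σ k l *
        (S t).U3 σ j n m k l := by
    rw [integral_sum₂ fun j k => integrable_finsetSum _ fun l _ =>
      integrable_finsetSum _ fun n _ => integrable_finsetSum _ fun m _ => i4 j k l n m]
    refine Finset.sum_congr rfl fun j _ => Finset.sum_congr rfl fun k _ => ?_
    rw [integral_finsetSum _ fun l _ => integrable_finsetSum _ fun n _ =>
      integrable_finsetSum _ fun m _ => i4 j k l n m]
    refine Finset.sum_congr rfl fun l _ => ?_
    rw [integral_sum₂ fun n m => i4 j k l n m]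
    simp only [integral_const_mul, integral_hs_mul_α_mul_α ht]
  simp only [e]
  rw [integral_linear_combination s1 s2 s3 s4, v1, v2, v3, v4, zero_add, bias]

end REMLReduction

end

end EmpiricalPredictor

namespace EmpiricalPredictor

noncomputable section

open scoped ContDiff MatrixOrder

namespace REMLReduction

variable {s : ℕ} {S : ℕ → ScoreModel s} {σ : Param s} {D : REMLReduction S σ}
  {t : ℕ} {x : Param s}

/-! #### Unbiasedness of the corrected estimator -/

/-- Roots of the score equation near the true parameter are of the order of the leading term. -/
lemma exists_norm_root_sub_le (D : REMLReduction S σ) : ∃ ε > 0, ∀ t ≥ D.t₀, ∀ y x,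
    (S t).score x y = 0 → (√(t : ℝ))⁻¹ * D.Ψ t (D.L t y) ≤ ε → ‖x - σ‖ ≤ ε →
      x ∈ Metric.ball σ D.r ∧ ‖x - σ‖ ≤ 36 / D.c * ((√t)⁻¹ * D.Ψ t (D.L t y)) := by
  obtain ⟨C, hC, h⟩ := D.exists_remainder
  have hκ := D.κ_nonneg
  have hr := D.r_pos
  set b : ℝ := C * (3 + D.κ) with hb
  have hb0 : 0 ≤ b := by positivity
  -- The bound `1` gives `dom ≤ 2 + κ`, the bound `r/2` places the root in the ball, and the last
  -- one makes the remainder at most half of `‖x - σ‖`, to be absorbed. The absorption turns `18/c`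
  -- into `36/c`.
  refine ⟨min (min 1 (D.r / 2)) (1 / (2 * b + 1)), by positivity,
    fun t ht y x h0 hP hx => ?_⟩
  have e1 : min (min 1 (D.r / 2)) (1 / (2 * b + 1)) ≤ 1 :=
    (min_le_left _ _).trans (min_le_left _ _)
  have e2 : min (min 1 (D.r / 2)) (1 / (2 * b + 1)) ≤ D.r / 2 :=
    (min_le_left _ _).trans (min_le_right _ _)
  have e3 : min (min 1 (D.r / 2)) (1 / (2 * b + 1)) ≤ 1 / (2 * b + 1) := min_le_right _ _
  set ε := min (min 1 (D.r / 2)) (1 / (2 * b + 1))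
  have hball : x ∈ Metric.ball σ D.r := by
    rw [Metric.mem_ball, dist_eq_norm]
    linarith
  refine ⟨hball, ?_⟩
  have h1 := h t ht y x hball h0
  have h2 := norm_inv_info₂_score_le ht y
  have h3 := dom_le ht (D.L t y)
  set q := (√(t : ℝ))⁻¹ * D.Ψ t (D.L t y)
  set w := WithLp.toLp 2 ((D.info₂ t σ)⁻¹ *ᵥ (S t).score σ y)
  have hn := norm_nonneg (x - σ)
  have h4 : ‖x - σ‖ ≤ ‖x - σ + w‖ + ‖w‖ := by
    have := norm_sub_le (x - σ + w) w
    rwa [add_sub_cancel_right] at this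
  have h5 : C * (q * ‖x - σ‖ + D.dom t (D.L t y) * ‖x - σ‖ ^ 2) ≤ b * ε * ‖x - σ‖ := by
    have hd : D.dom t (D.L t y) ≤ 2 + D.κ := by linarith
    calc C * (q * ‖x - σ‖ + D.dom t (D.L t y) * ‖x - σ‖ ^ 2)
        ≤ C * (ε * ‖x - σ‖ + (2 + D.κ) * (‖x - σ‖ * ε)) := by
          rw [sq]
          gcongr
      _ = b * ε * ‖x - σ‖ := by rw [hb]; ring
  have h6 : b * ε ≤ 1 / 2 := by
    rw [le_div_iff₀ (by positivity)] at e3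
    have : 0 ≤ ε := by positivity
    linarith
  have h7 : b * ε * ‖x - σ‖ ≤ 1 / 2 * ‖x - σ‖ := by gcongr
  have h8 : (36 : ℝ) / D.c * q = 2 * (18 / D.c * q) := by ring
  rw [h8]
  linarith

/-- The pointwise expansion of the corrected estimator. -/
lemma exists_etaHat_error {η : ℕ → Param s → ℝ} (hη : EtaBdd D η) [NeZero s] {lam c₀ : ℝ}
    (hlam : 0 < lam) (hc₀ : 0 < c₀) (σstar : Param s) :
    ∃ ε > 0, ∃ Y : ∀ t, EuclideanSpace ℝ (Fin (D.N t)) → ℝ, AllMom D Y ∧ ∃ t₁ ≥ D.t₀, ∀ t ≥ t₁,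
      ∀ (σhat : (S t).Y → Param s) (y : (S t).Y), (S t).score (σhat y) y = 0 →
        (√(t : ℝ))⁻¹ * D.Ψ t (D.L t y) ≤ ε → ‖σhat y - σ‖ ≤ ε →
        |(S t).etaHat (η t) c₀ lam σstar σhat y - η t σ - D.expansion η t (D.L t y) +
          (t : ℝ)⁻¹ * D.bias η t σ| ≤ (√t)⁻¹ ^ 3 * Y t (D.L t y) := by
  obtain ⟨ε, hε, hroot⟩ := D.exists_norm_root_sub_le
  have hc := D.c_pos
  obtain ⟨C₁, hC₁, hexp⟩ := exists_expansion_error hη (C₀ := 36 / D.c) (by positivity)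
  obtain ⟨C₂, hC₂, hbias⟩ := unifLip_bias hη
  obtain ⟨C₃, hC₃, hηb⟩ := hη
  refine ⟨ε, hε, fun t z => C₁ * (D.dom t z ^ 2 * D.Ψ t z ^ 3) + C₂ * (36 / D.c) * D.Ψ t z,
    (((allMom_dom.pow 2).mul (allMom_Ψ.pow 3)).const_mul _).add (allMom_Ψ.const_mul _), ?_⟩
  -- The truncation level tends to infinity while the corrected value near `σ` is at most `C₃ + C₂`,
  -- so for large `t` the truncation is inactive there.
  have hlim : Tendsto (fun t : ℕ => c₀ * √(t : ℝ) ^ lam) atTop atTop :=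
    ((tendsto_rpow_atTop hlam).comp
      (Real.tendsto_sqrt_atTop.comp tendsto_natCast_atTop_atTop)).const_mul_atTop hc₀
  obtain ⟨t₁, ht₁⟩ := (hlim.eventually_ge_atTop (C₃ + C₂)).exists_forall_of_atTop
  refine ⟨max t₁ D.t₀, le_max_right _ _, fun t htm σhat y h0 hP hx => ?_⟩
  have ht : t ≥ D.t₀ := (le_max_right _ _).trans htm
  have hbig := ht₁ t ((le_max_left _ _).trans htm)
  have ht0 := cast_pos ht
  obtain ⟨hball, hn⟩ := hroot t ht y _ h0 hP hx
  have hI := mem_interior ht hball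
  have hb := hbias t ht _ hball
  have hcorr : (S t).corrected (η t) (σhat y) =
      η t (σhat y) - (t : ℝ)⁻¹ * D.bias η t (σhat y) := corrected_eq ht hI η
  have hinv : (t : ℝ)⁻¹ ≤ 1 := inv_le_one_of_one_le₀ (one_le_cast ht)
  have hle : |(S t).corrected (η t) (σhat y)| ≤ c₀ * (S t).dStar ^ lam := by
    rw [dStar_eq D, hcorr]
    refine (abs_sub _ _).trans (le_trans ?_ hbig)
    have h1 : |η t (σhat y)| ≤ C₃ := (hηb t ht).2.norm_le hball
    rw [abs_mul, abs_of_pos (inv_pos.2 ht0)]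
    have h2 : (t : ℝ)⁻¹ * |D.bias η t (σhat y)| ≤ 1 * C₂ :=
      mul_le_mul hinv hb.1 (abs_nonneg _) zero_le_one
    linarith
  rw [ScoreModel.etaHat, if_pos ⟨hI, hle⟩, hcorr]
  have h1 := hexp t ht y _ hball h0 hn
  have e : η t (σhat y) - (t : ℝ)⁻¹ * D.bias η t (σhat y) - η t σ -
      D.expansion η t (D.L t y) + (t : ℝ)⁻¹ * D.bias η t σ =
      (η t (σhat y) - η t σ - D.expansion η t (D.L t y)) -
        (t : ℝ)⁻¹ * (D.bias η t (σhat y) - D.bias η t σ) := by ring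
  rw [e]
  refine (abs_sub _ _).trans ?_
  have h2 : |(t : ℝ)⁻¹ * (D.bias η t (σhat y) - D.bias η t σ)| ≤
      (√(t : ℝ))⁻¹ ^ 3 * (C₂ * (36 / D.c) * D.Ψ t (D.L t y)) := by
    have e2 : (t : ℝ)⁻¹ = (√(t : ℝ))⁻¹ ^ 2 := by rw [inv_pow, Real.sq_sqrt ht0.le]
    rw [abs_mul, abs_of_pos (inv_pos.2 ht0), e2]
    calc (√(t : ℝ))⁻¹ ^ 2 * |D.bias η t (σhat y) - D.bias η t σ|
        ≤ (√(t : ℝ))⁻¹ ^ 2 * (C₂ * (36 / D.c * ((√t)⁻¹ * D.Ψ t (D.L t y)))) := by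
          gcongr
          exact hb.2.trans (by gcongr)
      _ = _ := by ring
  rw [mul_add]
  refine add_le_add (h1.trans (le_of_eq ?_)) h2
  ring

/-- The truncation level bounds one branch and the growth condition on `η(σ*)` the other, so the
bound is deterministic. It gives integrability and controls the exceptional event. -/
lemma exists_abs_etaHat_le [NeZero s] (D : REMLReduction S σ) {η : ℕ → Param s → ℝ} {lam c₀ : ℝ}
    (hc₀ : 0 < c₀) {σstar : Param s}
    (hO : (fun t => η t σstar) =O[atTop] fun t => (S t).dStar ^ lam) :
    ∃ C ≥ 0, ∃ t₁ ≥ D.t₀, ∀ t ≥ t₁, ∀ (σhat : (S t).Y → Param s) (y : (S t).Y),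
      |(S t).etaHat (η t) c₀ lam σstar σhat y| ≤ C * √(t : ℝ) ^ lam := by
  obtain ⟨C, hC⟩ := hO.bound
  obtain ⟨t₁, ht₁⟩ := hC.exists_forall_of_atTop
  refine ⟨max c₀ C, hc₀.le.trans (le_max_left _ _), max t₁ D.t₀, le_max_right _ _,
    fun t ht σhat y => ?_⟩
  have h := ht₁ t ((le_max_left _ _).trans ht)
  have h0 : (0 : ℝ) ≤ √(t : ℝ) ^ lam := by positivity
  rw [dStar_eq D, Real.norm_eq_abs, Real.norm_of_nonneg h0] at h
  rw [ScoreModel.etaHat]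
  split_ifs with hif
  · rw [dStar_eq D] at hif
    exact hif.2.trans (mul_le_mul_of_nonneg_right (le_max_left _ _) h0)
  · exact h.trans (mul_le_mul_of_nonneg_right (le_max_right _ _) h0)

/-- Off the good event the expansion is unbounded. This splits it into the truncation level, to be
multiplied by a small probability, and a high power with a small coefficient, which makes Hölder's
inequality unnecessary. -/
lemma le_add_pow_div {M Y : ℝ} (hM : 0 < M) (hY : 0 ≤ Y) (k : ℕ) :
    Y ≤ M + Y ^ (k + 1) * (M ^ k)⁻¹ := by
  rcases le_total Y M with h | h
  · have : 0 ≤ Y ^ (k + 1) * (M ^ k)⁻¹ := by positivity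
    linarith
  · have h1 : M ^ k ≤ Y ^ k := pow_le_pow_left₀ hM.le h k
    have h2 : Y ≤ Y ^ (k + 1) * (M ^ k)⁻¹ := by
      rw [← div_eq_mul_inv, le_div_iff₀ (by positivity), pow_succ, mul_comm]
      gcongr
    linarith

/-- The probability that a consistent root of the score equation is not close to the true
parameter. -/
lemma exists_event [NeZero s] (D : REMLReduction S σ) {g : ℝ} (hg : 0 < g)
    {σhat : ∀ t, (S t).Y → Param s} (hσ : IsConsistentRoot S σ g σhat) {ε : ℝ} (hε : 0 < ε) :
    ∃ (𝒢 : ∀ t, Set (S t).Y) (C : ℝ), 0 ≤ C ∧ ∃ t₁ ≥ D.t₀, ∀ t ≥ t₁, MeasurableSet (𝒢 t) ∧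
      ((S t).law σ).real (𝒢 t)ᶜ ≤ C * √(t : ℝ) ^ (-(g / 4)) ∧ ∀ y ∈ 𝒢 t,
        (S t).score (σhat t y) y = 0 ∧ (√(t : ℝ))⁻¹ * D.Ψ t (D.L t y) ≤ ε ∧
        ‖σhat t y - σ‖ ≤ ε := by
  -- `ρ = 3/4` is the largest value for which `τ = (1/4) ∧ (1 - ρ)` still equals `1/4`.
  obtain ⟨ℬ, u, c, -, hev⟩ := hσ (3 / 4) (by norm_num) (by norm_num)
  obtain ⟨k, hk⟩ := exists_nat_ge g
  have ha0 : ∀ t ≥ D.t₀, 0 ≤ (√(t : ℝ))⁻¹ := fun t _ => by positivity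
  obtain ⟨c', hc', hmeas⟩ := (allMom_Ψ (D := D)).exists_measure_le hε _ ha0 k
  have hlim : Tendsto (fun t : ℕ => √(t : ℝ) ^ (-(3 / 4 : ℝ))) atTop (𝓝 0) :=
    (tendsto_rpow_neg_atTop (by norm_num)).comp
      (Real.tendsto_sqrt_atTop.comp tendsto_natCast_atTop_atTop)
  obtain ⟨t₁, ht₁⟩ := (hev.and (hlim.eventually_le_const hε)).exists_forall_of_atTop
  refine ⟨fun t => ℬ t ∩ {y | ε < (√(t : ℝ))⁻¹ * |D.Ψ t (D.L t y)|}ᶜ, |c| + c', by positivity,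
    max t₁ D.t₀, le_max_right _ _, fun t htm => ?_⟩
  have ht : t ≥ D.t₀ := (le_max_right _ _).trans htm
  obtain ⟨⟨hm, hp, hy⟩, hε'⟩ := ht₁ t ((le_max_left _ _).trans htm)
  have hprob := D.prob t σ
  have hs := sqrt_pos ht
  have hs1 := one_le_sqrt (D := D) ht
  refine ⟨hm.inter (measurableSet_lt measurable_const (Measurable.const_mul ?_ _)).compl, ?_,
    fun y hy' => ?_⟩
  · exact ((allMom_Ψ.1 t).1.measurable.comp (D.L_meas t)).abs
  · rw [Set.compl_inter, compl_compl, add_mul]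
    refine (measureReal_union_le _ _).trans (add_le_add ?_ ?_)
    · refine ENNReal.toReal_le_of_le_ofReal (by positivity) (hp.trans (ENNReal.ofReal_le_ofReal ?_))
      rw [dStar_eq D]
      have e : -(min (1 / 4) (1 - 3 / 4) * g) = -(g / 4) := by norm_num; ring
      rw [e]
      exact mul_le_mul_of_nonneg_right (le_abs_self c) (by positivity)
    · refine ENNReal.toReal_le_of_le_ofReal (by positivity) ((hmeas t ht).trans
        (ENNReal.ofReal_le_ofReal (mul_le_mul_of_nonneg_left ?_ hc')))
      rw [← Real.rpow_neg_one, ← Real.rpow_mul_natCast hs.le]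
      refine Real.rpow_le_rpow_of_exponent_le hs1 ?_
      push_cast
      linarith
  · obtain ⟨-, h0, hd, -⟩ := hy y hy'.1
    have h1 : ¬ ε < (√(t : ℝ))⁻¹ * |D.Ψ t (D.L t y)| := hy'.2
    rw [abs_of_nonneg (Ψ_nonneg _), not_lt] at h1
    refine ⟨h0, h1, le_trans ?_ hε'⟩
    have h3 : (fun i => (S t).d i * (σhat t y i - σ i)) =
      fun i => (S t).d i * (σhat t y - σ) i := rfl
    rw [h3, norm_d_mul D t (σhat t y - σ), dStar_eq D] at hd
    have h4 : (√(t : ℝ)) ^ (1 - 3 / 4 : ℝ) = √t * √t ^ (-(3 / 4 : ℝ)) := by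
      rw [← Real.rpow_one_add' hs.le (by norm_num)]
      rfl
    rw [h4] at hd
    exact (lt_of_mul_lt_mul_left hd hs.le).le

/-- On the good event the estimator equals `η(σ)` plus the expansion minus its mean, up to
`O(d_*^{-3})`. On the complement it is `O(d_*^λ)` with probability `O(d_*^{-g/4})`. Integrating
these bounds leaves only terms of smaller order than `d_*^{-2}`. -/
theorem etaHat_unbiased [NeZero s] (D : REMLReduction S σ) {η : ℕ → Param s → ℝ}
    (hη : EtaBdd D η) {lam g c₀ : ℝ} {σstar : Param s} {σhat : ∀ t, (S t).Y → Param s}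
    (hlam : 0 < lam) (hg : 8 + 4 * lam < g) (hc₀ : 0 < c₀)
    (hO : (fun t => η t σstar) =O[atTop] fun t => (S t).dStar ^ lam)
    (hm : ∀ t, Measurable (σhat t)) (hσ : IsConsistentRoot S σ g σhat) :
    (∀ᶠ t in atTop, Integrable ((S t).etaHat (η t) c₀ lam σstar (σhat t)) ((S t).law σ)) ∧
    (fun t => (∫ y, (S t).etaHat (η t) c₀ lam σstar (σhat t) y ∂(S t).law σ) - η t σ)
      =o[atTop] fun t => ((S t).dStar ^ 2)⁻¹ := by
  obtain ⟨ε, hε, Y₁, hY₁, t₁, ht₁, herr⟩ := exists_etaHat_error hη hlam hc₀ σstar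
  obtain ⟨𝒢, C₂, hC₂, t₂, ht₂, hG⟩ := D.exists_event (by linarith) hσ hε
  obtain ⟨C₃, hC₃, t₃, ht₃, habs⟩ := D.exists_abs_etaHat_le hc₀ hO
  have hY₂ := allMom_expansion hη
  obtain ⟨C₄, hC₄, hbias⟩ := unifLip_bias hη
  obtain ⟨C₅, hC₅, hηb⟩ := id hη
  -- With `M = d_*^λ` this choice gives `M^{-k} ≤ d_*^{-3}`.
  obtain ⟨k, hk⟩ := exists_nat_ge (3 / lam)
  obtain ⟨E₁, hE₁, hint₁⟩ := hY₁.exists_integral_abs_le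
  obtain ⟨E₂, hE₂, hint₂⟩ := (hY₂.abs.pow (k + 1)).exists_integral_abs_le
  set t₄ := max t₁ (max t₂ t₃) with ht₄
  -- The four summands account, off the good event and in units of `d_*^λ`, for the estimator, for
  -- `η(σ)`, for the bias, and for the bounded part of the expansion.
  set C₆ : ℝ := C₃ + C₅ + C₄ + 1 with hC₆
  have hmeas : ∀ t ≥ t₄, Integrable ((S t).etaHat (η t) c₀ lam σstar (σhat t)) ((S t).law σ) :=
    fun t ht => by
      have hprob := D.prob t σ
      have h3 : t ≥ t₃ := (le_max_right _ _).trans ((le_max_right _ _).trans ht)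
      have hme := measurable_etaHat (D := D) (ht₃.le.trans h3) (hηb t (ht₃.le.trans h3)).1 c₀ lam
        σstar (hm t)
      exact Integrable.of_bound hme.aestronglyMeasurable _
        (Eventually.of_forall fun y => habs t h3 (σhat t) y)
  have key : ∀ t ≥ t₄, |(∫ y, (S t).etaHat (η t) c₀ lam σstar (σhat t) y ∂(S t).law σ) - η t σ| ≤
      (E₁ + E₂ + C₆ * C₂) * (((S t).dStar ^ 2)⁻¹ *
        ((√(t : ℝ))⁻¹ + √t ^ (lam - g / 4 + 2))) := fun t ht => by
    have h1 : t ≥ t₁ := (le_max_left _ _).trans ht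
    have h2 : t ≥ t₂ := (le_max_left _ _).trans ((le_max_right _ _).trans ht)
    have h3 : t ≥ t₃ := (le_max_right _ _).trans ((le_max_right _ _).trans ht)
    have h0 : t ≥ D.t₀ := ht₁.le.trans h1
    have hprob := D.prob t σ
    have hs := sqrt_pos h0
    have hs1 := one_le_sqrt (D := D) h0
    have ht0 := cast_pos h0
    set q : ℝ := (√(t : ℝ))⁻¹ with hq
    have hq0 : 0 < q := inv_pos.2 hs
    set M : ℝ := √(t : ℝ) ^ lam with hM
    have hM1 : 1 ≤ M := Real.one_le_rpow hs1 hlam.le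
    have hM0 : 0 < M := zero_lt_one.trans_le hM1
    have hMk : (M ^ k)⁻¹ ≤ q ^ 3 := by
      rw [hq, inv_pow]
      refine inv_anti₀ (by positivity) ?_
      rw [hM, ← Real.rpow_mul_natCast hs.le, ← Real.rpow_natCast]
      refine Real.rpow_le_rpow_of_exponent_le hs1 ?_
      rw [div_le_iff₀ hlam] at hk
      push_cast
      linarith
    obtain ⟨hGm, hGp, hGy⟩ := hG t h2
    -- The expansion and its mean are subtracted together, so `Z` has exactly the mean `E(η̂) -
    -- η(σ)` while being small on the good event.
    set Z : (S t).Y → ℝ := fun y => (S t).etaHat (η t) c₀ lam σstar (σhat t) y - η t σ -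
      D.expansion η t (D.L t y) + (t : ℝ)⁻¹ * D.bias η t σ with hZ
    have iH := hmeas t ht
    have iE := hY₂.integrable h0
    have hZi : ∫ y, Z y ∂(S t).law σ =
        (∫ y, (S t).etaHat (η t) c₀ lam σstar (σhat t) y ∂(S t).law σ) - η t σ := by
      have i1 : Integrable (fun y => (S t).etaHat (η t) c₀ lam σstar (σhat t) y - η t σ)
        ((S t).law σ) := iH.sub (integrable_const _)
      have i2 : Integrable (fun y => (S t).etaHat (η t) c₀ lam σstar (σhat t) y - η t σ -
        D.expansion η t (D.L t y)) ((S t).law σ) := i1.sub iE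
      simp only [hZ]
      rw [integral_add i2 (integrable_const _), integral_sub i1 iE,
        integral_sub iH (integrable_const _), integral_expansion h0]
      simp
    have iY₁ := (hY₁.abs.integrable h0).const_mul (q ^ 3)
    have iY₂ := ((hY₂.abs.pow (k + 1)).abs.integrable h0).const_mul (q ^ 3)
    have iY : Integrable (fun y => q ^ 3 * |Y₁ t (D.L t y)| +
      q ^ 3 * |(|D.expansion η t (D.L t y)| ^ (k + 1))|) ((S t).law σ) := iY₁.add iY₂
    have iI : Integrable ((𝒢 t)ᶜ.indicator fun _ => C₆ * M) ((S t).law σ) :=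
      (integrable_const _).indicator hGm.compl
    have hpt : ∀ y, |Z y| ≤ q ^ 3 * |Y₁ t (D.L t y)| +
        q ^ 3 * |(|D.expansion η t (D.L t y)| ^ (k + 1))| +
        (𝒢 t)ᶜ.indicator (fun _ => C₆ * M) y := fun y => by
      by_cases hy : y ∈ 𝒢 t
      · obtain ⟨a1, a2, a3⟩ := hGy y hy
        rw [Set.indicator_of_notMem (by simpa using hy), add_zero]
        have b1 := herr t h1 (σhat t) y a1 a2 a3
        have b2 : q ^ 3 * Y₁ t (D.L t y) ≤ q ^ 3 * |Y₁ t (D.L t y)| := by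
          gcongr; exact le_abs_self _
        have b3 : 0 ≤ q ^ 3 * |(|D.expansion η t (D.L t y)| ^ (k + 1))| := by positivity
        exact (b1.trans b2).trans (le_add_of_nonneg_right b3)
      · rw [Set.indicator_of_mem hy]
        have b1 := habs t h3 (σhat t) y
        have b2 : |η t σ| ≤ C₅ := (hηb t h0).2.norm_le self_mem_ball
        have b3 := (hbias t h0 σ self_mem_ball).1
        have b4 : |(t : ℝ)⁻¹ * D.bias η t σ| ≤ C₄ := by
          rw [abs_mul, abs_of_pos (inv_pos.2 ht0)]
          exact (mul_le_of_le_one_left (abs_nonneg _)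
            (inv_le_one_of_one_le₀ (one_le_cast h0))).trans b3
        have b5 := le_add_pow_div hM0 (abs_nonneg (D.expansion η t (D.L t y))) k
        have b6 : |D.expansion η t (D.L t y)| ^ (k + 1) * (M ^ k)⁻¹ ≤
            q ^ 3 * |(|D.expansion η t (D.L t y)| ^ (k + 1))| := by
          rw [abs_of_nonneg (pow_nonneg (abs_nonneg (D.expansion η t (D.L t y))) (k + 1)), mul_comm]
          gcongr
        have c1 := abs_add_le ((S t).etaHat (η t) c₀ lam σstar (σhat t) y - η t σ -
          D.expansion η t (D.L t y)) ((t : ℝ)⁻¹ * D.bias η t σ)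
        have c2 := abs_sub ((S t).etaHat (η t) c₀ lam σstar (σhat t) y - η t σ)
          (D.expansion η t (D.L t y))
        have c3 := abs_sub ((S t).etaHat (η t) c₀ lam σstar (σhat t) y) (η t σ)
        have c4 : 0 ≤ q ^ 3 * |Y₁ t (D.L t y)| := by positivity
        have c5 : C₆ * M = C₃ * M + C₅ * M + C₄ * M + M := by rw [hC₆]; ring
        have c6 : C₅ ≤ C₅ * M := le_mul_of_one_le_right hC₅ hM1
        have c7 : C₄ ≤ C₄ * M := le_mul_of_one_le_right hC₄ hM1
        rw [c5]
        have c8 : |Z y| ≤ _ := c1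
        linarith
    rw [← hZi]
    calc |∫ y, Z y ∂(S t).law σ| ≤ ∫ y, |Z y| ∂(S t).law σ := abs_integral_le_integral_abs
      _ ≤ ∫ y, (q ^ 3 * |Y₁ t (D.L t y)| + q ^ 3 * |(|D.expansion η t (D.L t y)| ^ (k + 1))| +
            (𝒢 t)ᶜ.indicator (fun _ => C₆ * M) y) ∂(S t).law σ :=
          integral_mono_of_nonneg (Eventually.of_forall fun y => abs_nonneg _)
            (iY.add iI) (Eventually.of_forall hpt)
      _ = q ^ 3 * ∫ y, |Y₁ t (D.L t y)| ∂(S t).law σ +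
            q ^ 3 * ∫ y, |(|D.expansion η t (D.L t y)| ^ (k + 1))| ∂(S t).law σ +
            C₆ * M * ((S t).law σ).real (𝒢 t)ᶜ := by
          rw [integral_add iY iI, integral_add iY₁ iY₂, integral_const_mul,
            integral_const_mul, integral_indicator_const _ hGm.compl, smul_eq_mul,
            mul_comm (((S t).law σ).real _)]
      _ ≤ q ^ 3 * E₁ + q ^ 3 * E₂ + C₆ * M * (C₂ * √(t : ℝ) ^ (-(g / 4))) := by
          have := hint₁ t h0
          have := hint₂ t h0
          gcongr
      _ = (E₁ + E₂) * (q ^ 2 * q) + C₆ * C₂ * (q ^ 2 * √(t : ℝ) ^ (lam - g / 4 + 2)) := by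
          have e : M * √(t : ℝ) ^ (-(g / 4)) = q ^ 2 * √(t : ℝ) ^ (lam - g / 4 + 2) := by
            have e2 : q ^ 2 = √(t : ℝ) ^ (-2 : ℝ) := by
              rw [hq, inv_pow, Real.rpow_neg hs.le, Real.rpow_two]
            rw [e2, hM, ← Real.rpow_add hs, ← Real.rpow_add hs]
            congr 1; ring
          rw [mul_comm C₂, mul_assoc C₆, ← mul_assoc M, e]; ring
      _ ≤ (E₁ + E₂ + C₆ * C₂) * (q ^ 2 * (q + √(t : ℝ) ^ (lam - g / 4 + 2))) := by
          have h5 : 0 ≤ C₆ * C₂ * (q ^ 2 * q) := by positivity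
          have h6 : 0 ≤ (E₁ + E₂) * (q ^ 2 * √(t : ℝ) ^ (lam - g / 4 + 2)) := by positivity
          linarith
      _ = _ := by rw [dStar_eq D, hq, inv_pow]
  refine ⟨(eventually_ge_atTop t₄).mono hmeas, ?_⟩
  have hsq : Tendsto (fun t : ℕ => √(t : ℝ)) atTop atTop :=
    Real.tendsto_sqrt_atTop.comp tendsto_natCast_atTop_atTop
  have hlim : Tendsto (fun t : ℕ => (√(t : ℝ))⁻¹ + √(t : ℝ) ^ (lam - g / 4 + 2)) atTop (𝓝 0) := by
    -- This exponent is negative precisely because `g > 8 + 4λ`.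
    have h1 : Tendsto (fun t : ℕ => √(t : ℝ) ^ (-(g / 4 - lam - 2))) atTop (𝓝 0) :=
      (tendsto_rpow_neg_atTop (by linarith)).comp hsq
    have h2 : Tendsto (fun t : ℕ => (√(t : ℝ))⁻¹) atTop (𝓝 0) := tendsto_inv_atTop_zero.comp hsq
    have e : -(g / 4 - lam - 2) = lam - g / 4 + 2 := by ring
    rw [e] at h1
    simpa using h2.add h1
  refine IsBigO.trans_isLittleO (g := fun t => ((S t).dStar ^ 2)⁻¹ *
    ((√(t : ℝ))⁻¹ + √t ^ (lam - g / 4 + 2))) ?_ ?_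
  · refine IsBigO.of_bound (E₁ + E₂ + C₆ * C₂) ((eventually_ge_atTop t₄).mono fun t ht => ?_)
    rw [Real.norm_eq_abs, Real.norm_of_nonneg (by positivity)]
    exact key t ht
  · simpa using (isBigO_refl (fun t => ((S t).dStar ^ 2)⁻¹) atTop).mul_isLittleO
      ((isLittleO_one_iff ℝ).2 hlim)

end REMLReduction

end

end EmpiricalPredictor

namespace EmpiricalPredictor

noncomputable section

open scoped ContDiff MatrixOrder

/-! ### Standardized error contrasts -/

section Contrasts

variable {n m : Type} [Fintype n] [DecidableEq n] [Fintype m] [DecidableEq m]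

/-- The matrix `(T'CT)^{-1/2} T'`, which standardizes error contrasts. -/
def whiten (C : Matrix n n ℝ) (T : Matrix n m ℝ) : Matrix m n ℝ := (CFC.sqrt (Tᵀ * C * T))⁻¹ * Tᵀ

lemma posDef_transpose_mul_mul {C : Matrix n n ℝ} {T : Matrix n m ℝ} (hC : C.PosDef)
    (hT : Function.Injective T.mulVec) : (Tᵀ * C * T).PosDef := by
  have h := hC.conjTranspose_mul_mul_same hT
  rwa [Matrix.conjTranspose_eq_transpose_of_trivial] at h

lemma isUnit_det_sqrt {W : Matrix m m ℝ} (hW : W.PosDef) : IsUnit (CFC.sqrt W).det := by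
  have h := hW.det_pos.ne'
  rw [← sqrt_mul_sqrt hW.posSemidef, Matrix.det_mul] at h
  exact (left_ne_zero_of_mul h).isUnit

lemma transpose_whiten (C : Matrix n n ℝ) (T : Matrix n m ℝ) :
    (whiten C T)ᵀ = T * (CFC.sqrt (Tᵀ * C * T))⁻¹ := by
  rw [whiten, Matrix.transpose_mul, Matrix.transpose_transpose, Matrix.transpose_nonsing_inv,
    transpose_sqrt]

lemma whiten_mul_mul (C E : Matrix n n ℝ) (T : Matrix n m ℝ) :
    whiten C T * E * (whiten C T)ᵀ =
      (CFC.sqrt (Tᵀ * C * T))⁻¹ * (Tᵀ * E * T) * (CFC.sqrt (Tᵀ * C * T))⁻¹ := by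
  rw [transpose_whiten, whiten]
  simp only [Matrix.mul_assoc]

variable {C E : Matrix n n ℝ} {T : Matrix n m ℝ}

lemma whiten_mul_self (hC : C.PosDef) (hT : Function.Injective T.mulVec) :
    whiten C T * C * (whiten C T)ᵀ = 1 := by
  have hW := posDef_transpose_mul_mul hC hT
  have hu := isUnit_det_sqrt hW
  rw [whiten_mul_mul]
  nth_rw 2 [← sqrt_mul_sqrt hW.posSemidef]
  rw [← Matrix.mul_assoc, Matrix.nonsing_inv_mul _ hu, one_mul, Matrix.mul_nonsing_inv _ hu]

lemma transpose_mul_mul_eq (hC : C.PosDef) (hT : Function.Injective T.mulVec) :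
    Tᵀ * E * T = CFC.sqrt (Tᵀ * C * T) * (whiten C T * E * (whiten C T)ᵀ) *
      CFC.sqrt (Tᵀ * C * T) := by
  have hu := isUnit_det_sqrt (posDef_transpose_mul_mul hC hT)
  rw [whiten_mul_mul]
  set R := CFC.sqrt (Tᵀ * C * T)
  calc Tᵀ * E * T = R * R⁻¹ * (Tᵀ * E * T) * (R⁻¹ * R) := by
        rw [Matrix.mul_nonsing_inv _ hu, Matrix.nonsing_inv_mul _ hu, one_mul, mul_one]
    _ = _ := by simp only [mul_assoc]

lemma posDef_whiten_mul_mul (hC : C.PosDef) (hT : Function.Injective T.mulVec) (hE : E.PosDef) :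
    (whiten C T * E * (whiten C T)ᵀ).PosDef := by
  have hu := isUnit_det_sqrt (posDef_transpose_mul_mul hC hT)
  have h := (posDef_transpose_mul_mul hE hT).conjTranspose_mul_mul_same
    (B := (CFC.sqrt (Tᵀ * C * T))⁻¹)
    (Matrix.mulVec_injective_iff_isUnit.2 ((Matrix.isUnit_iff_isUnit_det _).2
      (Matrix.isUnit_nonsing_inv_det _ hu)))
  rwa [Matrix.conjTranspose_eq_transpose_of_trivial, Matrix.transpose_nonsing_inv,
    transpose_sqrt, ← whiten_mul_mul] at h

lemma log_det_transpose_mul_mul (hC : C.PosDef) (hT : Function.Injective T.mulVec)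
    (hE : E.PosDef) : Real.log (Tᵀ * E * T).det =
      Real.log (Tᵀ * C * T).det + Real.log (whiten C T * E * (whiten C T)ᵀ).det := by
  have h1 := (posDef_whiten_mul_mul hC hT hE).det_pos.ne'
  have hW := posDef_transpose_mul_mul hC hT
  have h2 : (Tᵀ * C * T).det = (CFC.sqrt (Tᵀ * C * T)).det * (CFC.sqrt (Tᵀ * C * T)).det := by
    rw [← Matrix.det_mul, sqrt_mul_sqrt hW.posSemidef]
  rw [← Real.log_mul hW.det_pos.ne' h1, h2, transpose_mul_mul_eq (C := C) hC hT, Matrix.det_mul,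
    Matrix.det_mul]
  congr 1; ring

/-- Expresses the REML projection matrix through the standardized contrasts: `y'Py` becomes the form
of the inverse reduced covariance at `Wy`. -/
lemma mul_inv_mul_transpose_eq (hC : C.PosDef) (hT : Function.Injective T.mulVec)  :
    T * (Tᵀ * E * T)⁻¹ * Tᵀ =
      (whiten C T)ᵀ * (whiten C T * E * (whiten C T)ᵀ)⁻¹ * whiten C T := by
  rw [transpose_mul_mul_eq (C := C) hC hT, Matrix.mul_inv_rev, Matrix.mul_inv_rev,
    transpose_whiten]
  simp only [whiten, Matrix.mul_assoc]

/-- Since `W C W' = 1`, the form of `C` at `W'v` is `|v|²`, and `C` is bounded below by `‖C⁻¹‖⁻¹`.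
-/
lemma norm_transpose_whiten_mulVec_sq_le (hC : C.PosDef) (hT : Function.Injective T.mulVec)
    (v : m → ℝ) :
    ‖WithLp.toLp 2 ((whiten C T)ᵀ *ᵥ v)‖ ^ 2 ≤ ‖C⁻¹‖ * ‖WithLp.toLp 2 v‖ ^ 2 := by
  refine (norm_sq_le_of_posDef hC _).trans (le_of_eq ?_)
  rw [Matrix.mulVec_mulVec, Matrix.dotProduct_mulVec, Matrix.vecMul_mulVec,
    ← Matrix.dotProduct_mulVec, Matrix.transpose_transpose, ← Matrix.mul_assoc, whiten_mul_self hC hT, Matrix.one_mulVec, dotProduct_self_eq_norm_sq]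

lemma norm_whiten_mul_mul_le (hC : C.PosDef) (hT : Function.Injective T.mulVec)
    (E : Matrix n n ℝ) : ‖whiten C T * E * (whiten C T)ᵀ‖ ≤ ‖C⁻¹‖ * ‖E‖ := by
  have h : ‖(whiten C T)ᵀ‖ ≤ √‖C⁻¹‖ := norm_le_of_mulVec_le _ (Real.sqrt_nonneg _) fun v => by
    refine le_of_sq_le_sq ?_ (by positivity)
    rw [mul_pow, Real.sq_sqrt (norm_nonneg _)]
    exact norm_transpose_whiten_mulVec_sq_le hC hT v
  have h' : ‖whiten C T‖ ≤ √‖C⁻¹‖ := by rwa [norm_transpose_eq] at h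
  calc ‖whiten C T * E * (whiten C T)ᵀ‖ ≤ ‖whiten C T‖ * ‖E‖ * ‖(whiten C T)ᵀ‖ :=
        (Matrix.l2_opNorm_mul _ _).trans
          (mul_le_mul_of_nonneg_right (Matrix.l2_opNorm_mul _ _) (norm_nonneg _))
    _ ≤ √‖C⁻¹‖ * ‖E‖ * √‖C⁻¹‖ := by gcongr
    _ = √‖C⁻¹‖ * √‖C⁻¹‖ * ‖E‖ := by ring
    _ = _ := by rw [Real.mul_self_sqrt (norm_nonneg _)]

lemma posSemidef_norm_smul_sub {A : Matrix n n ℝ} (hA : A.IsHermitian) :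
    (‖A‖ • (1 : Matrix n n ℝ) - A).PosSemidef := by
  refine .of_dotProduct_mulVec_nonneg (Matrix.IsHermitian.sub (by simp [Matrix.IsHermitian]) hA)
    fun v => ?_
  rw [star_trivial, Matrix.sub_mulVec, dotProduct_sub, Matrix.smul_mulVec, Matrix.one_mulVec,
    dotProduct_smul, dotProduct_self_eq_norm_sq, smul_eq_mul]
  have h := (le_abs_self _).trans (abs_dotProduct_mulVec_le A v v)
  linarith

lemma trace_mul_le_norm_mul_trace {A B : Matrix n n ℝ} (hA : A.IsHermitian) (hB : B.PosSemidef) :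
    (B * A).trace ≤ ‖A‖ * B.trace := by
  have h := trace_mul_nonneg hB (posSemidef_norm_smul_sub hA)
  rw [mul_sub, Matrix.trace_sub, mul_smul_comm, mul_one, Matrix.trace_smul, smul_eq_mul] at h
  linarith

/-- The standardized contrasts lose at most `n - m` dimensions of information. -/
lemma trace_whiten_mul_self_ge (hC : C.PosDef) (hT : Function.Injective T.mulVec)
    (hE : E.IsSymm) :
    (C⁻¹ * E * C⁻¹ * E).trace -
        2 * (‖C⁻¹‖ * (‖E‖ * ‖C⁻¹‖ * ‖E‖) * (Fintype.card n - Fintype.card m)) ≤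
      ((whiten C T * E * (whiten C T)ᵀ) * (whiten C T * E * (whiten C T)ᵀ)).trace := by
  have hu : IsUnit C.det := hC.det_pos.ne'.isUnit
  have h1 := whiten_mul_self hC hT
  set Lm := whiten C T
  -- `PCP = P` makes `C⁻¹ - P` nonnegative definite, and `tr((C⁻¹ - P)C) = n - m` bounds its trace:
  -- it measures the information removed by passing to contrasts.
  set P := Lmᵀ * Lm with hP
  have hPCP : P * C * P = P := by
    calc P * C * P = Lmᵀ * (Lm * C * Lmᵀ) * Lm := by rw [hP]; simp only [Matrix.mul_assoc]
      _ = P := by rw [h1, Matrix.mul_one]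
  have hPt : Pᵀ = P := by rw [hP, Matrix.transpose_mul, Matrix.transpose_transpose]
  have hCt : Cᵀ = C := (Matrix.conjTranspose_eq_transpose_of_trivial C).symm.trans hC.isHermitian
  have hCi : (C⁻¹)ᵀ = C⁻¹ := by rw [Matrix.transpose_nonsing_inv, hCt]
  have hCiH : (C⁻¹).PosDef := hC.inv
  have hR : (C⁻¹ - P).PosSemidef := by
    have h := hCiH.posSemidef.conjTranspose_mul_mul_same (1 - C * P)
    rw [Matrix.conjTranspose_eq_transpose_of_trivial, Matrix.transpose_sub, Matrix.transpose_one,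
      Matrix.transpose_mul, hPt, hCt] at h
    have e : (1 - P * C) * C⁻¹ * (1 - C * P) = C⁻¹ - P := by
      rw [sub_mul, one_mul, Matrix.mul_assoc P, Matrix.mul_nonsing_inv _ hu, mul_one, mul_sub, mul_one,
        sub_mul, ← Matrix.mul_assoc, Matrix.nonsing_inv_mul _ hu, one_mul, ← Matrix.mul_assoc, hPCP, sub_self,
        sub_zero]
    rwa [e] at h
  have hEH : E.IsHermitian := (Matrix.conjTranspose_eq_transpose_of_trivial E).trans hE
  have htr : (C⁻¹ - P).trace ≤ ‖C⁻¹‖ * (Fintype.card n - Fintype.card m) := by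
    have h2 : ((C⁻¹ - P) * C).trace = Fintype.card n - Fintype.card m := by
      rw [sub_mul, Matrix.nonsing_inv_mul _ hu, Matrix.trace_sub, Matrix.trace_one, hP,
        Matrix.mul_assoc, Matrix.trace_mul_comm, Matrix.mul_assoc, ← Matrix.mul_assoc, h1, Matrix.trace_one]
    rw [← h2]
    have h4 : (‖C⁻¹‖ • C - 1).PosSemidef := by
      refine .of_dotProduct_mulVec_nonneg (Matrix.IsHermitian.sub ?_ Matrix.isHermitian_one)
        fun v => ?_
      · rw [Matrix.IsHermitian, Matrix.conjTranspose_smul, hC.isHermitian.eq, star_trivial]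
      · rw [star_trivial, Matrix.sub_mulVec, dotProduct_sub, Matrix.smul_mulVec,
          Matrix.one_mulVec, dotProduct_smul, dotProduct_self_eq_norm_sq, smul_eq_mul]
        have := norm_sq_le_of_posDef hC v
        linarith
    have h5 := trace_mul_nonneg hR h4
    rw [mul_sub, mul_one, Matrix.trace_sub, mul_smul_comm, Matrix.trace_smul, smul_eq_mul] at h5
    linarith
  have hL : ((Lm * E * Lmᵀ) * (Lm * E * Lmᵀ)).trace = (P * E * P * E).trace := by
    have e : (Lm * E * Lmᵀ) * (Lm * E * Lmᵀ) = Lm * (E * P * E * Lmᵀ) := by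
      rw [hP]; simp only [Matrix.mul_assoc]
    rw [e, Matrix.trace_mul_comm, hP]
    have e2 : E * (Lmᵀ * Lm) * E * Lmᵀ * Lm = E * (P * E * P) := by
      rw [hP]; simp only [Matrix.mul_assoc]
    rw [e2, Matrix.trace_mul_comm]
  have hquad : 0 ≤ ((C⁻¹ - P) * (E * (C⁻¹ - P) * E)).trace := by
    refine trace_mul_nonneg hR ?_
    have h := hR.mul_mul_conjTranspose_same E
    rwa [hEH.eq] at h
  have hcross : ((C⁻¹ - P) * (E * C⁻¹ * E)).trace ≤
      ‖E‖ * ‖C⁻¹‖ * ‖E‖ * (‖C⁻¹‖ * (Fintype.card n - Fintype.card m)) := by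
    have hH : (E * C⁻¹ * E).IsHermitian := by
      rw [Matrix.IsHermitian, Matrix.conjTranspose_mul, Matrix.conjTranspose_mul, hEH.eq,
        hCiH.isHermitian.eq, Matrix.mul_assoc]
    refine (trace_mul_le_norm_mul_trace hH hR).trans ?_
    have hn : ‖E * C⁻¹ * E‖ ≤ ‖E‖ * ‖C⁻¹‖ * ‖E‖ := (Matrix.l2_opNorm_mul _ _).trans
      (mul_le_mul_of_nonneg_right (Matrix.l2_opNorm_mul _ _) (norm_nonneg _))
    have htr0 : 0 ≤ (C⁻¹ - P).trace := hR.trace_nonneg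
    exact mul_le_mul hn htr htr0 (by positivity)
  -- Writing `P = C⁻¹ - (C⁻¹ - P)` gives the full information, two equal cross terms controlled by
  -- the small trace, and a nonnegative square that is dropped.
  have hid : (P * E * P * E).trace = (C⁻¹ * E * C⁻¹ * E).trace -
      2 * ((C⁻¹ - P) * (E * C⁻¹ * E)).trace + ((C⁻¹ - P) * (E * (C⁻¹ - P) * E)).trace := by
    have c1 : (C⁻¹ * (E * P * E)).trace = (P * (E * C⁻¹ * E)).trace := by
      rw [Matrix.trace_mul_comm, Matrix.mul_assoc E, Matrix.mul_assoc E, Matrix.trace_mul_comm]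
      simp only [Matrix.mul_assoc]
    simp only [sub_mul, mul_sub, Matrix.trace_sub, c1]
    simp only [Matrix.mul_assoc]
    ring
  rw [hL, hid]
  linarith

/-- The characteristic functions agree: the linear image has covariance `ASA'`, and `Aμ = 0` removes
the mean. -/
lemma map_multivariateGaussian_of_mulVec_eq_zero {S : Matrix n n ℝ} (hS : S.PosSemidef)
    (μ : EuclideanSpace ℝ n) (A : Matrix m n ℝ) (hμ : A *ᵥ μ = 0) :
    (multivariateGaussian μ S).map (fun y : EuclideanSpace ℝ n => WithLp.toLp 2 (A *ᵥ (y : n → ℝ))) =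
      (stdGaussian (EuclideanSpace ℝ m)).map
        (Matrix.toEuclideanCLM (𝕜 := ℝ) (CFC.sqrt (A * S * Aᵀ))) := by
  have hS' : (A * S * Aᵀ).PosSemidef := by
    have h := hS.mul_mul_conjTranspose_same A
    rwa [Matrix.conjTranspose_eq_transpose_of_trivial] at h
  have h0 : (stdGaussian (EuclideanSpace ℝ m)).map
      (Matrix.toEuclideanCLM (𝕜 := ℝ) (CFC.sqrt (A * S * Aᵀ))) =
      multivariateGaussian 0 (A * S * Aᵀ) := by
    simp [multivariateGaussian]
  rw [h0]
  have hmeas : Measurable fun y : EuclideanSpace ℝ n => WithLp.toLp 2 (A *ᵥ y) := by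
    have : Continuous fun y : EuclideanSpace ℝ n => WithLp.toLp 2 (A *ᵥ y) :=
      (Matrix.toEuclideanLin A).continuous_of_finiteDimensional
    exact this.measurable
  have : IsProbabilityMeasure
      ((multivariateGaussian μ S).map (fun y : EuclideanSpace ℝ n => WithLp.toLp 2 (A *ᵥ (y : n → ℝ)))) :=
    Measure.isProbabilityMeasure_map hmeas.aemeasurable
  refine Measure.ext_of_charFun ?_
  funext x
  have hin : ∀ y : EuclideanSpace ℝ n, inner ℝ (WithLp.toLp 2 (A *ᵥ y)) x =
      inner ℝ y (WithLp.toLp 2 (Aᵀ *ᵥ (x : m → ℝ))) := fun y => by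
    simp only [EuclideanSpace.inner_eq_star_dotProduct, star_trivial]
    rw [Matrix.dotProduct_mulVec, Matrix.mulVec_transpose]
  rw [charFun_multivariateGaussian hS', charFun_apply, integral_map hmeas.aemeasurable
    (by fun_prop)]
  simp only [hin]
  rw [← charFun_apply, charFun_multivariateGaussian hS, real_inner_comm, ← hin, hμ]
  have e : (Aᵀ *ᵥ (x : m → ℝ)) ⬝ᵥ S *ᵥ (Aᵀ *ᵥ (x : m → ℝ)) =
      (x : m → ℝ) ⬝ᵥ (A * S * Aᵀ) *ᵥ (x : m → ℝ) := by
    rw [Matrix.mulVec_mulVec, Matrix.dotProduct_mulVec, Matrix.vecMul_mulVec,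
      ← Matrix.dotProduct_mulVec, Matrix.transpose_transpose, Matrix.mul_assoc]
  rw [← e]
  simp

end Contrasts

end

end EmpiricalPredictor

namespace EmpiricalPredictor

noncomputable section

open scoped ContDiff MatrixOrder

/-! ### Block diagonal matrices -/

section BlockDiagonal

variable {o : Type} [Fintype o] [DecidableEq o] {m : o → Type} [∀ i, Fintype (m i)]
  [∀ i, DecidableEq (m i)] (B : ∀ i, Matrix (m i) (m i) ℝ)

lemma blockDiagonal'_mulVec_apply (v : (Σ i, m i) → ℝ) (i : o) (a : m i) :
    (Matrix.blockDiagonal' B *ᵥ v) ⟨i, a⟩ = (B i *ᵥ fun b => v ⟨i, b⟩) a := by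
  simp only [Matrix.mulVec, dotProduct, Fintype.sum_sigma]
  rw [Finset.sum_eq_single i]
  · simp only [Matrix.blockDiagonal'_apply_eq]
  · intro k _ hk
    simp only [Matrix.blockDiagonal'_apply_ne _ _ _ hk.symm, zero_mul, Finset.sum_const_zero]
  · simp

lemma dotProduct_blockDiagonal'_mulVec (v : (Σ i, m i) → ℝ) :
    v ⬝ᵥ (Matrix.blockDiagonal' B *ᵥ v) =
      ∑ i, (fun b => v ⟨i, b⟩) ⬝ᵥ (B i *ᵥ fun b => v ⟨i, b⟩) := by
  rw [dotProduct, Fintype.sum_sigma]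
  simp only [blockDiagonal'_mulVec_apply]
  rfl

lemma norm_sq_toLp_sigma (v : (Σ i, m i) → ℝ) :
    ‖WithLp.toLp 2 v‖ ^ 2 = ∑ i, ‖WithLp.toLp 2 fun b => v ⟨i, b⟩‖ ^ 2 := by
  simp only [EuclideanSpace.real_norm_sq_eq, Fintype.sum_sigma]

lemma norm_blockDiagonal'_le {C : ℝ} (hC : 0 ≤ C) (h : ∀ i, ‖B i‖ ≤ C) :
    ‖Matrix.blockDiagonal' B‖ ≤ C := by
  refine norm_le_of_mulVec_le _ hC fun v => ?_
  refine le_of_sq_le_sq ?_ (by positivity)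
  rw [mul_pow, norm_sq_toLp_sigma, norm_sq_toLp_sigma v, Finset.mul_sum]
  refine Finset.sum_le_sum fun i _ => ?_
  have e : (fun b => (Matrix.blockDiagonal' B *ᵥ v) ⟨i, b⟩) = B i *ᵥ fun b => v ⟨i, b⟩ :=
    funext fun a => blockDiagonal'_mulVec_apply B v i a
  rw [e, ← mul_pow]
  refine pow_le_pow_left₀ (norm_nonneg _) ((norm_toLp_mulVec_le _ _).trans ?_) 2
  exact mul_le_mul_of_nonneg_right (h i) (norm_nonneg _)

variable {B}

lemma posDef_blockDiagonal' (h : ∀ i, (B i).PosDef) : (Matrix.blockDiagonal' B).PosDef := by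
  refine .of_dotProduct_mulVec_pos ?_ fun {v} hv => ?_
  · rw [Matrix.IsHermitian, Matrix.blockDiagonal'_conjTranspose]
    congr 1
    funext i
    exact (h i).isHermitian
  · rw [star_trivial, dotProduct_blockDiagonal'_mulVec]
    obtain ⟨⟨i, a⟩, hia⟩ := Function.ne_iff.1 hv
    refine Finset.sum_pos' (fun k _ => ?_) ⟨i, Finset.mem_univ i, ?_⟩
    · exact (h k).posSemidef.dotProduct_mulVec_nonneg _
    · exact (h i).dotProduct_mulVec_pos fun h0 => hia (congrFun h0 a)

lemma inv_blockDiagonal' (h : ∀ i, IsUnit (B i).det) :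
    (Matrix.blockDiagonal' B)⁻¹ = Matrix.blockDiagonal' fun i => (B i)⁻¹ := by
  refine Matrix.inv_eq_right_inv ?_
  rw [← Matrix.blockDiagonal'_mul, ← Matrix.blockDiagonal'_one]
  congr 1
  funext i
  exact Matrix.mul_nonsing_inv _ (h i)

lemma sum_smul_blockDiagonal' {s : ℕ} (v : Fin s → ℝ) (B : Fin s → ∀ i, Matrix (m i) (m i) ℝ) :
    ∑ j, v j • Matrix.blockDiagonal' (B j) =
      Matrix.blockDiagonal' fun i => ∑ j, v j • B j i := by
  ext ⟨i, a⟩ ⟨k, b⟩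
  simp only [Matrix.sum_apply, Matrix.smul_apply]
  by_cases h : i = k
  · subst h
    simp only [Matrix.blockDiagonal'_apply_eq, Matrix.sum_apply, Matrix.smul_apply]
  · simp only [Matrix.blockDiagonal'_apply_ne _ _ _ h, smul_zero, Finset.sum_const_zero]

end BlockDiagonal

lemma injective_mulVec_of_rank_eq {n : Type} [Fintype n] {N : ℕ} {T : Matrix n (Fin N) ℝ}
    (h : T.rank = N) : Function.Injective T.mulVec := by
  have h1 := T.mulVecLin.finrank_range_add_finrank_ker
  have h2 : Module.finrank ℝ (LinearMap.range T.mulVecLin) = N := h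
  rw [h2, Module.finrank_fin_fun, Nat.add_eq_left, Submodule.finrank_eq_zero] at h1
  exact LinearMap.ker_eq_bot.1 h1

/-- Perturbation of a lower bound for a quadratic form. -/
lemma dotProduct_mulVec_ge_of_norm_sub_le {n : Type} [Fintype n] [DecidableEq n]
    {A A' : Matrix n n ℝ} {a b : ℝ} {v : n → ℝ}
    (h : a * ‖WithLp.toLp 2 v‖ ^ 2 ≤ v ⬝ᵥ (A *ᵥ v)) (hA : ‖A' - A‖ ≤ b) :
    (a - b) * ‖WithLp.toLp 2 v‖ ^ 2 ≤ v ⬝ᵥ (A' *ᵥ v) := by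
  have h1 := abs_le.1 (abs_dotProduct_mulVec_le (A' - A) v v)
  have h2 : v ⬝ᵥ (A' *ᵥ v) = v ⬝ᵥ (A *ᵥ v) + v ⬝ᵥ ((A' - A) *ᵥ v) := by
    rw [Matrix.sub_mulVec, dotProduct_sub]; ring
  have h3 : ‖A' - A‖ * ‖WithLp.toLp 2 v‖ ^ 2 ≤ b * ‖WithLp.toLp 2 v‖ ^ 2 := by gcongr
  rw [h2]
  linarith [h1.1]

namespace LongitudinalModel

/-! ### The longitudinal model -/

section Single

variable {q t : ℕ} (M : LongitudinalModel q t) {x σ : Param (q + 1)}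

lemma isSymm_mul_mul_transpose {m n : Type} [Fintype m] [Fintype n] (Z : Matrix m n ℝ)
    {G : Matrix n n ℝ} (hG : G.IsSymm) : (Z * G * Zᵀ).IsSymm := by
  rw [Matrix.IsSymm, Matrix.transpose_mul, Matrix.transpose_mul, Matrix.transpose_transpose, hG.eq,
    Matrix.mul_assoc]

lemma isSymm_dV (i : Fin t) (j : Fin (q + 1)) : (M.dV i j).IsSymm :=
  (M.Rc_symm i j).add (isSymm_mul_mul_transpose _ (M.Gc_symm i j))

lemma G_eq (i : Fin t) (x σ : Param (q + 1)) :
    M.G i x = M.G i σ + ∑ j, (x j - σ j) • M.Gc i j := by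
  simp only [G, sub_smul, Finset.sum_sub_distrib]
  abel

lemma V_eq (i : Fin t) (x σ : Param (q + 1)) :
    M.V i x = M.V i σ + ∑ j, (x j - σ j) • M.dV i j := by
  have h : ∀ x, M.V i x = M.R0 i + M.Z i * M.G0 i * (M.Z i)ᵀ + ∑ j, x j • M.dV i j := fun x => by
    simp only [V, R, G, dV, smul_add, Finset.sum_add_distrib, Matrix.mul_add, Matrix.add_mul,
      Matrix.mul_sum, Matrix.sum_mul, Matrix.mul_smul, Matrix.smul_mul]
    abel
  rw [h x, h σ]
  simp only [sub_smul, Finset.sum_sub_distrib]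
  abel

lemma norm_V_sub_le {K : ℝ} {i : Fin t} (h : ∀ j, ‖M.dV i j‖ ≤ K) (x σ : Param (q + 1)) :
    ‖M.V i x - M.V i σ‖ ≤ (q + 1 : ℕ) * K * ‖x - σ‖ := by
  rw [M.V_eq i x σ, add_sub_cancel_left]
  calc ‖∑ j, (x j - σ j) • M.dV i j‖ ≤ ∑ _j : Fin (q + 1), ‖x - σ‖ * K := by
        refine norm_sum_le_of_le _ fun j _ => ?_
        rw [norm_smul]
        exact mul_le_mul (PiLp.norm_apply_le (x - σ) j) (h j) (norm_nonneg _) (norm_nonneg _)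
    _ = _ := by simp; ring

/-- Covariance matrices are nonsingular in the interior of the parameter space. -/
lemma posDef_V_of_mem_interior (hσ : ∀ i, (M.V i σ).PosDef) (hx : x ∈ interior M.Θ) (i : Fin t) :
    (M.V i x).PosDef := by
  -- The segment from `σ` to `x` is prolonged slightly beyond `x` inside the parameter space. Then
  -- `Σ_i(x)` is a positive combination of a nonnegative definite matrix and the nonsingular
  -- `Σ_i(σ)`.
  have hcont : Tendsto (fun ε : ℝ => x + ε • (x - σ)) (𝓝[>] 0) (𝓝 x) := by
    have h : Continuous fun ε : ℝ => x + ε • (x - σ) := by fun_prop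
    simpa using (h.tendsto 0).mono_left nhdsWithin_le_nhds
  obtain ⟨ε, hε, hpos⟩ := ((hcont.eventually (isOpen_interior.mem_nhds hx)).and
    self_mem_nhdsWithin).exists
  have hpos : 0 < ε := hpos
  have h1 : (M.V i (x + ε • (x - σ))).PosSemidef := interior_subset hε i
  have h2 : (1 + ε) • M.V i x = M.V i (x + ε • (x - σ)) + ε • M.V i σ := by
    have hs : ∑ j, ((x + ε • (x - σ)) j - σ j) • M.dV i j =
        (1 + ε) • ∑ j, (x j - σ j) • M.dV i j := by
      rw [Finset.smul_sum]
      refine Finset.sum_congr rfl fun j _ => ?_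
      rw [smul_smul]
      congr 1
      simp only [PiLp.add_apply, PiLp.smul_apply, PiLp.sub_apply, smul_eq_mul]
      ring
    rw [M.V_eq i (x + ε • (x - σ)) σ, M.V_eq i x σ, hs]
    module
  have h3 : ((1 + ε) • M.V i x).PosDef := by
    rw [h2]
    exact Matrix.PosDef.posSemidef_add h1 ((hσ i).smul hpos)
  have h4 := h3.smul (inv_pos.2 (by linarith : (0:ℝ) < 1 + ε))
  rwa [smul_smul, inv_mul_cancel₀ (by linarith), one_smul] at h4

lemma cov_eq (x σ : Param (q + 1)) : M.cov x = M.cov σ +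
    ∑ j, (x j - σ j) • Matrix.blockDiagonal' fun i => M.dV i j := by
  rw [sum_smul_blockDiagonal' (fun j => x j - σ j) fun j i => M.dV i j, cov, cov,
    ← Matrix.blockDiagonal'_add]
  congr 1
  funext i
  exact M.V_eq i x σ

lemma trace_information (hσ : ∀ i, (M.V i σ).PosDef) (v : Fin (q + 1) → ℝ) :
    ((M.cov σ)⁻¹ * (∑ j, v j • Matrix.blockDiagonal' fun i => M.dV i j) * (M.cov σ)⁻¹ *
      (∑ j, v j • Matrix.blockDiagonal' fun i => M.dV i j)).trace =
      v ⬝ᵥ ((∑ i, M.B i σ) *ᵥ v) := by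
  rw [sum_smul_blockDiagonal' v fun j i => M.dV i j, cov,
    inv_blockDiagonal' fun i => (hσ i).det_pos.ne'.isUnit, ← Matrix.blockDiagonal'_mul,
    ← Matrix.blockDiagonal'_mul, ← Matrix.blockDiagonal'_mul, Matrix.trace_blockDiagonal',
    Matrix.sum_mulVec, dotProduct_sum]
  refine Finset.sum_congr rfl fun i _ => ?_
  simp only [Matrix.sum_mul, Matrix.trace_sum, Matrix.mul_smul, Matrix.smul_mul,
    Matrix.trace_smul, smul_eq_mul, dotProduct, Matrix.mulVec, B, Matrix.of_apply, Finset.mul_sum]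
  rw [Finset.sum_comm]
  exact Finset.sum_congr rfl fun j _ => Finset.sum_congr rfl fun k _ => by ring

end Single

/-- Uniform bounds for the quantities in the longitudinal models, with the growth of the
information. -/
structure UniformBounds {q : ℕ} (M : ∀ t, LongitudinalModel q t) (σ : Param (q + 1)) (K c : ℝ)
    (t₁ : ℕ) : Prop where
  one_le : 1 ≤ K
  c_pos : 0 < c
  posDef : ∀ t i, ((M t).V i σ).PosDef
  norm_inv : ∀ t i, ‖((M t).V i σ)⁻¹‖ ≤ K
  norm_G : ∀ t i, ‖(M t).G i σ‖ ≤ K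
  norm_Gc : ∀ t i j, ‖(M t).Gc i j‖ ≤ K
  norm_V : ∀ t i, ‖(M t).V i σ‖ ≤ K
  norm_dV : ∀ t i j, ‖(M t).dV i j‖ ≤ K
  p_le : ∀ t, ((M t).p : ℝ) ≤ K
  n_le : ∀ t i, ((M t).n i : ℝ) ≤ K
  norm_X : ∀ t i, ‖(M t).X i‖ ≤ K
  norm_Z : ∀ t i, ‖(M t).Z i‖ ≤ K
  norm_l : ∀ t, ‖(M t).l‖ ≤ K
  sum_m : ∀ t, ∑ i, ‖(M t).m i‖ ≤ K
  B_ge : ∀ t ≥ t₁, ∀ v : Fin (q + 1) → ℝ,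
    c * t * ‖WithLp.toLp 2 v‖ ^ 2 ≤ v ⬝ᵥ ((∑ i, (M t).B i σ) *ᵥ v)
  X_ge : ∀ t ≥ t₁, ∀ v : Fin (M t).p → ℝ,
    c * t * ‖WithLp.toLp 2 v‖ ^ 2 ≤ v ⬝ᵥ ((M t).XVX σ *ᵥ v)

namespace UniformBounds

variable {q : ℕ} {M : ∀ t, LongitudinalModel q t} {σ : Param (q + 1)} {K c : ℝ} {t₁ : ℕ}

lemma K_pos (h : UniformBounds M σ K c t₁) : 0 < K := zero_lt_one.trans_le h.one_le

lemma V_ge (h : UniformBounds M σ K c t₁) (t : ℕ) (i : Fin t) (v : Fin ((M t).n i) → ℝ) :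
    K⁻¹ * ‖WithLp.toLp 2 v‖ ^ 2 ≤ v ⬝ᵥ ((M t).V i σ *ᵥ v) := by
  have hK := h.K_pos
  rw [inv_mul_le_iff₀ hK]
  refine (norm_sq_le_of_posDef (h.posDef t i) v).trans ?_
  exact mul_le_mul_of_nonneg_right (h.norm_inv t i)
    ((h.posDef t i).posSemidef.dotProduct_mulVec_nonneg v)

/-- The radius is chosen so that the perturbation uses at most half of the lower bound `K⁻¹` valid
at `σ`. -/
lemma V_ge_of_mem_ball (h : UniformBounds M σ K c t₁) {r : ℝ}
    (hr : (q + 1 : ℕ) * (K * K) * r ≤ 1 / 2) {x : Param (q + 1)} (hx : x ∈ Metric.ball σ r)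
    (t : ℕ) (i : Fin t) (v : Fin ((M t).n i) → ℝ) :
    (2 * K)⁻¹ * ‖WithLp.toLp 2 v‖ ^ 2 ≤ v ⬝ᵥ ((M t).V i x *ᵥ v) := by
  have hK := h.K_pos
  rw [Metric.mem_ball, dist_eq_norm] at hx
  have h1 : ‖(M t).V i x - (M t).V i σ‖ ≤ (2 * K)⁻¹ := by
    refine ((M t).norm_V_sub_le (h.norm_dV t i) x σ).trans ?_
    rw [← one_div, le_div_iff₀ (by positivity)]
    calc (q + 1 : ℕ) * K * ‖x - σ‖ * (2 * K) = 2 * ((q + 1 : ℕ) * (K * K) * ‖x - σ‖) := by ring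
      _ ≤ 2 * ((q + 1 : ℕ) * (K * K) * r) := by gcongr
      _ ≤ 1 := by linarith
  have h2 := dotProduct_mulVec_ge_of_norm_sub_le (h.V_ge t i v) h1
  have e : K⁻¹ - (2 * K)⁻¹ = (2 * K)⁻¹ := by field_simp; ring
  rwa [e] at h2

/-- The radius does not depend on `t`, which makes the interiority of `σ` uniform. -/
lemma ball_subset (h : UniformBounds M σ K c t₁) {r : ℝ}
    (hr : (q + 1 : ℕ) * (K * K) * r ≤ 1 / 2) (t : ℕ) :
    Metric.ball σ r ⊆ interior (M t).Θ := by
  have hK := h.K_pos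
  refine interior_maximal (fun x hx i => ?_) Metric.isOpen_ball
  refine .of_dotProduct_mulVec_nonneg ?_ fun v => ?_
  · rw [(M t).V_eq i x σ]
    refine (h.posDef t i).isHermitian.add ?_
    rw [Matrix.IsHermitian, Matrix.conjTranspose_eq_transpose_of_trivial, Matrix.transpose_sum]
    simp only [Matrix.transpose_smul, ((M t).isSymm_dV i _).eq]
  · rw [star_trivial]
    exact le_trans (by positivity) (h.V_ge_of_mem_ball hr hx t i v)

lemma posDef_cov (h : UniformBounds M σ K c t₁) (t : ℕ) : ((M t).cov σ).PosDef :=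
  posDef_blockDiagonal' (h.posDef t)

lemma norm_inv_cov (h : UniformBounds M σ K c t₁) (t : ℕ) : ‖((M t).cov σ)⁻¹‖ ≤ K := by
  rw [cov, inv_blockDiagonal' fun i => (h.posDef t i).det_pos.ne'.isUnit]
  exact norm_blockDiagonal'_le _ h.K_pos.le (h.norm_inv t)

lemma norm_dcov (h : UniformBounds M σ K c t₁) (t : ℕ) (j : Fin (q + 1)) :
    ‖Matrix.blockDiagonal' fun i => (M t).dV i j‖ ≤ K :=
  norm_blockDiagonal'_le _ h.K_pos.le fun i => h.norm_dV t i j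

/-- The restricted likelihoods of the longitudinal models reduce to those of standardized error
contrasts. -/
theorem exists_remlReduction (h : UniformBounds M σ K c t₁) (β : ∀ t, Fin (M t).p → ℝ)
    (T : ∀ t, Matrix (M t).Obs (Fin (M t).contrasts) ℝ) (hT : ∀ t, (M t).IsContrast (T t))
    {r₁ : ℝ} (hr₁ : 0 < r₁) :
    ∃ D : REMLReduction (fun t => (M t).reml (T t) (β t)) σ, D.r ≤ r₁ ∧
      (q + 1 : ℕ) * (K * K) * D.r ≤ 1 / 2 ∧ t₁ ≤ D.t₀ := by
  have hK := h.K_pos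
  have hK1 := h.one_le
  have hc := h.c_pos
  have hTi : ∀ t, Function.Injective (T t).mulVec := fun t => injective_mulVec_of_rank_eq (hT t).1
  set s : ℝ := ((q + 1 : ℕ) : ℝ) with hs
  have hs0 : 0 < s := by positivity
  set r : ℝ := min r₁ (1 / (2 * (s * (K * K)))) with hr
  have hr0 : 0 < r := by positivity
  have hrle : s * (K * K) * r ≤ 1 / 2 := by
    have h1 : r ≤ 1 / (2 * (s * (K * K))) := min_le_right _ _
    rw [le_div_iff₀ (by positivity)] at h1
    linarith
  -- From `t₂` on, the bounded loss caused by eliminating the fixed effects is at most half of the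
  -- information `c t`; hence the constant `c / 2` in the reduction.
  obtain ⟨t₂, ht₂⟩ := exists_nat_ge (4 * (s ^ 2 * K ^ 5) / c)
  set W : ∀ t, Matrix (Fin (M t).contrasts) (M t).Obs ℝ := fun t =>
    whiten ((M t).cov σ) (T t) with hW
  set dC : ∀ t, Fin (q + 1) → Matrix (M t).Obs (M t).Obs ℝ := fun t j =>
    Matrix.blockDiagonal' fun i => (M t).dV i j with hdC
  set Km : ∀ t, Fin (q + 1) → Matrix (Fin (M t).contrasts) (Fin (M t).contrasts) ℝ := fun t j =>
    W t * dC t j * (W t)ᵀ with hKm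
  have hdCs : ∀ t j, (dC t j).IsSymm := fun t j => by
    rw [Matrix.IsSymm, hdC, Matrix.blockDiagonal'_transpose]
    congr 1
    funext i
    exact (M t).isSymm_dV i j
  have hred : ∀ t x, redCov (Km t) σ x = W t * (M t).cov x * (W t)ᵀ := fun t x => by
    rw [(M t).cov_eq x σ, Matrix.mul_add, Matrix.add_mul, hW,
      whiten_mul_self (h.posDef_cov t) (hTi t), redCov, Matrix.mul_sum, Matrix.sum_mul]
    congr 1
    refine Finset.sum_congr rfl fun j _ => ?_
    rw [Matrix.mul_smul, Matrix.smul_mul]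
  have hcovx : ∀ t, ∀ x ∈ interior (M t).Θ, ((M t).cov x).PosDef := fun t x hx =>
    posDef_blockDiagonal' fun i => (M t).posDef_V_of_mem_interior (h.posDef t) hx i
  have hN : ∀ t : ℕ, ((M t).contrasts : ℝ) ≤ K * t := fun t => by
    have h1 : (M t).contrasts ≤ ∑ i, (M t).n i := Nat.sub_le _ _
    calc ((M t).contrasts : ℝ) ≤ ((∑ i, (M t).n i : ℕ) : ℝ) := by exact_mod_cast h1
      _ = ∑ i, ((M t).n i : ℝ) := by push_cast; rfl
      _ ≤ ∑ _i : Fin t, K := Finset.sum_le_sum fun i _ => h.n_le t i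
      _ = K * t := by simp [mul_comm]
  refine ⟨
    { t₀ := max 1 (max t₁ t₂)
      one_le_t₀ := le_max_left _ _
      N := fun t => (M t).contrasts
      K := Km
      L := fun t (y : EuclideanSpace ℝ (M t).Obs) => WithLp.toLp 2 (W t *ᵥ (y : (M t).Obs → ℝ))
      c₀ := fun t => -(1 / 2) * Real.log ((T t)ᵀ * (M t).cov σ * T t).det
      κ := K * K
      c := c / 2
      r := r
      κ_nonneg := by positivity
      c_pos := by positivity
      r_pos := hr0
      r_le := hrle
      K_symm := fun t j => isSymm_mul_mul_transpose _ (hdCs t j)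
      K_norm := fun t _ j => ?_
      N_le := fun t _ => ?_
      info := fun t ht v => ?_
      L_meas := fun t => ?_
      d_eq := fun t i => rfl
      ball_subset := fun t _ => h.ball_subset hrle t
      posDef := fun t _ x hx => ?_
      l_eq := fun t _ x hx y => ?_
      law_map := fun t _ x hx => ?_
      prob := fun t x => inferInstanceAs (IsProbabilityMeasure (multivariateGaussian _ _)) },
    min_le_left _ _, hrle, (le_max_left _ _).trans (le_max_right _ _)⟩
  · refine (norm_whiten_mul_mul_le (h.posDef_cov t) (hTi t) _).trans ?_
    exact mul_le_mul (h.norm_inv_cov t) (h.norm_dcov t j) (norm_nonneg _) hK.le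
  · refine (hN t).trans (mul_le_mul_of_nonneg_right ?_ (Nat.cast_nonneg t))
    exact le_mul_of_one_le_left hK.le hK1
  · have ht1 : t ≥ t₁ := (le_max_left _ _).trans ((le_max_right _ _).trans ht)
    have ht2 : t ≥ t₂ := (le_max_right _ _).trans ((le_max_right _ _).trans ht)
    set E := ∑ j, v j • dC t j with hE
    have hEs : E.IsSymm := by
      rw [Matrix.IsSymm, hE, Matrix.transpose_sum]
      simp only [Matrix.transpose_smul, (hdCs t _).eq]
    have e1 : ∑ j, v j • Km t j = W t * E * (W t)ᵀ := by
      rw [hE, Matrix.mul_sum, Matrix.sum_mul]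
      refine Finset.sum_congr rfl fun j _ => ?_
      rw [Matrix.mul_smul, Matrix.smul_mul]
    have hEn : ‖E‖ ≤ s * K * ‖WithLp.toLp 2 v‖ := by
      calc ‖E‖ ≤ ∑ _j : Fin (q + 1), ‖WithLp.toLp 2 v‖ * K := by
            refine norm_sum_le_of_le _ fun j _ => ?_
            rw [norm_smul]
            exact mul_le_mul (PiLp.norm_apply_le (WithLp.toLp 2 v) j) (h.norm_dcov t j)
              (norm_nonneg _) (norm_nonneg _)
        _ = _ := by rw [Finset.sum_const, Finset.card_univ, Fintype.card_fin, nsmul_eq_mul]; ring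
    have h1 := trace_whiten_mul_self_ge (h.posDef_cov t) (hTi t) hEs
    rw [(M t).trace_information (h.posDef t) v] at h1
    have h2 := h.B_ge t ht1 v
    rw [e1]
    refine le_trans ?_ h1
    have hcard : 0 ≤ (Fintype.card (M t).Obs : ℝ) - Fintype.card (Fin (M t).contrasts) ∧
        (Fintype.card (M t).Obs : ℝ) - Fintype.card (Fin (M t).contrasts) ≤ K := by
      have e2 : Fintype.card (M t).Obs = ∑ i, (M t).n i := by
        rw [Fintype.card_sigma]; simp
      rw [e2, Fintype.card_fin]
      -- The number of contrasts is a truncated difference of natural numbers; this inequality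
      -- survives truncation.
      have e3 : ∑ i, (M t).n i ≤ (M t).contrasts + (M t).p := le_tsub_add
      have e4 : ((∑ i, (M t).n i : ℕ) : ℝ) ≤ (M t).contrasts + (M t).p := by exact_mod_cast e3
      have e5 : ((M t).contrasts : ℝ) ≤ ((∑ i, (M t).n i : ℕ) : ℝ) := by
        exact_mod_cast Nat.sub_le _ _
      have := h.p_le t
      constructor <;> linarith
    obtain ⟨hcard0, hcard⟩ := hcard
    set nv := ‖WithLp.toLp 2 v‖
    have hinv := h.norm_inv_cov t
    have h3 : ‖((M t).cov σ)⁻¹‖ * (‖E‖ * ‖((M t).cov σ)⁻¹‖ * ‖E‖) *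
        (Fintype.card (M t).Obs - Fintype.card (Fin (M t).contrasts)) ≤
        K * (s * K * nv * K * (s * K * nv)) * K := by gcongr
    have h4 : 2 * (K * (s * K * nv * K * (s * K * nv)) * K) ≤ c / 2 * t * nv ^ 2 := by
      have h5 : 4 * (s ^ 2 * K ^ 5) ≤ c * t := by
        rw [div_le_iff₀ hc] at ht₂
        refine ht₂.trans ?_
        rw [mul_comm]
        gcongr
      have h6 : 0 ≤ nv ^ 2 := sq_nonneg _
      nlinarith
    linarith
  · have hcont : Continuous fun y : EuclideanSpace ℝ (M t).Obs =>
        WithLp.toLp 2 (W t *ᵥ (y : (M t).Obs → ℝ)) :=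
      (Matrix.toEuclideanLin (W t)).continuous_of_finiteDimensional
    exact hcont.measurable
  · rw [hred]
    exact posDef_whiten_mul_mul (h.posDef_cov t) (hTi t) (hcovx t x hx)
  · have e0 : ((M t).reml (T t) (β t)).l x y = -(1 / 2) *
        (Real.log ((T t)ᵀ * (M t).cov x * T t).det + WithLp.ofLp y ⬝ᵥ
          ((T t * ((T t)ᵀ * (M t).cov x * T t)⁻¹ * (T t)ᵀ) *ᵥ WithLp.ofLp y)) := rfl
    rw [e0, hred, log_det_transpose_mul_mul (h.posDef_cov t) (hTi t) (hcovx t x hx),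
      mul_inv_mul_transpose_eq (h.posDef_cov t) (hTi t)]
    have e : WithLp.ofLp y ⬝ᵥ (((W t)ᵀ * (W t * (M t).cov x * (W t)ᵀ)⁻¹ * W t) *ᵥ
        WithLp.ofLp y) = qf (W t * (M t).cov x * (W t)ᵀ)⁻¹
          (WithLp.toLp 2 (W t *ᵥ WithLp.ofLp y)) := by
      rw [qf, Matrix.mul_assoc, ← Matrix.mulVec_mulVec, ← Matrix.mulVec_mulVec,
        Matrix.dotProduct_mulVec, Matrix.vecMul_transpose]
    rw [e]
    ring
  -- The contrasts annihilate the design, so the reduced law does not involve `β`.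
  · have hzero : W t *ᵥ (WithLp.toLp 2 ((M t).stackedX *ᵥ β t)).ofLp = 0 := by
      simp only [hW, whiten]
      rw [Matrix.mulVec_mulVec, Matrix.mul_assoc, (hT t).2, Matrix.mul_zero,
        Matrix.zero_mulVec]
    rw [hred]
    exact map_multivariateGaussian_of_mulVec_eq_zero (hcovx t x hx).posSemidef _ (W t) hzero

end UniformBounds

end LongitudinalModel

end

end EmpiricalPredictor

namespace EmpiricalPredictor

noncomputable section

open scoped ContDiff MatrixOrder

/-! ### Affine functions of the parameter -/

section Affine

variable {s : ℕ} {E : Type*} [NormedAddCommGroup E] [NormedSpace ℝ E] {σ : Param s}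

lemma hasFDerivAt_affine (A₀ : E) (A : Fin s → E) (x : Param s) :
    HasFDerivAt (fun x : Param s => A₀ + ∑ j, (x j - σ j) • A j)
      (∑ j, (EuclideanSpace.proj j : Param s →L[ℝ] ℝ).smulRight (A j)) x := by
  refine (HasFDerivAt.fun_sum fun j _ => ?_).const_add _
  exact ((EuclideanSpace.proj j : Param s →L[ℝ] ℝ).hasFDerivAt.sub_const (σ j)).smul_const (A j)

lemma contDiff_affine {k : WithTop ℕ∞} (A₀ : E) (A : Fin s → E) :
    ContDiff ℝ k (fun x : Param s => A₀ + ∑ j, (x j - σ j) • A j) := by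
  refine contDiff_const.add (ContDiff.sum fun j _ => ContDiff.smul ?_ contDiff_const)
  exact (EuclideanSpace.proj j : Param s →L[ℝ] ℝ).contDiff.sub contDiff_const

lemma bddDeriv_affine {U : Set (Param s)} {A₀ : E} {A : Fin s → E} {C : ℝ}
    (h : ∀ x ∈ U, ‖A₀ + ∑ j, (x j - σ j) • A j‖ ≤ C) (hA : ∀ j, ‖A j‖ ≤ C) (k : ℕ) :
    BddDeriv U k (fun x : Param s => A₀ + ∑ j, (x j - σ j) • A j) C := by
  cases k with
  | zero => exact h
  | succ k =>
    refine ⟨h, fun x _ => (hasFDerivAt_affine A₀ A x).differentiableAt, fun i => ?_⟩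
    have e : vpd i (fun x : Param s => A₀ + ∑ j, (x j - σ j) • A j) = fun _ => A i := by
      funext x
      rw [vpd, (hasFDerivAt_affine A₀ A x).fderiv]
      simp [PiLp.single_apply]
    rw [e]
    exact (BddDeriv.const _ _ _).mono (hA i)

lemma norm_affine_le {A₀ : E} {A : Fin s → E} {K : ℝ} (hA₀ : ‖A₀‖ ≤ K) (hA : ∀ j, ‖A j‖ ≤ K)
    (x : Param s) : ‖A₀ + ∑ j, (x j - σ j) • A j‖ ≤ K + s * K * ‖x - σ‖ := by
  refine (norm_add_le _ _).trans (add_le_add hA₀ ?_)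
  calc ‖∑ j, (x j - σ j) • A j‖ ≤ ∑ _j : Fin s, ‖x - σ‖ * K := by
        refine norm_sum_le_of_le _ fun j _ => ?_
        rw [norm_smul]
        exact mul_le_mul (PiLp.norm_apply_le (x - σ) j) (hA j) (norm_nonneg _) (norm_nonneg _)
    _ = _ := by simp; ring

end Affine

lemma inv_eq_smul_inv_smul {n : Type} [Fintype n] [DecidableEq n] {A : Matrix n n ℝ}
    (hA : IsUnit A.det) {a : ℝ} (ha : a ≠ 0) : A⁻¹ = a • (a • A)⁻¹ := by
  refine Matrix.inv_eq_right_inv ?_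
  have hu : IsUnit (a • A).det := by
    rw [Matrix.det_smul]
    exact ((IsUnit.mk0 _ ha).pow _).mul hA
  rw [Matrix.mul_smul, ← Matrix.smul_mul, Matrix.mul_nonsing_inv _ hu]

/-! ### Smoothness of the mean squared error approximation and uniform bounds for its derivatives -/

namespace LongitudinalModel

section Single

variable {q t : ℕ} (M : LongitudinalModel q t) {σ : Param (q + 1)}

lemma contDiff_G {k : WithTop ℕ∞} (i : Fin t) : ContDiff ℝ k (M.G i) := by
  have e : M.G i = _ := funext fun x => M.G_eq i x 0
  rw [e]
  exact contDiff_affine _ _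

lemma contDiff_V {k : WithTop ℕ∞} (i : Fin t) : ContDiff ℝ k (M.V i) := by
  have e : M.V i = _ := funext fun x => M.V_eq i x 0
  rw [e]
  exact contDiff_affine _ _

lemma contDiffOn_inv_V (hσ : ∀ i, (M.V i σ).PosDef) (i : Fin t) :
    ContDiffOn ℝ ∞ (fun x => (M.V i x)⁻¹) (interior M.Θ) :=
  (M.contDiff_V i).contDiffOn.matInv fun _ hx =>
    (M.posDef_V_of_mem_interior hσ hx i).det_pos.ne'.isUnit

lemma contDiffOn_sVec (hσ : ∀ i, (M.V i σ).PosDef) (i : Fin t) :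
    ContDiffOn ℝ ∞ (fun x => WithLp.toLp 2 (M.sVec i x)) (interior M.Θ) :=
  (((M.contDiffOn_inv_V hσ i).matMul contDiffOn_const).matMul
    (M.contDiff_G i).contDiffOn).mulVec_const _

lemma dsVec_eqOn {O : Set (Param (q + 1))} (i : Fin t) (j : Fin (q + 1))
    (h : ∀ x ∈ O, DifferentiableAt ℝ (fun x => WithLp.toLp 2 (M.sVec i x)) x) :
    Set.EqOn (vpd j fun x => WithLp.toLp 2 (M.sVec i x))
      (fun x => WithLp.toLp 2 (M.dsVec i j x)) O := fun x hx => by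
  ext a
  exact (vpd_clm (EuclideanSpace.proj a : EuclideanSpace ℝ (Fin (M.n i)) →L[ℝ] ℝ) (h x hx) j).symm

lemma contDiffOn_dsVec (hσ : ∀ i, (M.V i σ).PosDef) (i : Fin t) (j : Fin (q + 1)) :
    ContDiffOn ℝ ∞ (fun x => WithLp.toLp 2 (M.dsVec i j x)) (interior M.Θ) := by
  have h := M.contDiffOn_sVec hσ i
  refine (h.vpd isOpen_interior (k' := ∞) (by simp) j).congr fun x hx => ?_
  exact (M.dsVec_eqOn i j (fun x hx => h.differentiableAt_of_isOpen isOpen_interior (by simp) hx)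
    hx).symm

lemma contDiffOn_XVX (hσ : ∀ i, (M.V i σ).PosDef) :
    ContDiffOn ℝ ∞ M.XVX (interior M.Θ) :=
  ContDiffOn.sum fun i _ => (contDiffOn_const.matMul (M.contDiffOn_inv_V hσ i)).matMul
    contDiffOn_const

lemma _root_.ContDiffOn.euclideanDotProduct {s : ℕ} {n : Type} [Fintype n] [DecidableEq n]
    {k : WithTop ℕ∞} {O : Set (Param s)} {f g : Param s → n → ℝ}
    (hf : ContDiffOn ℝ k (fun x => WithLp.toLp 2 (f x)) O)
    (hg : ContDiffOn ℝ k (fun x => WithLp.toLp 2 (g x)) O) :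
    ContDiffOn ℝ k (fun x => f x ⬝ᵥ g x) O := by
  refine (hf.inner ℝ hg).congr fun x _ => ?_
  simp [PiLp.inner_apply, dotProduct, mul_comm]

lemma contDiffOn_g1 (hσ : ∀ i, (M.V i σ).PosDef) : ContDiffOn ℝ ∞ M.g1 (interior M.Θ) := by
  refine ContDiffOn.sum fun i _ => ?_
  have hG := (M.contDiff_G (k := ∞) i).contDiffOn (s := interior M.Θ)
  exact (hG.sub ((((hG.matMul contDiffOn_const).matMul (M.contDiffOn_inv_V hσ i)).matMul
    contDiffOn_const).matMul hG)).qf (M.m i)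

lemma contDiffOn_g2Vec (hσ : ∀ i, (M.V i σ).PosDef) :
    ContDiffOn ℝ ∞ (fun x => WithLp.toLp 2 (M.g2Vec x)) (interior M.Θ) := by
  have e : (fun x => WithLp.toLp 2 (M.g2Vec x)) =
      fun x => M.l - ∑ i, WithLp.toLp 2 ((M.X i)ᵀ *ᵥ M.sVec i x) := by
    funext x
    simp only [g2Vec, WithLp.toLp_sub, WithLp.toLp_sum, WithLp.toLp_ofLp]
  rw [e]
  exact contDiffOn_const.sub (ContDiffOn.sum fun i _ =>
    contDiffOn_const.mulVec (M.contDiffOn_sVec hσ i))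

lemma contDiffOn_g2 (hσ : ∀ i, (M.V i σ).PosDef)
    (hX : ∀ x ∈ interior M.Θ, IsUnit (M.XVX x).det) : ContDiffOn ℝ ∞ M.g2 (interior M.Θ) :=
  (M.contDiffOn_g2Vec hσ).euclideanDotProduct
    (((M.contDiffOn_XVX hσ).matInv hX).mulVec (M.contDiffOn_g2Vec hσ))

lemma contDiffOn_sSensitivity (hσ : ∀ i, (M.V i σ).PosDef) :
    ContDiffOn ℝ ∞ M.sSensitivity (interior M.Θ) := by
  refine ContDiffOn.matrix_of_apply fun j k => ?_
  simp only [sSensitivity, Matrix.of_apply]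
  exact ContDiffOn.sum fun i _ => (M.contDiffOn_dsVec hσ i j).euclideanDotProduct
      ((M.contDiff_V i).contDiffOn.mulVec (M.contDiffOn_dsVec hσ i k))

lemma dotProduct_XVX_mulVec (x : Param (q + 1)) (v : Fin M.p → ℝ) :
    v ⬝ᵥ (M.XVX x *ᵥ v) = ∑ i, (M.X i *ᵥ v) ⬝ᵥ ((M.V i x)⁻¹ *ᵥ (M.X i *ᵥ v)) := by
  rw [XVX, Matrix.sum_mulVec, dotProduct_sum]
  refine Finset.sum_congr rfl fun i _ => ?_
  rw [← Matrix.mulVec_mulVec, ← Matrix.mulVec_mulVec, Matrix.dotProduct_mulVec,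
    Matrix.vecMul_transpose]

end Single

namespace UniformBounds

variable {q : ℕ} {M : ∀ t, LongitudinalModel q t} {σ : Param (q + 1)} {K c : ℝ} {t₁ : ℕ}

/-- Each `|m_i|` is at most the whole sum. Terms quadratic in `m_i` can thus be added over `i`
without a factor `t`. -/
lemma sum_sq_m (h : UniformBounds M σ K c t₁) (t : ℕ) : ∑ i, ‖(M t).m i‖ ^ 2 ≤ K * K := by
  have hK := h.K_pos
  calc ∑ i, ‖(M t).m i‖ ^ 2 ≤ ∑ i, K * ‖(M t).m i‖ := by
        refine Finset.sum_le_sum fun i hi => ?_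
        rw [sq]
        refine mul_le_mul_of_nonneg_right (le_trans ?_ (h.sum_m t)) (norm_nonneg _)
        exact Finset.single_le_sum (f := fun i => ‖(M t).m i‖) (fun _ _ => norm_nonneg _) hi
    _ = K * ∑ i, ‖(M t).m i‖ := (Finset.mul_sum _ _ _).symm
    _ ≤ K * K := mul_le_mul_of_nonneg_left (h.sum_m t) hK.le

/-- Blockwise `Σ_i(σ)⁻¹ ≤ K ≤ K b Σ_i(x)⁻¹` when `Σ_i(x) ≤ b`, so the lower bound at `σ` passes to
`x`. -/
lemma XVX_ge (h : UniformBounds M σ K c t₁) {t : ℕ} (ht : t₁ ≤ t) {x : Param (q + 1)}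
    (hx : x ∈ interior (M t).Θ) {b : ℝ} (hb : 0 < b) (hV : ∀ i, ‖(M t).V i x‖ ≤ b)
    (v : Fin (M t).p → ℝ) :
    c * t / (K * b) * ‖WithLp.toLp 2 v‖ ^ 2 ≤ v ⬝ᵥ ((M t).XVX x *ᵥ v) := by
  have hK := h.K_pos
  have h1 := h.X_ge t ht v
  have h2 : v ⬝ᵥ ((M t).XVX σ *ᵥ v) ≤ K * b * v ⬝ᵥ ((M t).XVX x *ᵥ v) := by
    rw [dotProduct_XVX_mulVec, dotProduct_XVX_mulVec, Finset.mul_sum]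
    refine Finset.sum_le_sum fun i _ => ?_
    set w := (M t).X i *ᵥ v
    have h3 := (abs_le.1 (abs_dotProduct_mulVec_le ((M t).V i σ)⁻¹ w w)).2
    have hp := ((M t).posDef_V_of_mem_interior (h.posDef t) hx i)
    have h4 := norm_sq_le_of_posDef hp.inv w
    rw [Matrix.nonsing_inv_nonsing_inv _ hp.det_pos.ne'.isUnit] at h4
    have h5 := hp.inv.posSemidef.dotProduct_mulVec_nonneg w
    rw [star_trivial] at h5
    have h6 := h.norm_inv t i
    have h7 : ‖WithLp.toLp 2 w‖ ^ 2 ≤ b * w ⬝ᵥ (((M t).V i x)⁻¹ *ᵥ w) :=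
      h4.trans (mul_le_mul_of_nonneg_right (hV i) h5)
    calc w ⬝ᵥ (((M t).V i σ)⁻¹ *ᵥ w) ≤ K * ‖WithLp.toLp 2 w‖ ^ 2 := by
          refine h3.trans ?_
          rw [mul_assoc, ← sq]
          exact mul_le_mul_of_nonneg_right h6 (sq_nonneg _)
      _ ≤ _ := by
          rw [mul_assoc]
          exact mul_le_mul_of_nonneg_left h7 hK.le
  rw [div_mul_eq_mul_div, div_le_iff₀ (by positivity)]
  linarith

lemma isUnit_det_XVX (h : UniformBounds M σ K c t₁) {t : ℕ} (ht : t₁ ≤ t) (ht0 : 0 < t)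
    {x : Param (q + 1)} (hx : x ∈ interior (M t).Θ) : IsUnit ((M t).XVX x).det := by
  have hK := h.K_pos
  have hc := h.c_pos
  have ht0' : (0 : ℝ) < t := by exact_mod_cast ht0
  -- A crude bound depending on `x` and `t` is enough here: only invertibility on the whole interior
  -- is wanted.
  set b := 1 + ∑ i, ‖(M t).V i x‖ with hb
  have hb0 : 0 < b := by positivity
  refine (norm_inv_le_of_lower_bound (a := c * t / (K * b)) (by positivity)
    (h.XVX_ge ht hx hb0 fun i => ?_)).1
  have := Finset.single_le_sum (f := fun i => ‖(M t).V i x‖) (fun _ _ => norm_nonneg _)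
    (Finset.mem_univ i)
  linarith

lemma radius_le (h : UniformBounds M σ K c t₁) {r : ℝ}
    (hr : (q + 1 : ℕ) * (K * K) * r ≤ 1 / 2) {x : Param (q + 1)} (hx : x ∈ Metric.ball σ r) :
    K + (q + 1 : ℕ) * K * ‖x - σ‖ ≤ 2 * K := by
  have hK := h.one_le
  rw [Metric.mem_ball, dist_eq_norm] at hx
  have h1 : (q + 1 : ℕ) * K * ‖x - σ‖ ≤ (q + 1 : ℕ) * (K * K) * r := by
    have : K ≤ K * K := by nlinarith
    gcongr
  linarith

lemma norm_V_le (h : UniformBounds M σ K c t₁) {r : ℝ}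
    (hr : (q + 1 : ℕ) * (K * K) * r ≤ 1 / 2) {x : Param (q + 1)} (hx : x ∈ Metric.ball σ r)
    (t : ℕ) (i : Fin t) : ‖(M t).V i x‖ ≤ 2 * K := by
  rw [(M t).V_eq i x σ]
  exact (norm_affine_le (h.norm_V t i) (h.norm_dV t i) x).trans (h.radius_le hr hx)

lemma bddDeriv_V (h : UniformBounds M σ K c t₁) {r : ℝ}
    (hr : (q + 1 : ℕ) * (K * K) * r ≤ 1 / 2) (k t : ℕ) (i : Fin t) :
    BddDeriv (Metric.ball σ r) k ((M t).V i) (2 * K) := by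
  have e : (M t).V i = _ := funext fun x => (M t).V_eq i x σ
  rw [e]
  refine bddDeriv_affine (fun x hx => ?_) (fun j => ?_) k
  · rw [← (M t).V_eq i x σ]
    exact h.norm_V_le hr hx t i
  · have := h.K_pos
    linarith [h.norm_dV t i j]

lemma bddDeriv_G (h : UniformBounds M σ K c t₁) {r : ℝ}
    (hr : (q + 1 : ℕ) * (K * K) * r ≤ 1 / 2) (k t : ℕ) (i : Fin t) :
    BddDeriv (Metric.ball σ r) k ((M t).G i) (2 * K) := by
  have e : (M t).G i = _ := funext fun x => (M t).G_eq i x σ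
  rw [e]
  refine bddDeriv_affine (fun x hx => ?_) (fun j => ?_) k
  · exact (norm_affine_le (h.norm_G t i) (h.norm_Gc t i) x).trans (h.radius_le hr hx)
  · have := h.K_pos
    linarith [h.norm_Gc t i j]

lemma exists_bddDeriv_inv_V (h : UniformBounds M σ K c t₁) (k : ℕ) : ∃ C ≥ 0, ∀ {r : ℝ},
    (q + 1 : ℕ) * (K * K) * r ≤ 1 / 2 → ∀ (t : ℕ) (i : Fin t),
      BddDeriv (Metric.ball σ r) k (fun x => ((M t).V i x)⁻¹) C := by
  have hK := h.K_pos
  obtain ⟨C, hC, hi⟩ := BddDeriv.exists_inv (s := q + 1) k (2 * K) (2 * K) (by positivity)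
    (by positivity)
  refine ⟨C, hC, fun {r} hr t i => ?_⟩
  have hb : ∀ x ∈ Metric.ball σ r, _ := fun x hx =>
    norm_inv_le_of_lower_bound (inv_pos.2 (by positivity)) (h.V_ge_of_mem_ball hr hx t i)
  refine hi Metric.isOpen_ball (h.bddDeriv_V hr k t i) (fun x hx => (hb x hx).1) fun x hx => ?_
  simpa only [inv_inv] using (hb x hx).2

/-- The proportionality to `|m_i|` is what makes the sums over `i` in `g2` and `g3` bounded. -/
lemma exists_bddDeriv_sVec (h : UniformBounds M σ K c t₁) (k : ℕ) : ∃ C ≥ 0, ∀ {r : ℝ},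
    (q + 1 : ℕ) * (K * K) * r ≤ 1 / 2 → ∀ (t : ℕ) (i : Fin t),
      BddDeriv (Metric.ball σ r) k (fun x => WithLp.toLp 2 ((M t).sVec i x))
        (C * ‖(M t).m i‖) := by
  have hK := h.K_pos
  obtain ⟨C, hC, hV⟩ := h.exists_bddDeriv_inv_V k
  refine ⟨2 ^ k * (2 ^ k * C * K) * (2 * K), by positivity, fun {r} hr t i => ?_⟩
  have hO : IsOpen (Metric.ball σ r) := Metric.isOpen_ball
  have h1 := ((hV hr t i).matMul hO ((BddDeriv.const _ k ((M t).Z i)).mono (h.norm_Z t i)) hC)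
  have h2 := (h1.matMul hO (h.bddDeriv_G hr k t i) (by positivity)).mulVec_const hO
    ((M t).m i : Fin ((M t).r i) → ℝ)
  rw [mul_comm] at h2
  exact h2

lemma exists_bddDeriv_dsVec (h : UniformBounds M σ K c t₁) (k : ℕ) : ∃ C ≥ 0, ∀ {r : ℝ},
    (q + 1 : ℕ) * (K * K) * r ≤ 1 / 2 → ∀ (t : ℕ) (i : Fin t) (j : Fin (q + 1)),
      BddDeriv (Metric.ball σ r) k (fun x => WithLp.toLp 2 ((M t).dsVec i j x))
        (C * ‖(M t).m i‖) := by
  obtain ⟨C, hC, hs⟩ := h.exists_bddDeriv_sVec (k + 1)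
  refine ⟨C, hC, fun {r} hr t i j => ?_⟩
  exact ((hs hr t i).vpd j).congr Metric.isOpen_ball
    ((M t).dsVec_eqOn i j fun x hx => (hs hr t i).differentiableAt hx)

lemma exists_bddDeriv_g1 (h : UniformBounds M σ K c t₁) (k : ℕ) : ∃ C ≥ 0, ∀ {r : ℝ},
    (q + 1 : ℕ) * (K * K) * r ≤ 1 / 2 → ∀ t, BddDeriv (Metric.ball σ r) k (M t).g1 C := by
  have hK := h.K_pos
  obtain ⟨C, hC, hV⟩ := h.exists_bddDeriv_inv_V k
  set C₁ := 2 * K + 2 ^ k * (2 ^ k * (2 ^ k * (2 ^ k * (2 * K) * K) * C) * K) * (2 * K) with hC₁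
  refine ⟨K * K * C₁, by positivity, fun {r} hr t => ?_⟩
  have hO : IsOpen (Metric.ball σ r) := Metric.isOpen_ball
  have h1 : ∀ i, BddDeriv (Metric.ball σ r) k (fun x => (M t).G i x -
      (M t).G i x * ((M t).Z i)ᵀ * ((M t).V i x)⁻¹ * (M t).Z i * (M t).G i x) C₁ := fun i => by
    have hG := h.bddDeriv_G hr k t i
    have hZ := (BddDeriv.const (Metric.ball σ r) k ((M t).Z i)).mono (h.norm_Z t i)
    have hZt := (BddDeriv.const (Metric.ball σ r) k ((M t).Z i)ᵀ).mono
      ((norm_transpose_eq _).trans_le (h.norm_Z t i))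
    exact hG.sub hO (((((hG.matMul hO hZt (by positivity)).matMul hO (hV hr t i)
      (by positivity)).matMul hO hZ (by positivity)).matMul hO hG (by positivity)))
  refine (BddDeriv.sum hO Finset.univ fun i _ => (h1 i).qf hO ((M t).m i)).mono ?_
  rw [← Finset.sum_mul]
  exact mul_le_mul_of_nonneg_right (h.sum_sq_m t) (by positivity)

lemma exists_bddDeriv_g2Vec (h : UniformBounds M σ K c t₁) (k : ℕ) : ∃ C ≥ 0, ∀ {r : ℝ},
    (q + 1 : ℕ) * (K * K) * r ≤ 1 / 2 → ∀ t,
      BddDeriv (Metric.ball σ r) k (fun x => WithLp.toLp 2 ((M t).g2Vec x)) C := by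
  have hK := h.K_pos
  obtain ⟨C, hC, hs⟩ := h.exists_bddDeriv_sVec k
  refine ⟨K + 2 ^ k * K * C * K, by positivity, fun {r} hr t => ?_⟩
  have hO : IsOpen (Metric.ball σ r) := Metric.isOpen_ball
  have e : (fun x => WithLp.toLp 2 ((M t).g2Vec x)) =
      fun x => (M t).l - ∑ i, WithLp.toLp 2 (((M t).X i)ᵀ *ᵥ (M t).sVec i x) := by
    funext x
    simp only [g2Vec, WithLp.toLp_sub, WithLp.toLp_sum, WithLp.toLp_ofLp]
  rw [e]
  refine ((BddDeriv.const _ k (M t).l).mono (h.norm_l t)).sub hO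
    ((BddDeriv.sum hO Finset.univ fun i _ => ((BddDeriv.const _ k ((M t).X i)ᵀ).mono
      ((norm_transpose_eq _).trans_le (h.norm_X t i))).mulVec hO (hs hr t i) hK.le).mono ?_)
  simp only [← mul_assoc]
  rw [← Finset.mul_sum]
  exact mul_le_mul_of_nonneg_left (h.sum_m t) (by positivity)

/-- Normalized by `t`, the matrix and its inverse are uniformly bounded near `σ`; undoing the
normalization only contributes the factor `t⁻¹ ≤ 1`. -/
lemma exists_bddDeriv_inv_XVX (h : UniformBounds M σ K c t₁) (k : ℕ) : ∃ C ≥ 0, ∀ {r : ℝ},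
    (q + 1 : ℕ) * (K * K) * r ≤ 1 / 2 → ∀ t ≥ t₁, 1 ≤ t →
      BddDeriv (Metric.ball σ r) k (fun x => ((M t).XVX x)⁻¹) C := by
  have hK := h.K_pos
  have hc := h.c_pos
  obtain ⟨C, hC, hV⟩ := h.exists_bddDeriv_inv_V k
  set C₁ := 2 ^ k * (2 ^ k * K * C) * K with hC₁
  obtain ⟨C₂, hC₂, hinv⟩ := BddDeriv.exists_inv (s := q + 1) k C₁ (c / (K * (2 * K)))⁻¹
    (by positivity) (by positivity)
  refine ⟨C₂, hC₂, fun {r} hr t ht ht1 => ?_⟩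
  have hO : IsOpen (Metric.ball σ r) := Metric.isOpen_ball
  have ht1' : (1 : ℝ) ≤ t := by exact_mod_cast ht1
  have ht0 : (0 : ℝ) < t := by linarith
  have h1 : BddDeriv (Metric.ball σ r) k (fun x => (t : ℝ)⁻¹ • (M t).XVX x) C₁ := by
    refine ((BddDeriv.sum hO Finset.univ fun i _ => (((BddDeriv.const _ k ((M t).X i)ᵀ).mono
      ((norm_transpose_eq _).trans_le (h.norm_X t i))).matMul hO (hV hr t i) hK.le).matMul hO
      ((BddDeriv.const _ k ((M t).X i)).mono (h.norm_X t i)) (by positivity)).const_smul hO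
      (t : ℝ)⁻¹).mono ?_
    rw [Finset.sum_const, Finset.card_univ, Fintype.card_fin, nsmul_eq_mul, abs_of_pos (by positivity),
      inv_mul_cancel_left₀ ht0.ne']
  have hb : ∀ x ∈ Metric.ball σ r, _ := fun x hx =>
    norm_inv_le_of_lower_bound (M := (t : ℝ)⁻¹ • (M t).XVX x) (a := c / (K * (2 * K)))
      (by positivity) fun v => by
        have h2 := h.XVX_ge ht (h.ball_subset hr t hx) (by positivity) (h.norm_V_le hr hx t) v
        rw [Matrix.smul_mulVec, dotProduct_smul, smul_eq_mul, ← div_eq_inv_mul,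
          le_div_iff₀ ht0]
        refine le_trans (le_of_eq ?_) h2
        ring
  have h3 := (hinv hO h1 (fun x hx => (hb x hx).1) fun x hx => (hb x hx).2).const_smul hO (t : ℝ)⁻¹
  refine (h3.congr hO fun x hx => ?_).mono ?_
  · exact (inv_eq_smul_inv_smul (h.isUnit_det_XVX ht ht1 (h.ball_subset hr t hx))
      (inv_ne_zero ht0.ne')).symm
  · rw [abs_of_pos (by positivity)]
    exact mul_le_of_le_one_left hC₂ (inv_le_one_of_one_le₀ ht1')

lemma exists_bddDeriv_g2 (h : UniformBounds M σ K c t₁) (k : ℕ) : ∃ C ≥ 0, ∀ {r : ℝ},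
    (q + 1 : ℕ) * (K * K) * r ≤ 1 / 2 → ∀ t ≥ t₁, 1 ≤ t →
      BddDeriv (Metric.ball σ r) k (M t).g2 C := by
  obtain ⟨C, hC, hv⟩ := h.exists_bddDeriv_g2Vec k
  obtain ⟨C', hC', hX⟩ := h.exists_bddDeriv_inv_XVX k
  refine ⟨2 ^ k * C * (2 ^ k * C' * C), by positivity, fun {r} hr t ht ht1 => ?_⟩
  have hO : IsOpen (Metric.ball σ r) := Metric.isOpen_ball
  exact (hv hr t).dotProduct hO ((hX hr t ht ht1).mulVec hO (hv hr t) hC') hC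

lemma exists_bddDeriv_sSensitivity (h : UniformBounds M σ K c t₁) (k : ℕ) : ∃ C ≥ 0, ∀ {r : ℝ},
    (q + 1 : ℕ) * (K * K) * r ≤ 1 / 2 → ∀ t,
      BddDeriv (Metric.ball σ r) k (M t).sSensitivity C := by
  have hK := h.K_pos
  obtain ⟨C, hC, hd⟩ := h.exists_bddDeriv_dsVec k
  set C₁ := 2 ^ k * C * (2 ^ k * (2 * K) * C) with hC₁
  refine ⟨Fintype.card (Fin (q + 1)) * (Fintype.card (Fin (q + 1)) * (C₁ * (K * K))),
    by positivity, fun {r} hr t => ?_⟩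
  have hO : IsOpen (Metric.ball σ r) := Metric.isOpen_ball
  refine BddDeriv.of_apply hO fun j l => ?_
  refine (BddDeriv.sum hO Finset.univ fun i _ => (hd hr t i j).dotProduct hO
    ((h.bddDeriv_V hr k t i).mulVec hO (hd hr t i l) (by positivity)) (by positivity)).mono ?_
  calc ∑ i, 2 ^ k * (C * ‖(M t).m i‖) * (2 ^ k * (2 * K) * (C * ‖(M t).m i‖))
      = C₁ * ∑ i, ‖(M t).m i‖ ^ 2 := by
        rw [Finset.mul_sum]
        exact Finset.sum_congr rfl fun i _ => by rw [hC₁]; ring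
    _ ≤ _ := mul_le_mul_of_nonneg_left (h.sum_sq_m t) (by positivity)

/-- The approximation to the mean squared error has uniformly bounded derivatives near `σ`. -/
theorem etaBdd (h : UniformBounds M σ K c t₁) {β : ∀ t, Fin (M t).p → ℝ}
    {T : ∀ t, Matrix (M t).Obs (Fin (M t).contrasts) ℝ}
    (D : REMLReduction (fun t => (M t).reml (T t) (β t)) σ)
    (hr : (q + 1 : ℕ) * (K * K) * D.r ≤ 1 / 2) (ht₁ : t₁ ≤ D.t₀) :
    REMLReduction.EtaBdd D fun t => (M t).eta (T t) (β t) := by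
  obtain ⟨C₁, hC₁, h1⟩ := h.exists_bddDeriv_g1 3
  obtain ⟨C₂, hC₂, h2⟩ := h.exists_bddDeriv_g2 3
  obtain ⟨C₃, hC₃, h3⟩ := h.exists_bddDeriv_sSensitivity 3
  obtain ⟨C₄, hC₄, h4⟩ := D.exists_bddDeriv_inv_info₂ 3
  have hO : IsOpen (Metric.ball σ D.r) := Metric.isOpen_ball
  refine ⟨C₁ + C₂ + Fintype.card (Fin (q + 1)) * (2 ^ 3 * C₃ * C₄), by positivity,
    fun t ht => ⟨?_, ?_⟩⟩
  · have hu : ∀ x ∈ interior (M t).Θ, IsUnit (-D.info₂ t x).det := fun x hx => by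
      rw [Matrix.det_neg]
      exact ((isUnit_one.neg).pow _).mul (REMLReduction.isUnit_det_info₂ ht hx)
    have e : Set.EqOn ((M t).g3 (T t) (β t))
        (fun x => ((M t).sSensitivity x * (-D.info₂ t x)⁻¹).trace) (interior (M t).Θ) :=
      fun x hx => by
        change ((M t).sSensitivity x * (-((M t).reml (T t) (β t)).A x)⁻¹).trace = _
        rw [REMLReduction.A_eq (D := D) ht hx]
    have hg3 := (((M t).contDiffOn_sSensitivity (h.posDef t)).matMul
      ((REMLReduction.contDiffOn_info₂ (D := D) ht).neg.matInv hu)).trace.congr e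
    have hX : ∀ x ∈ interior (M t).Θ, IsUnit ((M t).XVX x).det := fun x hx =>
      h.isUnit_det_XVX (ht₁.trans ht) (D.one_le_t₀.trans ht) hx
    have := (((M t).contDiffOn_g1 (h.posDef t)).add ((M t).contDiffOn_g2 (h.posDef t) hX)).add hg3
    exact this.of_le (WithTop.coe_le_coe.2 le_top)
  · have ht1 := REMLReduction.one_le_cast (D := D) ht
    have ht0 : (0 : ℝ) < t := by linarith
    refine ((h1 hr t).add hO (h2 hr t (ht₁.trans ht) (D.one_le_t₀.trans ht))).add hO ?_
    have h5 := ((h4 t ht).const_smul hO (-(t : ℝ)⁻¹)).mono (C' := C₄) (by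
      rw [abs_neg, abs_of_pos (by positivity)]
      exact mul_le_of_le_one_left hC₄ (inv_le_one_of_one_le₀ ht1))
    refine (((h3 hr t).matMul hO h5 hC₃).trace hO).congr hO fun x hx => ?_
    have hx' := REMLReduction.mem_interior (D := D) ht hx
    -- The information enters `g3` through its inverse, which is `t⁻¹` times a matrix with bounded
    -- derivatives.
    have e : (-D.info₂ t x)⁻¹ = -(t : ℝ)⁻¹ • ((t : ℝ)⁻¹ • D.info₂ t x)⁻¹ := by
      rw [inv_eq_smul_inv_smul (A := -D.info₂ t x) (a := -(t : ℝ)⁻¹) _ (by simp [ht0.ne']),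
        neg_smul_neg]
      rw [Matrix.det_neg]
      exact ((isUnit_one.neg).pow _).mul (REMLReduction.isUnit_det_info₂ ht hx')
    change _ = ((M t).sSensitivity x * (-((M t).reml (T t) (β t)).A x)⁻¹).trace
    rw [REMLReduction.A_eq (D := D) ht hx', e]

end UniformBounds

end LongitudinalModel

end

end EmpiricalPredictor

/-! ### From the hypotheses to the uniform bounds, and the theorem -/

namespace EmpiricalPredictor

noncomputable section

open scoped ContDiff MatrixOrder

lemma exists_lt_of_pos_liminf {f : ℕ → ℝ}
    (h : 0 < liminf (fun t => ((f t : ℝ) : EReal)) atTop) :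
    ∃ c > 0, ∀ᶠ t in atTop, c < f t := by
  obtain ⟨c, hc0, hc⟩ := EReal.lt_iff_exists_real_btwn.1 h
  refine ⟨c, by exact_mod_cast hc0, ?_⟩
  filter_upwards [eventually_lt_of_lt_liminf hc] with t ht
  exact_mod_cast ht

lemma mul_le_dotProduct_of_lt_lambdaMin {p t : ℕ} {A : Matrix (Fin p) (Fin p) ℝ}
    (hA : A.IsHermitian) (ht : 0 < t) {c : ℝ} (hc : c < lambdaMin ((t : ℝ)⁻¹ • A))
    (v : Fin p → ℝ) : c * t * ‖WithLp.toLp 2 v‖ ^ 2 ≤ v ⬝ᵥ (A *ᵥ v) := by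
  have ht0 : (0 : ℝ) < t := by exact_mod_cast ht
  have hs : ((t : ℝ)⁻¹ • A).IsHermitian := by
    rw [Matrix.IsHermitian, Matrix.conjTranspose_smul, hA.eq, star_trivial]
  have h := (mul_le_mul_of_nonneg_right hc.le (sq_nonneg ‖WithLp.toLp 2 v‖)).trans
    (lambdaMin_mul_le hs v)
  rw [Matrix.smul_mulVec, dotProduct_smul, smul_eq_mul, ← div_eq_inv_mul, le_div_iff₀ ht0] at h
  linarith

namespace LongitudinalModel

section Single

variable {q t : ℕ} (M : LongitudinalModel q t) {σ : Param (q + 1)}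

lemma isHermitian_B (i : Fin t) (x : Param (q + 1)) : (M.B i x).IsHermitian := by
  ext j k
  simp only [Matrix.conjTranspose_apply, B, Matrix.of_apply, star_trivial]
  rw [Matrix.mul_assoc _ _ (M.dV i j), Matrix.trace_mul_comm, Matrix.mul_assoc _ _ (M.dV i k)]

lemma isHermitian_XVX (hσ : ∀ i, (M.V i σ).PosDef) : (M.XVX σ).IsHermitian := by
  rw [Matrix.IsHermitian, XVX, Matrix.conjTranspose_sum]
  refine Finset.sum_congr rfl fun i _ => ?_
  rw [Matrix.conjTranspose_mul, Matrix.conjTranspose_mul, (hσ i).inv.isHermitian.eq,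
    Matrix.conjTranspose_eq_transpose_of_trivial, Matrix.conjTranspose_eq_transpose_of_trivial,
    Matrix.transpose_transpose, Matrix.mul_assoc]

lemma norm_add_mul_mul_transpose_le {m n : Type} [Fintype m] [Fintype n] [DecidableEq m]
    [DecidableEq n] {R : Matrix m m ℝ} {G : Matrix n n ℝ} {Z : Matrix m n ℝ} {a b : ℝ}
    (ha : 0 ≤ a) (hb : 0 ≤ b) (hR : ‖R‖ ≤ a) (hG : ‖G‖ ≤ a) (hZ : ‖Z‖ ≤ b) :
    ‖R + Z * G * Zᵀ‖ ≤ a + b * a * b := by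
  refine (norm_add_le _ _).trans (add_le_add hR ?_)
  refine (Matrix.l2_opNorm_mul _ _).trans (mul_le_mul ((Matrix.l2_opNorm_mul _ _).trans ?_)
    ((norm_transpose_eq Z).trans_le hZ) (norm_nonneg _) (by positivity))
  exact mul_le_mul hZ hG (norm_nonneg _) hb

end Single

/-- With `a, b ≥ 1` the single number `a + b a b` dominates all the given bounds as well as those
for `Σ_i = R_i + Z_i G_i Z_i'` and its derivatives. The positive lower limits give linear growth
from some `t₁` on. -/
theorem exists_uniformBounds {q : ℕ} {M : ∀ t, LongitudinalModel q t} {σ : Param (q + 1)}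
    (hV_pd : ∀ t i, ((M t).V i σ).PosDef)
    (hbound : ∃ K : ℝ, ∀ t i, ‖(M t).G i σ‖ ≤ K ∧ ‖(M t).R i σ‖ ≤ K ∧
      (∀ j, ‖(M t).Gc i j‖ ≤ K ∧ ‖(M t).Rc i j‖ ≤ K) ∧ ‖((M t).V i σ)⁻¹‖ ≤ K)
    (hdesign : ∃ K : ℝ, ∀ t, ((M t).p : ℝ) ≤ K ∧ ‖(M t).l‖ ≤ K ∧ ∑ i, ‖(M t).m i‖ ≤ K ∧
      ∀ i, ((M t).n i : ℝ) ≤ K ∧ ‖(M t).X i‖ ≤ K ∧ ‖(M t).Z i‖ ≤ K)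
    (hB : 0 < liminf (fun t : ℕ =>
      ((lambdaMin ((t : ℝ)⁻¹ • ∑ i, (M t).B i σ) : ℝ) : EReal)) atTop)
    (hX : 0 < liminf (fun t : ℕ =>
      ((lambdaMin ((t : ℝ)⁻¹ • (M t).XVX σ) : ℝ) : EReal)) atTop) :
    ∃ (K c : ℝ) (t₁ : ℕ), UniformBounds M σ K c t₁ := by
  obtain ⟨K₁, h1⟩ := hbound
  obtain ⟨K₂, h2⟩ := hdesign
  obtain ⟨c₁, hc₁, hB⟩ := exists_lt_of_pos_liminf hB
  obtain ⟨c₂, hc₂, hX⟩ := exists_lt_of_pos_liminf hX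
  obtain ⟨t₁, ht₁⟩ := eventually_atTop.1 ((hB.and hX).and (eventually_gt_atTop 0))
  set a := max K₁ 1
  set b := max K₂ 1
  have ha : 1 ≤ a := le_max_right _ _
  have hb : 1 ≤ b := le_max_right _ _
  have ha1 : K₁ ≤ a := le_max_left _ _
  have hb1 : K₂ ≤ b := le_max_left _ _
  have hbab : 1 ≤ b * a * b := by
    have := one_le_mul_of_one_le_of_one_le hb ha
    exact one_le_mul_of_one_le_of_one_le this hb
  have hba : b ≤ b * a * b := by
    refine le_mul_of_one_le_left (by linarith) ?_
    exact one_le_mul_of_one_le_of_one_le hb ha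
  have hK1 : K₁ ≤ a + b * a * b := by linarith
  have hK2 : K₂ ≤ a + b * a * b := by linarith
  refine ⟨a + b * a * b, min c₁ c₂, t₁,
    { one_le := by linarith
      c_pos := lt_min hc₁ hc₂
      posDef := hV_pd
      norm_inv := fun t i => (h1 t i).2.2.2.trans hK1
      norm_G := fun t i => (h1 t i).1.trans hK1
      norm_Gc := fun t i j => ((h1 t i).2.2.1 j).1.trans hK1
      norm_V := fun t i => norm_add_mul_mul_transpose_le (by linarith) (by linarith)
        ((h1 t i).2.1.trans ha1) ((h1 t i).1.trans ha1) (((h2 t).2.2.2 i).2.2.trans hb1)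
      norm_dV := fun t i j => norm_add_mul_mul_transpose_le (by linarith) (by linarith)
        (((h1 t i).2.2.1 j).2.trans ha1) (((h1 t i).2.2.1 j).1.trans ha1)
        (((h2 t).2.2.2 i).2.2.trans hb1)
      p_le := fun t => (h2 t).1.trans hK2
      n_le := fun t i => ((h2 t).2.2.2 i).1.trans hK2
      norm_X := fun t i => ((h2 t).2.2.2 i).2.1.trans hK2
      norm_Z := fun t i => ((h2 t).2.2.2 i).2.2.trans hK2
      norm_l := fun t => (h2 t).2.1.trans hK2
      sum_m := fun t => (h2 t).2.2.1.trans hK2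
      B_ge := fun t ht v => ?_
      X_ge := fun t ht v => ?_ }⟩
  · have hs : (∑ i, (M t).B i σ).IsHermitian := by
      rw [Matrix.IsHermitian, Matrix.conjTranspose_sum]
      exact Finset.sum_congr rfl fun i _ => (M t).isHermitian_B i σ
    exact mul_le_dotProduct_of_lt_lambdaMin hs (ht₁ t ht).2
      ((min_le_left _ _).trans_lt (ht₁ t ht).1.1) v
  · exact mul_le_dotProduct_of_lt_lambdaMin ((M t).isHermitian_XVX (hV_pd t)) (ht₁ t ht).2
      ((min_le_right _ _).trans_lt (ht₁ t ht).1.2) v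

end LongitudinalModel

end

end EmpiricalPredictor

open EmpiricalPredictor in
theorem mainTheorem11 (q : ℕ) (M : ∀ t, LongitudinalModel q t) (σ : Param (q + 1))
    (β : ∀ t, Fin (M t).p → ℝ)
    (T : ∀ t, Matrix (M t).Obs (Fin (M t).contrasts) ℝ) (hT : ∀ t, (M t).IsContrast (T t))
    -- `G_i`, `R_i` are covariance matrices and `Σ_i` is nonsingular at the true `σ`
    (hG_psd : ∀ t i, ((M t).G i σ).PosSemidef) (hR_psd : ∀ t i, ((M t).R i σ).PosSemidef)
    (hV_pd : ∀ t i, ((M t).V i σ).PosDef)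
    -- condition on `G_i`, `R_i`, their derivatives and `Σ_i⁻¹`
    (hbound : ∃ K : ℝ, ∀ t i, ‖(M t).G i σ‖ ≤ K ∧ ‖(M t).R i σ‖ ≤ K ∧
      (∀ j, ‖(M t).Gc i j‖ ≤ K ∧ ‖(M t).Rc i j‖ ≤ K) ∧ ‖((M t).V i σ)⁻¹‖ ≤ K)
    (hcont : ∀ ε > 0, ∃ δ > 0, ∀ x : Param (q + 1), ‖x - σ‖ ≤ δ → ∀ t i,
      ‖(M t).G i x - (M t).G i σ‖ ≤ ε ∧ ‖(M t).R i x - (M t).R i σ‖ ≤ ε)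
    -- `σ` is interior
    (hinterior : ∀ t, σ ∈ interior (M t).Θ)
    -- the design is bounded
    (hdesign : ∃ K : ℝ, ∀ t, ((M t).p : ℝ) ≤ K ∧ ‖(M t).l‖ ≤ K ∧ ∑ i, ‖(M t).m i‖ ≤ K ∧
      ∀ i, ((M t).n i : ℝ) ≤ K ∧ ‖(M t).X i‖ ≤ K ∧ ‖(M t).Z i‖ ≤ K)
    -- the eigenvalue conditions
    (hB : 0 < liminf (fun t : ℕ =>
      ((lambdaMin ((t : ℝ)⁻¹ • ∑ i, (M t).B i σ) : ℝ) : EReal)) atTop)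
    (hX : 0 < liminf (fun t : ℕ =>
      ((lambdaMin ((t : ℝ)⁻¹ • (M t).XVX σ) : ℝ) : EReal)) atTop) :
    -- the conditions hold for REML, for every truncation exponent and every moment order
    (∀ lam g : ℝ, 0 < lam → 8 + 4 * lam < g →
      MSEConditions (fun t => (M t).reml (T t) (β t)) (fun t => (M t).eta (T t) (β t)) σ g lam) ∧
    -- a REML estimator, with the asymptotic representation, exists
    (∃ σhat : ∀ t, ((M t).reml (T t) (β t)).Y → Param (q + 1),
      (∀ t, Measurable (σhat t)) ∧
      ∀ g > 0, IsConsistentRoot (fun t => (M t).reml (T t) (β t)) σ g σhat) ∧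
    -- for every such estimator, `E(η̂) = η(σ) + o(d_*⁻²)`
    (∀ (lam g c₀ : ℝ) (σstar : Param (q + 1))
      (σhat : ∀ t, ((M t).reml (T t) (β t)).Y → Param (q + 1)),
      0 < lam → 8 + 4 * lam < g → 0 < c₀ → (∀ t, σstar ∈ (M t).Θ) →
      ((fun t => (M t).eta (T t) (β t) σstar) =O[atTop]
        fun t => ((M t).reml (T t) (β t)).dStar ^ lam) →
      (∀ t, Measurable (σhat t)) →
      IsConsistentRoot (fun t => (M t).reml (T t) (β t)) σ g σhat →
      (∀ᶠ t in atTop, Integrable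
        (((M t).reml (T t) (β t)).etaHat ((M t).eta (T t) (β t)) c₀ lam σstar (σhat t))
        (((M t).reml (T t) (β t)).law σ)) ∧
      (fun t => (∫ y, ((M t).reml (T t) (β t)).etaHat ((M t).eta (T t) (β t)) c₀ lam σstar
          (σhat t) y ∂((M t).reml (T t) (β t)).law σ) - (M t).eta (T t) (β t) σ)
        =o[atTop] fun t => (((M t).reml (T t) (β t)).dStar ^ 2)⁻¹) := by
  obtain ⟨K, c, t₁, h⟩ :=
    LongitudinalModel.exists_uniformBounds hV_pd hbound hdesign hB hX
  -- The upper limit `1` for the radius is arbitrary; the radius is cut down as far as the bounds on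
  -- the covariance matrices require.
  obtain ⟨D, -, hr, ht₁⟩ := h.exists_remlReduction β T hT one_pos
  have hη := h.etaBdd D hr ht₁
  refine ⟨fun lam g hlam hg => D.mseConditions hη hlam hg,
    ⟨D.root, D.measurable_root, fun g hg => D.isConsistentRoot_root hg⟩, ?_⟩
  intro lam g c₀ σstar σhat hlam hg hc₀ _ hO hm hσ
  exact D.etaHat_unbiased hη hlam hg hc₀ hO hm hσ
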